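/- **Setting.** Let $\Sigma$ be a compact oriented surface, $B\subset\partial\Sigma$ a finite set, and $T$ an oriented tangle diagram in $(\Sigma,B)$: finitely many arcs and circles in general position, with over/under information at the crossings, which meet $\partial\Sigma$ exactly in $B$, the set of the ends of the arcs. (Surface and diagram are presented by a finite cell decomposition of $\Sigma$ whose 1-skeleton contains $T$ and $\partial \Sigma$.) Attach a variable $x_f$ to each edge $f$ of $T$ (a piece of $T$ between consecutive crossings or ends), and let $\mathbb F_T$ be the field of rational functions over $\mathbb Z/2$ in the $x_f$. A *resolution* $r$ chooses the 0- or 1-resolution at each crossing (the 0-resolution joins the two regions which the overstrand sweeps when it is turned counterclockwise); $|r|$ is the number of 1-resolved crossings. Its components are arcs and circles. A circle is *contractible* if it bounds a disc in $\Sigma$; then its weight $[C]$ is the sum of the $x_f$ over the edges $f$ of $C$; for a noncontractible circle $[C]=0$. A *pure state* is a resolution with a sign $\pm$ on each circle. Put $h=|r|$, $q=|r|+\#(+)-\#(-)$ and $\delta=2h-q-n_+(T)$, where $n_+(T)$ is the number of positive crossings. The *glyph* of a pure state consists of the isotopy classes (relative to $\partial\Sigma$) of its arcs and noncontractible circles,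 where parallel circles are merged into one, labelled by the number of $+$ minus the number of $-$ circles, and circles labelled $0$ are erased; contractible circles are erased as well. On the span of the pure states let $\partial_{\mathcal V}$ be the sum, over all circles $C$ with sign $+$, of the change of the sign to $-$ multiplied by $[C]$. Let $\partial_\Sigma$ be the sum, over the 0-resolved crossings, of the following maps for the change to the 1-resolution, which leave the components away from the crossing alone; $v_\pm$ stands for contractible circles, $w_\pm$ for noncontractible circles, and $v_0$ for arcs. Merging of two components into one: $v_+\otimes z\mapsto z$ for $z\in\{v_\pm,w_\pm,v_0\}$ (a circle or arc of the same kind), $v_\pm\otimes v_\mp\mapsto v_-$, and $w_\pm\otimes w_\mp\mapsto v_-$ if the resulting circle is contractible. Division of one component into two: if a contractible circle is split off, $v_+\mapsto v_+\otimes v_-+v_-\otimes v_+$, $v_-\mapsto v_-\otimes v_-$, $w_\pm\mapsto w_\pm\otimes v_-$, $v_0\mapsto v_0\otimes v_-$; if a contractible circle splits into two noncontractible ones, $v_+\mapsto w_+\otimes w_-+w_-\otimes w_+$. All other entries are $0$. The *totally twisted skein complex* $\underline{SK}(T)$ is the $\mathbb F_T$-span of the pure states with $\partial_{\mathcal V}+\partial_\Sigma$.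 The *Khovanov skein complex* $KS(T)$ of Asaeda, Przytycki and Sikora (in the present conventions) is the $\mathbb Z/2$-span of the pure states with $\partial_\Sigma$. For a glyph $b$ let $\underline{SK}_i(T,b)$ and $KS_i(T,b)$ be spanned by the pure states with glyph $b$ and $\delta=i$. **Theorem.** Suppose that $T$ consists only of arcs, that is, the tangle has no closed components. Then both differentials square to zero and map the part $(i,b)$ into the part $(i+2,b)$, and there is an isomorphism of complexes of $\mathbb F_T$-vector spaces $$\underline{SK}(T)\;\cong\;\mathbb F_T\otimes_{\mathbb Z/2}KS(T)$$ which maps $\underline{SK}_i(T,b)$ onto $\mathbb F_T\otimes KS_i(T,b)$ for each $i\in\mathbb Z$ and each glyph $b$. In particular $H_i(\underline{SK}(T,b))\cong \mathbb F_T\otimes_{\mathbb Z/2}H_i(KS(T,b))$ for all $i$ and $b$. The same holds for reduced homology: let $T$ be any diagram with finitely many marked points on its strands, away from crossings and ends, such that each closed component contains a marked point. Remove open disc neighbourhoods of the marked points from $\Sigma$. This gives a surface $\Sigma'$ and a diagram $T'$ in it, whose (twisted) skein complexes are the reduced (twisted) skein complexes of $T$ determined by the marked points. Then $T'$ consists only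 of arcs, and the conclusions above hold for $T'$ in $\Sigma'$. -/

import Mathlib

open scoped TensorProduct

namespace Skein

noncomputable section

/-! ### Compact oriented surfaces with a cell structure -/

/-- A compact oriented surface (possibly disconnected, possibly with boundary) with a finite cell
structure, given by its darts (oriented edges).  `rot d` is the next dart counterclockwise around the
initial vertex of `d`, and `rev d` is the same edge run backwards.  The 2-cells of the closed
surface described by `rot` and `rev` are discs, one for each orbit of `face` below; the dart `d` has
its 2-cell on its left.  The 2-cells whose darts lie in `hole` are removed, and their frontiers are
the boundary circles.  The last two conditions say that these circles are embedded and disjoint. -/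
structure CellSurface (D : Type*) where
  rot : Equiv.Perm D
  rev : D → D
  hole : Set D
  rev_rev : ∀ d, rev (rev d) = d
  rev_ne : ∀ d, rev d ≠ d
  hole_face : ∀ d, rot.symm (rev d) ∈ hole ↔ d ∈ hole
  hole_edge : ∀ d ∈ hole, rev d ∉ hole
  hole_vertex : ∀ d ∈ hole, ∀ e ∈ hole, rot.SameCycle d e → d = e

namespace CellSurface

variable {D : Type*} (M : CellSurface D)

/-- Two darts start at the same vertex. -/
def SameVertex (d e : D) : Prop := M.rot.SameCycle d e

/-- The next dart along the 2-cell on the left of `d`. -/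
def face : Equiv.Perm D where
  toFun d := M.rot.symm (M.rev d)
  invFun d := M.rev (M.rot d)
  left_inv d := by simp [M.rev_rev]
  right_inv d := by simp [M.rev_rev]

def vertexOf (d : D) : Set D := {e | M.rot.SameCycle d e}
def edgeOf (d : D) : Set D := {d, M.rev d}
def faceOf (d : D) : Set D := {e | M.face.SameCycle d e}

/-- For a union `A` of 2-cells: the number of vertices, minus the number of edges, plus the number
of 2-cells of the open region which `A` spans, i.e. the Euler characteristic of this region. -/
def euler (A : Set D) : ℤ :=
  ({v | (∃ d, v = M.vertexOf d) ∧ v ⊆ A}.ncard : ℤ)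
    - ({e | (∃ d, e = M.edgeOf d) ∧ e ⊆ A}.ncard : ℤ)
    + ({f | (∃ d, f = M.faceOf d) ∧ f ⊆ A}.ncard : ℤ)

/-- The circle made of the edges in `C` (a set of darts closed under `rev`, embedded in the
1-skeleton) bounds a disc in the surface: it is the frontier of a connected union `A` of 2-cells of
the surface, of Euler characteristic `1`. -/
def BoundsDisc (C : Set D) : Prop :=
  ∃ A : Set D,
    (∀ d, M.face d ∈ A ↔ d ∈ A) ∧
    Disjoint A M.hole ∧
    A.Nonempty ∧
    (∀ d ∈ A, ∀ e ∈ A, Relation.EqvGen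
      (fun x y => x ∈ A ∧ y ∈ A ∧ (y = M.face x ∨ y = M.rev x)) d e) ∧
    (∀ d, d ∈ C ↔ ¬ (d ∈ A ↔ M.rev d ∈ A)) ∧
    M.euler A = 1

/-! Edge paths and their homotopy classes. -/

def IsEdgePath (p : List D) : Prop := p.IsChain (fun d e => M.SameVertex (M.rev d) e)

def IsLoop (p : List D) : Prop :=
  M.IsEdgePath p ∧ ∀ d ∈ p.head?, ∀ e ∈ p.getLast?, M.SameVertex (M.rev e) d

/-- The boundary of the 2-cell on the left of `d`, read from `d` on. -/
def faceWord (d : D) : List D := (List.range (M.faceOf d).ncard).map (fun i => (M.face ^ i) d)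

def reversePath (p : List D) : List D := (p.map M.rev).reverse

/-- Elementary homotopy of edge paths with fixed ends: insertion of a backtrack or of the boundary
of a 2-cell of the surface. -/
def Move (p q : List D) : Prop :=
  M.IsEdgePath p ∧ M.IsEdgePath q ∧ ∃ u v d, p = u ++ v ∧
    (q = u ++ [d, M.rev d] ++ v ∨ (d ∉ M.hole ∧ q = u ++ M.faceWord d ++ v))

/-- Unoriented paths up to homotopy with fixed ends. -/
def PathClass : Type _ :=
  Quot (fun p q : List D => M.Move p q ∨ q = M.reversePath p)

/-- Unoriented loops up to free homotopy. -/
def LoopClass : Type _ :=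
  Quot (fun p q : List D => M.Move p q ∨ q = M.reversePath p ∨
    (M.IsLoop p ∧ ∃ u v, p = u ++ v ∧ q = v ++ u))

/-- The vertex of `d` meets the set `X` of darts in `d` only. -/
def IsEndOf (X : Set D) (d : D) : Prop :=
  d ∈ X ∧ ∀ e ∈ X, M.SameVertex d e → e = d

/-- The vertex of `d` meets the set `X` of darts in `d` and exactly one further dart. -/
def IsPassOf (X : Set D) (d : D) : Prop :=
  d ∈ X ∧ ∃ e ∈ X, e ≠ d ∧ M.SameVertex d e ∧ ∀ f ∈ X, M.SameVertex d f → f = d ∨ f = e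

/-- The vertex of `d` has exactly four darts, all of them in `X`. -/
def IsCrossingOf (X : Set D) (d : D) : Prop :=
  d ∈ X ∧ M.rot d ∈ X ∧ M.rot (M.rot d) ∈ X ∧ M.rot (M.rot (M.rot d)) ∈ X ∧
    M.rot d ≠ d ∧ M.rot (M.rot d) ≠ d ∧ M.rot (M.rot (M.rot (M.rot d))) = d

end CellSurface

/-! ### Oriented tangle diagrams -/

/-- An oriented tangle diagram in the 1-skeleton of the surface.  `strand` is the set of darts of the
diagram, `upper` says which darts at a crossing belong to the overstrand, and `fwd` is the set of
darts which agree with the orientation of the tangle.  A vertex on the diagram is an end point of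
an arc, an interior point of a strand, or a crossing; the end points are exactly its points on
the boundary of the surface.  (Every tangle diagram on a compact oriented surface is of this form for
a suitable cell structure, with all cells of the complement cut into discs.)  Edges outside the diagram belong to the cell structure only. -/
structure TangleDiagram {D : Type*} (M : CellSurface D) where
  strand : Set D
  upper : Set D
  fwd : Set D
  rev_mem : ∀ d ∈ strand, M.rev d ∈ strand
  strand_inner : ∀ d ∈ strand, d ∉ M.hole
  vertex_type : ∀ d ∈ strand,
    M.IsEndOf strand d ∨ M.IsPassOf strand d ∨ M.IsCrossingOf strand d
  end_iff : ∀ d ∈ strand,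
    M.IsEndOf strand d ↔ ∃ e ∈ M.hole, M.SameVertex d e
  upper_rot : ∀ d, M.IsCrossingOf strand d → (M.rot d ∈ upper ↔ d ∉ upper)
  fwd_rev : ∀ d ∈ strand, (M.rev d ∈ fwd ↔ d ∉ fwd)
  fwd_pass : ∀ d ∈ strand, ∀ e ∈ strand, ¬ M.IsCrossingOf strand d → M.SameVertex d e → e ≠ d →
    (e ∈ fwd ↔ d ∉ fwd)
  fwd_crossing : ∀ d, M.IsCrossingOf strand d → (M.rot (M.rot d) ∈ fwd ↔ d ∉ fwd)

namespace CellSurface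

variable {D : Type*} (M : CellSurface D)

theorem isCrossingOf_rot (X : Set D) (d : D) :
    M.IsCrossingOf X (M.rot d) ↔ M.IsCrossingOf X d := by
  constructor
  · rintro ⟨h1, h2, h3, h4, h5, h6, h7⟩
    have h7' := M.rot.injective h7
    rw [h7'] at h4
    exact ⟨h4, h1, h2, h3, fun h => h5 (congrArg M.rot h), fun h => h6 (congrArg M.rot h), h7'⟩
  · rintro ⟨h1, h2, h3, h4, h5, h6, h7⟩
    exact ⟨h2, h3, h4, by rw [h7]; exact h1, fun h => h5 (M.rot.injective h),
      fun h => h6 (M.rot.injective h), by rw [h7]⟩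

theorem isCrossingOf_rot_symm (X : Set D) (d : D) :
    M.IsCrossingOf X (M.rot.symm d) ↔ M.IsCrossingOf X d := by
  rw [← M.isCrossingOf_rot X (M.rot.symm d), Equiv.apply_symm_apply]

theorem isCrossingOf_sameVertex (X : Set D) {d e : D} (h : M.SameVertex d e) :
    M.IsCrossingOf X d ↔ M.IsCrossingOf X e := by
  obtain ⟨n, rfl⟩ := h
  induction n with
  | zero => simp
  | succ n ih =>
    rw [ih, add_comm, zpow_add, zpow_one, Equiv.Perm.mul_apply, M.isCrossingOf_rot]
  | pred n ih =>
    rw [ih, sub_eq_add_neg, add_comm, zpow_add, zpow_neg_one, Equiv.Perm.mul_apply]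
    exact (M.isCrossingOf_rot_symm X _).symm

end CellSurface

namespace TangleDiagram

variable {D : Type*} {M : CellSurface D} (T : TangleDiagram M)

def IsEnd (d : D) : Prop := M.IsEndOf T.strand d
def IsPass (d : D) : Prop := M.IsPassOf T.strand d
def IsCrossing (d : D) : Prop := M.IsCrossingOf T.strand d

/-- The crossings of the diagram. -/
def Crossing : Type _ :=
  Quot (fun x y : {d // T.IsCrossing d} => M.SameVertex x.1 y.1)

def crossingOf (d : D) (h : T.IsCrossing d) : T.Crossing := Quot.mk _ ⟨d, h⟩

/-- The edges of the diagram: its pieces between crossings and end points. -/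
def Edge : Type _ :=
  Quot (fun x y : T.strand => y.1 = M.rev x.1 ∨ (¬ T.IsCrossing x.1 ∧ M.SameVertex x.1 y.1))

def edge (d : T.strand) : T.Edge := Quot.mk _ d

/-- The components of the tangle. -/
def LinkComponent : Type _ :=
  Quot (fun x y : T.strand => y.1 = M.rev x.1 ∨ (¬ T.IsCrossing x.1 ∧ M.SameVertex x.1 y.1) ∨
    (T.IsCrossing x.1 ∧ y.1 = M.rot (M.rot x.1)))

def linkComponent (d : T.strand) : T.LinkComponent := Quot.mk _ d

/-- The tangle consists of arcs only. -/
def OnlyArcs : Prop :=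
  ∀ K : T.LinkComponent, ∃ d : T.strand, T.IsEnd d.1 ∧ T.linkComponent d = K

/-- A crossing is positive if the forward dart of the understrand follows the forward dart of the
overstrand counterclockwise. -/
def IsPositive (c : T.Crossing) : Prop :=
  ∃ d h, T.crossingOf d h = c ∧ d ∈ T.upper ∧ d ∈ T.fwd ∧ M.rot d ∈ T.fwd

/-- The number of positive crossings. -/
def nPos : ℕ := Nat.card {c // T.IsPositive c}

/-! ### Resolutions -/

/-- A resolution: `true` stands for the 1-resolution of a crossing. -/
abbrev Resolution : Type _ := T.Crossing → Bool

variable (S : T.Resolution)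

/-- The vertex of `d` is a crossing with the 1-resolution. -/
def IsOne (d : D) : Prop := ∃ h : T.IsCrossing d, S (T.crossingOf d h) = true

open Classical in
/-- At a crossing, the dart which the resolution joins to `d`.  The 0-resolution connects the two
regions which the overstrand sweeps when it is turned counterclockwise; thus it joins a dart of the
understrand to the next dart counterclockwise, and the 1-resolution does so with a dart of the
overstrand. -/
def turn (d : D) : D := if (d ∈ T.upper ↔ T.IsOne S d) then M.rot d else M.rot.symm d

/-- The components (arcs and circles) of the resolution. -/
def Component : Type _ :=
  Quot (fun x y : T.strand => y.1 = M.rev x.1 ∨ (¬ T.IsCrossing x.1 ∧ M.SameVertex x.1 y.1) ∨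
    (T.IsCrossing x.1 ∧ y.1 = T.turn S x.1))

def comp (d : T.strand) : T.Component S := Quot.mk _ d

variable {S}

def IsArc (C : T.Component S) : Prop := ∃ d : T.strand, T.IsEnd d.1 ∧ T.comp S d = C

variable (S) in
/-- The circles of the resolution. -/
def Circle : Type _ := {C : T.Component S // ¬ T.IsArc C}

theorem isOne_rot (d : D) : T.IsOne S (M.rot d) ↔ T.IsOne S d := by
  have key : ∀ (h : T.IsCrossing d) (h' : T.IsCrossing (M.rot d)),
      T.crossingOf (M.rot d) h' = T.crossingOf d h := fun h h' =>
    (Quot.sound (r := fun x y : {d // T.IsCrossing d} => M.SameVertex x.1 y.1)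
      (a := ⟨d, h⟩) (b := ⟨M.rot d, h'⟩) ⟨1, by simp⟩).symm
  constructor
  · rintro ⟨h', hS⟩
    have h := (M.isCrossingOf_rot _ _).1 h'
    exact ⟨h, by rw [← key h h']; exact hS⟩
  · rintro ⟨h, hS⟩
    have h' := (M.isCrossingOf_rot T.strand d).2 h
    exact ⟨h', by rw [key h h']; exact hS⟩

theorem isOne_rot_symm (d : D) : T.IsOne S (M.rot.symm d) ↔ T.IsOne S d := by
  rw [← T.isOne_rot (M.rot.symm d), Equiv.apply_symm_apply]

theorem isCrossing_rot (d : D) : T.IsCrossing (M.rot d) ↔ T.IsCrossing d :=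
  M.isCrossingOf_rot _ _

theorem isCrossing_rot_symm (d : D) : T.IsCrossing (M.rot.symm d) ↔ T.IsCrossing d :=
  M.isCrossingOf_rot_symm _ _

theorem upper_rot_symm (d : D) (h : T.IsCrossing d) : M.rot.symm d ∈ T.upper ↔ d ∉ T.upper := by
  have := T.upper_rot (M.rot.symm d) ((T.isCrossing_rot_symm d).2 h)
  rw [Equiv.apply_symm_apply] at this
  tauto

theorem not_hole_of_crossing (d : D) (h : T.IsCrossing d) : d ∉ M.hole := T.strand_inner d h.1

/-- The darts of the overstrands at the crossings; there are two of them at each crossing. -/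
abbrev OverDart : Type _ := {d // T.IsCrossing d ∧ d ∈ T.upper}

variable (S)

open Classical in
def resolvedRotFun : D ⊕ T.OverDart → D ⊕ T.OverDart
  | Sum.inl d =>
    if h : T.IsCrossing d then
      if T.IsOne S d then
        if ho : d ∈ T.upper then Sum.inl (M.rot d)
        else Sum.inr ⟨M.rot.symm d, (T.isCrossing_rot_symm d).2 h, (T.upper_rot_symm d h).2 ho⟩
      else
        if ho : d ∈ T.upper then Sum.inr ⟨d, h, ho⟩ else Sum.inl (M.rot d)
    else Sum.inl (M.rot d)
  | Sum.inr b => if T.IsOne S b.1 then Sum.inl b.1 else Sum.inl (M.rot.symm b.1)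

open Classical in
def resolvedRotInv : D ⊕ T.OverDart → D ⊕ T.OverDart
  | Sum.inl d =>
    if h : T.IsCrossing d then
      if T.IsOne S d then
        if ho : d ∈ T.upper then Sum.inr ⟨d, h, ho⟩ else Sum.inl (M.rot.symm d)
      else
        if ho : d ∈ T.upper then Sum.inl (M.rot.symm d)
        else Sum.inr ⟨M.rot d, (T.isCrossing_rot d).2 h, (T.upper_rot d h).2 ho⟩
    else Sum.inl (M.rot.symm d)
  | Sum.inr b => if T.IsOne S b.1 then Sum.inl (M.rot b.1) else Sum.inl b.1

def resolvedRot : Equiv.Perm (D ⊕ T.OverDart) where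
  toFun := T.resolvedRotFun S
  invFun := T.resolvedRotInv S
  left_inv := by
    rintro (d | ⟨d, h, ho⟩)
    · by_cases h : T.IsCrossing d
      · have hr := (T.isCrossing_rot d).2 h
        have hs := (T.isCrossing_rot_symm d).2 h
        have h1 := T.upper_rot d h
        have h2 := T.upper_rot_symm d h
        by_cases h3 : T.IsOne S d <;> by_cases h4 : d ∈ T.upper <;>
          simp [resolvedRotFun, resolvedRotInv, h, h1, h3, h4, hr, isOne_rot,
            isOne_rot_symm]
      · have hr : ¬ T.IsCrossing (M.rot d) := by rwa [T.isCrossing_rot]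
        simp [resolvedRotFun, resolvedRotInv, h, hr]
    · have hs := (T.isCrossing_rot_symm d).2 h
      have h2 := T.upper_rot_symm d h
      by_cases h3 : T.IsOne S d <;>
        simp [resolvedRotFun, resolvedRotInv, h, h2, h3, ho, hs, isOne_rot_symm]
  right_inv := by
    rintro (d | ⟨d, h, ho⟩)
    · by_cases h : T.IsCrossing d
      · have hr := (T.isCrossing_rot d).2 h
        have hs := (T.isCrossing_rot_symm d).2 h
        have h1 := T.upper_rot d h
        have h2 := T.upper_rot_symm d h
        by_cases h3 : T.IsOne S d <;> by_cases h4 : d ∈ T.upper <;>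
          simp [resolvedRotFun, resolvedRotInv, h, h2, h3, h4, hs, isOne_rot,
            isOne_rot_symm]
      · have hr : ¬ T.IsCrossing (M.rot.symm d) := by rwa [T.isCrossing_rot_symm]
        simp [resolvedRotFun, resolvedRotInv, h, hr]
    · have hr := (T.isCrossing_rot d).2 h
      have h1 := T.upper_rot d h
      by_cases h3 : T.IsOne S d <;>
        simp [resolvedRotFun, resolvedRotInv, h, h1, h3, ho, hr, isOne_rot]

def resolvedRev : D ⊕ T.OverDart → D ⊕ T.OverDart
  | Sum.inl d => Sum.inl (M.rev d)
  | Sum.inr b => Sum.inr ⟨M.rot (M.rot b.1),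
      (T.isCrossing_rot _).2 ((T.isCrossing_rot _).2 b.2.1), by
        have h1 := T.upper_rot b.1 b.2.1
        have h2 := T.upper_rot (M.rot b.1) ((T.isCrossing_rot _).2 b.2.1)
        have h3 := b.2.2
        tauto⟩

theorem resolvedRot_pow_inl (d : D) (h : ¬ T.IsCrossing d) (n : ℤ) :
    ((T.resolvedRot S) ^ n) (Sum.inl d) = Sum.inl ((M.rot ^ n) d) := by
  have hn : ∀ n : ℤ, ¬ T.IsCrossing ((M.rot ^ n) d) := fun n hc =>
    h ((M.isCrossingOf_sameVertex T.strand (show M.SameVertex d _ from ⟨n, rfl⟩)).2 hc)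
  induction n with
  | zero => simp
  | succ n ih =>
    rw [add_comm, zpow_add, zpow_one, Equiv.Perm.mul_apply, ih, zpow_add, zpow_one,
      Equiv.Perm.mul_apply]
    exact (dif_neg (hn _) : T.resolvedRotFun S (Sum.inl ((M.rot ^ (n : ℤ)) d)) = _)
  | pred n ih =>
    rw [sub_eq_add_neg, add_comm, zpow_add, zpow_neg_one, Equiv.Perm.mul_apply, ih, zpow_add,
      zpow_neg_one, Equiv.Perm.mul_apply]
    exact (dif_neg (hn _) : T.resolvedRotInv S (Sum.inl ((M.rot ^ (-n : ℤ)) d)) = _)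

/-- The same surface with a cell structure whose 1-skeleton contains the resolved diagram: each
crossing is replaced by two vertices, one on each of the two strands of the resolution there, and by
one new edge which joins them.  The darts of the new edge are labelled by the two darts of the
overstrand: the label of a new dart starts at the same vertex as this dart. -/
def resolved : CellSurface (D ⊕ T.OverDart) where
  rot := T.resolvedRot S
  rev := T.resolvedRev
  hole := Sum.inl '' M.hole
  rev_rev := by
    rintro (d | ⟨d, h, ho⟩)
    · simp [resolvedRev, M.rev_rev]
    · simp [resolvedRev, h.2.2.2.2.2.2]
  rev_ne := by
    rintro (d | ⟨d, h, ho⟩)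
    · simp [resolvedRev, M.rev_ne]
    · simp [resolvedRev, h.2.2.2.2.2.1]
  hole_face := by
    rintro (d | ⟨d, h, ho⟩)
    · show T.resolvedRotInv S (Sum.inl (M.rev d)) ∈ _ ↔ _
      by_cases hc : T.IsCrossing (M.rev d)
      · have hd : d ∉ M.hole := by
          have := T.strand_inner _ (T.rev_mem _ hc.1)
          rwa [M.rev_rev] at this
        have hs := T.not_hole_of_crossing _ ((T.isCrossing_rot_symm _).2 hc)
        by_cases h3 : T.IsOne S (M.rev d) <;> by_cases h4 : M.rev d ∈ T.upper <;>
          simp [resolvedRotInv, hc, h3, h4, hd, hs]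
      · simp [resolvedRotInv, hc, M.hole_face]
    · show T.resolvedRotInv S (Sum.inr ⟨M.rot (M.rot d), _⟩) ∈ _ ↔ _
      have h2 := (T.isCrossing_rot _).2 ((T.isCrossing_rot _).2 h)
      have h3 := T.not_hole_of_crossing _ h2
      have h4 := T.not_hole_of_crossing _ ((T.isCrossing_rot _).2 h2)
      by_cases h5 : T.IsOne S d <;> simp [resolvedRotInv, isOne_rot, h3, h4, h5]
  hole_edge := by
    rintro _ ⟨d, hd, rfl⟩
    simpa [resolvedRev] using M.hole_edge d hd
  hole_vertex := by
    rintro _ ⟨d, hd, rfl⟩ _ ⟨e, he, rfl⟩ ⟨n, hn⟩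
    have hc : ¬ T.IsCrossing d := fun hc => T.not_hole_of_crossing d hc hd
    rw [T.resolvedRot_pow_inl S d hc n] at hn
    rw [M.hole_vertex d hd e he ⟨n, Sum.inl_injective hn⟩]

variable {S}

/-- The circle `C` of the resolution bounds a disc in the surface. -/
def Contractible (C : T.Component S) : Prop :=
  (T.resolved S).BoundsDisc {x | ∃ d : T.strand, T.comp S d = C ∧ x = Sum.inl d.1}

/-! ### Pure states and gradings -/

/-- Pure states: a resolution with a sign (`true` is `+`) on each of its circles. -/
abbrev State : Type _ := Σ S : T.Resolution, (T.Circle S → Bool)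

variable (s : T.State)

/-- Homology grading. -/
def hGrading : ℤ := (Nat.card {c // s.1 c = true} : ℤ)

/-- Quantum grading. -/
def qGrading : ℤ :=
  T.hGrading s + (Nat.card {C // s.2 C = true} : ℤ) - (Nat.card {C // s.2 C = false} : ℤ)

/-- The grading `δ = 2 h - q`, shifted by the number of positive crossings. -/
def delta : ℤ := 2 * T.hGrading s - T.qGrading s - (T.nPos : ℤ)

/-! ### Glyphs -/

variable (S) in
/-- The component which arrives along `d` leaves along `e`. -/
def Follows (d e : D) : Prop :=
  e ∈ T.strand ∧
    ((¬ T.IsCrossing (M.rev d) ∧ M.SameVertex (M.rev d) e ∧ e ≠ M.rev d) ∨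
      (T.IsCrossing (M.rev d) ∧ e = T.turn S (M.rev d)))

variable (S) in
/-- `p` runs along an arc of the resolution from one end to the other. -/
def TracesArc (p : List D) : Prop :=
  p.IsChain (T.Follows S) ∧ (∃ d ∈ p.head?, T.IsEnd d) ∧ (∃ e ∈ p.getLast?, T.IsEnd (M.rev e))

/-- `p` runs once around the circle `C` of the resolution. -/
def TracesCircle (C : T.Component S) (p : List D) : Prop :=
  p.IsChain (T.Follows S) ∧ p.Nodup ∧
    (∃ d ∈ p.head?, ∃ e ∈ p.getLast?, T.Follows S e d) ∧
    ∀ d ∈ p, ∃ h : d ∈ T.strand, T.comp S ⟨d, h⟩ = C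

/-- A circle of the state which is noncontractible, lies in the class `γ` and has the sign `ε`. -/
def IsLabelled (γ : M.LoopClass) (ε : Bool) (C : T.Circle s.1) : Prop :=
  ¬ T.Contractible C.1 ∧ (∃ p, T.TracesCircle C.1 p ∧ Quot.mk _ p = γ) ∧ s.2 C = ε

end TangleDiagram

/-- Glyphs: a set of classes of arcs, and an integer label for each class of circles; circles with
the label `0` do not count.  Two noncontractible simple circles in an oriented surface cobound an
annulus after an isotopy if and only if they are freely homotopic up to orientation, and disjoint
simple arcs and pairwise non-parallel circles are isotopic relative to the boundary if and only if
they are homotopic one by one, with the ends of the arcs fixed. -/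
structure Glyph {D : Type*} (M : CellSurface D) where
  arcs : Set M.PathClass
  label : M.LoopClass → ℤ

namespace TangleDiagram

variable {D : Type*} {M : CellSurface D} (T : TangleDiagram M)

/-- The glyph of a pure state: contractible circles are erased, and parallel noncontractible circles
are replaced by one circle labelled with the number of `+` minus the number of `-`. -/
def glyph (s : T.State) : Glyph M where
  arcs := {κ | ∃ p, T.TracesArc s.1 p ∧ κ = Quot.mk _ p}
  label γ := (Nat.card {C // T.IsLabelled s γ true C} : ℤ)
    - (Nat.card {C // T.IsLabelled s γ false C} : ℤ)

/-! ### The horizontal differential -/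

end TangleDiagram

/-- Decorated components of a state: arcs, contractible (`triv`) and noncontractible (`ess`) circles
with a sign. -/
inductive Decor : Type
  | arc : Decor
  | triv : Bool → Decor
  | ess : Bool → Decor

/-- The nonzero entries for the merging of two components into one. -/
inductive Merge : Decor → Decor → Decor → Prop
  | pp : Merge (.triv true) (.triv true) (.triv true)
  | pm : Merge (.triv true) (.triv false) (.triv false)
  | mp : Merge (.triv false) (.triv true) (.triv false)
  | pe (ε : Bool) : Merge (.triv true) (.ess ε) (.ess ε)
  | ep (ε : Bool) : Merge (.ess ε) (.triv true) (.ess ε)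
  | ee (ε : Bool) : Merge (.ess ε) (.ess (!ε)) (.triv false)
  | pa : Merge (.triv true) .arc .arc
  | ap : Merge .arc (.triv true) .arc

/-- The nonzero entries for the division of one component into two. -/
inductive Divide : Decor → Decor → Decor → Prop
  | ppm : Divide (.triv true) (.triv true) (.triv false)
  | pmp : Divide (.triv true) (.triv false) (.triv true)
  | mmm : Divide (.triv false) (.triv false) (.triv false)
  | eem (ε : Bool) : Divide (.ess ε) (.ess ε) (.triv false)
  | eme (ε : Bool) : Divide (.ess ε) (.triv false) (.ess ε)
  | pee (ε : Bool) : Divide (.triv true) (.ess ε) (.ess (!ε))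
  | aam : Divide .arc .arc (.triv false)
  | ama : Divide .arc (.triv false) .arc

namespace TangleDiagram

variable {D : Type*} {M : CellSurface D} (T : TangleDiagram M)

open Classical in
def decor (s : T.State) (C : T.Component s.1) : Decor :=
  if h : T.IsArc C then .arc
  else if T.Contractible C then .triv (s.2 ⟨C, h⟩) else .ess (s.2 ⟨C, h⟩)

/-- The components of the resolution which abut the crossing `c`. -/
def touching (S : T.Resolution) (c : T.Crossing) : Set (T.Component S) :=
  {C | ∃ (d : T.strand) (h : T.IsCrossing d.1), T.crossingOf d.1 h = c ∧ T.comp S d = C}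

open Classical in
/-- The state `s'` occurs in the horizontal differential of `s` through the change of the crossing
`c` from its 0-resolution to its 1-resolution. -/
def Saddle (c : T.Crossing) (s s' : T.State) : Prop :=
  s.1 c = false ∧ s'.1 = Function.update s.1 c true ∧
  (∀ d : T.strand, T.comp s.1 d ∉ T.touching s.1 c →
    T.decor s (T.comp s.1 d) = T.decor s' (T.comp s'.1 d)) ∧
  ((∃ (A B : T.Component s.1) (C : T.Component s'.1), A ≠ B ∧
      T.touching s.1 c = {A, B} ∧ T.touching s'.1 c = {C} ∧
      Merge (T.decor s A) (T.decor s B) (T.decor s' C)) ∨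
   (∃ (A : T.Component s.1) (B C : T.Component s'.1), B ≠ C ∧
      T.touching s.1 c = {A} ∧ T.touching s'.1 c = {B, C} ∧
      Divide (T.decor s A) (T.decor s' B) (T.decor s' C)))

section Complexes

variable [Finite D]

instance : Finite T.Crossing := by unfold Crossing; infer_instance
instance : Finite T.Edge := by unfold Edge; infer_instance
instance (S : T.Resolution) : Finite (T.Component S) := by unfold Component; infer_instance
instance (S : T.Resolution) : Finite (T.Circle S) := by unfold Circle; infer_instance
instance : Fintype T.Edge := Fintype.ofFinite _
instance (S : T.Resolution) : Fintype (T.Circle S) := Fintype.ofFinite _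
instance : Fintype T.State := Fintype.ofFinite _

/-- The field of rational functions over `ℤ/2` in one variable for each edge of the diagram. -/
abbrev Coeff : Type _ := FractionRing (MvPolynomial T.Edge (ZMod 2))

/-- The formal variable of an edge. -/
def var (f : T.Edge) : T.Coeff := algebraMap (MvPolynomial T.Edge (ZMod 2)) T.Coeff (.X f)

open Classical in
/-- The weight `[C]`: the sum of the variables of the edges along `C` if `C` bounds a disc, and `0`
otherwise. -/
def weight {S : T.Resolution} (C : T.Component S) : T.Coeff :=
  if T.Contractible C then
    ∑ f : T.Edge, if ∃ d : T.strand, T.edge d = f ∧ T.comp S d = C then T.var f else 0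
  else 0

open Classical in
/-- The horizontal differential `∂_Σ` over the ring `R`, on the free module over the pure states.
With `R = ℤ/2` this is the Khovanov complex of Asaeda, Przytycki and Sikora. -/
def horizontal (R : Type*) [CommRing R] : (T.State →₀ R) →ₗ[R] (T.State →₀ R) :=
  Finsupp.linearCombination R (fun s : T.State =>
    ∑ s' : T.State, if ∃ c, T.Saddle c s s' then Finsupp.single s' (1 : R) else 0)

open Classical in
/-- The vertical (Koszul) differential: the sum over the circles `C` of `v₊ ↦ [C] v₋`. -/
def vertical : (T.State →₀ T.Coeff) →ₗ[T.Coeff] (T.State →₀ T.Coeff) :=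
  Finsupp.linearCombination T.Coeff (fun s : T.State =>
    ∑ C : T.Circle s.1, if s.2 C = true then
      Finsupp.single (⟨s.1, Function.update s.2 C false⟩ : T.State) (T.weight C.1) else 0)

/-- The differential of the totally twisted skein complex. -/
def twisted : (T.State →₀ T.Coeff) →ₗ[T.Coeff] (T.State →₀ T.Coeff) :=
  T.vertical + T.horizontal T.Coeff

/-- The span of the pure states with the glyph `b` in the grading `i`. -/
def piece (R : Type*) [CommRing R] (i : ℤ) (b : Glyph M) : Submodule R (T.State →₀ R) :=
  Finsupp.supported R R {s | T.delta s = i ∧ T.glyph s = b}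

end Complexes

end TangleDiagram

/-- For an endomorphism `d` with `d ∘ d = 0` which maps `B` into `Z`: the kernel of `d` in `Z` modulo
the image of `B`. -/
abbrev homologyAt {R V : Type*} [CommRing R] [AddCommGroup V] [Module R V] (d : V →ₗ[R] V)
    (B Z : Submodule R V) : Type _ :=
  ↥(Z ⊓ LinearMap.ker d) ⧸ (B.map d).comap (Z ⊓ LinearMap.ker d).subtype

namespace TangleDiagram

section Homology

variable {D : Type*} {M : CellSurface D} [Finite D] (T : TangleDiagram M)

/-- The homology of the totally twisted skein complex for the glyph `b` in the `δ`-grading `i`. -/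
abbrev TwistedHomology (i : ℤ) (b : Glyph M) : Type _ :=
  homologyAt T.twisted (T.piece T.Coeff (i - 2) b) (T.piece T.Coeff i b)

/-- The Khovanov skein homology for the glyph `b` in the `δ`-grading `i`. -/
abbrev SkeinHomology (i : ℤ) (b : Glyph M) : Type _ :=
  homologyAt (T.horizontal (ZMod 2)) (T.piece (ZMod 2) (i - 2) b) (T.piece (ZMod 2) i b)

/-- The totally twisted skein complex and the Khovanov skein complex are complexes which split along
glyphs, with differentials of degree `2`; there is an isomorphism of complexes from the first to
the second one with extended scalars, compatible with gradings and glyphs; and the homology groups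
are isomorphic for each grading and each glyph. -/
def TwistedIsoSkein : Prop :=
  T.twisted ∘ₗ T.twisted = 0 ∧
  T.horizontal (ZMod 2) ∘ₗ T.horizontal (ZMod 2) = 0 ∧
  (∀ i b, (T.piece T.Coeff i b).map T.twisted ≤ T.piece T.Coeff (i + 2) b) ∧
  (∀ i b, (T.piece (ZMod 2) i b).map (T.horizontal (ZMod 2)) ≤ T.piece (ZMod 2) (i + 2) b) ∧
  (∃ Φ : (T.State →₀ T.Coeff) ≃ₗ[T.Coeff] T.Coeff ⊗[ZMod 2] (T.State →₀ ZMod 2),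
    Φ.toLinearMap ∘ₗ T.twisted
      = (T.horizontal (ZMod 2)).baseChange T.Coeff ∘ₗ Φ.toLinearMap ∧
    ∀ i b, (T.piece T.Coeff i b).map Φ.toLinearMap
      = (T.piece (ZMod 2) i b).baseChange T.Coeff) ∧
  (∀ i b, Nonempty
    (T.TwistedHomology i b ≃ₗ[T.Coeff] T.Coeff ⊗[ZMod 2] T.SkeinHomology i b))

end Homology

/-! ### Marked points and reduced homology -/

variable {D : Type*} {M : CellSurface D} (T : TangleDiagram M)

/-- Marked points on the diagram, away from crossings and end points, taken as vertices of the cell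
structure; `darts` is the set of the darts which start at them. -/
structure Marking where
  darts : Set D
  rot_mem : ∀ d, M.rot d ∈ darts ↔ d ∈ darts
  on_strand : ∀ d ∈ darts, ∃ e, M.SameVertex d e ∧ T.IsPass e

/-- Every closed component of the tangle has a marked point. -/
def Marking.MeetsClosed {T : TangleDiagram M} (P : T.Marking) : Prop :=
  ∀ K : T.LinkComponent, ∃ d : T.strand, T.linkComponent d = K ∧ (T.IsEnd d.1 ∨ d.1 ∈ P.darts)

namespace Marking

variable {T} (P : T.Marking)

theorem rot_symm_mem (d : D) : M.rot.symm d ∈ P.darts ↔ d ∈ P.darts := by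
  rw [← P.rot_mem (M.rot.symm d), Equiv.apply_symm_apply]

theorem zpow_mem (d : D) (n : ℤ) : (M.rot ^ n) d ∈ P.darts ↔ d ∈ P.darts := by
  induction n with
  | zero => simp
  | succ n ih => rw [add_comm, zpow_add, zpow_one, Equiv.Perm.mul_apply, P.rot_mem, ih]
  | pred n ih =>
    rw [sub_eq_add_neg, add_comm, zpow_add, zpow_neg_one, Equiv.Perm.mul_apply, ← ih]
    exact P.rot_symm_mem _

theorem not_crossing (d : D) (h : d ∈ P.darts) : ¬ T.IsCrossing d := by
  intro hc
  obtain ⟨e, he, h1, f, hf, hfe, hef, h2⟩ := P.on_strand d h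
  obtain ⟨hc1, hc2, hc3, hc4, hc5, hc6, hc7⟩ := (M.isCrossingOf_sameVertex T.strand he).1 hc
  have a1 := h2 _ hc2 ⟨1, by simp⟩
  have a2 := h2 _ hc3 ⟨2, by rw [zpow_ofNat, pow_two, Equiv.Perm.mul_apply]⟩
  rcases a1 with a1 | a1
  · exact hc5 a1
  · rcases a2 with a2 | a2
    · exact hc6 a2
    · exact hc5 (M.rot.injective (a2.trans a1.symm))

theorem not_hole (d : D) (h : d ∈ P.darts) : d ∉ M.hole := by
  intro hd
  obtain ⟨e, he, h1, f, hf, hfe, hef, h2⟩ := P.on_strand d h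
  have := (T.end_iff e h1).2 ⟨d, hd, he.symm⟩
  exact hfe (this.2 f hf hef)

open Classical in
def rotFun : D ⊕ (P.darts × Bool) → D ⊕ (P.darts × Bool)
  | Sum.inl d => if h : d ∈ P.darts then Sum.inr (⟨d, h⟩, true) else Sum.inl (M.rot d)
  | Sum.inr (e, true) => Sum.inr (e, false)
  | Sum.inr (e, false) => Sum.inl e.1

open Classical in
def rotInv : D ⊕ (P.darts × Bool) → D ⊕ (P.darts × Bool)
  | Sum.inl d => if h : d ∈ P.darts then Sum.inr (⟨d, h⟩, false) else Sum.inl (M.rot.symm d)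
  | Sum.inr (e, true) => Sum.inl e.1
  | Sum.inr (e, false) => Sum.inr (e, true)

def rot : Equiv.Perm (D ⊕ (P.darts × Bool)) where
  toFun := P.rotFun
  invFun := P.rotInv
  left_inv := by
    rintro (d | ⟨e, _ | _⟩)
    · by_cases h : d ∈ P.darts
      · simp [rotFun, rotInv, h]
      · simp [rotFun, rotInv, h, P.rot_mem]
    · simp [rotFun, rotInv]
    · simp [rotFun, rotInv]
  right_inv := by
    rintro (d | ⟨e, _ | _⟩)
    · by_cases h : d ∈ P.darts
      · simp [rotFun, rotInv, h]
      · simp [rotFun, rotInv, h, P.rot_symm_mem]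
    · simp [rotFun, rotInv]
    · simp [rotFun, rotInv]

def rev : D ⊕ (P.darts × Bool) → D ⊕ (P.darts × Bool)
  | Sum.inl d => Sum.inl (M.rev d)
  | Sum.inr (e, true) => Sum.inr (⟨M.rot e.1, (P.rot_mem _).2 e.2⟩, false)
  | Sum.inr (e, false) => Sum.inr (⟨M.rot.symm e.1, (P.rot_symm_mem _).2 e.2⟩, true)

theorem rot_zpow_inl (d : D) (h : d ∉ P.darts) (n : ℤ) :
    (P.rot ^ n) (Sum.inl d) = Sum.inl ((M.rot ^ n) d) := by
  have hn : ∀ n : ℤ, (M.rot ^ n) d ∉ P.darts := fun n => by rwa [P.zpow_mem]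
  induction n with
  | zero => simp
  | succ n ih =>
    rw [add_comm, zpow_add, zpow_one, Equiv.Perm.mul_apply, ih, zpow_add, zpow_one,
      Equiv.Perm.mul_apply]
    exact (dif_neg (hn _) : P.rotFun (Sum.inl ((M.rot ^ (n : ℤ)) d)) = _)
  | pred n ih =>
    rw [sub_eq_add_neg, add_comm, zpow_add, zpow_neg_one, Equiv.Perm.mul_apply, ih, zpow_add,
      zpow_neg_one, Equiv.Perm.mul_apply]
    exact (dif_neg (hn _) : P.rotInv (Sum.inl ((M.rot ^ (-n : ℤ)) d)) = _)

def base : D ⊕ (P.darts × Bool) → D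
  | Sum.inl d => d
  | Sum.inr (e, _) => e.1

theorem base_zpow (x : D ⊕ (P.darts × Bool)) (h : P.base x ∈ P.darts) (n : ℤ) :
    P.base ((P.rot ^ n) x) = P.base x := by
  have h1 : ∀ y, P.base y ∈ P.darts → P.base (P.rotFun y) = P.base y := by
    rintro (d | ⟨e, _ | _⟩) hy
    · have : d ∈ P.darts := hy
      simp [rotFun, base, this]
    · rfl
    · rfl
  have h2 : ∀ y, P.base y ∈ P.darts → P.base (P.rotInv y) = P.base y := by
    rintro (d | ⟨e, _ | _⟩) hy
    · have : d ∈ P.darts := hy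
      simp [rotInv, base, this]
    · rfl
    · rfl
  induction n with
  | zero => simp
  | succ n ih =>
    rw [add_comm, zpow_add, zpow_one, Equiv.Perm.mul_apply]
    exact (h1 _ (by rw [ih]; exact h)).trans ih
  | pred n ih =>
    rw [sub_eq_add_neg, add_comm, zpow_add, zpow_neg_one, Equiv.Perm.mul_apply]
    exact (h2 _ (by rw [ih]; exact h)).trans ih

/-- The surface without open disc neighbourhoods of the marked points: each dart `e` at a marked point
now starts at its own vertex on the new boundary circle.  The new darts `(e, true)` and
`(e, false)` run along this circle, counterclockwise and clockwise as seen from the marked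
point, from the vertex of `e` to the vertices of its neighbours. -/
def surface : CellSurface (D ⊕ (P.darts × Bool)) where
  rot := P.rot
  rev := P.rev
  hole := {x | (∃ d ∈ M.hole, x = Sum.inl d) ∨ ∃ e, x = Sum.inr (e, true)}
  rev_rev := by
    rintro (d | ⟨e, _ | _⟩) <;> simp [rev, M.rev_rev]
  rev_ne := by
    rintro (d | ⟨e, _ | _⟩) <;> simp [rev, M.rev_ne]
  hole_face := by
    rintro (d | ⟨e, _ | _⟩)
    · show P.rotInv (Sum.inl (M.rev d)) ∈ _ ↔ _
      by_cases h : M.rev d ∈ P.darts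
      · have := P.not_hole _ ((P.rot_symm_mem _).2 h)
        rw [M.hole_face] at this
        simp [rotInv, h, this]
      · simp [rotInv, h, M.hole_face]
    · show P.rotInv (Sum.inr (_, true)) ∈ _ ↔ _
      have := P.not_hole _ ((P.rot_symm_mem _).2 e.2)
      simp [rotInv, this]
    · show P.rotInv (Sum.inr (_, false)) ∈ _ ↔ _
      simp [rotInv, P.rot_mem]
  hole_edge := by
    rintro _ (⟨d, hd, rfl⟩ | ⟨e, rfl⟩)
    · simpa [rev] using M.hole_edge d hd
    · simp [rev]
  hole_vertex := by
    rintro _ (⟨d, hd, rfl⟩ | ⟨e, rfl⟩) y hy ⟨n, hn⟩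
    · rw [P.rot_zpow_inl d (fun h => P.not_hole d h hd) n] at hn
      subst hn
      rcases hy with ⟨f, hf, hfe⟩ | ⟨f, hf⟩
      · rw [hfe, M.hole_vertex d hd f hf ⟨n, Sum.inl_injective hfe⟩]
      · simp at hf
    · have hb := P.base_zpow (Sum.inr (e, true)) e.2 n
      rw [hn] at hb
      rcases hy with ⟨f, hf, rfl⟩ | ⟨f, rfl⟩
      · exact absurd hf (P.not_hole f (by rw [show f = e.1 from hb]; exact e.2))
      · rw [Subtype.ext (show f.1 = e.1 from hb)]

theorem sameVertex_inl (d : D) (h : d ∉ P.darts) (x : D ⊕ (P.darts × Bool)) :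
    P.surface.SameVertex (Sum.inl d) x ↔ ∃ e, x = Sum.inl e ∧ M.SameVertex d e := by
  constructor
  · rintro ⟨n, rfl⟩
    exact ⟨_, P.rot_zpow_inl d h n, n, rfl⟩
  · rintro ⟨e, rfl, n, rfl⟩
    exact ⟨n, P.rot_zpow_inl d h n⟩

theorem sameVertex_marked (d : D) (h : d ∈ P.darts) (e : D)
    (he : P.surface.SameVertex (Sum.inl d) (Sum.inl e)) : e = d := by
  obtain ⟨n, hn⟩ := he
  have := P.base_zpow (Sum.inl d) h n
  rw [show (P.rot ^ n) (Sum.inl d) = Sum.inl e from hn] at this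
  exact this

theorem isCrossing_inl (x : D ⊕ (P.darts × Bool)) :
    P.surface.IsCrossingOf (Sum.inl '' T.strand) x ↔ ∃ d, x = Sum.inl d ∧ T.IsCrossing d := by
  have hrot : ∀ d, d ∉ P.darts → P.surface.rot (Sum.inl d) = Sum.inl (M.rot d) := fun d h =>
    (dif_neg h : P.rotFun (Sum.inl d) = _)
  have main : ∀ d, d ∉ P.darts →
      (P.surface.IsCrossingOf (Sum.inl '' T.strand) (Sum.inl d) ↔ T.IsCrossing d) := by
    intro d h
    have h1 := fun h' => h ((P.rot_mem d).1 h')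
    have h2 := fun h' => h1 ((P.rot_mem _).1 h')
    have h3 := fun h' => h2 ((P.rot_mem _).1 h')
    simp only [CellSurface.IsCrossingOf, IsCrossing, hrot d h, hrot _ h1, hrot _ h2, hrot _ h3,
      Set.mem_image, Sum.inl.injEq, exists_eq_right, ne_eq]
  constructor
  · intro hx
    obtain ⟨d, hd, rfl⟩ := hx.1
    refine ⟨d, rfl, (main d fun h => ?_).1 hx⟩
    obtain ⟨e, he, h2⟩ := hx.2.1
    rw [show P.surface.rot (Sum.inl d) = Sum.inr (⟨d, h⟩, true) from
      (dif_pos h : P.rotFun (Sum.inl d) = _)] at h2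
    simp at h2
  · rintro ⟨d, rfl, hd⟩
    exact (main d fun h => P.not_crossing d h hd).2 hd

/-- The tangle diagram on the surface without neighbourhoods of the marked points: each component of
the diagram is cut open at its marked points.  The twisted and the untwisted skein homology of this
diagram are the reduced homologies of `T` determined by the marked points. -/
def punctured : TangleDiagram P.surface where
  strand := Sum.inl '' T.strand
  upper := Sum.inl '' T.upper
  fwd := Sum.inl '' T.fwd
  rev_mem := by
    rintro _ ⟨d, hd, rfl⟩
    exact ⟨M.rev d, T.rev_mem d hd, rfl⟩
  strand_inner := by
    rintro _ ⟨d, hd, rfl⟩ (⟨e, he, h⟩ | ⟨e, h⟩)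
    · exact T.strand_inner d hd (by rw [Sum.inl_injective h]; exact he)
    · simp at h
  vertex_type := by
    rintro _ ⟨d, hd, rfl⟩
    by_cases h : d ∈ P.darts
    · refine Or.inl ⟨⟨d, hd, rfl⟩, ?_⟩
      rintro _ ⟨e, he, rfl⟩ hde
      rw [P.sameVertex_marked d h e hde]
    · rcases T.vertex_type d hd with h1 | ⟨_, e, he, hed, hde, h2⟩ | h1
      · refine Or.inl ⟨⟨d, hd, rfl⟩, ?_⟩
        rintro _ ⟨e, he, rfl⟩ hde
        rw [P.sameVertex_inl d h] at hde
        obtain ⟨f, hf, hdf⟩ := hde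
        rw [h1.2 e he (by rw [Sum.inl_injective hf]; exact hdf)]
      · refine Or.inr (Or.inl ⟨⟨d, hd, rfl⟩, Sum.inl e, ⟨e, he, rfl⟩, fun h' => hed
          (Sum.inl_injective h'), (P.sameVertex_inl d h _).2 ⟨e, rfl, hde⟩, ?_⟩)
        rintro _ ⟨f, hf, rfl⟩ hdf
        rw [P.sameVertex_inl d h] at hdf
        obtain ⟨g, hg, hdg⟩ := hdf
        rcases h2 f hf (by rw [Sum.inl_injective hg]; exact hdg) with h3 | h3
        · exact Or.inl (by rw [h3])
        · exact Or.inr (by rw [h3])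
      · exact Or.inr (Or.inr ((P.isCrossing_inl _).2 ⟨d, rfl, h1⟩))
  end_iff := by
    rintro _ ⟨d, hd, rfl⟩
    by_cases h : d ∈ P.darts
    · refine iff_of_true ⟨⟨d, hd, rfl⟩, ?_⟩ ?_
      · rintro _ ⟨e, he, rfl⟩ hde
        rw [P.sameVertex_marked d h e hde]
      · exact ⟨Sum.inr (⟨d, h⟩, true), Or.inr ⟨_, rfl⟩, 1,
          (dif_pos h : P.rotFun (Sum.inl d) = _)⟩
    · have key : P.surface.IsEndOf (Sum.inl '' T.strand) (Sum.inl d) ↔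
          M.IsEndOf T.strand d := by
        constructor
        · rintro ⟨_, h1⟩
          exact ⟨hd, fun e he hde => Sum.inl_injective
            (h1 _ ⟨e, he, rfl⟩ ((P.sameVertex_inl d h _).2 ⟨e, rfl, hde⟩))⟩
        · rintro ⟨_, h1⟩
          refine ⟨⟨d, hd, rfl⟩, ?_⟩
          rintro _ ⟨e, he, rfl⟩ hde
          rw [P.sameVertex_inl d h] at hde
          obtain ⟨f, hf, hdf⟩ := hde
          rw [h1 e he (by rw [Sum.inl_injective hf]; exact hdf)]
      rw [key, T.end_iff d hd]
      constructor
      · rintro ⟨e, he, hde⟩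
        exact ⟨Sum.inl e, Or.inl ⟨e, he, rfl⟩, (P.sameVertex_inl d h _).2 ⟨e, rfl, hde⟩⟩
      · rintro ⟨x, hx, hdx⟩
        rw [P.sameVertex_inl d h] at hdx
        obtain ⟨e, rfl, hde⟩ := hdx
        rcases hx with ⟨f, hf, hfe⟩ | ⟨f, hf⟩
        · exact ⟨e, by rw [Sum.inl_injective hfe]; exact hf, hde⟩
        · simp at hf
  upper_rot := by
    intro x hx
    obtain ⟨d, rfl, hd⟩ := (P.isCrossing_inl x).1 hx
    rw [show P.surface.rot (Sum.inl d) = Sum.inl (M.rot d) from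
      (dif_neg (fun h => P.not_crossing d h hd) : P.rotFun (Sum.inl d) = _)]
    simpa using T.upper_rot d hd
  fwd_rev := by
    rintro _ ⟨d, hd, rfl⟩
    simpa [surface, rev] using T.fwd_rev d hd
  fwd_pass := by
    rintro _ ⟨d, hd, rfl⟩ _ ⟨e, he, rfl⟩ hc hde hne
    have hc' : ¬ T.IsCrossing d := fun h => hc ((P.isCrossing_inl _).2 ⟨d, rfl, h⟩)
    by_cases h : d ∈ P.darts
    · exact absurd (by rw [P.sameVertex_marked d h e hde]) hne
    · rw [P.sameVertex_inl d h] at hde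
      obtain ⟨f, hf, hdf⟩ := hde
      rw [← Sum.inl_injective hf] at hdf
      simpa using T.fwd_pass d hd e he hc' hdf (fun h' => hne (by rw [h']))
  fwd_crossing := by
    intro x hx
    obtain ⟨d, rfl, hd⟩ := (P.isCrossing_inl x).1 hx
    have h1 : d ∉ P.darts := fun h => P.not_crossing d h hd
    have h2 : M.rot d ∉ P.darts := fun h => h1 ((P.rot_mem d).1 h)
    rw [show P.surface.rot (Sum.inl d) = Sum.inl (M.rot d) from
        (dif_neg h1 : P.rotFun (Sum.inl d) = _),
      show P.surface.rot (Sum.inl (M.rot d)) = Sum.inl (M.rot (M.rot d)) from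
        (dif_neg h2 : P.rotFun (Sum.inl (M.rot d)) = _)]
    simpa using T.fwd_crossing d hd

end Marking

end TangleDiagram

end

end Skein

/-!
The argument rests on one identity. For a crossing `c`, let `T.forward R c` be the change of `c` from its
0-resolution to its 1-resolution by the entries of the skein algebra, so that the horizontal differential
`d` is the sum of these operators, and let `T.backward R c` be the change in the opposite direction by the
same entries. For a dart `x` of the diagram, let `T.dot R x` be the change of the sign of the component of
`x` from `+` to `-`, if that component is a contractible circle. Over a ring of characteristic two,
`T.backward R c` commutes with the changes of the other crossings, and its commutator with `d` is
`T.bridgeDot R c`, the sum of the dots on two opposite darts at `c` (`saddle_sq`). Hence dots at two places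
of one strand are homotopic when they are separated by a crossing. The dot at an end of an arc is zero, so
for a tangle of arcs all dots are combinations of the operators `T.bridgeDot R c` (`dot_mem_span`), and so
is the vertical differential, which is the sum over the edges of the variable times the dot
(`exists_vertical_eq`). Since `T.backward R c` has square zero and is annihilated by `T.bridgeDot R c`, the
conjugation with the involution `1 + a • T.backward R c` removes the summand `a • T.bridgeDot R c`, and these
conjugations remove the vertical differential (`backward_conj`, `exists_conj`). This is the isomorphism of
`twistedIsoSkein`; in particular the twisted differential has square zero, as `d` has. The degrees and the glyph
are controlled for each of the operators separately (`saddle_degrees`, `dot_degrees`).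

It remains to show that the changes of two crossings commute and that the dots behave as stated; with the
rules of the skein algebra taken literally this would be a long case distinction. Instead, the surface is
disregarded at first: all circles are treated alike, and `T.surgery R c` acts by the multiplication and the
comultiplication of `R[X] / X ^ 2`, with zero for two arcs. A surgery commutes with the operators
`T.lower R x`, which multiply by `X` at the dart `x`, so that it is determined by its values on the states
without signs `-`, where it is `1` or the sum of the operators of two opposite darts. Which of the two it is
depends on a relation in the `ZMod 2`-module `T.rels S` spanned by the relations between darts of one
component, and the identities `surgery_comm`, `surgery_sq` and `surgery_bridge` become linear algebra in these
modules. The skein algebra is then recovered as an associated graded object: the number of signs `+` minus the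
number of signs `-` on the noncontractible circles does not increase, and the entries which preserve it are
exactly those of the skein algebra (`local_sign`). Passage to the graded operators is multiplicative
(`gr_mul`), so all identities are inherited.

The filtration needs one fact of topology: if two of the three circles at a merging are contractible, then so
is the third one (`contractible_merge`). A circle is contractible if and only if one of its two sides has no
holes and Euler characteristic `1` (`Side.contractible_iff`), and when two sides are joined or subtracted at
the crossing, their Euler characteristics change in a way which is counted cell by cell (`euler_flip`). A
connected region with nonempty frontier has Euler characteristic at most `1`, since gluing its polygons one
after the other ends with a disc or a smaller value (`euler_le_one`, `polygons`); so the equations and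
inequalities between the Euler characteristics of the six sides decide which of them are discs.

The glyph is preserved for a reason of homotopy. The gluing of polygons also shows that a region of Euler
characteristic `1` without holes has a contractible boundary loop (`nullAt_of_contractible`). A merging with a contractible
circle inserts such a loop into an edge path, which does not change the homotopy class of a circle
(`lap_merge`) or of an arc (`Run.detour`); and two noncontractible circles which merge to a contractible one
are parallel and have opposite signs, so that their labels cancel (`labelAt_add`, `glyph_local`).

For marked points, each strand of the punctured diagram ends at a puncture or at a former end, so that the
punctured diagram consists of arcs (`onlyArcs_punctured`).
-/

open scoped TensorProduct
namespace Skein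
noncomputable section

/-! ### Orbits of two involutions -/

section Dihedral

variable {X : Type*} {r m : X → X}

/-- Two points lie in the same orbit of the group generated by the involutions `r` and `m`. -/
def Conn (r m : X → X) : X → X → Prop := Relation.EqvGen (fun x y => y = r x ∨ y = m x)

theorem Conn.refl (x : X) : Conn r m x x := Relation.EqvGen.refl x
theorem Conn.symm {x y : X} (h : Conn r m x y) : Conn r m y x := Relation.EqvGen.symm _ _ h
theorem Conn.trans {x y z : X} (h : Conn r m x y) (h' : Conn r m y z) : Conn r m x z :=
  Relation.EqvGen.trans _ _ _ h h'
theorem Conn.left (x : X) : Conn r m x (r x) := Relation.EqvGen.rel _ _ (Or.inl rfl)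
theorem Conn.right (x : X) : Conn r m x (m x) := Relation.EqvGen.rel _ _ (Or.inr rfl)

theorem Conn.lift {β : Sort*} (g : X → β) (h1 : ∀ x, g (r x) = g x) (h2 : ∀ x, g (m x) = g x)
    {x y : X} (h : Conn r m x y) : g x = g y := by
  induction h with
  | rel x y h => rcases h with rfl | rfl
                 · exact (h1 x).symm
                 · exact (h2 x).symm
  | refl => rfl
  | symm _ _ _ ih => exact ih.symm
  | trans _ _ _ _ _ ih1 ih2 => exact ih1.trans ih2

theorem Conn.mono {m' : X → X} (H : ∀ x, Conn r m' x (m x)) {x y : X} (h : Conn r m x y) :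
    Conn r m' x y := by
  induction h with
  | rel x y h => rcases h with rfl | rfl
                 · exact Conn.left x
                 · exact H x
  | refl => exact Conn.refl _
  | symm _ _ _ ih => exact ih.symm
  | trans _ _ _ _ _ ih1 ih2 => exact ih1.trans ih2

/-- The composite of the two involutions, as a permutation. -/
def walk (hr : Function.Involutive r) (hm : Function.Involutive m) : Equiv.Perm X :=
  hm.toPerm m * hr.toPerm r

variable (hr : Function.Involutive r) (hm : Function.Involutive m)

theorem walk_apply (x : X) : walk hr hm x = m (r x) := rfl

theorem m_walk_zpow (k : ℤ) (x : X) :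
    m ((walk hr hm ^ k) x) = (walk hr hm ^ (-k)) (m x) := by
  have h : hm.toPerm m * walk hr hm * (hm.toPerm m)⁻¹ = (walk hr hm)⁻¹ := by
    ext x
    simp [walk, hm _]
  have h2 := conj_zpow (a := hm.toPerm m) (b := walk hr hm) (i := k)
  rw [h, inv_zpow', eq_mul_inv_iff_mul_eq] at h2
  exact (DFunLike.congr_fun h2 x).symm

theorem r_walk_zpow (k : ℤ) (x : X) :
    r ((walk hr hm ^ k) x) = (walk hr hm ^ (-k)) (r x) := by
  have h : hr.toPerm r * walk hr hm * (hr.toPerm r)⁻¹ = (walk hr hm)⁻¹ := by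
    ext x
    simp [walk, hr _]
  have h2 := conj_zpow (a := hr.toPerm r) (b := walk hr hm) (i := k)
  rw [h, inv_zpow', eq_mul_inv_iff_mul_eq] at h2
  exact (DFunLike.congr_fun h2 x).symm

theorem walk_symm_apply (x : X) : (walk hr hm ^ (-1 : ℤ)) x = r (m x) := by
  rw [zpow_neg_one]
  rfl

theorem Conn.walk_zpow (k : ℤ) (x : X) : Conn r m x ((walk hr hm ^ k) x) := by
  induction k with
  | zero => exact Conn.refl _
  | succ n ih =>
    rw [add_comm, zpow_add, zpow_one, Equiv.Perm.mul_apply, walk_apply]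
    exact (ih.trans (Conn.left _)).trans (Conn.right _)
  | pred n ih =>
    rw [sub_eq_add_neg, add_comm, zpow_add, Equiv.Perm.mul_apply, walk_symm_apply]
    exact (ih.trans (Conn.right _)).trans (Conn.left _)

/-- The orbit of `x` consists of the walk from `x` and of its reflection. -/
theorem Conn.exists_walk {x y : X} (h : Conn r m x y) :
    ∃ k : ℤ, y = (walk hr hm ^ k) x ∨ y = r ((walk hr hm ^ k) x) := by
  have key : ∀ y, (∃ k : ℤ, y = (walk hr hm ^ k) x ∨ y = r ((walk hr hm ^ k) x)) →
      ∃ k : ℤ, r y = (walk hr hm ^ k) x ∨ r y = r ((walk hr hm ^ k) x) := by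
    rintro y ⟨k, rfl | rfl⟩
    · exact ⟨k, Or.inr rfl⟩
    · exact ⟨k, Or.inl (hr _)⟩
  have key2 : ∀ y, (∃ k : ℤ, y = (walk hr hm ^ k) x ∨ y = r ((walk hr hm ^ k) x)) →
      ∃ k : ℤ, m y = (walk hr hm ^ k) x ∨ m y = r ((walk hr hm ^ k) x) := by
    rintro y ⟨k, rfl | rfl⟩
    · refine ⟨-1 + k, Or.inr ?_⟩
      rw [zpow_add, Equiv.Perm.mul_apply, walk_symm_apply, hr]
    · refine ⟨1 + k, Or.inl ?_⟩
      rw [zpow_add, zpow_one, Equiv.Perm.mul_apply, walk_apply]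
  have h3 := Conn.lift (r := r) (m := m)
    (fun y => ∃ k : ℤ, y = (walk hr hm ^ k) x ∨ y = r ((walk hr hm ^ k) x))
    (fun y => propext ⟨fun h => by simpa only [hr y] using key _ h, key y⟩)
    (fun y => propext ⟨fun h => by simpa only [hm y] using key2 _ h, key2 y⟩) h
  rw [← h3]
  exact ⟨0, Or.inl rfl⟩

/-- An orbit which contains a fixed point `x` of `m` is an arc: it contains exactly one further fixed
point of `m`. -/
theorem exists_other_end [Finite X] (hr : Function.Involutive r) (hm : Function.Involutive m)
    (hr' : ∀ x, r x ≠ x) {x : X} (hx : m x = x) :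
    ∃ y, y ≠ x ∧ m y = y ∧ Conn r m x y ∧ ∀ z, Conn r m x z → m z = z → z = x ∨ z = y := by
  set f := walk hr hm with hf
  have hrx : r x = (f ^ (-1 : ℤ)) x := by rw [hf, walk_symm_apply, hx]
  -- the orbit is the cycle of `x` under `f`; `m` reflects it in `x`, and `r` reflects it in the middle of an edge
  have hper : ∀ j : ℤ, (f ^ j) x = x ↔ (Function.minimalPeriod f x : ℤ) ∣ j := fun j => by
    have := MulAction.zpow_smul_eq_iff_minimalPeriod_dvd (a := f) (b := x) (n := j)
    simpa using this
  have hpos : 0 < Function.minimalPeriod f x :=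
    Function.minimalPeriod_pos_of_mem_periodicPts
      (Function.Injective.mem_periodicPts f.injective x)
  have hfix : ∀ j : ℤ, m ((f ^ j) x) = (f ^ j) x ↔ (Function.minimalPeriod f x : ℤ) ∣ 2 * j := by
    intro j
    rw [← hper, m_walk_zpow hr hm, hx, two_mul, zpow_add, Equiv.Perm.mul_apply, zpow_neg,
      Equiv.Perm.inv_eq_iff_eq, ← hf, eq_comm]
  have hrj : ∀ j : ℤ, ¬ (Function.minimalPeriod f x : ℤ) ∣ 2 * j + 1 := by
    intro j hj
    rw [← hper] at hj
    apply hr' ((f ^ j) x)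
    rw [r_walk_zpow hr hm, ← hf, hrx, ← Equiv.Perm.mul_apply, ← zpow_add]
    conv_rhs => rw [← Equiv.apply_symm_apply (f ^ (j + 1)) ((f ^ j) x)]
    have e : (f ^ (-j + -1)) x = (f ^ (-j - 1)) ((f ^ (2 * j + 1)) x) := by
      rw [hj]; rfl
    rw [e, ← Equiv.Perm.mul_apply, ← zpow_add, Equiv.apply_symm_apply]
    congr 2
    ring
  have hcov : ∀ z, Conn r m x z → ∃ j : ℤ, z = (f ^ j) x := by
    intro z hz
    obtain ⟨k, rfl | rfl⟩ := Conn.exists_walk hr hm hz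
    · exact ⟨k, rfl⟩
    · refine ⟨-k + -1, ?_⟩
      rw [r_walk_zpow hr hm, ← hf, hrx, ← Equiv.Perm.mul_apply, ← zpow_add]
  -- `r` has no fixed point, so the period is even; the other fixed point of `m` is the antipode of `x`
  obtain ⟨k, hk⟩ : ∃ k : ℕ, Function.minimalPeriod f x = 2 * k := by
    rcases Nat.even_or_odd' (Function.minimalPeriod f x) with ⟨k, hk | hk⟩
    · exact ⟨k, hk⟩
    · exact absurd (by rw [hk]; push_cast; rfl) (hrj k)
  refine ⟨(f ^ (k : ℤ)) x, ?_, (hfix _).2 (by rw [hk]; push_cast; rfl), Conn.walk_zpow hr hm _ _, ?_⟩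
  · rw [Ne, hper, hk]
    push_cast
    rintro ⟨c, hc⟩
    have hk0 : (k : ℤ) ≠ 0 := by omega
    have : (k : ℤ) * (2 * c - 1) = 0 := by linear_combination -hc
    rcases mul_eq_zero.1 this with h | h
    · exact hk0 h
    · omega
  · intro z hz hmz
    obtain ⟨j, rfl⟩ := hcov z hz
    rw [hfix, hk] at hmz
    push_cast at hmz
    obtain ⟨c, hc⟩ := (mul_dvd_mul_iff_left (two_ne_zero (α := ℤ))).1 hmz
    rcases Int.even_or_odd' c with ⟨b, hb | hb⟩
    · left
      rw [hper, hk]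
      exact ⟨b, by push_cast; rw [hc, hb]; ring⟩
    · right
      rw [hc, hb, mul_add, mul_one, add_comm, zpow_add, Equiv.Perm.mul_apply]
      congr 1
      rw [hper, hk]
      exact ⟨b, by push_cast; ring⟩

/-- The orbit of `x` is an arc. -/
def Arc (r m : X → X) (x : X) : Prop := ∃ e, Conn r m x e ∧ m e = e

/-- Two involutions which differ by a smoothing: `m` pairs `p, a` and `q, b`, whereas `m'` pairs `p, b`
and `q, a`. -/
structure Smoothing (m m' : X → X) (p a q b : X) : Prop where
  m_p : m p = a
  m_q : m q = b
  m'_p : m' p = b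
  m'_q : m' q = a
  off : ∀ x, x ≠ p → x ≠ a → x ≠ q → x ≠ b → m' x = m x
  ne : p ≠ a ∧ p ≠ q ∧ p ≠ b ∧ a ≠ q ∧ a ≠ b ∧ q ≠ b

namespace Smoothing

variable {m' : X → X} {p a q b : X}

theorem swap (h : Smoothing m m' p a q b) : Smoothing m' m p b q a :=
  ⟨h.m'_p, h.m'_q, h.m_p, h.m_q, fun x h1 h2 h3 h4 => (h.off x h1 h4 h3 h2).symm,
    ⟨h.ne.2.2.1, h.ne.2.1, h.ne.1, h.ne.2.2.2.2.2.symm, h.ne.2.2.2.2.1.symm,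
      h.ne.2.2.2.1.symm⟩⟩

theorem turn (h : Smoothing m m' p a q b) : Smoothing m m' q b p a :=
  ⟨h.m_q, h.m_p, h.m'_q, h.m'_p, fun x h1 h2 h3 h4 => h.off x h3 h4 h1 h2,
    ⟨h.ne.2.2.2.2.2, h.ne.2.1.symm, h.ne.2.2.2.1.symm, h.ne.2.2.1.symm, h.ne.2.2.2.2.1.symm,
      h.ne.1⟩⟩

theorem flip (hm : Function.Involutive m) (hm' : Function.Involutive m')
    (h : Smoothing m m' p a q b) : Smoothing m m' a p b q :=
  ⟨by rw [← h.m_p, hm], by rw [← h.m_q, hm], by rw [← h.m'_q, hm'], by rw [← h.m'_p, hm'],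
    fun x h1 h2 h3 h4 => h.off x h2 h1 h4 h3,
    ⟨h.ne.1.symm, h.ne.2.2.2.2.1, h.ne.2.2.2.1, h.ne.2.2.1, h.ne.2.1, h.ne.2.2.2.2.2.symm⟩⟩

open Classical in
/-- The common part of the two involutions: the four points become fixed. -/
def cut (_h : Smoothing m m' p a q b) (x : X) : X :=
  if x = p ∨ x = a ∨ x = q ∨ x = b then x else m x

theorem cut_eq_self (h : Smoothing m m' p a q b) {x : X} (hx : x = p ∨ x = a ∨ x = q ∨ x = b) :
    h.cut x = x := if_pos hx

theorem cut_of_not (h : Smoothing m m' p a q b) {x : X}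
    (hx : ¬ (x = p ∨ x = a ∨ x = q ∨ x = b)) : h.cut x = m x := if_neg hx

theorem off_not (h : Smoothing m m' p a q b) {x : X}
    (hx : ¬ (x = p ∨ x = a ∨ x = q ∨ x = b)) : m' x = m x := by
  push Not at hx
  exact h.off x hx.1 hx.2.1 hx.2.2.1 hx.2.2.2

theorem m_mem (hm : Function.Involutive m) (h : Smoothing m m' p a q b) {x : X} :
    (m x = p ∨ m x = a ∨ m x = q ∨ m x = b) ↔ (x = p ∨ x = a ∨ x = q ∨ x = b) := by
  have h1 : ∀ u v, m u = v → (m x = v ↔ x = u) := fun u v huv =>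
    ⟨fun hx => hm.injective (hx.trans huv.symm), fun hx => by rw [hx, huv]⟩
  have h3 : m a = p := by rw [← h.m_p, hm]
  have h4 : m b = q := by rw [← h.m_q, hm]
  rw [h1 _ _ h3, h1 _ _ h4, h1 _ _ h.m_p, h1 _ _ h.m_q]
  tauto

theorem cut_involutive (hm : Function.Involutive m) (h : Smoothing m m' p a q b) :
    Function.Involutive h.cut := by
  intro x
  by_cases hx : x = p ∨ x = a ∨ x = q ∨ x = b
  · rw [h.cut_eq_self hx, h.cut_eq_self hx]
  · rw [h.cut_of_not hx, h.cut_of_not (fun h' => hx ((h.m_mem hm).1 h')), hm]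

theorem conn_of_cut (h : Smoothing m m' p a q b) {x y : X} (hc : Conn r h.cut x y) :
    Conn r m x y := by
  refine Conn.mono (fun x => ?_) hc
  by_cases hx : x = p ∨ x = a ∨ x = q ∨ x = b
  · rw [h.cut_eq_self hx]; exact Conn.refl _
  · rw [h.cut_of_not hx]; exact Conn.right _

theorem conn_of_cut' (h : Smoothing m m' p a q b) {x y : X} (hc : Conn r h.cut x y) :
    Conn r m' x y := by
  refine Conn.mono (fun x => ?_) hc
  by_cases hx : x = p ∨ x = a ∨ x = q ∨ x = b
  · rw [h.cut_eq_self hx]; exact Conn.refl _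
  · rw [h.cut_of_not hx, ← h.off_not hx]; exact Conn.right _

theorem conn_pa (h : Smoothing m m' p a q b) : Conn r m p a := by
  rw [← h.m_p]; exact Conn.right _

theorem conn_qb (h : Smoothing m m' p a q b) : Conn r m q b := by
  rw [← h.m_q]; exact Conn.right _

theorem arc_of_fixed (h : Smoothing m m' p a q b) {x y : X} (hc : Conn r h.cut x y)
    (hy : h.cut y = y) (hn : ¬ (y = p ∨ y = a ∨ y = q ∨ y = b)) : Arc r m x ∧ Arc r m' x := by
  rw [h.cut_of_not hn] at hy
  exact ⟨⟨y, h.conn_of_cut hc, hy⟩, ⟨y, h.conn_of_cut' hc, by rw [h.off_not hn, hy]⟩⟩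

variable [Finite X]

/-- If the strand through `p` and `a` is a circle which does not pass through `q`, then it runs from
`p` to `a` outside the smoothing. -/
theorem conn_cut (hr : Function.Involutive r) (hr' : ∀ x, r x ≠ x) (hm : Function.Involutive m)
    (h : Smoothing m m' p a q b) (h1 : ¬ Conn r m p q) (h2 : ¬ Arc r m p) :
    Conn r h.cut p a := by
  obtain ⟨y, hyp, hy, hc, -⟩ := exists_other_end hr (h.cut_involutive hm) hr'
    (h.cut_eq_self (Or.inl rfl))
  by_cases hn : y = p ∨ y = a ∨ y = q ∨ y = b
  · rcases hn with rfl | rfl | rfl | rfl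
    · exact absurd rfl hyp
    · exact hc
    · exact absurd (h.conn_of_cut hc) h1
    · exact absurd ((h.conn_of_cut hc).trans h.conn_qb.symm) h1
  · exact absurd (h.arc_of_fixed hc hy hn).1 h2

/-- The two strands at a smoothing coincide before or after it, if all arcs are identified. -/
theorem same_or_same (hr : Function.Involutive r) (hr' : ∀ x, r x ≠ x)
    (hm : Function.Involutive m) (h : Smoothing m m' p a q b) :
    (Conn r m p q ∨ Arc r m p ∧ Arc r m q) ∨ Conn r m' p q ∨ Arc r m' p ∧ Arc r m' q := by
  by_contra hcon
  push Not at hcon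
  obtain ⟨⟨h1, h2⟩, h3, h4⟩ := hcon
  by_cases hp : Arc r m p
  · have hq := h2 hp
    have := (h.turn).conn_cut hr hr' hm (fun h' => h1 h'.symm) hq
    have := (h.turn).conn_of_cut' this
    exact h3 ((this.trans h.swap.conn_pa.symm).symm)
  · have := h.conn_cut hr hr' hm h1 hp
    exact h3 ((h.conn_of_cut' this).trans h.swap.conn_qb.symm)

/-- If a circle merges with another strand, then components become larger. -/
theorem merge_conn (hr : Function.Involutive r) (hr' : ∀ x, r x ≠ x)
    (hm : Function.Involutive m) (h : Smoothing m m' p a q b)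
    (h1 : ¬ Conn r m p q) (h2 : ¬ (Arc r m p ∧ Arc r m q)) : Conn r m' p q := by
  by_cases hp : Arc r m p
  · have := (h.turn).conn_cut hr hr' hm (fun h' => h1 h'.symm) (fun hq => h2 ⟨hp, hq⟩)
    have := (h.turn).conn_of_cut' this
    exact ((this.trans h.swap.conn_pa.symm).symm)
  · have := h.conn_cut hr hr' hm h1 hp
    exact ((h.conn_of_cut' this).trans h.swap.conn_qb.symm)

end Smoothing

end Dihedral

/-! ### Strands and their smoothings -/

namespace CellSurface

variable {D : Type*} (M : CellSurface D)

theorem SameVertex.refl (d : D) : M.SameVertex d d := Equiv.Perm.SameCycle.refl _ _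

variable {M} in
theorem SameVertex.symm {d e : D} (h : M.SameVertex d e) : M.SameVertex e d :=
  Equiv.Perm.SameCycle.symm h

variable {M} in
theorem SameVertex.trans {d e f : D} (h : M.SameVertex d e) (h' : M.SameVertex e f) :
    M.SameVertex d f := Equiv.Perm.SameCycle.trans h h'

theorem sameVertex_rot (d : D) : M.SameVertex d (M.rot d) := ⟨1, by simp⟩

theorem sameVertex_rot_symm (d : D) : M.SameVertex d (M.rot.symm d) := ⟨-1, by simp⟩

theorem rot_symm_of_crossing {X : Set D} {d : D} (h : M.IsCrossingOf X d) :
    M.rot.symm d = M.rot (M.rot (M.rot d)) := by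
  rw [Equiv.symm_apply_eq]
  exact h.2.2.2.2.2.2.symm

theorem sameVertex_crossing {X : Set D} {d e : D} (h : M.IsCrossingOf X d)
    (hde : M.SameVertex d e) :
    e = d ∨ e = M.rot d ∨ e = M.rot (M.rot d) ∨ e = M.rot (M.rot (M.rot d)) := by
  obtain ⟨n, rfl⟩ := hde
  have h4 : (M.rot ^ (4 : ℤ)) d = d := h.2.2.2.2.2.2
  have h5 : ∀ k : ℤ, (M.rot ^ (4 * k)) d = d := fun k => by
    rw [zpow_mul]
    exact Equiv.Perm.zpow_apply_eq_self_of_apply_eq_self h4 k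
  rw [← Int.emod_add_mul_ediv n 4, zpow_add, Equiv.Perm.mul_apply, h5]
  have h6 := Int.emod_nonneg n (by norm_num : (4 : ℤ) ≠ 0)
  have h7 := Int.emod_lt_of_pos n (by norm_num : (0 : ℤ) < 4)
  generalize n % 4 = k at h6 h7
  interval_cases k
  · left; rfl
  · right; left; rfl
  · right; right; left; rfl
  · right; right; right; rfl

end CellSurface

namespace TangleDiagram

variable {D : Type*} {M : CellSurface D} (T : TangleDiagram M)

/-- The reversal of darts on the diagram. -/
def sRev (d : T.strand) : T.strand := ⟨M.rev d.1, T.rev_mem _ d.2⟩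

theorem sRev_involutive : Function.Involutive T.sRev := fun d => Subtype.ext (M.rev_rev d.1)

theorem sRev_ne (d : T.strand) : T.sRev d ≠ d := fun h => M.rev_ne d.1 (congrArg Subtype.val h)

theorem turn_mem (S : T.Resolution) {d : D} (h : T.IsCrossing d) : T.turn S d ∈ T.strand := by
  unfold turn
  split_ifs
  · exact h.2.1
  · rw [M.rot_symm_of_crossing h]
    exact h.2.2.2.1

theorem sameVertex_turn (S : T.Resolution) (d : D) : M.SameVertex d (T.turn S d) := by
  unfold turn
  split_ifs
  · exact M.sameVertex_rot d
  · exact M.sameVertex_rot_symm d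

theorem isCrossing_sameVertex {d e : D} (h : M.SameVertex d e) :
    T.IsCrossing d ↔ T.IsCrossing e := M.isCrossingOf_sameVertex _ h

theorem turn_turn (S : T.Resolution) {d : D} (h : T.IsCrossing d) :
    T.turn S (T.turn S d) = d := by
  by_cases h1 : d ∈ T.upper ↔ T.IsOne S d
  · have h2 : ¬ (M.rot d ∈ T.upper ↔ T.IsOne S (M.rot d)) := by
      rw [T.upper_rot d h, T.isOne_rot]; tauto
    rw [turn, turn, if_pos h1, if_neg h2, Equiv.symm_apply_apply]
  · have h2 : (M.rot.symm d ∈ T.upper ↔ T.IsOne S (M.rot.symm d)) := by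
      rw [T.upper_rot_symm d h, T.isOne_rot_symm]; tauto
    rw [turn, turn, if_neg h1, if_pos h2, Equiv.apply_symm_apply]

theorem eq_of_not_crossing {d e f : D} (hd : d ∈ T.strand) (h : ¬ T.IsCrossing d)
    (he : e ∈ T.strand) (hf : f ∈ T.strand) (hed : e ≠ d) (hfd : f ≠ d) (h1 : M.SameVertex d e)
    (h2 : M.SameVertex d f) : e = f := by
  rcases T.vertex_type d hd with h3 | ⟨-, g, hg, hgd, hdg, h3⟩ | h3
  · exact absurd (h3.2 e he h1) hed
  · have a1 := (h3 e he h1).resolve_left hed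
    have a2 := (h3 f hf h2).resolve_left hfd
    rw [a1, a2]
  · exact absurd h3 h

open Classical in
/-- The dart which the resolution joins to a given dart at its initial vertex; at an end point of an
arc, this is the dart itself. -/
def mate (S : T.Resolution) (d : T.strand) : T.strand :=
  if h : T.IsCrossing d.1 then ⟨T.turn S d.1, T.turn_mem S h⟩
  else if h' : ∃ e : T.strand, e ≠ d ∧ M.SameVertex d.1 e.1 then h'.choose else d

variable (S : T.Resolution)

theorem mate_crossing {d : T.strand} (h : T.IsCrossing d.1) :
    (T.mate S d).1 = T.turn S d.1 := by
  rw [mate, dif_pos h]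

theorem sameVertex_mate (d : T.strand) : M.SameVertex d.1 (T.mate S d).1 := by
  by_cases h : T.IsCrossing d.1
  · rw [T.mate_crossing S h]
    exact T.sameVertex_turn S d.1
  · rw [mate, dif_neg h]
    split_ifs with h'
    · exact h'.choose_spec.2
    · exact .refl _ _

theorem mate_eq_of_not_crossing {d e : T.strand} (h : ¬ T.IsCrossing d.1) (hed : e ≠ d)
    (hde : M.SameVertex d.1 e.1) : T.mate S d = e := by
  have h' : ∃ e : T.strand, e ≠ d ∧ M.SameVertex d.1 e.1 := ⟨e, hed, hde⟩
  rw [mate, dif_neg h, dif_pos h']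
  exact Subtype.ext (T.eq_of_not_crossing d.2 h (Subtype.coe_prop _) e.2
    (fun h2 => h'.choose_spec.1 (Subtype.ext h2)) (fun h2 => hed (Subtype.ext h2))
    h'.choose_spec.2 hde)

theorem mate_not_crossing_congr (S' : T.Resolution) {d : T.strand} (h : ¬ T.IsCrossing d.1) :
    T.mate S d = T.mate S' d := by
  rw [mate, dif_neg h, mate, dif_neg h]

theorem mate_involutive : Function.Involutive (T.mate S) := by
  intro d
  by_cases h : T.IsCrossing d.1
  · have h1 := (T.isCrossing_sameVertex (T.sameVertex_mate S d)).1 h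
    apply Subtype.ext
    rw [T.mate_crossing S h1, T.mate_crossing S h, T.turn_turn S h]
  · by_cases hd : T.mate S d = d
    · rw [hd, hd]
    · have h2 := T.sameVertex_mate S d
      exact T.mate_eq_of_not_crossing S
        (fun h' => h ((T.isCrossing_sameVertex h2).2 h')) (fun h' => hd h'.symm) h2.symm

theorem mate_ne_of_crossing {d : T.strand} (h : T.IsCrossing d.1) : T.mate S d ≠ d := by
  intro h'
  have h1 := congrArg Subtype.val h'
  rw [T.mate_crossing S h, turn] at h1
  split_ifs at h1
  · exact h.2.2.2.2.1 h1
  · rw [Equiv.symm_apply_eq] at h1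
    exact h.2.2.2.2.1 h1.symm

theorem mate_eq_self_iff (d : T.strand) : T.mate S d = d ↔ T.IsEnd d.1 := by
  constructor
  · intro h
    have hc : ¬ T.IsCrossing d.1 := fun hc => T.mate_ne_of_crossing S hc h
    refine ⟨d.2, fun e he hde => ?_⟩
    by_contra hne
    have := T.mate_eq_of_not_crossing S (e := ⟨e, he⟩) hc (fun h' => hne (by rw [← h'])) hde
    exact hne (by rw [← h, this])
  · intro h
    exact Subtype.ext (h.2 _ (T.mate S d).2 (T.sameVertex_mate S d))

theorem comp_sound {x y : T.strand}
    (h : y.1 = M.rev x.1 ∨ (¬ T.IsCrossing x.1 ∧ M.SameVertex x.1 y.1) ∨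
      (T.IsCrossing x.1 ∧ y.1 = T.turn S x.1)) : T.comp S y = T.comp S x :=
  (Quot.sound (r := fun x y : T.strand => y.1 = M.rev x.1 ∨
    (¬ T.IsCrossing x.1 ∧ M.SameVertex x.1 y.1) ∨
    (T.IsCrossing x.1 ∧ y.1 = T.turn S x.1)) h).symm

theorem comp_sRev (d : T.strand) : T.comp S (T.sRev d) = T.comp S d :=
  T.comp_sound S (Or.inl rfl)

theorem comp_mate (d : T.strand) : T.comp S (T.mate S d) = T.comp S d := by
  by_cases h : T.IsCrossing d.1
  · exact T.comp_sound S (Or.inr (Or.inr ⟨h, T.mate_crossing S h⟩))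
  · exact T.comp_sound S (Or.inr (Or.inl ⟨h, T.sameVertex_mate S d⟩))

theorem comp_eq_iff {d e : T.strand} :
    T.comp S d = T.comp S e ↔ Conn T.sRev (T.mate S) d e := by
  constructor
  · intro h
    have := Quot.eqvGen_exact h
    induction this with
    | rel x y hxy =>
      rcases hxy with hxy | ⟨h1, h2⟩ | ⟨h1, h2⟩
      · rw [show y = T.sRev x from Subtype.ext hxy]
        exact Conn.left _
      · by_cases hyx : y = x
        · rw [hyx]; exact Conn.refl _
        · rw [← T.mate_eq_of_not_crossing S h1 hyx h2]
          exact Conn.right _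
      · rw [show y = T.mate S x from Subtype.ext (by rw [h2, T.mate_crossing S h1])]
        exact Conn.right _
    | refl => exact Conn.refl _
    | symm x y hxy ih => exact (ih (Quot.eqvGen_sound hxy)).symm
    | trans x y z h1 h2 ih1 ih2 =>
      exact (ih1 (Quot.eqvGen_sound h1)).trans (ih2 (Quot.eqvGen_sound h2))
  · exact Conn.lift (T.comp S) (T.comp_sRev S) (T.comp_mate S)

theorem isArc_comp_iff (d : T.strand) :
    T.IsArc (T.comp S d) ↔ Arc T.sRev (T.mate S) d := by
  constructor
  · rintro ⟨e, h1, h2⟩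
    exact ⟨e, ((T.comp_eq_iff S).1 h2).symm, (T.mate_eq_self_iff S e).2 h1⟩
  · rintro ⟨e, h1, h2⟩
    exact ⟨e, (T.mate_eq_self_iff S e).1 h2, ((T.comp_eq_iff S).2 h1).symm⟩

/-! ### The change of a resolution at one crossing -/

open Classical in
/-- The other resolution of the crossing `c`. -/
def flip (S : T.Resolution) (c : T.Crossing) : T.Resolution := Function.update S c (!S c)

theorem flip_same (c : T.Crossing) : T.flip S c c = !S c := by simp [flip]

theorem flip_of_ne {c c' : T.Crossing} (h : c' ≠ c) : T.flip S c c' = S c' := by simp [flip, h]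

theorem flip_flip (c : T.Crossing) : T.flip (T.flip S c) c = S := by
  funext c'
  by_cases h : c' = c
  · subst h; simp [flip_same]
  · simp [flip_of_ne _ _ h]

theorem flip_comm (c c' : T.Crossing) : T.flip (T.flip S c) c' = T.flip (T.flip S c') c := by
  funext x
  by_cases h : x = c' <;> by_cases h' : x = c
  · subst h; subst h'; rfl
  · subst h; rw [flip_same, flip_of_ne _ _ h', flip_of_ne _ _ h', flip_same]
  · subst h'; rw [flip_same, flip_of_ne _ _ h, flip_of_ne _ _ h, flip_same]
  · simp [flip_of_ne, h, h']

theorem crossingOf_eq_iff {d e : D} (h : T.IsCrossing d) (h' : T.IsCrossing e) :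
    T.crossingOf d h = T.crossingOf e h' ↔ M.SameVertex d e := by
  constructor
  · intro h2
    have h3 := Quot.eqvGen_exact h2
    have key : ∀ x y : {d // T.IsCrossing d}, Relation.EqvGen
        (fun x y : {d // T.IsCrossing d} => M.SameVertex x.1 y.1) x y → M.SameVertex x.1 y.1 := by
      intro x y hxy
      induction hxy with
      | rel _ _ h => exact h
      | refl => exact .refl _ _
      | symm _ _ _ ih => exact ih.symm
      | trans _ _ _ _ _ ih1 ih2 => exact ih1.trans ih2
    exact key _ _ h3
  · intro h2
    exact Quot.sound h2

theorem isOne_iff {d : D} (h : T.IsCrossing d) : T.IsOne S d ↔ S (T.crossingOf d h) = true :=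
  ⟨fun ⟨_, h'⟩ => h', fun h' => ⟨h, h'⟩⟩

theorem isOne_flip {d : D} (h : T.IsCrossing d) :
    T.IsOne (T.flip S (T.crossingOf d h)) d ↔ ¬ T.IsOne S d := by
  rw [T.isOne_iff _ h, T.isOne_iff _ h, flip_same]
  simp

theorem isOne_flip_of_ne {d e : D} (h : T.IsCrossing d) (hde : ¬ M.SameVertex d e) :
    T.IsOne (T.flip S (T.crossingOf d h)) e ↔ T.IsOne S e := by
  by_cases he : T.IsCrossing e
  · rw [T.isOne_iff _ he, T.isOne_iff _ he, flip_of_ne]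
    intro h2
    exact hde ((T.crossingOf_eq_iff he h).1 h2).symm
  · constructor <;> rintro ⟨h2, -⟩ <;> exact absurd h2 he

open Classical in
theorem turn_flip {d : D} (h : T.IsCrossing d) :
    T.turn (T.flip S (T.crossingOf d h)) d
      = if T.turn S d = M.rot d then M.rot.symm d else M.rot d := by
  have hne : M.rot.symm d ≠ M.rot d := by
    rw [Ne, Equiv.symm_apply_eq]
    exact fun h' => h.2.2.2.2.2.1 h'.symm
  unfold turn
  rw [T.isOne_flip S h]
  by_cases h1 : d ∈ T.upper <;> by_cases h2 : T.IsOne S d <;> simp [h1, h2, hne]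

/-- The opposite dart at a crossing. -/
def opp (d : T.strand) (h : T.IsCrossing d.1) : T.strand := ⟨M.rot (M.rot d.1), h.2.2.1⟩

theorem turn_rot {d : D} (h : T.IsCrossing d) :
    T.turn S (M.rot d) = M.rot (M.rot d) ↔ ¬ T.turn S d = M.rot d := by
  have hne : M.rot.symm d ≠ M.rot d := by
    rw [Ne, Equiv.symm_apply_eq]
    exact fun h' => h.2.2.2.2.2.1 h'.symm
  have hne' : d ≠ M.rot (M.rot d) := fun h' => h.2.2.2.2.2.1 h'.symm
  unfold turn
  rw [T.upper_rot d h, T.isOne_rot]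
  by_cases h1 : d ∈ T.upper <;> by_cases h2 : T.IsOne S d <;> simp [h1, h2, hne, hne']

theorem turn_eq_or (d : D) : T.turn S d = M.rot d ∨ T.turn S d = M.rot.symm d := by
  unfold turn
  split_ifs
  · exact Or.inl rfl
  · exact Or.inr rfl

/-- The two resolutions of a crossing are the two ways to pair its four darts with their neighbours. -/
theorem smoothing (d : T.strand) (h : T.IsCrossing d.1) :
    Smoothing (T.mate S) (T.mate (T.flip S (T.crossingOf d.1 h)))
      d (T.mate S d) (T.opp d h) (T.mate (T.flip S (T.crossingOf d.1 h)) d) := by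
  have hs := M.rot_symm_of_crossing h
  have hcr := (T.isCrossing_rot d.1).2 h
  have hcrr := (T.isCrossing_rot _).2 hcr
  have hne1 : M.rot d.1 ≠ d.1 := h.2.2.2.2.1
  have hne2 : M.rot (M.rot d.1) ≠ d.1 := h.2.2.2.2.2.1
  have h4 : M.rot (M.rot (M.rot (M.rot d.1))) = d.1 := h.2.2.2.2.2.2
  have hne3 : M.rot (M.rot (M.rot d.1)) ≠ d.1 := fun h' => hne1 (by rw [h'] at h4; exact h4)
  have hopp : T.crossingOf (T.opp d h).1 hcrr = T.crossingOf d.1 h :=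
    (T.crossingOf_eq_iff _ _).2 ((M.sameVertex_rot _).trans (M.sameVertex_rot _)).symm
  have e1 : ∀ S : T.Resolution, (T.mate S d).1 = T.turn S d.1 := fun S => T.mate_crossing S h
  have e2 : ∀ S : T.Resolution, (T.mate S (T.opp d h)).1 = T.turn S (M.rot (M.rot d.1)) :=
    fun S => T.mate_crossing S hcrr
  have hs2 : M.rot.symm (M.rot (M.rot d.1)) = M.rot d.1 := Equiv.symm_apply_apply _ _
  have key : ∀ S : T.Resolution,
      (T.turn S d.1 = M.rot d.1 ∧ T.turn S (M.rot (M.rot d.1)) = M.rot (M.rot (M.rot d.1))) ∨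
      (T.turn S d.1 = M.rot (M.rot (M.rot d.1)) ∧ T.turn S (M.rot (M.rot d.1)) = M.rot d.1) := by
    intro S
    have h1 := T.turn_rot S h
    have h2 := T.turn_rot S hcr
    rcases T.turn_eq_or S d.1 with h3 | h3
    · exact Or.inl ⟨h3, h2.2 (fun h5 => h1.1 h5 h3)⟩
    · right
      refine ⟨by rw [h3, hs], ?_⟩
      rcases T.turn_eq_or S (M.rot (M.rot d.1)) with h5 | h5
      · exfalso
        refine (h2.1 h5) (h1.2 ?_)
        rw [h3, hs]
        exact fun h6 => hne2 (M.rot.injective h6)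
      · rw [h5, hs2]
  have hflip := T.turn_flip S h
  have hkey : (T.turn S d.1 = M.rot d.1 ∧
        T.turn S (M.rot (M.rot d.1)) = M.rot (M.rot (M.rot d.1)) ∧
        T.turn (T.flip S (T.crossingOf d.1 h)) d.1 = M.rot (M.rot (M.rot d.1)) ∧
        T.turn (T.flip S (T.crossingOf d.1 h)) (M.rot (M.rot d.1)) = M.rot d.1) ∨
      (T.turn S d.1 = M.rot (M.rot (M.rot d.1)) ∧
        T.turn S (M.rot (M.rot d.1)) = M.rot d.1 ∧
        T.turn (T.flip S (T.crossingOf d.1 h)) d.1 = M.rot d.1 ∧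
        T.turn (T.flip S (T.crossingOf d.1 h)) (M.rot (M.rot d.1))
          = M.rot (M.rot (M.rot d.1))) := by
    rcases key S with ⟨h1, h2⟩ | ⟨h1, h2⟩ <;>
      rcases key (T.flip S (T.crossingOf d.1 h)) with ⟨h3, h5⟩ | ⟨h3, h5⟩
    · rw [if_pos h1, hs, h3] at hflip
      exact absurd (M.rot.injective hflip).symm hne2
    · exact Or.inl ⟨h1, h2, h3, h5⟩
    · exact Or.inr ⟨h1, h2, h3, h5⟩
    · rw [if_neg (by rw [h1]; exact fun h6 => hne2 (M.rot.injective h6)), h3] at hflip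
      exact absurd (M.rot.injective hflip) hne2
  have val : ∀ x y : T.strand, x = y ↔ x.1 = y.1 := fun x y => Subtype.ext_iff
  have off : ∀ x : T.strand, x.1 ≠ d.1 → x.1 ≠ M.rot d.1 → x.1 ≠ M.rot (M.rot d.1) →
      x.1 ≠ M.rot (M.rot (M.rot d.1)) →
      T.mate (T.flip S (T.crossingOf d.1 h)) x = T.mate S x := by
    intro x h1 h2 h3 h5
    by_cases hx : T.IsCrossing x.1
    · have hv : ¬ M.SameVertex d.1 x.1 := fun hv => by
        have := M.sameVertex_crossing h hv
        tauto
      rw [val, T.mate_crossing _ hx, T.mate_crossing _ hx, turn, turn,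
        T.isOne_flip_of_ne S h hv]
    · exact T.mate_not_crossing_congr _ _ hx
  have hdne : d ≠ T.opp d h := fun h' => hne2 (congrArg Subtype.val h').symm
  have n1 : M.rot d.1 ≠ M.rot (M.rot d.1) := fun h' => hne1 (M.rot.injective h').symm
  have n2 : M.rot d.1 ≠ M.rot (M.rot (M.rot d.1)) := fun h' => hne2 (M.rot.injective h').symm
  have n3 : M.rot (M.rot d.1) ≠ M.rot (M.rot (M.rot d.1)) := fun h' => n1 (M.rot.injective h')
  have ho : (T.opp d h).1 = M.rot (M.rot d.1) := rfl
  rcases hkey with ⟨h1, h2, h3, h5⟩ | ⟨h1, h2, h3, h5⟩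
  · refine ⟨rfl, ?_, rfl, ?_, fun x => ?_, ?_⟩
    · rw [val, e2, e1, h2, h3]
    · rw [val, e2, e1, h5, h1]
    · simp only [Ne, val, e1, h1, h3, ho]
      intro a1 a2 a3 a4
      exact (val _ _).1 (off x a1 a2 a3 a4)
    · simp only [Ne, val, e1, h1, h3, ho]
      exact ⟨hne1.symm, hne2.symm, hne3.symm, n1, n2, n3⟩
  · refine ⟨rfl, ?_, rfl, ?_, fun x => ?_, ?_⟩
    · rw [val, e2, e1, h2, h3]
    · rw [val, e2, e1, h5, h1]
    · simp only [Ne, val, e1, h1, h3, ho]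
      intro a1 a2 a3 a4
      exact (val _ _).1 (off x a1 a4 a3 a2)
    · simp only [Ne, val, e1, h1, h3, ho]
      exact ⟨hne3.symm, hne2.symm, hne1.symm, n3.symm, n2.symm, n1.symm⟩

/-- A dart at the crossing `c`. -/
def dartAt (c : T.Crossing) : T.strand := ⟨(Quot.out c).1, (Quot.out c).2.1⟩

theorem isCrossing_dartAt (c : T.Crossing) : T.IsCrossing (T.dartAt c).1 := (Quot.out c).2

theorem crossingOf_dartAt (c : T.Crossing) :
    T.crossingOf (T.dartAt c).1 (T.isCrossing_dartAt c) = c := Quot.out_eq c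

/-- The dart opposite to `T.dartAt c`. -/
def oppAt (c : T.Crossing) : T.strand := T.opp (T.dartAt c) (T.isCrossing_dartAt c)

theorem smoothing_at (c : T.Crossing) :
    Smoothing (T.mate S) (T.mate (T.flip S c)) (T.dartAt c) (T.mate S (T.dartAt c)) (T.oppAt c)
      (T.mate (T.flip S c) (T.dartAt c)) := by
  have := T.smoothing S (T.dartAt c) (T.isCrossing_dartAt c)
  rwa [T.crossingOf_dartAt] at this

/-- The components which abut a crossing are those of two opposite darts. -/
theorem touching_eq (c : T.Crossing) :
    T.touching S c = {T.comp S (T.dartAt c), T.comp S (T.oppAt c)} := by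
  have h := T.isCrossing_dartAt c
  have hc := T.crossingOf_dartAt c
  have hs := T.smoothing_at S c
  ext C
  constructor
  · rintro ⟨d, hd, hdc, rfl⟩
    rw [← hc, T.crossingOf_eq_iff] at hdc
    have hd4 := M.sameVertex_crossing h hdc.symm
    have hmem : d = T.dartAt c ∨ d = T.mate S (T.dartAt c) ∨ d = T.oppAt c ∨
        d = T.mate S (T.oppAt c) := by
      have e1 := T.mate_crossing S h
      have e2 := T.mate_crossing S (d := T.oppAt c)
        ((T.isCrossing_rot _).2 ((T.isCrossing_rot _).2 h))
      have o : (T.oppAt c).1 = M.rot (M.rot (T.dartAt c).1) := rfl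
      have t1 := T.turn_rot S h
      have t2 := T.turn_rot S ((T.isCrossing_rot _).2 h)
      have s1 := M.rot_symm_of_crossing h
      have s2 : M.rot.symm (M.rot (M.rot (T.dartAt c).1)) = M.rot (T.dartAt c).1 :=
        Equiv.symm_apply_apply _ _
      simp only [Subtype.ext_iff, e1, e2, o]
      rcases T.turn_eq_or S (T.dartAt c).1 with h3 | h3 <;>
        rcases T.turn_eq_or S (M.rot (M.rot (T.dartAt c).1)) with h5 | h5
      · rw [h3, h5]; tauto
      · exfalso
        have hm := hs.m_q
        have hne := hs.ne.2.2.2.2.1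
        apply hne
        rw [← hm, Subtype.ext_iff, e1, e2, o, h5, s2, h3]
      · exfalso
        have hm := hs.m_q
        have hne := hs.ne.2.2.2.2.1
        apply hne
        rw [← hm, Subtype.ext_iff, e1, e2, o, h5, h3, s1]
      · rw [h3, h5, s1, s2]; tauto
    rcases hmem with rfl | rfl | rfl | rfl
    · exact Or.inl rfl
    · exact Or.inl (T.comp_mate S _)
    · exact Or.inr rfl
    · exact Or.inr (T.comp_mate S _)
  · rintro (rfl | rfl)
    · exact ⟨T.dartAt c, h, hc, rfl⟩
    · refine ⟨T.oppAt c, (T.isCrossing_rot _).2 ((T.isCrossing_rot _).2 h), ?_, rfl⟩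
      exact ((T.crossingOf_eq_iff _ _).2
        ((M.sameVertex_rot _).trans (M.sameVertex_rot _)).symm).trans hc

end TangleDiagram

/-! ### Linear relations between the strands of a resolution -/

section Lattice

variable {V : Type*} [AddCommGroup V] [Module (ZMod 2) V]

theorem mem_sup_span_singleton_iff (N : Submodule (ZMod 2) V) (e x : V) :
    x ∈ N ⊔ Submodule.span (ZMod 2) {e} ↔ x ∈ N ∨ x + e ∈ N := by
  rw [Submodule.mem_sup]
  constructor
  · rintro ⟨y, hy, z, hz, rfl⟩
    obtain ⟨t, rfl⟩ := Submodule.mem_span_singleton.1 hz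
    fin_cases t
    · left
      show y + (0 : ZMod 2) • e ∈ N
      rwa [zero_smul, add_zero]
    · right
      have : y + (1 : ZMod 2) • e + e = y := by
        rw [one_smul, add_assoc, ZModModule.add_self, add_zero]
      exact (show y + (1 : ZMod 2) • e + e ∈ N by rw [this]; exact hy)
  · rintro (h | h)
    · exact ⟨x, h, 0, Submodule.zero_mem _, add_zero x⟩
    · exact ⟨x + e, h, e, Submodule.mem_span_singleton_self e, by
        rw [add_assoc, ZModModule.add_self, add_zero]⟩

theorem add_mem_cancel {N : Submodule (ZMod 2) V} {x y : V} (h : x + y ∈ N) (hy : y ∈ N) :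
    x ∈ N := by
  have := N.add_mem h hy
  rwa [add_assoc, ZModModule.add_self, add_zero] at this

end Lattice

namespace TangleDiagram

variable {D : Type*} {M : CellSurface D} (T : TangleDiagram M)

/-- The relation imposed by the resolution at the initial vertex of `d`. -/
def mateRel (S : T.Resolution) (d : T.strand) : T.strand →₀ ZMod 2 :=
  open Classical in
  if T.mate S d = d then Finsupp.single d 1
  else Finsupp.single d 1 + Finsupp.single (T.mate S d) 1

/-- The relations between the darts of the diagram, modulo two: the darts of one component are equal,
and the darts of the arcs are zero. -/
def rels (S : T.Resolution) : Submodule (ZMod 2) (T.strand →₀ ZMod 2) :=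
  Submodule.span (ZMod 2)
    (Set.range (fun d => Finsupp.single d 1 + Finsupp.single (T.sRev d) 1)
      ∪ Set.range (T.mateRel S))

variable (S : T.Resolution)

theorem sRev_mem_rels (d : T.strand) :
    (Finsupp.single d 1 + Finsupp.single (T.sRev d) 1 : T.strand →₀ ZMod 2) ∈ T.rels S :=
  Submodule.subset_span (Or.inl ⟨d, rfl⟩)

theorem mateRel_mem_rels (d : T.strand) : T.mateRel S d ∈ T.rels S :=
  Submodule.subset_span (Or.inr ⟨d, rfl⟩)

theorem mate_mem_rels (d : T.strand) :
    (Finsupp.single d 1 + Finsupp.single (T.mate S d) 1 : T.strand →₀ ZMod 2) ∈ T.rels S := by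
  by_cases h : T.mate S d = d
  · rw [h, ZModModule.add_self]
    exact Submodule.zero_mem _
  · have := T.mateRel_mem_rels S d
    rwa [mateRel, if_neg h] at this

theorem pair_mem_rels {d e : T.strand} (h : T.comp S d = T.comp S e) :
    (Finsupp.single d 1 + Finsupp.single e 1 : T.strand →₀ ZMod 2) ∈ T.rels S := by
  rw [T.comp_eq_iff] at h
  induction h with
  | rel x y h =>
    rcases h with rfl | rfl
    · exact T.sRev_mem_rels S x
    · exact T.mate_mem_rels S x
  | refl x => rw [ZModModule.add_self]; exact Submodule.zero_mem _
  | symm x y _ ih => rwa [add_comm]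
  | trans x y z _ _ ih1 ih2 =>
    have := Submodule.add_mem _ ih1 ih2
    rwa [add_assoc, ← add_assoc (Finsupp.single y 1), ZModModule.add_self, zero_add] at this

theorem single_mem_rels {d : T.strand} (h : T.IsArc (T.comp S d)) :
    (Finsupp.single d 1 : T.strand →₀ ZMod 2) ∈ T.rels S := by
  obtain ⟨e, h1, h2⟩ := h
  have h3 := T.mateRel_mem_rels S e
  rw [mateRel, if_pos ((T.mate_eq_self_iff S e).2 h1)] at h3
  exact add_mem_cancel (T.pair_mem_rels S h2.symm) h3

/-- Equality of components, if all arcs are identified. -/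
def Same (d e : T.strand) : Prop :=
  T.comp S d = T.comp S e ∨ T.IsArc (T.comp S d) ∧ T.IsArc (T.comp S e)

theorem not_pair_mem_rels {d e : T.strand} (h : T.comp S d ≠ T.comp S e)
    (hd : ¬ T.IsArc (T.comp S d)) :
    (Finsupp.single d 1 + Finsupp.single e 1 : T.strand →₀ ZMod 2) ∉ T.rels S := by
  classical
  intro hmem
  let φ : (T.strand →₀ ZMod 2) →ₗ[ZMod 2] ZMod 2 := Finsupp.linearCombination (ZMod 2)
    (fun x => if T.comp S x = T.comp S d then 1 else 0)
  have hφ : ∀ x, φ (Finsupp.single x 1) = if T.comp S x = T.comp S d then 1 else 0 := fun x => by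
    simp [φ]
  have hle : T.rels S ≤ LinearMap.ker φ := by
    refine Submodule.span_le.2 ?_
    rintro _ (⟨x, rfl⟩ | ⟨x, rfl⟩)
    · show φ _ = 0
      rw [map_add, hφ, hφ, T.comp_sRev, CharTwo.add_self_eq_zero]
    · show φ _ = 0
      unfold mateRel
      split_ifs with hx
      · rw [hφ, if_neg]
        intro hxd
        exact hd ⟨x, (T.mate_eq_self_iff S x).1 hx, hxd⟩
      · rw [map_add, hφ, hφ, T.comp_mate, CharTwo.add_self_eq_zero]
  have := hle hmem
  rw [LinearMap.mem_ker, map_add, hφ, hφ, if_pos rfl, if_neg h.symm, add_zero] at this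
  exact one_ne_zero this

theorem pair_mem_rels_iff {d e : T.strand} :
    (Finsupp.single d 1 + Finsupp.single e 1 : T.strand →₀ ZMod 2) ∈ T.rels S
      ↔ T.Same S d e := by
  constructor
  · intro h
    by_contra hn
    rw [Same] at hn
    push Not at hn
    by_cases hd : T.IsArc (T.comp S d)
    · rw [add_comm] at h
      exact T.not_pair_mem_rels S hn.1.symm (hn.2 hd) h
    · exact T.not_pair_mem_rels S hn.1 hd h
  · rintro (h | ⟨h1, h2⟩)
    · exact T.pair_mem_rels S h
    · exact Submodule.add_mem _ (T.single_mem_rels S h1) (T.single_mem_rels S h2)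

/-- The sum of two opposite darts at the crossing `c`. -/
def bridge (c : T.Crossing) : T.strand →₀ ZMod 2 :=
  Finsupp.single (T.dartAt c) 1 + Finsupp.single (T.oppAt c) 1

theorem bridge_mem_iff (c : T.Crossing) :
    T.bridge c ∈ T.rels S ↔ T.Same S (T.dartAt c) (T.oppAt c) := T.pair_mem_rels_iff S

theorem bridge_mem_or [Finite D] (c : T.Crossing) :
    T.bridge c ∈ T.rels S ∨ T.bridge c ∈ T.rels (T.flip S c) := by
  have := (T.smoothing_at S c).same_or_same T.sRev_involutive T.sRev_ne (T.mate_involutive S)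
  simp only [bridge_mem_iff, Same, T.comp_eq_iff, T.isArc_comp_iff]
  exact this

theorem rels_le_of_flip (c : T.Crossing) {N : Submodule (ZMod 2) (T.strand →₀ ZMod 2)}
    (h1 : T.rels (T.flip S c) ≤ N) (h2 : T.bridge c ∈ N) : T.rels S ≤ N := by
  have hs := T.smoothing_at S c
  have hsw := hs.swap
  obtain ⟨hne1, hne2, hne3, hne4, hne5, hne6⟩ := hs.ne
  have hb : (Finsupp.single (T.dartAt c) 1 + Finsupp.single (T.mate (T.flip S c) (T.dartAt c)) 1 :
      T.strand →₀ ZMod 2) ∈ N := h1 (T.mate_mem_rels _ _)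
  have ha : (Finsupp.single (T.oppAt c) 1 + Finsupp.single (T.mate S (T.dartAt c)) 1 :
      T.strand →₀ ZMod 2) ∈ N := by
    have := h1 (T.mate_mem_rels (T.flip S c) (T.oppAt c))
    rwa [hs.m'_q] at this
  unfold bridge at h2
  have key1 : (Finsupp.single (T.dartAt c) 1 + Finsupp.single (T.mate S (T.dartAt c)) 1 :
      T.strand →₀ ZMod 2) ∈ N := by
    have := N.add_mem h2 ha
    rwa [add_assoc, ← add_assoc (Finsupp.single (T.oppAt c) 1), ZModModule.add_self,
      zero_add] at this
  have key2 : (Finsupp.single (T.oppAt c) 1 + Finsupp.single (T.mate (T.flip S c) (T.dartAt c)) 1 :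
      T.strand →₀ ZMod 2) ∈ N := by
    have := N.add_mem (add_comm (Finsupp.single (T.dartAt c) (1 : ZMod 2)) _ ▸ h2) hb
    rwa [add_assoc, ← add_assoc (Finsupp.single (T.dartAt c) 1), ZModModule.add_self,
      zero_add] at this
  refine Submodule.span_le.2 ?_
  rintro _ (⟨x, rfl⟩ | ⟨x, rfl⟩)
  · exact h1 (T.sRev_mem_rels _ x)
  · show T.mateRel S x ∈ N
    by_cases hx : x = T.dartAt c ∨ x = T.mate S (T.dartAt c) ∨ x = T.oppAt c ∨
        x = T.mate (T.flip S c) (T.dartAt c)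
    · unfold mateRel
      rcases hx with rfl | rfl | rfl | rfl
      · rw [if_neg hne1.symm]
        exact key1
      · rw [T.mate_involutive, if_neg hne1, add_comm]
        exact key1
      · rw [hs.m_q, if_neg hne6.symm]
        exact key2
      · have h3 : T.mate S (T.mate (T.flip S c) (T.dartAt c)) = T.oppAt c := by
          conv_lhs => rw [← hs.m_q]
          exact T.mate_involutive S _
        rw [h3, if_neg hne6, add_comm]
        exact key2
    · have h3 := hs.off_not hx
      have h5 := h1 (T.mateRel_mem_rels (T.flip S c) x)
      unfold mateRel at h5 ⊢
      rwa [h3] at h5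

theorem rels_le_flip [Finite D] {c : T.Crossing} (h : T.bridge c ∈ T.rels (T.flip S c)) :
    T.rels S ≤ T.rels (T.flip S c) := T.rels_le_of_flip S c le_rfl h

theorem rels_flip_le [Finite D] {c : T.Crossing} (h : T.bridge c ∈ T.rels S) :
    T.rels (T.flip S c) ≤ T.rels S :=
  T.rels_le_of_flip (T.flip S c) c (by rw [T.flip_flip]) h

theorem rels_le_sup (c : T.Crossing) :
    T.rels S ≤ T.rels (T.flip S c) ⊔ Submodule.span (ZMod 2) {T.bridge c} :=
  T.rels_le_of_flip S c le_sup_left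
    ((le_sup_right : _ ≤ T.rels (T.flip S c) ⊔ _) (Submodule.mem_span_singleton_self _))

theorem rels_flip_le_sup (c : T.Crossing) :
    T.rels (T.flip S c) ≤ T.rels S ⊔ Submodule.span (ZMod 2) {T.bridge c} := by
  have := T.rels_le_sup (T.flip S c) c
  rwa [T.flip_flip] at this

section TwoCrossings

variable [Finite D] {S} {c c' : T.Crossing}

theorem not_bridge_mem_of_merge_merge (h1 : T.bridge c ∉ T.rels S)
    (h2 : T.bridge c' ∉ T.rels (T.flip S c)) :
    T.bridge c' ∉ T.rels S ∧ T.bridge c ∉ T.rels (T.flip S c') := by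
  have h3 := (T.bridge_mem_or S c).resolve_left h1
  have h4 := T.rels_le_flip S h3
  refine ⟨fun h => h2 (h4 h), fun h => ?_⟩
  rcases (mem_sup_span_singleton_iff _ _ _).1 (T.rels_flip_le_sup S c' h) with h5 | h5
  · exact h1 h5
  · refine h2 (add_mem_cancel (y := T.bridge c) ?_ h3)
    rw [add_comm]
    exact h4 h5

theorem add_bridge_mem (h1 : T.bridge c ∉ T.rels S) (h1' : T.bridge c' ∉ T.rels S) :
    T.bridge c + T.bridge c' ∈ T.rels (T.flip (T.flip S c) c') := by
  have h3 := (T.bridge_mem_or S c).resolve_left h1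
  have h3' := (T.bridge_mem_or S c').resolve_left h1'
  rcases (mem_sup_span_singleton_iff _ _ _).1 (T.rels_le_sup (T.flip S c) c' h3) with h5 | h5
  · have h6 := T.rels_le_of_flip (T.flip S c') c
      (N := T.rels (T.flip (T.flip S c) c')) (by rw [T.flip_comm]) h5
    exact Submodule.add_mem _ h5 (h6 h3')
  · exact h5

theorem not_merge_split (h1 : T.bridge c ∉ T.rels S)
    (h1' : T.bridge c' ∈ T.rels S) : T.bridge c ∉ T.rels (T.flip S c') :=
  fun h => h1 (T.rels_flip_le S h1' h)

theorem bridge_mem_of_split_merge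
    (h2 : T.bridge c' ∉ T.rels (T.flip S c)) (h1' : T.bridge c' ∈ T.rels S) :
    T.bridge c ∈ T.rels (T.flip (T.flip S c) c') := by
  have h3 := (T.bridge_mem_or (T.flip S c) c').resolve_left h2
  rcases (mem_sup_span_singleton_iff _ _ _).1 (T.rels_le_sup S c h1') with h5 | h5
  · exact absurd h5 h2
  · refine add_mem_cancel (y := T.bridge c') ?_ h3
    rw [add_comm]
    exact T.rels_le_flip (T.flip S c) h3 h5

end TwoCrossings

end TangleDiagram

/-! ### The complex without regard to the surface -/

namespace TangleDiagram

variable {D : Type*} {M : CellSurface D} (T : TangleDiagram M)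
variable (R : Type*) [CommRing R]

variable {T} in
/-- A component which is not an arc, as a circle. -/
def circ {S : T.Resolution} (C : T.Component S) (h : ¬ T.IsArc C) : T.Circle S := ⟨C, h⟩

open Classical in
/-- The change of the sign of the component `C` from `+` to `-`; zero if `C` is an arc or has the
sign `-`. -/
def hit {S : T.Resolution} (C : T.Component S) (σ : T.Circle S → Bool) : T.State →₀ R :=
  if h : T.IsArc C then 0
  else if σ (circ C h) = true then Finsupp.single ⟨S, Function.update σ (circ C h) false⟩ 1 else 0

/-- Multiplication by `v₋` on the component of `d`, contractible or not. -/
def lower (d : T.strand) : Module.End R (T.State →₀ R) :=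
  Finsupp.linearCombination R (fun s : T.State => T.hit R (T.comp s.1 d) s.2)

variable {R}

theorem lower_single (d : T.strand) (s : T.State) :
    T.lower R d (Finsupp.single s 1) = T.hit R (T.comp s.1 d) s.2 := by
  simp [lower]

theorem hit_arc {S : T.Resolution} {C : T.Component S} (h : T.IsArc C) (σ : T.Circle S → Bool) :
    T.hit R C σ = 0 := dif_pos h

theorem hit_neg {S : T.Resolution} {C : T.Component S} (h : ¬ T.IsArc C) {σ : T.Circle S → Bool}
    (hσ : σ (circ C h) = false) : T.hit R C σ = 0 := by
  rw [hit, dif_neg h, if_neg (by rw [hσ]; simp)]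

open Classical in
theorem hit_pos {S : T.Resolution} {C : T.Component S} (h : ¬ T.IsArc C) {σ : T.Circle S → Bool}
    (hσ : σ (circ C h) = true) :
    T.hit R C σ = Finsupp.single ⟨S, Function.update σ (circ C h) false⟩ 1 := by
  rw [hit, dif_neg h, if_pos hσ]

theorem linearMap_ext {V : Type*} [AddCommGroup V] [Module R V] {f g : (T.State →₀ R) →ₗ[R] V}
    (h : ∀ s, f (Finsupp.single s 1) = g (Finsupp.single s 1)) : f = g :=
  Finsupp.lhom_ext' fun s => LinearMap.ext_ring (h s)

open Classical in
theorem lower_comm (d e : T.strand) : T.lower R d * T.lower R e = T.lower R e * T.lower R d := by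
  refine T.linearMap_ext fun s => ?_
  obtain ⟨S, σ⟩ := s
  simp only [Module.End.mul_apply, lower_single]
  by_cases hd : T.IsArc (T.comp S d)
  · rw [T.hit_arc hd, map_zero]
    by_cases he : T.IsArc (T.comp S e)
    · rw [T.hit_arc he, map_zero]
    · cases hσ : σ (circ _ he)
      · rw [T.hit_neg he hσ, map_zero]
      · rw [T.hit_pos he hσ, lower_single, T.hit_arc hd]
  by_cases he : T.IsArc (T.comp S e)
  · rw [T.hit_arc he, map_zero]
    cases hσ : σ (circ _ hd)
    · rw [T.hit_neg hd hσ, map_zero]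
    · rw [T.hit_pos hd hσ, lower_single, T.hit_arc he]
  by_cases hde : T.comp S d = T.comp S e
  · cases hσ : σ (circ _ hd)
    · rw [← hde, T.hit_neg hd hσ, map_zero, map_zero]
    · rw [← hde, T.hit_pos hd hσ, lower_single, lower_single, ← hde]
  have hne : circ _ hd ≠ circ _ he := fun h => hde (congrArg Subtype.val h)
  cases hσd : σ (circ _ hd) <;> cases hσe : σ (circ _ he)
  · rw [T.hit_neg hd hσd, T.hit_neg he hσe, map_zero, map_zero]
  · rw [T.hit_neg hd hσd, T.hit_pos he hσe, map_zero, lower_single, T.hit_neg hd]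
    exact (Function.update_of_ne hne _ _).trans hσd
  · rw [T.hit_pos hd hσd, T.hit_neg he hσe, map_zero, lower_single, T.hit_neg he]
    exact (Function.update_of_ne hne.symm _ _).trans hσe
  · rw [T.hit_pos hd hσd, T.hit_pos he hσe, lower_single, lower_single, T.hit_pos hd, T.hit_pos he]
    · show Finsupp.single (⟨S, Function.update (Function.update σ _ _) _ _⟩ : T.State) 1 = _
      rw [Function.update_comm hne]
    · exact (Function.update_of_ne hne.symm _ _).trans hσe
    · exact (Function.update_of_ne hne _ _).trans hσd

theorem lower_comm_apply (d e : T.strand) (v : T.State →₀ R) :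
    T.lower R d (T.lower R e v) = T.lower R e (T.lower R d v) :=
  LinearMap.congr_fun (T.lower_comm d e) v

theorem lower_sq (d : T.strand) : T.lower R d * T.lower R d = 0 := by
  classical
  refine T.linearMap_ext fun s => ?_
  obtain ⟨S, σ⟩ := s
  simp only [Module.End.mul_apply, lower_single, LinearMap.zero_apply]
  by_cases hd : T.IsArc (T.comp S d)
  · rw [T.hit_arc hd, map_zero]
  · cases hσ : σ (circ _ hd)
    · rw [T.hit_neg hd hσ, map_zero]
    · rw [T.hit_pos hd hσ, lower_single, T.hit_neg hd]
      show Function.update σ (circ _ hd) false (circ _ hd) = false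
      simp

theorem lower_lower (d : T.strand) (v : T.State →₀ R) : T.lower R d (T.lower R d v) = 0 :=
  LinearMap.congr_fun (T.lower_sq d) v

instance : LeftCommutative (fun (d : T.strand) (v : T.State →₀ R) => T.lower R d v) :=
  ⟨fun d e v => T.lower_comm_apply d e v⟩

variable (R) in
/-- The state in which all circles have the sign `+`. -/
def top (S : T.Resolution) : T.State →₀ R := Finsupp.single ⟨S, fun _ => true⟩ 1

variable (R) in
/-- The product of the operators `T.lower R d`, for the darts `d` in `m`, applied to `T.top R S`. -/
def mon (S : T.Resolution) (m : Multiset T.strand) : T.State →₀ R :=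
  Multiset.foldr (fun d v => T.lower R d v) (T.top R S) m

theorem mon_zero (S : T.Resolution) : T.mon R S 0 = T.top R S := rfl

theorem mon_cons (S : T.Resolution) (d : T.strand) (m : Multiset T.strand) :
    T.mon R S (d ::ₘ m) = T.lower R d (T.mon R S m) := Multiset.foldr_cons _ _ _ _

/-- A dart on a component. -/
def rep {S : T.Resolution} (C : T.Component S) : T.strand := Quot.out C

theorem comp_rep {S : T.Resolution} (C : T.Component S) : T.comp S (T.rep C) = C := Quot.out_eq C

open Classical in
theorem mon_finset (S : T.Resolution) (t : Finset (T.Circle S)) :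
    T.mon R S (t.val.map (fun C => T.rep C.1))
      = Finsupp.single ⟨S, fun C => decide (C ∉ t)⟩ 1 := by
  induction t using Finset.induction_on with
  | empty => simp [mon_zero, top]
  | insert a t ha ih =>
    rw [Finset.insert_val_of_notMem ha, Multiset.map_cons, mon_cons, ih, lower_single]
    have h1 : ¬ T.IsArc (T.comp S (T.rep a.1)) := by rw [T.comp_rep]; exact a.2
    have h2 : circ _ h1 = a := Subtype.ext (T.comp_rep a.1)
    rw [T.hit_pos h1 (by simp [h2, ha]), h2]
    congr 2
    funext C
    by_cases hC : C = a
    · subst hC; simp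
    · simp [hC]

section FiniteDarts

variable [Finite D]

open Classical in
/-- Darts on the circles with the sign `-`, one for each of them. -/
def minusReps {S : T.Resolution} (σ : T.Circle S → Bool) : Multiset T.strand :=
  (Finset.univ.filter (fun C => σ C = false)).val.map (fun C => T.rep C.1)

theorem mon_minusReps {S : T.Resolution} (σ : T.Circle S → Bool) :
    T.mon R S (T.minusReps σ) = Finsupp.single ⟨S, σ⟩ 1 := by
  classical
  rw [minusReps, mon_finset]
  congr 2
  funext C
  cases h : σ C <;> simp [h]

open Classical in
theorem minusReps_update {S : T.Resolution} {σ : T.Circle S → Bool} {C : T.Circle S}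
    (h : σ C = true) :
    T.minusReps (Function.update σ C false) = T.rep C.1 ::ₘ T.minusReps σ := by
  have : Finset.univ.filter (fun C' => Function.update σ C false C' = false)
      = insert C (Finset.univ.filter (fun C' => σ C' = false)) := by
    ext C'
    by_cases hC : C' = C
    · subst hC; simp
    · simp [hC]
  rw [minusReps, this, Finset.insert_val_of_notMem (by simp [h]), Multiset.map_cons]
  rfl

/-- Two endomorphisms which commute with the operators `T.lower R d` agree if they agree on the states
without signs `-`. -/
theorem ext_of_lower {f g : Module.End R (T.State →₀ R)}
    (hf : ∀ d v, f (T.lower R d v) = T.lower R d (f v))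
    (hg : ∀ d v, g (T.lower R d v) = T.lower R d (g v))
    (h : ∀ S, f (T.top R S) = g (T.top R S)) : f = g := by
  refine T.linearMap_ext fun s => ?_
  obtain ⟨S, σ⟩ := s
  rw [← T.mon_minusReps]
  generalize T.minusReps σ = m
  induction m using Multiset.induction_on with
  | empty => exact h S
  | cons d m ih => rw [mon_cons, hf, hg, ih]

end FiniteDarts

section CharTwo

variable [Algebra (ZMod 2) R]

theorem add_self_eq_zero' (v : T.State →₀ R) : v + v = 0 := by
  have : ((1 : ZMod 2) + 1) • v = 0 := by
    rw [CharTwo.add_self_eq_zero, zero_smul]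
  rwa [add_smul, one_smul] at this

variable (R) in
/-- The operator of a formal sum of darts. -/
def lowerSum : (T.strand →₀ ZMod 2) →ₗ[ZMod 2] Module.End R (T.State →₀ R) :=
  Finsupp.linearCombination (ZMod 2) (T.lower R)

theorem lowerSum_single (d : T.strand) : T.lowerSum R (Finsupp.single d 1) = T.lower R d := by
  simp [lowerSum]

theorem lowerSum_apply_comm (v : T.strand →₀ ZMod 2) (d : T.strand) (w : T.State →₀ R) :
    T.lowerSum R v (T.lower R d w) = T.lower R d (T.lowerSum R v w) := by
  induction v using Finsupp.induction_linear with
  | zero => simp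
  | add a b ha hb => simp only [map_add, LinearMap.add_apply, ha, hb]
  | single e t =>
    fin_cases t
    · show T.lowerSum R (Finsupp.single e (0 : ZMod 2)) _
        = T.lower R d (T.lowerSum R (Finsupp.single e (0 : ZMod 2)) w)
      simp
    · show T.lowerSum R (Finsupp.single e (1 : ZMod 2)) _
        = T.lower R d (T.lowerSum R (Finsupp.single e (1 : ZMod 2)) w)
      rw [T.lowerSum_single, T.lower_comm_apply]

/-- The relations of the resolution hold for the operators. -/
theorem lowerSum_top {S : T.Resolution} {v : T.strand →₀ ZMod 2} (h : v ∈ T.rels S) :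
    T.lowerSum R v (T.top R S) = 0 := by
  induction h using Submodule.span_induction with
  | zero => simp
  | add a b _ _ ha hb => rw [map_add, LinearMap.add_apply, ha, hb, add_zero]
  | smul t a _ ha => rw [map_smul, LinearMap.smul_apply, ha, smul_zero]
  | mem v hv =>
    have key : ∀ d e : T.strand, T.comp S d = T.comp S e →
        T.lowerSum R (Finsupp.single d 1 + Finsupp.single e 1) (T.top R S) = 0 := by
      intro d e hde
      rw [map_add, lowerSum_single, lowerSum_single, LinearMap.add_apply, top, lower_single,
        lower_single]
      show T.hit R (T.comp S d) _ + T.hit R (T.comp S e) _ = 0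
      rw [hde]
      exact T.add_self_eq_zero' _
    rcases hv with ⟨d, rfl⟩ | ⟨d, rfl⟩
    · exact key _ _ (T.comp_sRev S d).symm
    · unfold mateRel
      split_ifs with hd
      · rw [lowerSum_single, top, lower_single]
        exact T.hit_arc ⟨d, (T.mate_eq_self_iff S d).1 hd, rfl⟩ _
      · exact key _ _ (T.comp_mate S d).symm

theorem lowerSum_mon {S : T.Resolution} {v : T.strand →₀ ZMod 2} (h : v ∈ T.rels S)
    (m : Multiset T.strand) : T.lowerSum R v (T.mon R S m) = 0 := by
  induction m using Multiset.induction_on with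
  | empty => exact T.lowerSum_top h
  | cons d m ih => rw [mon_cons, lowerSum_apply_comm, ih, map_zero]

theorem lowerSum_bridge (c : T.Crossing) :
    T.lowerSum R (T.bridge c) = T.lower R (T.dartAt c) + T.lower R (T.oppAt c) := by
  rw [bridge, map_add, lowerSum_single, lowerSum_single]

theorem lowerSum_bridge_sq (c : T.Crossing) (w : T.State →₀ R) :
    T.lowerSum R (T.bridge c) (T.lowerSum R (T.bridge c) w) = 0 := by
  rw [lowerSum_bridge]
  simp only [LinearMap.add_apply, map_add, lower_lower, zero_add, add_zero]
  rw [T.lower_comm_apply (T.oppAt c)]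
  exact T.add_self_eq_zero' _

variable (R) in
open Classical in
/-- The factor of the surgery at the crossing `c`: the identity if two components merge. If a component
is divided, then `1` has the comultiplication `1 ⊗ v₋ + v₋ ⊗ 1`, which is the operator of `T.bridge c`. -/
def factor (c : T.Crossing) (S : T.Resolution) : Module.End R (T.State →₀ R) :=
  if T.bridge c ∈ T.rels S then T.lowerSum R (T.bridge c) else 1

theorem factor_comm (c : T.Crossing) (S : T.Resolution) (d : T.strand) (w : T.State →₀ R) :
    T.factor R c S (T.lower R d w) = T.lower R d (T.factor R c S w) := by
  unfold factor
  split_ifs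
  · exact T.lowerSum_apply_comm _ _ _
  · rfl

end CharTwo

section Surgery

variable [Finite D] [Algebra (ZMod 2) R]

theorem factor_lowerSum_mon {c : T.Crossing} {S : T.Resolution} {v : T.strand →₀ ZMod 2}
    (h : v ∈ T.rels S) (m : Multiset T.strand) :
    T.factor R c S (T.lowerSum R v (T.mon R (T.flip S c) m)) = 0 := by
  unfold factor
  split_ifs with hb
  · rcases (mem_sup_span_singleton_iff _ _ _).1 (T.rels_le_sup S c h) with h1 | h1
    · rw [T.lowerSum_mon h1, map_zero]
    · have h2 := T.lowerSum_mon (R := R) h1 m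
      rw [map_add, LinearMap.add_apply] at h2
      have h3 : T.lowerSum R v (T.mon R (T.flip S c) m)
          = T.lowerSum R (T.bridge c) (T.mon R (T.flip S c) m) := by
        rw [← sub_eq_zero, sub_eq_add_neg, neg_eq_of_add_eq_zero_left (T.add_self_eq_zero' _), h2]
      rw [h3, T.lowerSum_bridge_sq]
  · have h1 := T.rels_le_flip S ((T.bridge_mem_or S c).resolve_left hb) h
    rw [T.lowerSum_mon h1, map_zero]

theorem factor_lower_congr {c : T.Crossing} {S : T.Resolution} {d e : T.strand}
    (h : T.comp S d = T.comp S e) (m : Multiset T.strand) :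
    T.factor R c S (T.lower R d (T.mon R (T.flip S c) m))
      = T.factor R c S (T.lower R e (T.mon R (T.flip S c) m)) := by
  have h2 := T.factor_lowerSum_mon (R := R) (c := c) (T.pair_mem_rels S h) m
  rw [map_add, lowerSum_single, lowerSum_single, LinearMap.add_apply, map_add] at h2
  rw [← sub_eq_zero, sub_eq_add_neg, neg_eq_of_add_eq_zero_left (T.add_self_eq_zero' _), h2]

variable (R) in
/-- The change of the resolution of the crossing `c`, in either direction, by the multiplication or the
comultiplication of the algebra of `v₊` and `v₋`, without regard to the surface. -/
def surgery (c : T.Crossing) : Module.End R (T.State →₀ R) :=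
  Finsupp.linearCombination R
    (fun s : T.State => T.factor R c s.1 (T.mon R (T.flip s.1 c) (T.minusReps s.2)))

theorem surgery_single (c : T.Crossing) (s : T.State) :
    T.surgery R c (Finsupp.single s 1)
      = T.factor R c s.1 (T.mon R (T.flip s.1 c) (T.minusReps s.2)) := by
  simp [surgery]

theorem surgery_lower (c : T.Crossing) (d : T.strand) :
    T.surgery R c * T.lower R d = T.lower R d * T.surgery R c := by
  classical
  refine T.linearMap_ext fun s => ?_
  obtain ⟨S, σ⟩ := s
  simp only [Module.End.mul_apply, lower_single, surgery_single]
  rw [← T.factor_comm]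
  by_cases hd : T.IsArc (T.comp S d)
  · rw [T.hit_arc hd, map_zero, ← T.lowerSum_single, T.factor_lowerSum_mon]
    exact T.single_mem_rels S hd
  have hc : T.comp S d = T.comp S (T.rep (circ _ hd).1) := (T.comp_rep _).symm
  cases hσ : σ (circ _ hd)
  · rw [T.hit_neg hd hσ, map_zero, T.factor_lower_congr hc]
    have h2 : T.minusReps σ = T.rep (circ _ hd).1 ::ₘ
        T.minusReps (Function.update σ (circ _ hd) true) := by
      rw [← T.minusReps_update (Function.update_self _ _ _), Function.update_idem, ← hσ,
        Function.update_eq_self]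
    rw [h2, mon_cons, lower_lower, map_zero]
  · rw [T.hit_pos hd hσ, surgery_single, T.minusReps_update hσ, mon_cons,
      T.factor_lower_congr hc]

theorem surgery_lower_apply (c : T.Crossing) (d : T.strand) (v : T.State →₀ R) :
    T.surgery R c (T.lower R d v) = T.lower R d (T.surgery R c v) :=
  LinearMap.congr_fun (T.surgery_lower c d) v

theorem surgery_top (c : T.Crossing) (S : T.Resolution) :
    T.surgery R c (T.top R S) = T.factor R c S (T.top R (T.flip S c)) := by
  rw [top, surgery_single]
  simp [minusReps, mon_zero]

theorem surgery_lowerSum (c : T.Crossing) (w : T.strand →₀ ZMod 2) (v : T.State →₀ R) :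
    T.surgery R c (T.lowerSum R w v) = T.lowerSum R w (T.surgery R c v) := by
  induction w using Finsupp.induction_linear with
  | zero => simp
  | add a b ha hb => simp only [map_add, LinearMap.add_apply, ha, hb]
  | single e t =>
    fin_cases t
    · show T.surgery R c (T.lowerSum R (Finsupp.single e (0 : ZMod 2)) v)
        = T.lowerSum R (Finsupp.single e (0 : ZMod 2)) _
      simp
    · show T.surgery R c (T.lowerSum R (Finsupp.single e (1 : ZMod 2)) v)
        = T.lowerSum R (Finsupp.single e (1 : ZMod 2)) _
      rw [T.lowerSum_single, T.surgery_lower_apply]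

theorem surgery_surgery_top (c c' : T.Crossing) (S : T.Resolution) :
    T.surgery R c' (T.surgery R c (T.top R S))
      = T.factor R c S (T.factor R c' (T.flip S c) (T.top R (T.flip (T.flip S c) c'))) := by
  rw [surgery_top]
  have : ∀ v, T.surgery R c' (T.factor R c S v) = T.factor R c S (T.surgery R c' v) := by
    intro v
    unfold factor
    split_ifs
    · exact T.surgery_lowerSum _ _ _
    · rfl
  rw [this, surgery_top]

/-- The surgeries at two crossings commute. Both composites commute with the operators `T.lower R d`; on
the states without signs `-` they are compared by cases, according to which of the two bridges are relations
of which of the four resolutions. -/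
theorem surgery_comm (c c' : T.Crossing) :
    T.surgery R c' * T.surgery R c = T.surgery R c * T.surgery R c' := by
  refine T.ext_of_lower (fun d v => ?_) (fun d v => ?_) (fun S => ?_)
  · simp only [Module.End.mul_apply, surgery_lower_apply]
  · simp only [Module.End.mul_apply, surgery_lower_apply]
  have comm : T.lowerSum R (T.bridge c) (T.lowerSum R (T.bridge c')
      (T.top R (T.flip (T.flip S c) c'))) = T.lowerSum R (T.bridge c') (T.lowerSum R (T.bridge c)
      (T.top R (T.flip (T.flip S c) c'))) := by
    rw [T.lowerSum_bridge c']
    simp only [LinearMap.add_apply, map_add, lowerSum_apply_comm]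
  have zero : ∀ v ∈ T.rels (T.flip (T.flip S c) c'),
      T.lowerSum R v (T.top R (T.flip (T.flip S c) c')) = 0 := fun v hv => T.lowerSum_top hv
  have hc : T.flip (T.flip S c') c = T.flip (T.flip S c) c' := T.flip_comm S c' c
  simp only [Module.End.mul_apply, surgery_surgery_top, hc]
  simp only [factor]
  by_cases a : T.bridge c ∈ T.rels S <;> by_cases b : T.bridge c' ∈ T.rels (T.flip S c) <;>
    by_cases a' : T.bridge c' ∈ T.rels S <;> by_cases b' : T.bridge c ∈ T.rels (T.flip S c') <;>
    simp only [a, b, a', b', if_true, if_false, Module.End.one_apply]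
  · exact comm
  · have := T.bridge_mem_of_split_merge b' a
    rw [hc] at this
    rw [zero _ this, map_zero]
  · exact absurd b (T.not_merge_split a' a)
  · exact absurd a (T.not_bridge_mem_of_merge_merge a' b').1
  · rw [zero _ (T.bridge_mem_of_split_merge b a'), map_zero]
  · have h1 := (T.bridge_mem_or (T.flip S c') c).resolve_left b'
    rw [hc] at h1
    rw [zero _ h1, zero _ ((T.bridge_mem_or (T.flip S c) c').resolve_left b)]
  · exact absurd a (T.not_bridge_mem_of_merge_merge a' b').1
  · exact absurd b' (T.not_merge_split a a')
  · have h1 := zero _ (T.add_bridge_mem a a')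
    rw [map_add, LinearMap.add_apply] at h1
    rw [← sub_eq_zero, sub_eq_add_neg, neg_eq_of_add_eq_zero_left (T.add_self_eq_zero' _),
      add_comm, h1]
  · exact absurd b (T.not_bridge_mem_of_merge_merge a' b').2
  · exact absurd a' (T.not_bridge_mem_of_merge_merge a b).1
  · exact absurd a' (T.not_bridge_mem_of_merge_merge a b).1
  · exact absurd b' (T.not_bridge_mem_of_merge_merge a b).2

/-- The square of a surgery: a multiplication followed by a comultiplication, or conversely, is the
multiplication by the sum of two generators. -/
theorem surgery_sq (c : T.Crossing) :
    T.surgery R c * T.surgery R c = T.lower R (T.dartAt c) + T.lower R (T.oppAt c) := by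
  refine T.ext_of_lower (fun d v => ?_) (fun d v => ?_) (fun S => ?_)
  · simp only [Module.End.mul_apply, surgery_lower_apply]
  · simp only [LinearMap.add_apply, map_add, T.lower_comm_apply _ d]
  simp only [Module.End.mul_apply, surgery_surgery_top, ← T.lowerSum_bridge, T.flip_flip]
  unfold factor
  split_ifs with h1 h2 h2
  · rw [T.lowerSum_bridge_sq, T.lowerSum_top h1]
  · rfl
  · rfl
  · exact absurd ((T.bridge_mem_or S c).resolve_left h1) h2

end Surgery

end TangleDiagram

/-! ### Merging of two components -/

namespace TangleDiagram

variable {D : Type*} {M : CellSurface D} (T : TangleDiagram M)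

/-- The component of `d` abuts the crossing `c`. -/
def Touches (S : T.Resolution) (c : T.Crossing) (d : T.strand) : Prop :=
  T.comp S d = T.comp S (T.dartAt c) ∨ T.comp S d = T.comp S (T.oppAt c)

section Merge

variable [Finite D] {T} {S : T.Resolution} {c : T.Crossing} (hb : T.bridge c ∉ T.rels S)

include hb

omit [Finite D] in
theorem merge_ne : T.comp S (T.dartAt c) ≠ T.comp S (T.oppAt c) :=
  fun h => hb ((T.bridge_mem_iff S c).2 (Or.inl h))

omit [Finite D] in
theorem merge_not_arc (h : T.IsArc (T.comp S (T.dartAt c))) :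
    ¬ T.IsArc (T.comp S (T.oppAt c)) :=
  fun h' => hb ((T.bridge_mem_iff S c).2 (Or.inr ⟨h, h'⟩))

theorem merge_comp :
    T.comp (T.flip S c) (T.dartAt c) = T.comp (T.flip S c) (T.oppAt c) := by
  rw [T.comp_eq_iff]
  refine (T.smoothing_at S c).merge_conn T.sRev_involutive T.sRev_ne (T.mate_involutive S) ?_ ?_
  · rw [← T.comp_eq_iff]
    exact merge_ne hb
  · rw [← T.isArc_comp_iff, ← T.isArc_comp_iff]
    exact fun h => merge_not_arc hb h.1 h.2

/-- When two components merge, the components become larger. -/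
theorem merge_coarse {d e : T.strand} (h : T.comp S d = T.comp S e) :
    T.comp (T.flip S c) d = T.comp (T.flip S c) e := by
  have hs := T.smoothing_at S c
  have hm := merge_comp hb
  have e1 : T.comp (T.flip S c) (T.mate S (T.dartAt c)) = T.comp (T.flip S c) (T.oppAt c) := by
    rw [← hs.m'_q, T.comp_mate]
  have e2 : T.comp (T.flip S c) (T.mate (T.flip S c) (T.dartAt c))
      = T.comp (T.flip S c) (T.dartAt c) := T.comp_mate _ _
  rw [T.comp_eq_iff] at h
  refine Conn.lift (T.comp (T.flip S c)) (T.comp_sRev _) (fun x => ?_) h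
  by_cases hx : x = T.dartAt c ∨ x = T.mate S (T.dartAt c) ∨ x = T.oppAt c ∨
      x = T.mate (T.flip S c) (T.dartAt c)
  · rcases hx with rfl | rfl | rfl | rfl
    · rw [e1, hm]
    · rw [T.mate_involutive, e1, hm]
    · rw [hs.m_q, e2, hm]
    · rw [e2]
      conv_lhs => rw [← hs.m_q]
      rw [T.mate_involutive, hm]
  · rw [← hs.off_not hx, T.comp_mate]

omit [Finite D] hb in
/-- Only the two components at the crossing become equal when the resolution is changed there. -/
theorem merge_fine {d e : T.strand} (h : T.comp (T.flip S c) d = T.comp (T.flip S c) e) :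
    T.comp S d = T.comp S e ∨ T.Touches S c d ∧ T.Touches S c e := by
  classical
  have hs := T.smoothing_at S c
  let g : T.strand → T.Component S := fun x =>
    if T.Touches S c x then T.comp S (T.dartAt c) else T.comp S x
  have hg : ∀ x, T.Touches S c x → g x = T.comp S (T.dartAt c) := fun x hx => if_pos hx
  have t1 : T.Touches S c (T.dartAt c) := Or.inl rfl
  have t2 : T.Touches S c (T.oppAt c) := Or.inr rfl
  have t3 : T.Touches S c (T.mate S (T.dartAt c)) := Or.inl (T.comp_mate _ _)
  have t5 : T.Touches S c (T.mate (T.flip S c) (T.dartAt c)) := Or.inr (by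
    rw [← hs.m_q, T.comp_mate])
  have hgc : ∀ x y, T.comp S x = T.comp S y → g x = g y := fun x y hxy => by
    by_cases hx : T.Touches S c x
    · rw [hg x hx, hg y (by rwa [Touches, ← hxy])]
    · have hy : ¬ T.Touches S c y := by rwa [Touches, ← hxy]
      simp only [g, if_neg hx, if_neg hy, hxy]
  have key : g d = g e := by
    rw [T.comp_eq_iff] at h
    refine Conn.lift g (fun x => hgc _ _ (T.comp_sRev S x)) (fun x => ?_) h
    by_cases hx : x = T.dartAt c ∨ x = T.mate S (T.dartAt c) ∨ x = T.oppAt c ∨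
        x = T.mate (T.flip S c) (T.dartAt c)
    · have hm : T.Touches S c x ∧ T.Touches S c (T.mate (T.flip S c) x) := by
        rcases hx with rfl | rfl | rfl | rfl
        · exact ⟨t1, t5⟩
        · refine ⟨t3, ?_⟩
          rw [← hs.m'_q, T.mate_involutive]
          exact t2
        · refine ⟨t2, ?_⟩
          rw [hs.m'_q]
          exact t3
        · refine ⟨t5, ?_⟩
          rw [T.mate_involutive]
          exact t1
      rw [hg _ hm.1, hg _ hm.2]
    · rw [hs.off_not hx]
      exact hgc _ _ (T.comp_mate S x)
  by_cases hd : T.Touches S c d <;> by_cases he : T.Touches S c e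
  · exact Or.inr ⟨hd, he⟩
  · simp only [g, if_pos hd, if_neg he] at key
    exact absurd (Or.inl key.symm) he
  · simp only [g, if_neg hd, if_pos he] at key
    exact absurd (Or.inl key) hd
  · simp only [g, if_neg hd, if_neg he] at key
    exact Or.inl key

theorem merge_touches {d : T.strand} :
    T.comp (T.flip S c) d = T.comp (T.flip S c) (T.dartAt c) ↔ T.Touches S c d := by
  constructor
  · intro h
    rcases merge_fine h with h | h
    · exact Or.inl h
    · exact h.1
  · rintro (h | h)
    · exact merge_coarse hb h
    · rw [merge_comp hb]
      exact merge_coarse hb h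

omit [Finite D] hb in
theorem merge_fine_off {d e : T.strand} (hd : ¬ T.Touches S c d)
    (h : T.comp (T.flip S c) d = T.comp (T.flip S c) e) : T.comp S d = T.comp S e :=
  (merge_fine h).resolve_right fun h => hd h.1

theorem merge_isArc_off {d : T.strand} (hd : ¬ T.Touches S c d) :
    T.IsArc (T.comp (T.flip S c) d) ↔ T.IsArc (T.comp S d) := by
  constructor
  · rintro ⟨e, h1, h2⟩
    exact ⟨e, h1, (merge_fine_off hd h2.symm).symm⟩
  · rintro ⟨e, h1, h2⟩
    exact ⟨e, h1, merge_coarse hb h2⟩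

theorem merge_isArc :
    T.IsArc (T.comp (T.flip S c) (T.dartAt c)) ↔
      T.IsArc (T.comp S (T.dartAt c)) ∨ T.IsArc (T.comp S (T.oppAt c)) := by
  constructor
  · rintro ⟨e, h1, h2⟩
    rcases (merge_touches hb).1 h2 with h | h
    · exact Or.inl ⟨e, h1, h⟩
    · exact Or.inr ⟨e, h1, h⟩
  · rintro (⟨e, h1, h2⟩ | ⟨e, h1, h2⟩)
    · exact ⟨e, h1, merge_coarse hb h2⟩
    · exact ⟨e, h1, (merge_coarse hb h2).trans (merge_comp hb).symm⟩

/-- A sum over the components before and after the merging of two of them. -/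
theorem merge_sum [Fintype (T.Component S)] [Fintype (T.Component (T.flip S c))]
    {f : T.Component S → ℤ} {g : T.Component (T.flip S c) → ℤ}
    (h : ∀ d, ¬ T.Touches S c d → f (T.comp S d) = g (T.comp (T.flip S c) d)) :
    ∑ C, f C - f (T.comp S (T.dartAt c)) - f (T.comp S (T.oppAt c))
      = ∑ C, g C - g (T.comp (T.flip S c) (T.dartAt c)) := by
  classical
  have h1 := Finset.add_sum_erase Finset.univ f (Finset.mem_univ (T.comp S (T.dartAt c)))
  have h2 := Finset.add_sum_erase (Finset.univ.erase (T.comp S (T.dartAt c))) f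
    (Finset.mem_erase.2 ⟨(merge_ne hb).symm, Finset.mem_univ (T.comp S (T.oppAt c))⟩)
  have h3 := Finset.add_sum_erase Finset.univ g
    (Finset.mem_univ (T.comp (T.flip S c) (T.dartAt c)))
  have h5 : ∑ C ∈ (Finset.univ.erase (T.comp S (T.dartAt c))).erase (T.comp S (T.oppAt c)), f C
      = ∑ C ∈ Finset.univ.erase (T.comp (T.flip S c) (T.dartAt c)), g C := by
    have hnt : ∀ C : T.Component S, C ∈ (Finset.univ.erase (T.comp S (T.dartAt c))).erase
        (T.comp S (T.oppAt c)) ↔ ¬ T.Touches S c (T.rep C) := by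
      intro C
      simp only [Finset.mem_erase, Finset.mem_univ, and_true, Touches, T.comp_rep]
      tauto
    have hnt' : ∀ C : T.Component (T.flip S c),
        C ∈ Finset.univ.erase (T.comp (T.flip S c) (T.dartAt c)) ↔
          ¬ T.Touches S c (T.rep C) := by
      intro C
      rw [← merge_touches hb, T.comp_rep]
      simp
    have hl : ∀ C : T.Component S, ¬ T.Touches S c (T.rep C) →
        T.comp S (T.rep (T.comp (T.flip S c) (T.rep C))) = C := by
      intro C hC
      have := merge_fine_off hC (T.comp_rep (T.comp (T.flip S c) (T.rep C))).symm
      rw [← this, T.comp_rep]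
    have hr : ∀ C : T.Component (T.flip S c),
        T.comp (T.flip S c) (T.rep (T.comp S (T.rep C))) = C := by
      intro C
      rw [merge_coarse hb (T.comp_rep (T.comp S (T.rep C))), T.comp_rep]
    have htc : ∀ d e, T.comp S d = T.comp S e → (T.Touches S c d ↔ T.Touches S c e) :=
      fun d e hde => by simp only [Touches, hde]
    refine Finset.sum_bij' (fun C _ => T.comp (T.flip S c) (T.rep C))
      (fun C _ => T.comp S (T.rep C)) ?_ ?_ ?_ ?_ ?_
    · intro C hC
      rw [hnt] at hC
      rw [hnt', htc _ (T.rep C)]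
      · exact hC
      · rw [hl C hC, T.comp_rep]
    · intro C hC
      rw [hnt'] at hC
      rw [hnt, htc _ (T.rep C)]
      · exact hC
      · rw [T.comp_rep]
    · intro C hC
      exact hl C ((hnt C).1 hC)
    · intro C hC
      exact hr C
    · intro C hC
      rw [← h _ ((hnt C).1 hC), T.comp_rep]
  linarith

end Merge

end TangleDiagram

/-! ### The entries of a surgery -/

/-- The nonzero entries of the multiplication of two components, without regard to the surface: `none` is
an arc. -/
inductive SignMerge : Option Bool → Option Bool → Option Bool → Prop
  | pp : SignMerge (some true) (some true) (some true)
  | pm : SignMerge (some true) (some false) (some false)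
  | mp : SignMerge (some false) (some true) (some false)
  | pa : SignMerge (some true) none none
  | ap : SignMerge none (some true) none

/-- The nonzero entries of the comultiplication, without regard to the surface. -/
inductive SignDivide : Option Bool → Option Bool → Option Bool → Prop
  | ppm : SignDivide (some true) (some true) (some false)
  | pmp : SignDivide (some true) (some false) (some true)
  | mmm : SignDivide (some false) (some false) (some false)
  | aam : SignDivide none none (some false)
  | ama : SignDivide none (some false) none

theorem SignMerge.unique {x y z z' : Option Bool} (h : SignMerge x y z) (h' : SignMerge x y z') :
    z = z' := by
  cases h <;> cases h' <;> rfl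

theorem SignMerge.not_arcs {z : Option Bool} : ¬ SignMerge none none z := nofun

theorem SignDivide.not_arcs {z : Option Bool} : ¬ SignDivide z none none := nofun

namespace TangleDiagram

variable {D : Type*} {M : CellSurface D} (T : TangleDiagram M)

open Classical in
/-- The sign of the component of `d`; `none` for an arc. -/
def sign (s : T.State) (d : T.strand) : Option Bool :=
  if h : T.IsArc (T.comp s.1 d) then none else some (s.2 (circ _ h))

theorem sign_arc {s : T.State} {d : T.strand} (h : T.IsArc (T.comp s.1 d)) : T.sign s d = none :=
  dif_pos h

theorem sign_circ {s : T.State} {d : T.strand} (h : ¬ T.IsArc (T.comp s.1 d)) :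
    T.sign s d = some (s.2 (circ _ h)) := dif_neg h

theorem sign_congr (s : T.State) {d e : T.strand} (h : T.comp s.1 d = T.comp s.1 e) :
    T.sign s d = T.sign s e := by
  unfold sign
  rw [h]

theorem state_ext {S : T.Resolution} {σ τ : T.Circle S → Bool}
    (h : ∀ d, T.sign ⟨S, σ⟩ d = T.sign ⟨S, τ⟩ d) : σ = τ := by
  funext C
  have hC : ¬ T.IsArc (T.comp S (T.rep C.1)) := by rw [T.comp_rep]; exact C.2
  have h1 := h (T.rep C.1)
  rw [T.sign_circ (s := ⟨S, σ⟩) hC, T.sign_circ (s := ⟨S, τ⟩) hC] at h1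
  have h2 : circ _ hC = C := Subtype.ext (T.comp_rep C.1)
  rw [h2] at h1
  exact Option.some_injective _ h1

/-- The state `s'` arises from `s` by the change of the crossing `c`, with local entries given by the
relations `Mg` and `Dv` between the decorations `δ` of the components. -/
def Local {α : Type*} (δ : T.State → T.strand → α) (Mg Dv : α → α → α → Prop) (c : T.Crossing)
    (s s' : T.State) : Prop :=
  s'.1 = T.flip s.1 c ∧ (∀ d, ¬ T.Touches s.1 c d → δ s d = δ s' d) ∧
  ((T.comp s.1 (T.dartAt c) ≠ T.comp s.1 (T.oppAt c) ∧
      T.comp s'.1 (T.dartAt c) = T.comp s'.1 (T.oppAt c) ∧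
      Mg (δ s (T.dartAt c)) (δ s (T.oppAt c)) (δ s' (T.dartAt c))) ∨
   (T.comp s.1 (T.dartAt c) = T.comp s.1 (T.oppAt c) ∧
      T.comp s'.1 (T.dartAt c) ≠ T.comp s'.1 (T.oppAt c) ∧
      Dv (δ s (T.dartAt c)) (δ s' (T.dartAt c)) (δ s' (T.oppAt c))))

theorem touches_congr (S : T.Resolution) (c : T.Crossing) {d e : T.strand}
    (h : T.comp S d = T.comp S e) : T.Touches S c d ↔ T.Touches S c e := by
  rw [Touches, Touches, h]

section Entries

variable {R : Type*} [CommRing R]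

open Classical in
/-- The state over `S` whose circles with the sign `-` are those of the darts in `m`. -/
def monState (S : T.Resolution) (m : Multiset T.strand) : T.State :=
  ⟨S, fun C => decide (∀ e ∈ m, T.comp S e ≠ C.1)⟩

open Classical in
theorem monState_sign (S : T.Resolution) (m : Multiset T.strand) {d : T.strand}
    (h : ¬ T.IsArc (T.comp S d)) :
    T.sign (T.monState S m) d = some (decide (∀ e ∈ m, T.comp S e ≠ T.comp S d)) :=
  T.sign_circ (s := T.monState S m) h

theorem mon_eq_single {S : T.Resolution} {m : Multiset T.strand}
    (h1 : ∀ d ∈ m, ¬ T.IsArc (T.comp S d)) (h2 : (m.map (T.comp S)).Nodup) :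
    T.mon R S m = Finsupp.single (T.monState S m) 1 := by
  classical
  induction m using Multiset.induction_on with
  | empty => simp [mon_zero, top, monState]
  | cons d m ih =>
    rw [Multiset.map_cons, Multiset.nodup_cons] at h2
    have hd := h1 d (Multiset.mem_cons_self _ _)
    have hd2 : ∀ e ∈ m, T.comp S e ≠ T.comp S d :=
      fun e he hed => h2.1 (Multiset.mem_map.2 ⟨e, he, hed⟩)
    rw [mon_cons, ih (fun e he => h1 e (Multiset.mem_cons_of_mem he)) h2.2, lower_single]
    show T.hit R (T.comp S d) (T.monState S m).2 = _
    refine (T.hit_pos (R := R) hd (σ := fun C => decide (∀ e ∈ m, T.comp S e ≠ C.1))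
      (decide_eq_true hd2)).trans ?_
    show Finsupp.single (⟨S, _⟩ : T.State) 1 = Finsupp.single (⟨S, _⟩ : T.State) 1
    congr 2
    funext C
    by_cases hC : C = circ _ hd
    · subst hC
      rw [Function.update_self, eq_comm, decide_eq_false_iff_not]
      exact fun h => h d (Multiset.mem_cons_self _ _) rfl
    · have : T.comp S d ≠ C.1 := fun h => hC (Subtype.ext h.symm)
      rw [Function.update_of_ne hC]
      simp only [Multiset.mem_cons, forall_eq_or_imp, this, ne_eq, not_false_eq_true,
        true_and]

open Classical in
theorem lower_entry (d : T.strand) (r s' : T.State) :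
    T.lower R d (Finsupp.single r 1) s'
      = if s'.1 = r.1 ∧ T.sign r d = some true ∧ T.sign s' d = some false ∧
          ∀ e, T.comp r.1 e ≠ T.comp r.1 d → T.sign s' e = T.sign r e then 1 else 0 := by
  obtain ⟨S, σ⟩ := r
  rw [lower_single]
  by_cases ha : T.IsArc (T.comp S d)
  · rw [if_neg (fun h => by
      have := h.2.1
      rw [T.sign_arc (s := ⟨S, σ⟩) ha] at this
      cases this)]
    exact DFunLike.congr_fun (T.hit_arc ha σ) s'
  cases hσ : σ (circ _ ha)
  · rw [if_neg (fun h => by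
      have := h.2.1
      rw [T.sign_circ (s := ⟨S, σ⟩) ha] at this
      have h2 : σ (circ _ ha) = true := Option.some_injective _ this
      rw [hσ] at h2
      cases h2)]
    exact DFunLike.congr_fun (T.hit_neg ha hσ) s'
  · refine (DFunLike.congr_fun (T.hit_pos ha hσ) s').trans ?_
    rw [Finsupp.single_apply]
    refine if_congr ?_ rfl rfl
    set r' : T.State := ⟨S, Function.update σ (circ _ ha) false⟩ with hr'
    have h1 : T.sign r' d = some false := by
      rw [T.sign_circ (s := r') ha]
      show some (Function.update σ (circ _ ha) false (circ _ ha)) = some false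
      rw [Function.update_self]
    have h2 : ∀ e, T.comp S e ≠ T.comp S d → T.sign r' e = T.sign ⟨S, σ⟩ e := by
      intro e he
      by_cases hea : T.IsArc (T.comp S e)
      · rw [T.sign_arc (s := r') hea, T.sign_arc (s := ⟨S, σ⟩) hea]
      · rw [T.sign_circ (s := r') hea, T.sign_circ (s := ⟨S, σ⟩) hea]
        show some (Function.update σ (circ _ ha) false (circ _ hea)) = some (σ (circ _ hea))
        exact congrArg some (Function.update_of_ne (fun h : circ _ hea = circ _ ha =>
          he (congrArg Subtype.val h)) _ _)
    constructor
    · rintro rfl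
      exact ⟨rfl, by rw [T.sign_circ (s := ⟨S, σ⟩) ha]; exact congrArg some hσ, h1, h2⟩
    · obtain ⟨S', σ'⟩ := s'
      rintro ⟨h3, -, h5, h6⟩
      have h3' : S' = S := h3
      subst h3'
      show (⟨S', _⟩ : T.State) = ⟨S', σ'⟩
      congr 1
      refine T.state_ext fun e => ?_
      by_cases he : T.comp S' e = T.comp S' d
      · exact ((T.sign_congr r' he).trans (h1.trans h5.symm)).trans
          (T.sign_congr ⟨S', σ'⟩ he).symm
      · exact (h2 e he).trans (h6 e he).symm

variable [Algebra (ZMod 2) R]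

theorem mon_eq_zero_of_arc {S : T.Resolution} {m : Multiset T.strand} {d : T.strand}
    (h : d ∈ m) (hd : T.IsArc (T.comp S d)) : T.mon R S m = 0 := by
  obtain ⟨m', rfl⟩ := Multiset.exists_cons_of_mem h
  rw [mon_cons, ← lowerSum_single]
  exact T.lowerSum_mon (T.single_mem_rels S hd) m'

theorem mon_eq_zero_of_pair {S : T.Resolution} {m : Multiset T.strand} {d e : T.strand}
    (h : d ∈ m) (h' : e ∈ m) (hde : d ≠ e) (hc : T.comp S d = T.comp S e) : T.mon R S m = 0 := by
  obtain ⟨m', rfl⟩ := Multiset.exists_cons_of_mem h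
  have h2 := (Multiset.mem_cons.1 h').resolve_left hde.symm
  obtain ⟨m'', rfl⟩ := Multiset.exists_cons_of_mem h2
  have h3 := T.lowerSum_mon (R := R) (T.pair_mem_rels S hc) m''
  rw [map_add, lowerSum_single, lowerSum_single, LinearMap.add_apply] at h3
  rw [mon_cons, mon_cons, T.lower_comm_apply]
  have h5 : T.lower R d (T.mon R S m'') = T.lower R e (T.mon R S m'') := by
    rw [← sub_eq_zero, sub_eq_add_neg, neg_eq_of_add_eq_zero_left (T.add_self_eq_zero' _), h3]
  rw [h5, lower_lower]

variable [Finite D]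

omit [Algebra (ZMod 2) R] in
theorem mem_minusReps {S : T.Resolution} {σ : T.Circle S → Bool} {d : T.strand} :
    d ∈ T.minusReps σ ↔ ∃ C, σ C = false ∧ T.rep C.1 = d := by
  simp [minusReps]

theorem map_comp_minusReps {S : T.Resolution} (σ : T.Circle S → Bool) :
    ((T.minusReps σ).map (T.comp S)).Nodup := by
  classical
  rw [minusReps, Multiset.map_map]
  refine Multiset.Nodup.map_on ?_ (Finset.nodup _)
  intro C _ C' _ h
  simp only [Function.comp_apply, T.comp_rep] at h
  exact Subtype.ext h

theorem not_isArc_of_mem_minusReps {S : T.Resolution} {σ : T.Circle S → Bool} {d : T.strand}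
    (h : d ∈ T.minusReps σ) : ¬ T.IsArc (T.comp S d) := by
  obtain ⟨C, -, rfl⟩ := T.mem_minusReps.1 h
  rw [T.comp_rep]
  exact C.2

theorem sign_eq_minus_iff {S : T.Resolution} {σ : T.Circle S → Bool} {d : T.strand} :
    T.sign ⟨S, σ⟩ d = some false ↔ ∃ e ∈ T.minusReps σ, T.comp S e = T.comp S d := by
  constructor
  · intro h
    by_cases hd : T.IsArc (T.comp S d)
    · rw [T.sign_arc hd] at h
      cases h
    · rw [T.sign_circ (s := ⟨S, σ⟩) hd] at h
      exact ⟨_, T.mem_minusReps.2 ⟨_, Option.some_injective _ h, rfl⟩, T.comp_rep _⟩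
  · rintro ⟨e, he, hed⟩
    have hna := T.not_isArc_of_mem_minusReps he
    rw [← T.sign_congr ⟨S, σ⟩ hed, T.sign_circ (s := ⟨S, σ⟩) hna]
    obtain ⟨C, hC, rfl⟩ := T.mem_minusReps.1 he
    have h2 : circ _ hna = C := Subtype.ext (T.comp_rep C.1)
    rw [h2]
    exact congrArg some hC

section MergeEntries

variable {T} {S : T.Resolution} {c : T.Crossing} (hb : T.bridge c ∉ T.rels S)
  (σ : T.Circle S → Bool)

include hb

open Classical in
theorem merge_entry (s' : T.State) :
    T.surgery R c (Finsupp.single ⟨S, σ⟩ 1) s'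
      = if T.Local T.sign SignMerge SignDivide c ⟨S, σ⟩ s' then 1 else 0 := by
  rw [surgery_single]
  simp only [factor, if_neg hb, Module.End.one_apply]
  have hne := merge_ne hb
  have hloc : ∀ s'', T.Local T.sign SignMerge SignDivide c ⟨S, σ⟩ s'' →
      SignMerge (T.sign ⟨S, σ⟩ (T.dartAt c)) (T.sign ⟨S, σ⟩ (T.oppAt c))
        (T.sign s'' (T.dartAt c)) := by
    rintro s'' ⟨-, -, ⟨-, -, h⟩ | ⟨h, -⟩⟩
    · exact h
    · exact absurd h hne
  have hminus : ∀ d, T.Touches S c d → T.sign ⟨S, σ⟩ d = some false →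
      ∃ e ∈ T.minusReps σ, T.comp S e = T.comp S d ∧
        T.comp (T.flip S c) e = T.comp (T.flip S c) (T.dartAt c) := by
    intro d hd h
    obtain ⟨e, he, hed⟩ := T.sign_eq_minus_iff.1 h
    exact ⟨e, he, hed, (merge_touches hb).2 ((T.touches_congr S c hed).2 hd)⟩
  -- both sides vanish if a circle with the sign `-` merges with an arc or with another one
  by_cases hz : (∃ d ∈ T.minusReps σ, T.IsArc (T.comp (T.flip S c) d)) ∨
      ∃ d ∈ T.minusReps σ, ∃ e ∈ T.minusReps σ, d ≠ e ∧
        T.comp (T.flip S c) d = T.comp (T.flip S c) e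
  · have h0 : T.mon R (T.flip S c) (T.minusReps σ) = 0 := by
      rcases hz with ⟨d, hd, h⟩ | ⟨d, hd, e, he, hde, h⟩
      · exact T.mon_eq_zero_of_arc hd h
      · exact T.mon_eq_zero_of_pair hd he hde h
    rw [h0, Finsupp.zero_apply, if_neg]
    intro hl
    have hm := hloc _ hl
    rcases hz with ⟨d, hd, h⟩ | ⟨d, hd, e, he, hde, h⟩
    · have hna := T.not_isArc_of_mem_minusReps hd
      have hs : T.sign ⟨S, σ⟩ d = some false := T.sign_eq_minus_iff.2 ⟨d, hd, rfl⟩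
      by_cases ht : T.Touches S c d
      · rw [(merge_touches hb).2 ht, merge_isArc hb] at h
        rcases ht with ht | ht
        · rw [← T.sign_congr ⟨S, σ⟩ ht, hs] at hm
          rw [← ht] at h
          rw [T.sign_arc (s := ⟨S, σ⟩) (h.resolve_left hna)] at hm
          cases hm
        · rw [← T.sign_congr ⟨S, σ⟩ ht, hs] at hm
          rw [← ht] at h
          rw [T.sign_arc (s := ⟨S, σ⟩) (h.resolve_right hna)] at hm
          cases hm
      · exact hna ((merge_isArc_off hb ht).1 h)
    · have hsd : T.sign ⟨S, σ⟩ d = some false := T.sign_eq_minus_iff.2 ⟨d, hd, rfl⟩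
      have hse : T.sign ⟨S, σ⟩ e = some false := T.sign_eq_minus_iff.2 ⟨e, he, rfl⟩
      have hcomp : T.comp S d ≠ T.comp S e := by
        intro h2
        obtain ⟨C, -, rfl⟩ := T.mem_minusReps.1 hd
        obtain ⟨C', -, rfl⟩ := T.mem_minusReps.1 he
        rw [T.comp_rep, T.comp_rep] at h2
        exact hde (by rw [h2])
      rcases merge_fine h with h2 | ⟨h2 | h2, h3 | h3⟩
      · exact hcomp h2
      · exact hcomp (h2.trans h3.symm)
      · rw [← T.sign_congr ⟨S, σ⟩ h2, ← T.sign_congr ⟨S, σ⟩ h3, hsd, hse] at hm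
        cases hm
      · rw [← T.sign_congr ⟨S, σ⟩ h2, ← T.sign_congr ⟨S, σ⟩ h3, hsd, hse] at hm
        cases hm
      · exact hcomp (h2.trans h3.symm)
  · push Not at hz
    have hnd : ((T.minusReps σ).map (T.comp (T.flip S c))).Nodup := by
      refine Multiset.Nodup.map_on (fun d hd e he h => ?_)
        (Multiset.Nodup.of_map _ (T.map_comp_minusReps σ))
      by_contra hde
      exact hz.2 d hd e he hde h
    rw [T.mon_eq_single hz.1 hnd, Finsupp.single_apply]
    -- otherwise `r` is the only state in the image
    set r : T.State := T.monState (T.flip S c) (T.minusReps σ) with hr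
    have hrs : ∀ d, ¬ T.IsArc (T.comp (T.flip S c) d) → T.sign r d =
        some (decide (∀ e ∈ T.minusReps σ, T.comp (T.flip S c) e ≠ T.comp (T.flip S c) d)) :=
      fun d hd => T.monState_sign _ _ hd
    have hoff : ∀ d, ¬ T.Touches S c d → T.sign ⟨S, σ⟩ d = T.sign r d := by
      intro d hd
      by_cases ha : T.IsArc (T.comp S d)
      · rw [T.sign_arc (s := ⟨S, σ⟩) ha, T.sign_arc (s := r) ((merge_isArc_off hb hd).2 ha)]
      · rw [hrs d (fun h => ha ((merge_isArc_off hb hd).1 h))]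
        cases hsd : T.sign ⟨S, σ⟩ d with
        | none => rw [T.sign_circ (s := ⟨S, σ⟩) ha] at hsd; cases hsd
        | some b =>
          congr 1
          cases b
          · obtain ⟨e, he, hed⟩ := T.sign_eq_minus_iff.1 hsd
            rw [eq_comm, decide_eq_false_iff_not]
            exact fun h => h e he (merge_coarse hb hed)
          · rw [eq_comm, decide_eq_true_iff]
            intro e he hed
            have := T.sign_eq_minus_iff.2 ⟨e, he, (merge_fine_off hd hed.symm).symm⟩
            rw [this] at hsd
            cases hsd
    have hall : (∃ e ∈ T.minusReps σ, T.comp (T.flip S c) e = T.comp (T.flip S c) (T.dartAt c)) ↔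
        T.sign ⟨S, σ⟩ (T.dartAt c) = some false ∨ T.sign ⟨S, σ⟩ (T.oppAt c) = some false := by
      constructor
      · rintro ⟨e, he, hec⟩
        rcases (merge_touches hb).1 hec with h | h
        · exact Or.inl (T.sign_eq_minus_iff.2 ⟨e, he, h⟩)
        · exact Or.inr (T.sign_eq_minus_iff.2 ⟨e, he, h⟩)
      · rintro (h | h)
        · obtain ⟨e, he, -, h2⟩ := hminus _ (Or.inl rfl) h
          exact ⟨e, he, h2⟩
        · obtain ⟨e, he, -, h2⟩ := hminus _ (Or.inr rfl) h
          exact ⟨e, he, h2⟩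
    have hc : ∀ b : Bool, ¬ T.IsArc (T.comp (T.flip S c) (T.dartAt c)) →
        ((T.sign ⟨S, σ⟩ (T.dartAt c) = some false ∨ T.sign ⟨S, σ⟩ (T.oppAt c) = some false)
          ↔ b = false) → T.sign r (T.dartAt c) = some b := by
      intro b h h2
      rw [hrs _ h]
      rw [← hall] at h2
      congr 1
      cases b
      · rw [decide_eq_false_iff_not]
        obtain ⟨e, he, h3⟩ := h2.2 rfl
        exact fun h => h e he h3
      · rw [decide_eq_true_iff]
        exact fun e he h3 => absurd (h2.1 ⟨e, he, h3⟩) (by simp)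
    have hmerge : SignMerge (T.sign ⟨S, σ⟩ (T.dartAt c)) (T.sign ⟨S, σ⟩ (T.oppAt c))
        (T.sign r (T.dartAt c)) := by
      by_cases hA : T.IsArc (T.comp S (T.dartAt c))
      · have hB := merge_not_arc hb hA
        have hC := (merge_isArc hb).2 (Or.inl hA)
        rw [T.sign_arc (s := r) hC, T.sign_arc (s := ⟨S, σ⟩) hA]
        cases hσ : T.sign ⟨S, σ⟩ (T.oppAt c) with
        | none => rw [T.sign_circ (s := ⟨S, σ⟩) hB] at hσ; cases hσ
        | some b =>
          cases b
          · obtain ⟨e, he, -, h2⟩ := hminus _ (Or.inr rfl) hσ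
            exact absurd (by rw [h2]; exact hC) (hz.1 e he)
          · exact .ap
      · by_cases hB : T.IsArc (T.comp S (T.oppAt c))
        · have hC := (merge_isArc hb).2 (Or.inr hB)
          rw [T.sign_arc (s := r) hC, T.sign_arc (s := ⟨S, σ⟩) hB]
          cases hσ : T.sign ⟨S, σ⟩ (T.dartAt c) with
          | none => rw [T.sign_circ (s := ⟨S, σ⟩) hA] at hσ; cases hσ
          | some b =>
            cases b
            · obtain ⟨e, he, -, h2⟩ := hminus _ (Or.inl rfl) hσ
              exact absurd (by rw [h2]; exact hC) (hz.1 e he)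
            · exact .pa
        · have hC : ¬ T.IsArc (T.comp (T.flip S c) (T.dartAt c)) := fun h =>
            ((merge_isArc hb).1 h).elim hA hB
          cases hσ : T.sign ⟨S, σ⟩ (T.dartAt c) with
          | none => rw [T.sign_circ (s := ⟨S, σ⟩) hA] at hσ; cases hσ
          | some b =>
            cases hτ : T.sign ⟨S, σ⟩ (T.oppAt c) with
            | none => rw [T.sign_circ (s := ⟨S, σ⟩) hB] at hτ; cases hτ
            | some b' =>
              cases b <;> cases b'
              · obtain ⟨e, he, h1, h2⟩ := hminus _ (Or.inl rfl) hσ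
                obtain ⟨f, hf, h3, h5⟩ := hminus _ (Or.inr rfl) hτ
                exact absurd (h2.trans h5.symm) (hz.2 e he f hf (fun hef => hne (by
                  rw [← h1, ← h3, hef])))
              · rw [hc false hC (by simp [hσ])]
                exact .mp
              · rw [hc false hC (by simp [hτ])]
                exact .pm
              · rw [hc true hC (by simp [hσ, hτ])]
                exact .pp
    have hrl : T.Local T.sign SignMerge SignDivide c ⟨S, σ⟩ r :=
      ⟨rfl, hoff, Or.inl ⟨hne, merge_comp hb, hmerge⟩⟩
    by_cases hs : r = s'
    · rw [if_pos hs, if_pos (hs ▸ hrl)]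
    · rw [if_neg hs, if_neg]
      intro hl
      apply hs
      have hm := hloc _ hl
      obtain ⟨S', σ'⟩ := s'
      obtain ⟨h1, h2, -⟩ := hl
      have h1' : S' = T.flip S c := h1
      subst h1'
      show (⟨T.flip S c, _⟩ : T.State) = ⟨T.flip S c, σ'⟩
      congr 1
      refine T.state_ext fun d => ?_
      by_cases hd : T.Touches S c d
      · have hd' := (merge_touches hb).2 hd
        exact ((T.sign_congr r hd').trans (hmerge.unique hm)).trans
          (T.sign_congr ⟨_, σ'⟩ hd').symm
      · rw [← h2 d hd]
        exact (hoff d hd).symm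

open Classical in
/-- The entry of a division; `⟨T.flip S c, σ⟩` is the state with the undivided component. -/
theorem divide_entry (σ : T.Circle (T.flip S c) → Bool) (s' : T.State) :
    T.surgery R c (Finsupp.single ⟨T.flip S c, σ⟩ 1) s'
      = if T.Local T.sign SignMerge SignDivide c ⟨T.flip S c, σ⟩ s' then 1 else 0 := by
  classical
  have hb2 : T.bridge c ∈ T.rels (T.flip S c) := (T.bridge_mem_or S c).resolve_left hb
  set s : T.State := ⟨T.flip S c, σ⟩ with hs
  rw [surgery_single]
  simp only [factor, hs, if_pos hb2, T.flip_flip, lowerSum_bridge, LinearMap.add_apply,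
    Finsupp.add_apply]
  have hne := merge_ne hb
  have hm := merge_comp hb
  have hna : ∀ d ∈ T.minusReps σ, ¬ T.IsArc (T.comp S d) := by
    intro d hd ha
    have h2 := T.not_isArc_of_mem_minusReps hd
    by_cases ht : T.Touches S c d
    · rw [(merge_touches hb).2 ht, merge_isArc hb] at h2
      rcases ht with ht | ht <;> rw [ht] at ha
      · exact h2 (Or.inl ha)
      · exact h2 (Or.inr ha)
    · exact h2 ((merge_isArc_off hb ht).2 ha)
  have hnd : ((T.minusReps σ).map (T.comp S)).Nodup := by
    have h0 := T.map_comp_minusReps σ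
    refine Multiset.Nodup.map_on (fun d hd e he h => ?_) (Multiset.Nodup.of_map _ h0)
    exact Multiset.inj_on_of_nodup_map h0 d hd e he (merge_coarse hb h)
  rw [T.mon_eq_single hna hnd]
  set r : T.State := T.monState S (T.minusReps σ) with hr
  have hrs : ∀ d, ¬ T.IsArc (T.comp S d) → T.sign r d =
      some (decide (∀ e ∈ T.minusReps σ, T.comp S e ≠ T.comp S d)) :=
    fun d hd => T.monState_sign _ _ hd
  have hoff : ∀ d, ¬ T.Touches S c d → T.sign s d = T.sign r d := by
    intro d hd
    by_cases ha : T.IsArc (T.comp S d)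
    · rw [T.sign_arc (s := r) ha, T.sign_arc (s := s) ((merge_isArc_off hb hd).2 ha)]
    · have ha' : ¬ T.IsArc (T.comp (T.flip S c) d) := fun h => ha ((merge_isArc_off hb hd).1 h)
      rw [hrs d ha]
      cases hsd : T.sign s d with
      | none => rw [T.sign_circ (s := s) ha'] at hsd; cases hsd
      | some b =>
        congr 1
        cases b
        · obtain ⟨e, he, hed⟩ := T.sign_eq_minus_iff.1 hsd
          rw [eq_comm, decide_eq_false_iff_not]
          exact fun h => h e he (merge_fine_off hd hed.symm).symm
        · rw [eq_comm, decide_eq_true_iff]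
          intro e he hed
          have := T.sign_eq_minus_iff.2 ⟨e, he, merge_coarse hb hed⟩
          rw [← hs, hsd] at this
          cases this
  -- the signs of the two halves of the divided component
  have hpq : (T.sign s (T.dartAt c) = none ∧ T.sign r (T.dartAt c) = none ∧
        T.sign r (T.oppAt c) = some true) ∨
      (T.sign s (T.dartAt c) = none ∧ T.sign r (T.dartAt c) = some true ∧
        T.sign r (T.oppAt c) = none) ∨
      (T.sign s (T.dartAt c) = some true ∧ T.sign r (T.dartAt c) = some true ∧
        T.sign r (T.oppAt c) = some true) ∨
      (T.sign s (T.dartAt c) = some false ∧ T.sign r (T.dartAt c) = some false ∧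
        T.sign r (T.oppAt c) = some true) ∨
      (T.sign s (T.dartAt c) = some false ∧ T.sign r (T.dartAt c) = some true ∧
        T.sign r (T.oppAt c) = some false) := by
    have hplus : ∀ d, T.Touches S c d → ¬ T.IsArc (T.comp S d) →
        T.sign s (T.dartAt c) ≠ some false → T.sign r d = some true := by
      intro d hd ha hsd
      rw [hrs d ha]
      congr 1
      rw [decide_eq_true_iff]
      intro e he hed
      refine hsd (T.sign_eq_minus_iff.2 ⟨e, he, ?_⟩)
      rw [merge_coarse hb hed]
      exact (merge_touches hb).2 hd
    by_cases hC : T.IsArc (T.comp (T.flip S c) (T.dartAt c))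
    · have hsC : T.sign s (T.dartAt c) = none := T.sign_arc (s := s) hC
      by_cases hA : T.IsArc (T.comp S (T.dartAt c))
      · exact Or.inl ⟨hsC, T.sign_arc (s := r) hA,
          hplus _ (Or.inr rfl) (merge_not_arc hb hA) (by rw [hsC]; simp)⟩
      · exact Or.inr (Or.inl ⟨hsC, hplus _ (Or.inl rfl) hA (by rw [hsC]; simp),
          T.sign_arc (s := r) (((merge_isArc hb).1 hC).resolve_left hA)⟩)
    · have hA : ¬ T.IsArc (T.comp S (T.dartAt c)) := fun h => hC ((merge_isArc hb).2 (Or.inl h))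
      have hB : ¬ T.IsArc (T.comp S (T.oppAt c)) := fun h => hC ((merge_isArc hb).2 (Or.inr h))
      refine Or.inr (Or.inr ?_)
      cases hsd : T.sign s (T.dartAt c) with
      | none => rw [T.sign_circ (s := s) hC] at hsd; cases hsd
      | some b =>
        cases b
        · refine Or.inr ?_
          obtain ⟨e, he, hed⟩ := T.sign_eq_minus_iff.1 hsd
          have uniq : ∀ f ∈ T.minusReps σ, T.Touches S c f → f = e := by
            intro f hf hft
            refine Multiset.inj_on_of_nodup_map (T.map_comp_minusReps σ) f hf e he ?_
            rw [(merge_touches hb).2 hft]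
            exact hed.symm
          have hneg : ∀ d, T.comp S e = T.comp S d → T.sign r d = some false := by
            intro d hd
            rw [hrs d (hd ▸ hna e he)]
            congr 1
            rw [decide_eq_false_iff_not]
            exact fun h => h e he hd
          have hpos : ∀ d, T.Touches S c d → ¬ T.IsArc (T.comp S d) → T.comp S e ≠ T.comp S d →
              T.sign r d = some true := by
            intro d hd ha h2
            rw [hrs d ha]
            congr 1
            rw [decide_eq_true_iff]
            intro f hf hfd
            rw [uniq f hf ((T.touches_congr S c hfd).2 hd)] at hfd
            exact h2 hfd
          rcases (merge_touches hb).1 hed with h2 | h2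
          · exact Or.inl ⟨rfl, hneg _ h2, hpos _ (Or.inr rfl) hB (by rw [h2]; exact hne)⟩
          · exact Or.inr ⟨rfl, hpos _ (Or.inl rfl) hA (by rw [h2]; exact hne.symm), hneg _ h2⟩
        · exact Or.inl ⟨rfl, hplus _ (Or.inl rfl) hA (by rw [hsd]; simp),
            hplus _ (Or.inr rfl) hB (by rw [hsd]; simp)⟩
  -- the entry is the sum of two terms, in which one of the two halves of `r` changes its sign to `-`
  rw [T.lower_entry, T.lower_entry]
  have hloc : T.Local T.sign SignMerge SignDivide c s s' ↔
      s'.1 = S ∧ (∀ d, ¬ T.Touches S c d → T.sign s d = T.sign s' d) ∧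
        SignDivide (T.sign s (T.dartAt c)) (T.sign s' (T.dartAt c)) (T.sign s' (T.oppAt c)) := by
    have htouch : ∀ d, T.Touches (T.flip S c) c d ↔ T.Touches S c d := by
      intro d
      rw [← merge_touches hb, Touches, ← hm, or_self]
    unfold Local
    show (s'.1 = T.flip (T.flip S c) c ∧ _) ↔ _
    rw [T.flip_flip]
    refine and_congr_right fun h1 => and_congr ?_ ?_
    · exact forall_congr' fun d => by rw [← htouch d]
    · obtain ⟨S', σ'⟩ := s'
      have h1' : S' = S := h1
      subst h1'
      constructor
      · rintro (⟨h, -⟩ | ⟨-, -, h⟩)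
        · exact absurd hm h
        · exact h
      · exact fun h => Or.inr ⟨hm, hne, h⟩
  rw [if_congr hloc rfl rfl]
  obtain ⟨S', σ'⟩ := s'
  by_cases hS : S' = S
  swap
  · rw [if_neg (fun h => hS h.1), if_neg (fun h => hS h.1), if_neg (fun h => hS h.1), add_zero]
  subst hS
  set s' : T.State := ⟨S', σ'⟩ with hs'
  have hcomp : ∀ d, ¬ T.Touches S' c d → T.comp S' d ≠ T.comp S' (T.dartAt c) ∧
      T.comp S' d ≠ T.comp S' (T.oppAt c) := fun d hd => ⟨fun h => hd (Or.inl h),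
        fun h => hd (Or.inr h)⟩
  -- the entry of the term in which the half at `x` changes its sign; the other half is at `y`
  have hP : ∀ x y, T.comp S' x ≠ T.comp S' y → (∀ d, T.Touches S' c d ↔
      T.comp S' d = T.comp S' x ∨ T.comp S' d = T.comp S' y) →
      ((s'.1 = r.1 ∧ T.sign r x = some true ∧ T.sign s' x = some false ∧
        ∀ e, T.comp r.1 e ≠ T.comp r.1 x → T.sign s' e = T.sign r e) ↔
      (∀ d, ¬ T.Touches S' c d → T.sign s d = T.sign s' d) ∧ T.sign r x = some true ∧
        T.sign s' x = some false ∧ T.sign s' y = T.sign r y) := by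
    intro x y hxy ht
    constructor
    · rintro ⟨-, h2, h3, h4⟩
      refine ⟨fun d hd => ?_, h2, h3, h4 y (Ne.symm hxy)⟩
      rw [hoff d hd]
      rw [ht] at hd
      exact (h4 d (fun h => hd (Or.inl h))).symm
    · rintro ⟨h1, h2, h3, h4⟩
      refine ⟨rfl, h2, h3, fun e he => ?_⟩
      by_cases hd : T.Touches S' c e
      · have he' := ((ht e).1 hd).resolve_left he
        rw [T.sign_congr s' (d := e) (e := y) he', T.sign_congr r (d := e) (e := y) he', h4]
      · rw [← h1 e hd, hoff e hd]
  have e1 := hP (T.dartAt c) (T.oppAt c) hne (fun d => Iff.rfl)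
  have e2 := hP (T.oppAt c) (T.dartAt c) hne.symm (fun d => or_comm)
  rw [if_congr e1 rfl rfl, if_congr e2 rfl rfl]
  have e3 : (s'.1 = S') := rfl
  by_cases ho : ∀ d, ¬ T.Touches S' c d → T.sign s d = T.sign s' d
  swap
  · rw [if_neg (fun h => ho h.1), if_neg (fun h => ho h.1), if_neg (fun h => ho h.2.1), add_zero]
  have h0 : ∀ P : Prop, ((∀ d, ¬ T.Touches S' c d → T.sign s d = T.sign s' d) ∧ P) ↔ P :=
    fun P => and_iff_right ho
  have h1 : ∀ P : Prop, (s'.1 = S' ∧ P) ↔ P := fun P => and_iff_right rfl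
  simp only [h0, h1]
  have hn : ∀ d, T.sign s' d = none ↔ T.sign r d = none := by
    intro d
    by_cases ha : T.IsArc (T.comp S' d)
    · rw [T.sign_arc (s := s') ha, T.sign_arc (s := r) ha]
    · rw [T.sign_circ (s := s') ha, T.sign_circ (s := r) ha]
      simp
  have hn1 := hn (T.dartAt c)
  have hn2 := hn (T.oppAt c)
  -- what remains is a statement about five values of the signs
  generalize T.sign s' (T.dartAt c) = y at *
  generalize T.sign s' (T.oppAt c) = z at *
  have hdec : ∀ x y z, SignDivide x y z ↔ (x = none ∧ y = none ∧ z = some false) ∨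
      (x = none ∧ y = some false ∧ z = none) ∨ (x = some true ∧ y = some true ∧ z = some false) ∨
      (x = some true ∧ y = some false ∧ z = some true) ∨
      (x = some false ∧ y = some false ∧ z = some false) := by
    intro x y z
    constructor
    · rintro (_ | _ | _ | _ | _) <;> simp
    · rintro (⟨rfl, rfl, rfl⟩ | ⟨rfl, rfl, rfl⟩ | ⟨rfl, rfl, rfl⟩ | ⟨rfl, rfl, rfl⟩ |
        ⟨rfl, rfl, rfl⟩)
      exacts [.aam, .ama, .ppm, .pmp, .mmm]
  rw [hdec]
  rcases hpq with ⟨a1, a2, a3⟩ | ⟨a1, a2, a3⟩ | ⟨a1, a2, a3⟩ | ⟨a1, a2, a3⟩ | ⟨a1, a2, a3⟩ <;>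
    rw [a1, a2, a3] <;> rw [a2] at hn1 <;> rw [a3] at hn2 <;>
    rcases y with _ | _ | _ <;> rcases z with _ | _ | _ <;> simp at hn1 hn2 ⊢

end MergeEntries

/-- The entries of a surgery. -/
theorem surgery_entry (c : T.Crossing) (s s' : T.State) :
    T.surgery R c (Finsupp.single s 1) s'
      = open Classical in if T.Local T.sign SignMerge SignDivide c s s' then 1 else 0 := by
  classical
  obtain ⟨S, σ⟩ := s
  by_cases hb : T.bridge c ∈ T.rels S
  swap
  · exact merge_entry hb σ s'
  by_cases hb' : T.bridge c ∈ T.rels (T.flip S c)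
  swap
  · have h2 : T.flip (T.flip S c) c = S := T.flip_flip S c
    generalize T.flip S c = S' at hb' h2
    subst h2
    exact divide_entry hb' σ s'
  rw [surgery_single]
  simp only [factor, if_pos hb]
  rw [T.lowerSum_mon hb', Finsupp.zero_apply, if_neg]
  obtain ⟨S', σ'⟩ := s'
  rintro ⟨h1, -, h3⟩
  have h1' : S' = T.flip S c := h1
  subst h1'
  rw [bridge_mem_iff] at hb hb'
  rcases h3 with ⟨h3, h4, h5⟩ | ⟨h3, h4, h5⟩
  · obtain ⟨ha, ha'⟩ := hb.resolve_left h3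
    rw [T.sign_arc (s := ⟨S, σ⟩) ha, T.sign_arc (s := ⟨S, σ⟩) ha'] at h5
    exact SignMerge.not_arcs h5
  · obtain ⟨ha, ha'⟩ := hb'.resolve_left h4
    rw [T.sign_arc (s := ⟨T.flip S c, σ'⟩) ha, T.sign_arc (s := ⟨T.flip S c, σ'⟩) ha'] at h5
    exact SignDivide.not_arcs h5

end Entries

end TangleDiagram

/-! ### The filtration by the noncontractible circles -/

namespace Decor

/-- The sign of a decorated component; `none` for an arc. -/
def toSign : Decor → Option Bool
  | arc => none
  | triv b => some b
  | ess b => some b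

/-- The contribution of a component to the number of `+` minus the number of `-` on noncontractible
circles. -/
def weight : Decor → ℤ
  | ess true => 1
  | ess false => -1
  | _ => 0

/-- The contribution of a component to the number of `+` minus the number of `-`. -/
def charge : Decor → ℤ
  | arc => 0
  | triv b => if b then 1 else -1
  | ess b => if b then 1 else -1

/-- A contractible circle. -/
def IsTriv : Decor → Prop
  | triv _ => True
  | _ => False

end Decor

/-- The decorations are those of three circles which cobound a pair of pants. -/
def Pants (A B C : Decor) : Prop :=
  A ≠ .arc → B ≠ .arc → (A.IsTriv → B.IsTriv → C.IsTriv) ∧ (A.IsTriv → C.IsTriv → B.IsTriv) ∧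
    (B.IsTriv → C.IsTriv → A.IsTriv)

theorem merge_iff (A B C : Decor) : Merge A B C ↔
    (∃ x y z, A = .triv x ∧ B = .triv y ∧ C = .triv z ∧ (x || y) = true ∧ z = (x && y)) ∨
    (∃ ε, A = .triv true ∧ B = .ess ε ∧ C = .ess ε) ∨
    (∃ ε, A = .ess ε ∧ B = .triv true ∧ C = .ess ε) ∨
    (∃ ε, A = .ess ε ∧ B = .ess (!ε) ∧ C = .triv false) ∨
    (A = .triv true ∧ B = .arc ∧ C = .arc) ∨ (A = .arc ∧ B = .triv true ∧ C = .arc) := by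
  constructor
  · rintro (_ | _ | _ | _ | _ | _ | _ | _) <;> simp
  · rintro (⟨x, y, z, rfl, rfl, rfl, h, rfl⟩ | ⟨ε, rfl, rfl, rfl⟩ | ⟨ε, rfl, rfl, rfl⟩ |
      ⟨ε, rfl, rfl, rfl⟩ | ⟨rfl, rfl, rfl⟩ | ⟨rfl, rfl, rfl⟩)
    · cases x <;> cases y
      exacts [absurd h (by simp), .mp, .pm, .pp]
    exacts [.pe ε, .ep ε, .ee ε, .pa, .ap]

theorem divide_iff (A B C : Decor) : Divide A B C ↔
    (∃ x y z, A = .triv x ∧ B = .triv y ∧ C = .triv z ∧ (y && z) = false ∧ x = (y || z)) ∨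
    (∃ ε, A = .ess ε ∧ B = .ess ε ∧ C = .triv false) ∨
    (∃ ε, A = .ess ε ∧ B = .triv false ∧ C = .ess ε) ∨
    (∃ ε, A = .triv true ∧ B = .ess ε ∧ C = .ess (!ε)) ∨
    (A = .arc ∧ B = .arc ∧ C = .triv false) ∨ (A = .arc ∧ B = .triv false ∧ C = .arc) := by
  constructor
  · rintro (_ | _ | _ | _ | _ | _ | _ | _) <;> simp
  · rintro (⟨x, y, z, rfl, rfl, rfl, h, rfl⟩ | ⟨ε, rfl, rfl, rfl⟩ | ⟨ε, rfl, rfl, rfl⟩ |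
      ⟨ε, rfl, rfl, rfl⟩ | ⟨rfl, rfl, rfl⟩ | ⟨rfl, rfl, rfl⟩)
    · cases y <;> cases z
      exacts [.mmm, .pmp, .ppm, absurd h (by simp)]
    exacts [.eem ε, .eme ε, .pee ε, .aam, .ama]

theorem signMerge_iff (x y z : Option Bool) : SignMerge x y z ↔
    (∃ a b, x = some a ∧ y = some b ∧ (a || b) = true ∧ z = some (a && b)) ∨
    (x = some true ∧ y = none ∧ z = none) ∨ (x = none ∧ y = some true ∧ z = none) := by
  constructor
  · rintro (_ | _ | _ | _ | _) <;> simp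
  · rintro (⟨x, y, rfl, rfl, h, rfl⟩ | ⟨rfl, rfl, rfl⟩ | ⟨rfl, rfl, rfl⟩)
    · cases x <;> cases y
      exacts [absurd h (by simp), .mp, .pm, .pp]
    exacts [.pa, .ap]

theorem signDivide_iff (x y z : Option Bool) : SignDivide x y z ↔
    (∃ a b, y = some a ∧ z = some b ∧ (a && b) = false ∧ x = some (a || b)) ∨
    (x = none ∧ y = none ∧ z = some false) ∨ (x = none ∧ y = some false ∧ z = none) := by
  constructor
  · rintro (_ | _ | _ | _ | _) <;> simp
  · rintro (⟨x, y, rfl, rfl, h, rfl⟩ | ⟨rfl, rfl, rfl⟩ | ⟨rfl, rfl, rfl⟩)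
    · cases x <;> cases y
      exacts [.mmm, .pmp, .ppm, absurd h (by simp)]
    exacts [.aam, .ama]

theorem Merge.toSign {A B C : Decor} (h : Merge A B C) :
    SignMerge A.toSign B.toSign C.toSign := by
  cases h with
  | pe ε => cases ε <;> constructor
  | ep ε => cases ε <;> constructor
  | ee ε => cases ε <;> constructor
  | _ => constructor

theorem Divide.toSign {A B C : Decor} (h : Divide A B C) :
    SignDivide A.toSign B.toSign C.toSign := by
  cases h with
  | pee ε => cases ε <;> constructor
  | eem ε => cases ε <;> constructor
  | eme ε => cases ε <;> constructor
  | _ => constructor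

/-- An entry of the multiplication on a pair of pants does not increase the weight, and preserves it
if and only if it is an entry of the skein algebra. -/
theorem SignMerge.weight {A B C : Decor} (h : SignMerge A.toSign B.toSign C.toSign)
    (hp : Pants A B C) :
    C.weight ≤ A.weight + B.weight ∧ C.charge = A.charge + B.charge - 1 ∧
      (C.weight = A.weight + B.weight ↔ Merge A B C) := by
  rw [signMerge_iff] at h
  rw [merge_iff]
  rcases A with _ | (_ | _) | (_ | _) <;> rcases B with _ | (_ | _) | (_ | _) <;>
    rcases C with _ | (_ | _) | (_ | _) <;>
    simp [Decor.toSign, Decor.weight, Decor.charge, Pants, Decor.IsTriv] at h hp ⊢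

/-- The analogue of `SignMerge.weight` for the comultiplication. -/
theorem SignDivide.weight {A B C : Decor} (h : SignDivide A.toSign B.toSign C.toSign)
    (hp : Pants B C A) :
    B.weight + C.weight ≤ A.weight ∧ B.charge + C.charge = A.charge - 1 ∧
      (B.weight + C.weight = A.weight ↔ Divide A B C) := by
  rw [signDivide_iff] at h
  rw [divide_iff]
  rcases A with _ | (_ | _) | (_ | _) <;> rcases B with _ | (_ | _) | (_ | _) <;>
    rcases C with _ | (_ | _) | (_ | _) <;>
    simp [Decor.toSign, Decor.weight, Decor.charge, Pants, Decor.IsTriv] at h hp ⊢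

theorem Merge.symm {A B C : Decor} (h : Merge A B C) : Merge B A C := by
  cases h with
  | ee ε =>
    have := Merge.ee (!ε)
    rwa [Bool.not_not] at this
  | _ => constructor

theorem Divide.symm {A B C : Decor} (h : Divide A B C) : Divide A C B := by
  cases h with
  | pee ε =>
    have := Divide.pee (!ε)
    rwa [Bool.not_not] at this
  | _ => constructor

theorem Decor.ext_sign {A B : Decor} (h : A.toSign = B.toSign) (h' : A.IsTriv ↔ B.IsTriv) :
    A = B := by
  rcases A with _ | a | a <;> rcases B with _ | b | b <;>
    simp [Decor.toSign, Decor.IsTriv] at h h' ⊢ <;> exact h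

namespace TangleDiagram

variable {D : Type*} {M : CellSurface D} (T : TangleDiagram M)

/-- The decoration of the component of a dart. -/
def dec (s : T.State) (d : T.strand) : Decor := T.decor s (T.comp s.1 d)

theorem toSign_dec (s : T.State) (d : T.strand) : (T.dec s d).toSign = T.sign s d := by
  unfold dec decor
  split_ifs with h1 h2
  · exact (T.sign_arc h1).symm
  · exact (T.sign_circ h1).symm
  · exact (T.sign_circ h1).symm

theorem dec_eq_arc_iff {s : T.State} {d : T.strand} :
    T.dec s d = .arc ↔ T.IsArc (T.comp s.1 d) := by
  unfold dec decor
  split_ifs with h1 h2 <;> simp [h1]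

theorem isTriv_dec_iff {s : T.State} {d : T.strand} (h : ¬ T.IsArc (T.comp s.1 d)) :
    (T.dec s d).IsTriv ↔ T.Contractible (T.comp s.1 d) := by
  unfold dec decor
  rw [dif_neg h]
  split_ifs with h2 <;> simp [h2, Decor.IsTriv]

end TangleDiagram

/-! ### Regions of a cell surface -/

theorem ncard_image_pairs {α β : Type*} [Finite α] {Γ : Set α} {f : α → β} {m : α → α}
    (hm : ∀ x ∈ Γ, m x ∈ Γ) (hne : ∀ x ∈ Γ, m x ≠ x)
    (hf : ∀ x ∈ Γ, ∀ y ∈ Γ, f y = f x ↔ y = x ∨ y = m x) :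
    2 * (f '' Γ).ncard = Γ.ncard := by
  classical
  have := Fintype.ofFinite α
  have h1 : (f '' Γ).ncard = (Γ.toFinset.image f).card := by
    rw [← Set.ncard_coe_finset, Finset.coe_image, Set.coe_toFinset]
  rw [Set.ncard_eq_toFinset_card' Γ, h1, Finset.card_eq_sum_card_image f Γ.toFinset,
    Finset.sum_congr rfl (g := fun _ => 2), Finset.sum_const, smul_eq_mul, mul_comm]
  intro b hb
  obtain ⟨x, hx, rfl⟩ := Finset.mem_image.1 hb
  rw [Set.mem_toFinset] at hx
  rw [Finset.card_eq_two]
  refine ⟨x, m x, (hne x hx).symm, ?_⟩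
  ext y
  rw [Finset.mem_filter, Set.mem_toFinset, Finset.mem_insert, Finset.mem_singleton]
  constructor
  · rintro ⟨hy, h⟩
    exact (hf x hx y hy).1 h
  · rintro (rfl | rfl)
    · exact ⟨hx, rfl⟩
    · exact ⟨hm x hx, (hf x hx _ (hm x hx)).2 (Or.inr rfl)⟩

theorem ncard_classes_union {α : Type*} [Finite α] {o : α → Set α} (ho : ∀ x, x ∈ o x)
    {P Q : Set α} (h : Disjoint P Q) :
    {v | (∃ d, v = o d) ∧ v ⊆ P ∪ Q}.ncard
      = {v | (∃ d, v = o d) ∧ v ⊆ P}.ncard + {v | (∃ d, v = o d) ∧ v ⊆ Q}.ncard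
        + {v | (∃ d, v = o d) ∧ v ⊆ P ∪ Q ∧ ¬ v ⊆ P ∧ ¬ v ⊆ Q}.ncard := by
  rw [← Set.ncard_union_eq ?_ (Set.toFinite _) (Set.toFinite _),
    ← Set.ncard_union_eq ?_ (Set.toFinite _) (Set.toFinite _)]
  · congr 1
    ext v
    simp only [Set.mem_ofPred_eq, Set.mem_union]
    constructor
    · rintro ⟨h1, h2⟩
      by_cases h3 : v ⊆ P
      · exact Or.inl (Or.inl ⟨h1, h3⟩)
      · by_cases h4 : v ⊆ Q
        · exact Or.inl (Or.inr ⟨h1, h4⟩)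
        · exact Or.inr ⟨h1, h2, h3, h4⟩
    · rintro ((⟨h1, h2⟩ | ⟨h1, h2⟩) | ⟨h1, h2, -⟩)
      · exact ⟨h1, h2.trans Set.subset_union_left⟩
      · exact ⟨h1, h2.trans Set.subset_union_right⟩
      · exact ⟨h1, h2⟩
  · rw [Set.disjoint_left]
    rintro v (⟨-, h1⟩ | ⟨-, h1⟩) ⟨-, -, h3, h4⟩
    · exact h3 h1
    · exact h4 h1
  · rw [Set.disjoint_left]
    rintro _ ⟨⟨d, rfl⟩, h1⟩ ⟨-, h2⟩
    exact Set.disjoint_left.1 h (h1 (ho d)) (h2 (ho d))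

namespace CellSurface

variable {D : Type*} (M : CellSurface D)

/-- A union of 2-cells. -/
def FaceClosed (A : Set D) : Prop := ∀ d, M.face d ∈ A ↔ d ∈ A

/-- The darts on the edges with one side in `A`. -/
def frontier (A : Set D) : Set D := {d | ¬ (d ∈ A ↔ M.rev d ∈ A)}

/-- Adjacency of darts inside a region: they bound the same 2-cell or have the same edge. -/
def Linked (A : Set D) : D → D → Prop :=
  Relation.EqvGen (fun x y => x ∈ A ∧ y ∈ A ∧ (y = M.face x ∨ y = M.rev x))

/-- A region closed under all adjacencies whose darts are all linked: a component of the closed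
surface. -/
structure IsComponent (Z : Set D) : Prop where
  faceClosed : M.FaceClosed Z
  rev_mem : ∀ d ∈ Z, M.rev d ∈ Z
  linked : ∀ d ∈ Z, ∀ e ∈ Z, M.Linked Z d e

/-- The set `Γ` of darts is an embedded circle; `m` exchanges the two darts at each of its vertices. -/
structure Circuit (Γ : Set D) (m : D → D) : Prop where
  rev_mem : ∀ d ∈ Γ, M.rev d ∈ Γ
  m_mem : ∀ d ∈ Γ, m d ∈ Γ
  m_ne : ∀ d ∈ Γ, m d ≠ d
  same : ∀ d ∈ Γ, M.SameVertex d (m d)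
  only : ∀ d ∈ Γ, ∀ e ∈ Γ, M.SameVertex d e → e = d ∨ e = m d
  conn : ∀ P : D → Prop, (∀ d ∈ Γ, P d → P (M.rev d)) → (∀ d ∈ Γ, P d → P (m d)) →
    ∀ d ∈ Γ, P d → ∀ e ∈ Γ, P e

variable {M}

theorem face_rev (d : D) : M.face (M.rev d) = M.rot.symm d := by
  show M.rot.symm (M.rev (M.rev d)) = _
  rw [M.rev_rev]

theorem face_rev_rot (d : D) : M.face (M.rev (M.rot d)) = d := by
  rw [face_rev, Equiv.symm_apply_apply]

namespace FaceClosed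

variable {A B : Set D}

theorem rev_rot_mem (h : M.FaceClosed A) (d : D) : M.rev (M.rot d) ∈ A ↔ d ∈ A := by
  rw [← h, face_rev_rot]

theorem rev_mem_iff (h : M.FaceClosed A) (d : D) : M.rev d ∈ A ↔ M.rot.symm d ∈ A := by
  rw [← h, face_rev]

theorem rot_mem (h : M.FaceClosed A) {d : D} (hd : M.rot d ∉ M.frontier A) :
    M.rot d ∈ A ↔ d ∈ A := by
  rw [frontier, Set.mem_ofPred_eq, not_not] at hd
  rw [hd, h.rev_rot_mem]

theorem union (h : M.FaceClosed A) (h' : M.FaceClosed B) : M.FaceClosed (A ∪ B) :=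
  fun d => or_congr (h d) (h' d)

theorem diff (h : M.FaceClosed A) (h' : M.FaceClosed B) : M.FaceClosed (A \ B) :=
  fun d => and_congr (h d) (not_congr (h' d))

theorem faceOf_subset (h : M.FaceClosed A) {d : D} (hd : d ∈ A) : M.faceOf d ⊆ A := by
  rintro e ⟨n, rfl⟩
  induction n with
  | zero => exact hd
  | succ n ih => rwa [add_comm, zpow_add, zpow_one, Equiv.Perm.mul_apply, h]
  | pred n ih =>
    rw [sub_eq_add_neg, add_comm, zpow_add, zpow_neg_one, Equiv.Perm.mul_apply, ← h]
    rwa [show M.face (M.face⁻¹ _) = _ from M.face.apply_symm_apply _]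

end FaceClosed

theorem Linked.mem_iff {A : Set D} {P : Set D}
    (hP : ∀ x ∈ A, (M.face x ∈ P ↔ x ∈ P) ∧ (M.rev x ∈ A → (M.rev x ∈ P ↔ x ∈ P)))
    {d e : D} (h : M.Linked A d e) : d ∈ P ↔ e ∈ P := by
  induction h with
  | rel x y hxy =>
    obtain ⟨hx, hy, rfl | rfl⟩ := hxy
    · exact (hP x hx).1.symm
    · exact ((hP x hx).2 hy).symm
  | refl x => exact Iff.rfl
  | symm x y _ ih => exact ih.symm
  | trans x y z _ _ ih1 ih2 => exact ih1.trans ih2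

theorem Linked.mem {A : Set D} {d e : D} (h : M.Linked A d e) : d = e ∨ d ∈ A ∧ e ∈ A := by
  induction h with
  | rel x y hxy => exact Or.inr ⟨hxy.1, hxy.2.1⟩
  | refl x => exact Or.inl rfl
  | symm x y _ ih => exact ih.imp Eq.symm And.symm
  | trans x y z _ _ ih1 ih2 =>
    rcases ih1 with rfl | ih1
    · exact ih2
    · rcases ih2 with rfl | ih2
      · exact Or.inr ih1
      · exact Or.inr ⟨ih1.1, ih2.2⟩

section Sides

variable [Finite D] {A : Set D} (hA : M.FaceClosed A)

include hA

/-- If the frontier of `A` meets the vertex only in the two darts `rev d` and `e`, then `d` and `e` are on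
the same side. -/
theorem side_iff {d e : D} (hde : M.SameVertex e (M.rev d)) (hne : e ≠ M.rev d)
    (hf : ∀ x ∈ M.frontier A, M.SameVertex e x → x = e ∨ x = M.rev d) : d ∈ A ↔ e ∈ A := by
  classical
  have hex : ∃ n, (M.rot ^ n) e = M.rev d := by
    obtain ⟨n, -, hn⟩ := hde.exists_pow_eq'
    exact ⟨n, hn⟩
  set n := Nat.find hex with hn
  have h1 : (M.rot ^ n) e = M.rev d := Nat.find_spec hex
  have hmin : ∀ j < n, (M.rot ^ j) e ≠ M.rev d := fun j hj => Nat.find_min hex hj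
  have key : ∀ j, j < n → ((M.rot ^ j) e ∈ A ↔ e ∈ A) := by
    intro j
    induction j with
    | zero => intro _; rfl
    | succ j ih =>
      intro hj
      rw [← ih (by omega), pow_succ', Equiv.Perm.mul_apply]
      refine hA.rot_mem fun hfr => ?_
      rw [← Equiv.Perm.mul_apply, ← pow_succ'] at hfr
      rcases hf _ hfr ⟨(j + 1 : ℕ), by rw [zpow_natCast]⟩ with h | h
      · refine hmin (n - (j + 1)) (by omega) ?_
        rw [← h1]
        conv_rhs => rw [show n = (n - (j + 1)) + (j + 1) by omega, pow_add, Equiv.Perm.mul_apply, h]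
      · exact hmin _ hj h
  obtain ⟨k, hk⟩ : ∃ k, n = k + 1 := by
    refine Nat.exists_eq_succ_of_ne_zero fun h0 => hne ?_
    rw [h0] at h1
    exact h1
  rw [← key k (by omega), ← hA d]
  have : M.face d = (M.rot ^ k) e := by
    show M.rot.symm (M.rev d) = _
    rw [Equiv.symm_apply_eq, ← h1, hk, pow_succ', Equiv.Perm.mul_apply]
  rw [this]

omit [Finite D] in
theorem vertex_iff {d e : D} (hde : M.SameVertex d e)
    (hf : ∀ x ∈ M.frontier A, ¬ M.SameVertex d x) : d ∈ A ↔ e ∈ A := by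
  have step : ∀ x, M.SameVertex d x → (M.rot x ∈ A ↔ x ∈ A) := fun x hx =>
    hA.rot_mem fun h => hf _ h (hx.trans (M.sameVertex_rot x))
  obtain ⟨n, rfl⟩ := hde
  induction n with
  | zero => rfl
  | succ n ih =>
    refine ih.trans ?_
    rw [add_comm, zpow_add, zpow_one, Equiv.Perm.mul_apply, step]
    exact ⟨n, rfl⟩
  | pred n ih =>
    refine ih.trans ?_
    rw [← step ((M.rot ^ (-(n : ℤ) - 1)) d) ⟨_, rfl⟩, ← Equiv.Perm.mul_apply]
    conv_rhs => rw [show M.rot * M.rot ^ (-(n : ℤ) - 1) = M.rot ^ (-(n : ℤ)) by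
      rw [← zpow_one_add]; congr 1; ring]

end Sides

namespace IsComponent

variable {Z : Set D}

theorem rev_mem_iff (hZ : M.IsComponent Z) (d : D) : M.rev d ∈ Z ↔ d ∈ Z :=
  ⟨fun h => by rw [← M.rev_rev d]; exact hZ.rev_mem _ h, hZ.rev_mem d⟩

theorem frontier_eq (hZ : M.IsComponent Z) : M.frontier Z = ∅ := by
  ext d
  simp [frontier, hZ.rev_mem_iff]

theorem frontier_diff (hZ : M.IsComponent Z) {U : Set D} (hU : U ⊆ Z) :
    M.frontier (Z \ U) = M.frontier U := by
  ext d
  have h1 := hZ.rev_mem_iff d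
  have h2 := @hU d
  have h3 := @hU (M.rev d)
  simp only [frontier, Set.mem_ofPred_eq, Set.mem_sdiff]
  tauto

theorem sameVertex (hZ : M.IsComponent Z) {d e : D} (h : M.SameVertex d e) : d ∈ Z ↔ e ∈ Z :=
  vertex_iff hZ.faceClosed h (by simp [hZ.frontier_eq])

theorem subset_of_linked (hZ : M.IsComponent Z) {A : Set D}
    (hc : ∀ d ∈ A, ∀ e ∈ A, M.Linked A d e) {d : D} (hd : d ∈ A) (hdZ : d ∈ Z) : A ⊆ Z := by
  intro e he
  exact (Linked.mem_iff (fun x _ => ⟨hZ.faceClosed x, fun _ => hZ.rev_mem_iff x⟩)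
    (hc d hd e he)).1 hdZ

end IsComponent

section Connected

variable [Finite D] {Z U Γ : Set D} {m : D → D}

/-- A region of a component of the surface whose frontier is a circle is connected. -/
theorem linked_of_circuit (hZ : M.IsComponent Z) (hΓ : M.Circuit Γ m) (hU : M.FaceClosed U)
    (hUZ : U ⊆ Z) (hf : M.frontier U = Γ) (hne : Γ.Nonempty) :
    ∀ d ∈ U, ∀ e ∈ U, M.Linked U d e := by
  obtain ⟨γ, hγ, hγU⟩ : ∃ γ ∈ Γ, γ ∈ U := by
    obtain ⟨γ, hγ⟩ := hne
    by_cases h : γ ∈ U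
    · exact ⟨γ, hγ, h⟩
    · refine ⟨M.rev γ, hΓ.rev_mem γ hγ, ?_⟩
      rw [← hf, frontier, Set.mem_ofPred_eq] at hγ
      tauto
  suffices h : ∀ d ∈ U, M.Linked U d γ from
    fun d hd e he => (h d hd).trans _ _ _ ((h e he).symm _ _)
  intro d hd
  -- the linked component of `d` is a region whose frontier is a part of the circle
  set V : Set D := {e | M.Linked U d e} with hV
  have hVU : V ⊆ U := by
    intro e he
    have he' : M.Linked U d e := he
    rcases he'.mem with h | h
    · exact h ▸ hd
    · exact h.2
  have hVstep : ∀ x ∈ V, ∀ y ∈ U, (y = M.face x ∨ y = M.rev x) → y ∈ V := fun x hx y hy h =>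
    Relation.EqvGen.trans _ _ _ hx (Relation.EqvGen.rel _ _ ⟨hVU hx, hy, h⟩)
  have hVc : M.FaceClosed V := by
    intro x
    constructor
    · intro hx
      have hxU : x ∈ U := (hU x).1 (hVU hx)
      exact Relation.EqvGen.trans _ _ _ hx (Relation.EqvGen.symm _ _
        (Relation.EqvGen.rel _ _ ⟨hxU, hVU hx, Or.inl rfl⟩))
    · intro hx
      exact hVstep x hx _ ((hU x).2 (hVU hx)) (Or.inl rfl)
  have hVf : M.frontier V ⊆ Γ := by
    intro x hx
    rw [← hf]
    rw [frontier, Set.mem_ofPred_eq] at hx ⊢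
    intro h
    apply hx
    constructor
    · intro hxV
      exact hVstep x hxV _ (h.1 (hVU hxV)) (Or.inr rfl)
    · intro hxV
      exact hVstep _ hxV _ (h.2 (hVU hxV)) (Or.inr (M.rev_rev x).symm)
  -- the property to touch `V` propagates along the circle
  have hprop : ∀ x ∈ Γ, (x ∈ V ∨ M.rev x ∈ V) → ∀ y ∈ Γ, (y ∈ V ∨ M.rev y ∈ V) := by
    have hside : ∀ x ∈ Γ, M.rev x ∈ V → m x ∈ V := by
      intro x hx h
      refine (side_iff hVc (d := M.rev x) (e := m x) ?_ ?_ ?_).1 h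
      · rw [M.rev_rev]
        exact (hΓ.same x hx).symm
      · rw [M.rev_rev]
        exact hΓ.m_ne x hx
      · intro y hy hxy
        rw [M.rev_rev]
        exact (hΓ.only x hx y (hVf hy) ((hΓ.same x hx).trans hxy)).symm
    have hside' : ∀ x ∈ Γ, x ∈ V → M.rev (m x) ∈ V := by
      intro x hx h
      refine (side_iff hVc (d := M.rev (m x)) (e := x) ?_ ?_ ?_).2 h
      · rw [M.rev_rev]
        exact hΓ.same x hx
      · rw [M.rev_rev]
        exact (hΓ.m_ne x hx).symm
      · intro y hy hxy
        rw [M.rev_rev]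
        exact hΓ.only x hx y (hVf hy) hxy
    refine hΓ.conn _ ?_ ?_
    · intro x _ h
      rw [M.rev_rev]
      exact h.symm
    · rintro x hx (h | h)
      · exact Or.inr (hside' x hx h)
      · exact Or.inl (hside x hx h)
  -- otherwise `V` would be the whole component of the surface
  have hVne : (M.frontier V).Nonempty := by
    rw [Set.nonempty_iff_ne_empty]
    intro h0
    have hγZ : γ ∈ V := by
      refine (Linked.mem_iff (P := V) (fun x _ => ⟨hVc x, fun _ => ?_⟩)
        (hZ.linked d (hUZ hd) γ (hUZ hγU))).1 (Relation.EqvGen.refl _)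
      by_contra hx
      have : x ∈ M.frontier V := fun h => hx h.symm
      rw [h0] at this
      exact this
    have h1 : M.rev γ ∈ V := by
      by_contra hx
      have : γ ∈ M.frontier V := fun h => hx (h.1 hγZ)
      rw [h0] at this
      exact this
    rw [← hf] at hγ
    exact hγ ⟨fun _ => hVU h1, fun _ => hγU⟩
  obtain ⟨x, hx⟩ := hVne
  have hx' : x ∈ V ∨ M.rev x ∈ V := by
    rw [frontier, Set.mem_ofPred_eq] at hx
    tauto
  rcases hprop x (hVf hx) hx' γ hγ with h | h
  · exact h
  · rw [← hf] at hγ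
    exact absurd ⟨fun _ => hVU h, fun _ => hγU⟩ hγ

end Connected

section Euler

variable [Finite D] {P Q Z U Γ : Set D} {m : D → D}

omit [Finite D] in
theorem mem_vertexOf_self (d : D) : d ∈ M.vertexOf d := M.sameVertex_rot d |>.trans
  (M.sameVertex_rot d).symm

omit [Finite D] in
theorem mem_edgeOf_self (d : D) : d ∈ M.edgeOf d := Or.inl rfl

omit [Finite D] in
theorem mem_faceOf_self (d : D) : d ∈ M.faceOf d := Equiv.Perm.SameCycle.refl _ _

omit [Finite D] in
theorem vertexOf_eq_iff {d e : D} : M.vertexOf e = M.vertexOf d ↔ M.SameVertex d e := by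
  constructor
  · intro h
    have := mem_vertexOf_self (M := M) e
    rw [h] at this
    exact this
  · intro h
    ext x
    exact ⟨fun hx => h.trans hx, fun hx => h.symm.trans hx⟩

omit [Finite D] in
theorem edgeOf_eq_iff {d e : D} : M.edgeOf e = M.edgeOf d ↔ e = d ∨ e = M.rev d := by
  constructor
  · intro h
    have := mem_edgeOf_self (M := M) e
    rw [h] at this
    exact this
  · rintro (rfl | rfl)
    · rfl
    · rw [edgeOf, edgeOf, M.rev_rev, Set.pair_comm]

theorem euler_union (hP : M.FaceClosed P) (hQ : M.FaceClosed Q) (h : Disjoint P Q) :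
    M.euler (P ∪ Q) = M.euler P + M.euler Q
      + ({v | (∃ d, v = M.vertexOf d) ∧ v ⊆ P ∪ Q ∧ ¬ v ⊆ P ∧ ¬ v ⊆ Q}.ncard : ℤ)
      - ({v | (∃ d, v = M.edgeOf d) ∧ v ⊆ P ∪ Q ∧ ¬ v ⊆ P ∧ ¬ v ⊆ Q}.ncard : ℤ) := by
  have hf : {v | (∃ d, v = M.faceOf d) ∧ v ⊆ P ∪ Q ∧ ¬ v ⊆ P ∧ ¬ v ⊆ Q} = ∅ := by
    rw [Set.eq_empty_iff_forall_notMem]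
    rintro _ ⟨⟨d, rfl⟩, h1, h2, h3⟩
    rcases h1 (mem_faceOf_self d) with h4 | h4
    · exact h2 (hP.faceOf_subset h4)
    · exact h3 (hQ.faceOf_subset h4)
  unfold euler
  rw [ncard_classes_union mem_vertexOf_self h, ncard_classes_union mem_edgeOf_self h,
    ncard_classes_union mem_faceOf_self h, hf, Set.ncard_empty]
  push_cast
  ring

/-- The Euler characteristics of the two sides of a circle add up. -/
theorem euler_add_diff (hZ : M.IsComponent Z) (hΓ : M.Circuit Γ m) (hU : M.FaceClosed U)
    (hUZ : U ⊆ Z) (hf : M.frontier U = Γ) :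
    M.euler U + M.euler (Z \ U) = M.euler Z := by
  have hu := euler_union hU (hZ.faceClosed.diff hU) Set.disjoint_sdiff_right
  rw [Set.union_sdiff_cancel hUZ] at hu
  have hΓZ : Γ ⊆ Z := by
    intro x hx
    rw [← hf, frontier, Set.mem_ofPred_eq] at hx
    by_contra hxZ
    have h1 : x ∉ U := fun h => hxZ (hUZ h)
    have h2 : M.rev x ∉ U := fun h => hxZ ((hZ.rev_mem_iff x).1 (hUZ h))
    tauto
  -- the vertices and the edges in neither of the two sides are those of the circle, which has as many vertices
  -- as edges
  have hv : {v | (∃ d, v = M.vertexOf d) ∧ v ⊆ Z ∧ ¬ v ⊆ U ∧ ¬ v ⊆ Z \ U}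
      = M.vertexOf '' Γ := by
    ext v
    constructor
    · rintro ⟨⟨d, rfl⟩, h1, h2, h3⟩
      by_contra hcon
      have hno : ∀ x ∈ M.frontier U, ¬ M.SameVertex d x := by
        intro x hx hdx
        rw [hf] at hx
        exact hcon ⟨x, hx, vertexOf_eq_iff.2 hdx⟩
      by_cases hd : d ∈ U
      · exact h2 fun e he => (vertex_iff hU he hno).1 hd
      · exact h3 fun e he => ⟨h1 he, fun he' => hd ((vertex_iff hU he hno).2 he')⟩
    · rintro ⟨x, hx, rfl⟩
      have hxU := hx
      rw [← hf, frontier, Set.mem_ofPred_eq, hU.rev_mem_iff] at hxU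
      have hs := M.sameVertex_rot_symm x
      refine ⟨⟨x, rfl⟩, fun e he => (hZ.sameVertex he).1 (hΓZ hx), fun h => ?_, fun h => ?_⟩
      · exact hxU ⟨fun _ => h hs, fun _ => h (mem_vertexOf_self x)⟩
      · exact hxU ⟨fun h' => absurd h' (h (mem_vertexOf_self x)).2,
          fun h' => absurd h' (h hs).2⟩
  have he : {v | (∃ d, v = M.edgeOf d) ∧ v ⊆ Z ∧ ¬ v ⊆ U ∧ ¬ v ⊆ Z \ U} = M.edgeOf '' Γ := by
    ext v
    constructor
    · rintro ⟨⟨d, rfl⟩, h1, h2, h3⟩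
      refine ⟨d, ?_, rfl⟩
      rw [← hf, frontier, Set.mem_ofPred_eq]
      intro h
      have hd : d ∈ Z := h1 (Or.inl rfl)
      by_cases hdU : d ∈ U
      · refine h2 ?_
        rintro x (rfl | rfl)
        exacts [hdU, h.1 hdU]
      · refine h3 ?_
        rintro x (rfl | rfl)
        exacts [⟨hd, hdU⟩, ⟨hZ.rev_mem _ hd, fun h' => hdU (h.2 h')⟩]
    · rintro ⟨x, hx, rfl⟩
      have hxU := hx
      rw [← hf, frontier, Set.mem_ofPred_eq] at hxU
      refine ⟨⟨x, rfl⟩, ?_, fun h => ?_, fun h => ?_⟩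
      · rintro y (rfl | rfl)
        exacts [hΓZ hx, hZ.rev_mem _ (hΓZ hx)]
      · exact hxU ⟨fun _ => h (Or.inr rfl), fun _ => h (Or.inl rfl)⟩
      · exact hxU ⟨fun h' => absurd h' (h (Or.inl rfl)).2,
          fun h' => absurd h' (h (Or.inr rfl)).2⟩
  have c1 := ncard_image_pairs (f := M.vertexOf) hΓ.m_mem hΓ.m_ne (fun x hx y hy => by
    rw [vertexOf_eq_iff]
    refine ⟨hΓ.only x hx y hy, ?_⟩
    rintro (rfl | rfl)
    · exact SameVertex.refl _ _
    · exact hΓ.same x hx)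
  have c2 := ncard_image_pairs (f := M.edgeOf) hΓ.rev_mem (fun x _ => M.rev_ne x)
    (fun x _ y _ => edgeOf_eq_iff)
  rw [hv, he] at hu
  rw [hu]
  omega

/-- The Euler characteristics of two regions without common edges add up. -/
theorem euler_disjoint_union (hP : M.FaceClosed P) (hQ : M.FaceClosed Q) (h : Disjoint P Q)
    (hf : Disjoint (M.frontier P) (M.frontier Q)) :
    M.euler (P ∪ Q) = M.euler P + M.euler Q := by
  have key : ∀ x, x ∈ P → M.rev x ∉ Q := by
    intro x hx hx'
    have h1 : x ∈ M.frontier P := fun h' : x ∈ P ↔ M.rev x ∈ P =>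
      Set.disjoint_left.1 h (h'.1 hx) hx'
    have h2 : x ∈ M.frontier Q := fun h' : x ∈ Q ↔ M.rev x ∈ Q =>
      Set.disjoint_left.1 h hx (h'.2 hx')
    exact Set.disjoint_left.1 hf h1 h2
  have hv : {v | (∃ d, v = M.vertexOf d) ∧ v ⊆ P ∪ Q ∧ ¬ v ⊆ P ∧ ¬ v ⊆ Q} = ∅ := by
    rw [Set.eq_empty_iff_forall_notMem]
    rintro _ ⟨⟨d, rfl⟩, h1, h2, h3⟩
    have hstep : ∀ x, M.SameVertex d x → (M.rot x ∈ P ↔ x ∈ P) := by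
      intro x hx
      have hx1 := h1 hx
      have hx2 := h1 (hx.trans (M.sameVertex_rot x))
      constructor
      · intro hP'
        refine hx1.resolve_right fun hxQ => key _ hP' ((hQ.rev_rot_mem x).2 hxQ)
      · intro hP'
        refine hx2.resolve_right fun hxQ => key _ ((hP.rev_rot_mem x).2 hP') ?_
        rwa [M.rev_rev]
    have hall : ∀ e, M.SameVertex d e → (e ∈ P ↔ d ∈ P) := by
      rintro e ⟨n, rfl⟩
      induction n with
      | zero => rfl
      | succ n ih =>
        rw [← ih, add_comm, zpow_add, zpow_one, Equiv.Perm.mul_apply, hstep]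
        exact ⟨n, rfl⟩
      | pred n ih =>
        rw [← ih, ← hstep ((M.rot ^ (-(n : ℤ) - 1)) d) ⟨_, rfl⟩, ← Equiv.Perm.mul_apply]
        conv_lhs => rw [show M.rot * M.rot ^ (-(n : ℤ) - 1) = M.rot ^ (-(n : ℤ)) by
          rw [← zpow_one_add]; congr 1; ring]
    by_cases hd : d ∈ P
    · exact h2 fun e he => (hall e he).2 hd
    · exact h3 fun e he => (h1 he).resolve_left fun h' => hd ((hall e he).1 h')
  have he : {v | (∃ d, v = M.edgeOf d) ∧ v ⊆ P ∪ Q ∧ ¬ v ⊆ P ∧ ¬ v ⊆ Q} = ∅ := by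
    rw [Set.eq_empty_iff_forall_notMem]
    rintro _ ⟨⟨d, rfl⟩, h1, h2, h3⟩
    have a1 := h1 (show d ∈ M.edgeOf d from Or.inl rfl)
    have a2 := h1 (show M.rev d ∈ M.edgeOf d from Or.inr rfl)
    rcases a1 with a1 | a1
    · refine h2 ?_
      rintro x (rfl | rfl)
      exacts [a1, a2.resolve_right (key _ a1)]
    · refine h3 ?_
      rintro x (rfl | rfl)
      exacts [a1, a2.resolve_left fun h' => key _ h' (by rwa [M.rev_rev])]
  rw [euler_union hP hQ h, hv, he]
  simp

end Euler

end CellSurface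

/-! ### Gluing polygons to a disc -/

/-- `w` is an edge path from `a` to `b`, where the dart `x` runs from `src x` to `src (rev x)`. -/
def IsWalk {α V : Type*} (rev : α → α) (src : α → V) : V → List α → V → Prop
  | a, [], b => a = b
  | a, x :: w, b => src x = a ∧ IsWalk rev src (src (rev x)) w b

namespace IsWalk

variable {α V : Type*} {rev : α → α} {src : α → V} {a b c : V} {u v w : List α} {x : α}

theorem nil_iff : IsWalk rev src a [] b ↔ a = b := Iff.rfl

theorem cons_iff : IsWalk rev src a (x :: w) b ↔ src x = a ∧ IsWalk rev src (src (rev x)) w b :=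
  Iff.rfl

theorem append_iff : IsWalk rev src a (u ++ v) b ↔
    ∃ c, IsWalk rev src a u c ∧ IsWalk rev src c v b := by
  induction u generalizing a with
  | nil => simp [nil_iff]
  | cons x u ih =>
    rw [List.cons_append, cons_iff, ih]
    simp only [cons_iff, and_assoc, exists_and_left]

theorem append (h : IsWalk rev src a u b) (h' : IsWalk rev src b v c) :
    IsWalk rev src a (u ++ v) c := append_iff.2 ⟨b, h, h'⟩

end IsWalk

section Polygons

variable {α V : Type*} (rev : α → α) (src : α → V)

/-- The darts with both sides in the region. -/
def innerDarts (A : Set α) : Set α := {x | x ∈ A ∧ rev x ∈ A}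

/-- The vertices of the region which do not lie on its frontier. -/
def innerVertices (A : Set α) : Set V :=
  {v | (∃ x ∈ A, src x = v) ∧ ∀ x ∈ A, rev x ∉ A → src x ≠ v ∧ src (rev x) ≠ v}

variable {rev src} (hrr : ∀ x, rev (rev x) = x) (hne : ∀ x, rev x ≠ x)

include hrr in
theorem innerDarts_diff {A : Set α} {y : α} :
    innerDarts rev (A \ {y, rev y}) = innerDarts rev A \ {y, rev y} := by
  have h1 : ∀ x, rev x = y ↔ x = rev y := fun x =>
    ⟨fun h => by rw [← h, hrr], fun h => by rw [h, hrr]⟩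
  have h2 : ∀ x, rev x = rev y ↔ x = y := fun x =>
    ⟨fun h => by rw [← hrr x, h, hrr], fun h => by rw [h]⟩
  ext x
  simp only [innerDarts, Set.mem_ofPred_eq, Set.mem_sdiff, Set.mem_insert_iff,
    Set.mem_singleton_iff, h1, h2]
  tauto

include hrr hne in
theorem ncard_innerDarts_diff [Finite α] {A : Set α} {y : α} (hy : y ∈ A) (hy' : rev y ∈ A) :
    (innerDarts rev (A \ {y, rev y})).ncard + 2 = (innerDarts rev A).ncard := by
  rw [innerDarts_diff hrr, ← Set.ncard_pair (hne y).symm]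
  refine Set.ncard_sdiff_add_ncard_of_subset ?_ (Set.toFinite _)
  rintro x (rfl | rfl)
  exacts [⟨hy, hy'⟩, ⟨hy', by rwa [hrr]⟩]

include hrr in
theorem front_diff {A : Set α} {y : α} (hy : y ∈ A) (hy' : rev y ∈ A) (x : α) :
    (x ∈ A \ {y, rev y} ∧ rev x ∉ A \ {y, rev y}) ↔ (x ∈ A ∧ rev x ∉ A) := by
  have h1 : rev x = y ↔ x = rev y :=
    ⟨fun h => by rw [← h, hrr], fun h => by rw [h, hrr]⟩
  have h2 : rev x = rev y ↔ x = y :=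
    ⟨fun h => by rw [← hrr x, h, hrr], fun h => by rw [h]⟩
  have h3 : x = y → rev x ∈ A := by rintro rfl; exact hy'
  have h4 : x = rev y → rev x ∈ A := by rintro rfl; rwa [hrr]
  simp only [Set.mem_sdiff, Set.mem_insert_iff, Set.mem_singleton_iff, h1, h2]
  tauto

include hrr in
/-- Removal of an inner edge removes at most the inner vertices at its two ends. -/
theorem innerVertices_diff {A : Set α} {y : α} (hy : y ∈ A) (hy' : rev y ∈ A) {v : V}
    (hv : v ∈ innerVertices rev src A) (h : ∃ x ∈ A \ {y, rev y}, src x = v) :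
    v ∈ innerVertices rev src (A \ {y, rev y}) := by
  refine ⟨h, fun x hx hx' => ?_⟩
  have := (front_diff hrr hy hy' x).1 ⟨hx, hx'⟩
  exact hv.2 x this.1 this.2

theorem finite_innerVertices [Finite α] (A : Set α) : (innerVertices rev src A).Finite :=
  (Set.toFinite (src '' A)).subset fun _ ⟨⟨x, hx, h⟩, _⟩ => ⟨x, hx, h⟩

include hrr in
/-- The union of polygons stays connected when the polygons `w₁` and `w₂` are glued to `g` along the
edge of `y`. -/
theorem glue_connected {L N : List (List α)} {w₁ w₂ g : List α} {y : α} (hL : ∀ w ∈ L, w = w₁ ∨ w = w₂ ∨ w ∈ N)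
    (hw₁ : ∀ u ∈ w₁, u = y ∨ u = rev y ∨ u ∈ g) (hw₂ : ∀ u ∈ w₂, u = y ∨ u = rev y ∨ u ∈ g)
    (hmem : ∀ z, z ∈ L.flatten ↔ z = y ∨ z = rev y ∨ z ∈ (g :: N).flatten)
    (hyn : y ∉ (g :: N).flatten) (hryn : rev y ∉ (g :: N).flatten)
    (hcon : ∀ Q : α → Prop, (∀ w ∈ L, ∀ x ∈ w, ∀ y ∈ w, Q x → Q y) →
        (∀ x ∈ L.flatten, rev x ∈ L.flatten → Q x → Q (rev x)) →
        ∀ x ∈ L.flatten, Q x → ∀ y ∈ L.flatten, Q y) :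
    ∀ Q : α → Prop, (∀ w ∈ g :: N, ∀ x ∈ w, ∀ y ∈ w, Q x → Q y) →
        (∀ x ∈ (g :: N).flatten, rev x ∈ (g :: N).flatten → Q x → Q (rev x)) →
        ∀ x ∈ (g :: N).flatten, Q x → ∀ y ∈ (g :: N).flatten, Q y := by
  classical
  intro Q h1 h2 x hx hQx t ht
  have hstep : ∀ w ∈ N, ∀ u ∈ w, u ≠ y ∧ u ≠ rev y := by
    intro w hw u hu
    have : u ∈ (g :: N).flatten := List.mem_flatten.2 ⟨w, List.mem_cons_of_mem _ hw, hu⟩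
    exact ⟨fun h => hyn (h ▸ this), fun h => hryn (h ▸ this)⟩
  have hg' : ∀ u ∈ g, u ≠ y ∧ u ≠ rev y := by
    intro u hu
    have : u ∈ (g :: N).flatten := List.mem_flatten.2 ⟨g, List.mem_cons_self, hu⟩
    exact ⟨fun h => hyn (h ▸ this), fun h => hryn (h ▸ this)⟩
  have hgN : g ∈ g :: N := List.mem_cons_self
  -- extend `Q` to the two glued edges, which belong to the same polygon as the darts of `g`
  let Q' : α → Prop := fun u => if u = y ∨ u = rev y then ∃ v ∈ g, Q v else Q u
  have e1 : ∀ u, u ≠ y ∧ u ≠ rev y → (Q' u ↔ Q u) := fun u hu => by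
    simp only [Q']
    rw [if_neg (not_or.2 hu)]
  have e2 : ∀ u, (u = y ∨ u = rev y) → (Q' u ↔ ∃ v ∈ g, Q v) := fun u hu => by
    simp only [Q']
    rw [if_pos hu]
  have e3 : ∀ u, (u = y ∨ u = rev y ∨ u ∈ g) → Q' u → ∃ v ∈ g, Q v := by
    intro u hu h
    by_cases hu' : u = y ∨ u = rev y
    · exact (e2 u hu').1 h
    · exact ⟨u, by tauto, (e1 u (not_or.1 hu')).1 h⟩
  have e4 : ∀ u, (u = y ∨ u = rev y ∨ u ∈ g) → (∃ v ∈ g, Q v) → Q' u := by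
    rintro u hu ⟨v, hv, hQv⟩
    by_cases hu' : u = y ∨ u = rev y
    · exact (e2 u hu').2 ⟨v, hv, hQv⟩
    · exact (e1 u (not_or.1 hu')).2 (h1 g hgN v hv u (by tauto) hQv)
  have hnot : ∀ u ∈ (g :: N).flatten, u ≠ y ∧ u ≠ rev y := fun u hu =>
    ⟨fun h => hyn (h ▸ hu), fun h => hryn (h ▸ hu)⟩
  rw [← e1 t (hnot t ht)]
  refine hcon Q' ?_ ?_ x ((hmem x).2 (Or.inr (Or.inr hx))) ((e1 x (hnot x hx)).2 hQx) t
    ((hmem t).2 (Or.inr (Or.inr ht)))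
  · intro w hw u hu v hv hQu
    rcases hL w hw with rfl | rfl | hwN
    · exact e4 v (hw₁ v hv) (e3 u (hw₁ u hu) hQu)
    · exact e4 v (hw₂ v hv) (e3 u (hw₂ u hu) hQu)
    · rw [e1 _ (hstep w hwN _ hv)]
      rw [e1 _ (hstep w hwN _ hu)] at hQu
      exact h1 w (List.mem_cons_of_mem _ hwN) u hu v hv hQu
  · intro u hu hu' hQu
    by_cases huy : u = y ∨ u = rev y
    · refine e4 _ ?_ (e3 u (by tauto) hQu)
      rcases huy with rfl | rfl
      · exact Or.inr (Or.inl rfl)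
      · exact Or.inl (hrr _)
    · have hru : rev u ≠ y ∧ rev u ≠ rev y := by
        constructor
        · intro h
          exact huy (Or.inr (by rw [← h, hrr]))
        · intro h
          exact huy (Or.inl (by rw [← hrr u, h, hrr]))
      rw [e1 _ hru]
      rw [e1 _ (not_or.1 huy)] at hQu
      refine h2 u ?_ ?_ hQu
      · have := (hmem u).1 hu
        tauto
      · have := (hmem _).1 hu'
        tauto

variable [Finite α] {R : V → List α → Prop}

include hrr hne in
/-- A polygon with some of its sides glued in pairs: the Euler characteristic of the result is at most
`1`, and if it is `1`, then the boundary word is obtained from the polygon by removing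
backtracks. -/
theorem single_polygon (hR : ∀ a w, R a w → IsWalk rev src a w a)
    (hrot : ∀ a b u v, IsWalk rev src a u b → IsWalk rev src b v a → R a (u ++ v) → R b (v ++ u))
    (hleaf : ∀ a x w, R a (x :: rev x :: w) → R a w) (n : ℕ) :
    ∀ (a : V) (w : List α), w.length = n → R a w → w.Nodup → (∃ x ∈ w, rev x ∉ w) →
      2 * (innerVertices rev src {x | x ∈ w}).ncard ≤ (innerDarts rev {x | x ∈ w}).ncard ∧
      (2 * (innerVertices rev src {x | x ∈ w}).ncard = (innerDarts rev {x | x ∈ w}).ncard →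
        ∃ b w', R b w' ∧ w'.Nodup ∧ ∀ x, x ∈ w' ↔ x ∈ w ∧ rev x ∉ w) := by
  classical
  induction n using Nat.strong_induction_on with
  | _ n ih =>
  intro a w hlen hw hnd hfr
  -- rotation of the polygon to any of its sides
  have hto : ∀ x ∈ w, ∃ t, R (src x) (x :: t) ∧ (x :: t).Perm w := by
    intro x hx
    obtain ⟨u, v, rfl⟩ := List.append_of_mem hx
    obtain ⟨b, h1, h2⟩ := IsWalk.append_iff.1 (hR _ _ hw)
    have h3 := hrot _ _ _ _ h1 h2 hw
    rw [← h2.1] at h3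
    exact ⟨v ++ u, h3, (List.perm_append_comm : (x :: v ++ u).Perm _)⟩
  -- fold a backtrack: this removes one edge and at most one inner vertex, the leaf
  by_cases hex : ∃ x t, R (src x) (x :: rev x :: t) ∧ (x :: rev x :: t).Perm w
  · obtain ⟨x, t, hxt, hp⟩ := hex
    have hmem : ∀ z, z ∈ w ↔ z = x ∨ z = rev x ∨ z ∈ t := fun z => by
      rw [← hp.mem_iff, List.mem_cons, List.mem_cons]
    have hnd' := hp.nodup_iff.2 hnd
    rw [List.nodup_cons, List.nodup_cons, List.mem_cons, not_or] at hnd'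
    obtain ⟨⟨-, hxt'⟩, hrt, htn⟩ := hnd'
    have hset : {z | z ∈ t} = {z | z ∈ w} \ {x, rev x} := by
      ext z
      simp only [Set.mem_ofPred_eq, Set.mem_sdiff, hmem, Set.mem_insert_iff,
        Set.mem_singleton_iff]
      constructor
      · intro hz
        refine ⟨Or.inr (Or.inr hz), ?_⟩
        rintro (rfl | rfl)
        exacts [hxt' hz, hrt hz]
      · tauto
    have hx : x ∈ {z | z ∈ w} := (hmem x).2 (Or.inl rfl)
    have hx' : rev x ∈ {z | z ∈ w} := (hmem _).2 (Or.inr (Or.inl rfl))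
    have hfd : ∀ z, (z ∈ t ∧ rev z ∉ t) ↔ (z ∈ w ∧ rev z ∉ w) := by
      intro z
      have := front_diff hrr hx hx' z
      rw [← hset] at this
      exact this
    have htR := hleaf _ _ _ hxt
    obtain ⟨z, hz⟩ := hfr
    have hz' := (hfd z).2 hz
    have hlen' : t.length < n := by
      have := hp.length_eq
      simp only [List.length_cons] at this
      omega
    obtain ⟨i1, i2⟩ := ih _ hlen' _ _ rfl htR htn ⟨z, hz'⟩
    have hE := ncard_innerDarts_diff hrr hne hx hx'
    rw [← hset] at hE
    have hV : innerVertices rev src {z | z ∈ w}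
        ⊆ insert (src (rev x)) (innerVertices rev src {z | z ∈ t}) := by
      intro v hv
      rw [Set.mem_insert_iff, or_iff_not_imp_left]
      intro hvx
      rw [hset]
      refine innerVertices_diff hrr hx hx' hv ?_
      rw [← hset]
      obtain ⟨⟨y, hy, hyv⟩, -⟩ := hv
      rcases (hmem y).1 hy with rfl | rfl | hy
      · rcases t with _ | ⟨s, t⟩
        · simp at hz'
        · exact ⟨s, List.mem_cons_self, ((hR _ _ htR).1).trans hyv⟩
      · exact absurd hyv.symm hvx
      · exact ⟨y, hy, hyv⟩
    have hV' := (Set.ncard_le_ncard hV ((finite_innerVertices _).insert _)).trans (Set.ncard_insert_le _ _)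
    refine ⟨by omega, fun heq => ?_⟩
    obtain ⟨b, w', h1, h2, h3⟩ := i2 (by omega)
    exact ⟨b, w', h1, h2, fun z => (h3 z).trans (hfd z)⟩
  · set A : Set α := {x | x ∈ w} with hA
    have hint : ∀ x ∈ A, src x ∈ innerVertices rev src A → rev x ∈ A := fun x hx hv => by
      by_contra h
      exact (hv.2 x hx h).1 rfl
    -- without backtracks, each inner vertex has at least two darts
    have htwo : ∀ v ∈ innerVertices rev src A, ∃ x ∈ A, ∃ y ∈ A, x ≠ y ∧ src x = v ∧ src y = v := by
      rintro v hv
      obtain ⟨⟨x, hx, rfl⟩, -⟩ := id hv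
      have hrx := hint x hx hv
      obtain ⟨t, ht, hp⟩ := hto (rev x) hrx
      rcases t with _ | ⟨y, t⟩
      · have := hp.mem_iff.2 hx
        rw [List.mem_singleton] at this
        exact absurd this.symm (hne x)
      · have hw := (hR _ _ ht).2.1
        rw [hrr] at hw
        refine ⟨x, hx, y, hp.mem_iff.1 (by simp), ?_, rfl, hw⟩
        rintro rfl
        exact hex ⟨rev x, t, by rwa [hrr], by rwa [hrr]⟩
    -- the darts which start at inner vertices are inner
    set O : Set α := {x | x ∈ A ∧ src x ∈ innerVertices rev src A} with hO
    have hOE : O ⊆ innerDarts rev A := fun x hx => ⟨hx.1, hint x hx.1 hx.2⟩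
    have hVO : 2 * (innerVertices rev src A).ncard ≤ O.ncard := by
      have : Nonempty α := ⟨hfr.choose⟩
      choose! f hf g hg hfg hsf hsg using htwo
      have c1 : (f '' innerVertices rev src A).ncard = (innerVertices rev src A).ncard :=
        Set.InjOn.ncard_image fun v hv v' hv' h => by rw [← hsf v hv, h, hsf v' hv']
      have c2 : (g '' innerVertices rev src A).ncard = (innerVertices rev src A).ncard :=
        Set.InjOn.ncard_image fun v hv v' hv' h => by rw [← hsg v hv, h, hsg v' hv']
      have c3 : Disjoint (f '' innerVertices rev src A) (g '' innerVertices rev src A) := by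
        rw [Set.disjoint_left]
        rintro _ ⟨v, hv, rfl⟩ ⟨v', hv', h⟩
        have : v' = v := by rw [← hsg v' hv', h, hsf v hv]
        subst this
        exact hfg _ hv h.symm
      have c4 := Set.ncard_union_eq c3 (Set.toFinite _) (Set.toFinite _)
      have c5 : f '' innerVertices rev src A ∪ g '' innerVertices rev src A ⊆ O := by
        rintro _ (⟨v, hv, rfl⟩ | ⟨v, hv, rfl⟩)
        · exact ⟨hf v hv, by rwa [hsf v hv]⟩
        · exact ⟨hg v hv, by rwa [hsg v hv]⟩
      have c6 := Set.ncard_le_ncard c5 (Set.toFinite _)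
      omega
    have hOE' := Set.ncard_le_ncard hOE (Set.toFinite _)
    refine ⟨by omega, fun heq => ?_⟩
    have hEq : O = innerDarts rev A := Set.eq_of_subset_of_ncard_le hOE (by omega) (Set.toFinite _)
    -- now no dart which starts on the frontier is inner, hence all darts lie on the frontier
    have hrun : ∀ (t : List α) (b c : V), b ∉ innerVertices rev src A → IsWalk rev src b t c →
        (∀ x ∈ t, x ∈ A) → ∀ x ∈ t, rev x ∉ A := by
      intro t
      induction t with
      | nil => simp
      | cons y t iht =>
        rintro b c hb ⟨rfl, ht⟩ hmem
        have hy : y ∈ A := hmem y List.mem_cons_self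
        have h1 : rev y ∉ A := by
          intro h
          have : y ∈ O := by rw [hEq]; exact ⟨hy, h⟩
          exact hb this.2
        intro x hx
        rcases List.mem_cons.1 hx with rfl | hx
        · exact h1
        · exact iht _ _ (fun hv => (hv.2 y hy h1).2 rfl) ht
            (fun z hz => hmem z (List.mem_cons_of_mem _ hz)) x hx
    obtain ⟨z, hz, hz'⟩ := hfr
    obtain ⟨t, ht, hp⟩ := hto z hz
    have hall := hrun (z :: t) _ _ (fun hv => (hv.2 z hz hz').1 rfl) (hR _ _ ht)
      (fun x hx => hp.mem_iff.1 hx)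
    exact ⟨a, w, hw, hnd, fun x =>
      ⟨fun hx => ⟨hx, hall x (hp.mem_iff.2 hx)⟩, fun hx => hx.1⟩⟩

include hrr hne in
/-- A connected region made of polygons whose sides are glued in pairs, not all of them, has Euler
characteristic at most `1`; if it is `1`, the region is a disc, whose boundary word is obtained from
the polygons by gluing along edges and removing backtracks. -/
theorem polygons (hR : ∀ a w, R a w → IsWalk rev src a w a)
    (hrot : ∀ a b u v, IsWalk rev src a u b → IsWalk rev src b v a → R a (u ++ v) → R b (v ++ u))
    (hleaf : ∀ a x w, R a (x :: rev x :: w) → R a w)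
    (hglue : ∀ x u v, R (src x) (x :: u) → R (src (rev x)) (rev x :: v) → R (src (rev x)) (u ++ v))
    (n : ℕ) :
    ∀ (L : List (List α)), L.length = n + 1 → (∀ w ∈ L, w ≠ [] ∧ ∃ a, R a w) → L.flatten.Nodup →
      (∃ x ∈ L.flatten, rev x ∉ L.flatten) →
      (∀ Q : α → Prop, (∀ w ∈ L, ∀ x ∈ w, ∀ y ∈ w, Q x → Q y) →
        (∀ x ∈ L.flatten, rev x ∈ L.flatten → Q x → Q (rev x)) →
        ∀ x ∈ L.flatten, Q x → ∀ y ∈ L.flatten, Q y) →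
      2 * (innerVertices rev src {x | x ∈ L.flatten}).ncard + 2 * n
          ≤ (innerDarts rev {x | x ∈ L.flatten}).ncard ∧
      (2 * (innerVertices rev src {x | x ∈ L.flatten}).ncard + 2 * n
          = (innerDarts rev {x | x ∈ L.flatten}).ncard →
        ∃ b w', R b w' ∧ w'.Nodup ∧ ∀ x, x ∈ w' ↔ x ∈ L.flatten ∧ rev x ∉ L.flatten) := by
  classical
  induction n with
  | zero =>
    intro L hL hw hnd hfr _
    obtain ⟨w, rfl⟩ := List.length_eq_one_iff.1 hL
    obtain ⟨-, a, ha⟩ := hw w List.mem_cons_self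
    simp only [List.flatten_cons, List.flatten_nil, List.append_nil] at hnd hfr ⊢
    exact single_polygon hrr hne hR hrot hleaf _ a w rfl ha hnd hfr
  | succ n ih =>
    intro L hL hw hnd hfr hcon
    obtain ⟨w₁, L, rfl⟩ := List.exists_cons_of_length_eq_add_one hL
    simp only [List.length_cons, add_left_inj] at hL
    have hnd0 := hnd
    rw [List.flatten_cons, List.nodup_append] at hnd0
    obtain ⟨hnd1, hnd2, hnd3⟩ := hnd0
    -- by connectedness, the first polygon is glued along some edge to another one
    obtain ⟨y, hy, hy2⟩ : ∃ y ∈ w₁, rev y ∈ L.flatten := by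
      by_contra hcon'
      push Not at hcon'
      obtain ⟨w₂, L', rfl⟩ := List.exists_cons_of_length_eq_add_one hL
      obtain ⟨x, hx⟩ := List.exists_mem_of_ne_nil _ (hw w₁ (by simp)).1
      obtain ⟨z, hz⟩ := List.exists_mem_of_ne_nil _ (hw w₂ (by simp)).1
      have hz' : z ∈ (w₂ :: L').flatten := by simp [hz]
      refine hnd3 z (hcon (fun x => x ∈ w₁) ?_ ?_ x (by simp [hx]) hx z (by simp [hz])) z hz' rfl
      · intro w hw' s hs t ht h
        rcases List.mem_cons.1 hw' with rfl | hw'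
        · exact ht
        · exact absurd rfl (hnd3 s h s (List.mem_flatten.2 ⟨w, hw', hs⟩))
      · intro s _ hs' h
        rw [List.flatten_cons, List.mem_append] at hs'
        exact hs'.resolve_right (hcon' s h)
    obtain ⟨w₂, hw₂, hy₂⟩ := List.mem_flatten.1 hy2
    obtain ⟨L₁, L₂, rfl⟩ := List.append_of_mem hw₂
    obtain ⟨p, q, rfl⟩ := List.append_of_mem hy
    obtain ⟨r, s, rfl⟩ := List.append_of_mem hy₂
    have hto : ∀ x u v a, R a (u ++ x :: v) → R (src x) (x :: (v ++ u)) := by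
      intro x u v a hx
      obtain ⟨b, h1, h2⟩ := IsWalk.append_iff.1 (hR _ _ hx)
      have h3 := hrot _ _ _ _ h1 h2 hx
      rwa [← h2.1] at h3
    obtain ⟨-, a₁, ha₁⟩ := hw _ List.mem_cons_self
    obtain ⟨-, a₂, ha₂⟩ := hw (r ++ rev y :: s) (by simp)
    -- the two polygons are replaced by the polygon `g`
    have hg := hglue y (q ++ p) (s ++ r) (hto _ _ _ _ ha₁) (hto _ _ _ _ ha₂)
    set g := (q ++ p) ++ (s ++ r) with hgdef
    set N := L₁ ++ L₂ with hN
    have hperm : ((p ++ y :: q) :: (L₁ ++ (r ++ rev y :: s) :: L₂)).flatten.Perm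
        (y :: rev y :: (g :: N).flatten) := by
      rw [List.perm_iff_count]
      intro z
      simp only [hgdef, hN, List.flatten_cons, List.flatten_append, List.count_append,
        List.count_cons]
      omega
    have hmem : ∀ z, z ∈ ((p ++ y :: q) :: (L₁ ++ (r ++ rev y :: s) :: L₂)).flatten ↔
        z = y ∨ z = rev y ∨ z ∈ (g :: N).flatten := fun z => by
      rw [hperm.mem_iff, List.mem_cons, List.mem_cons]
    have hnd' := hperm.nodup_iff.1 hnd
    rw [List.nodup_cons, List.nodup_cons, List.mem_cons, not_or] at hnd'
    obtain ⟨⟨-, hyn⟩, hryn, hNn⟩ := hnd'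
    set A : Set α := {x | x ∈ ((p ++ y :: q) :: (L₁ ++ (r ++ rev y :: s) :: L₂)).flatten} with hA
    have hyA : y ∈ A := (hmem y).2 (Or.inl rfl)
    have hyA' : rev y ∈ A := (hmem _).2 (Or.inr (Or.inl rfl))
    have hset : {z | z ∈ (g :: N).flatten} = A \ {y, rev y} := by
      ext z
      rw [Set.mem_sdiff, hA, Set.mem_ofPred_eq, Set.mem_ofPred_eq, hmem, Set.mem_insert_iff,
        Set.mem_singleton_iff]
      constructor
      · intro hz
        refine ⟨Or.inr (Or.inr hz), ?_⟩
        rintro (rfl | rfl)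
        exacts [hyn hz, hryn hz]
      · tauto
    have hfd : ∀ z, (z ∈ (g :: N).flatten ∧ rev z ∉ (g :: N).flatten) ↔ (z ∈ A ∧ rev z ∉ A) := by
      intro z
      have := front_diff hrr hyA hyA' z
      rw [← hset] at this
      exact this
    obtain ⟨z, hz⟩ := hfr
    have hz' := (hfd z).2 hz
    have hwalk1 := (hR _ _ (hto _ _ _ _ ha₁)).2
    have hwalk2 := (hR _ _ (hto _ _ _ _ ha₂)).2
    rw [hrr] at hwalk2
    have hw1 : ∀ u ∈ p ++ y :: q, u = y ∨ u = rev y ∨ u ∈ g := by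
      intro u hu
      simp only [hgdef, List.mem_append, List.mem_cons] at hu ⊢
      tauto
    have hw2 : ∀ u ∈ r ++ rev y :: s, u = y ∨ u = rev y ∨ u ∈ g := by
      intro u hu
      simp only [hgdef, List.mem_append, List.mem_cons] at hu ⊢
      tauto
    have hLN : ∀ w ∈ (p ++ y :: q) :: (L₁ ++ (r ++ rev y :: s) :: L₂),
        w = p ++ y :: q ∨ w = r ++ rev y :: s ∨ w ∈ N := by
      intro w hw
      simp only [hN, List.mem_append, List.mem_cons] at hw ⊢
      tauto
    have hQ := glue_connected hrr hLN hw1 hw2 hmem hyn hryn hcon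
    have hgne : g ≠ [] := by
      intro hg0
      -- otherwise the two polygons would have no other sides and be all there is
      have hN0 : ∀ u ∈ A, u = y ∨ u = rev y := by
        refine hcon (fun u => u = y ∨ u = rev y) ?_ ?_ y hyA (Or.inl rfl)
        · intro w hw u hu v hv hQu
          have hg1 : ∀ u, u ∉ g := by simp [hg0]
          rcases hLN w hw with rfl | rfl | hwN
          · have := hw1 v hv
            have := hg1 v
            tauto
          · have := hw2 v hv
            have := hg1 v
            tauto
          · have : u ∈ (g :: N).flatten := List.mem_flatten.2 ⟨w, List.mem_cons_of_mem _ hwN, hu⟩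
            rcases hQu with rfl | rfl
            exacts [absurd this hyn, absurd this hryn]
        · rintro u _ _ (rfl | rfl)
          exacts [Or.inr rfl, Or.inl (hrr _)]
      rcases hN0 z hz.1 with rfl | rfl
      · exact hz.2 hyA'
      · exact hz.2 (by rw [hrr]; exact hyA)
    have hlenN : (g :: N).length = n + 1 := by
      simp only [hN, List.length_cons, List.length_append] at hL ⊢
      omega
    have hgN : ∀ w ∈ g :: N, w ≠ [] ∧ ∃ a, R a w := by
      intro w hw'
      rcases List.mem_cons.1 hw' with rfl | hw'
      · exact ⟨hgne, _, hg⟩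
      · refine hw w ?_
        simp only [hN, List.mem_append, List.mem_cons] at hw' ⊢
        tauto
    obtain ⟨i1, i2⟩ := ih (g :: N) hlenN hgN hNn ⟨z, hz'⟩ hQ
    have hE := ncard_innerDarts_diff hrr hne hyA hyA'
    rw [← hset] at hE
    -- both ends of the edge are still ends of sides of the new polygon
    have ht1 : ∀ v, v = src y ∨ v = src (rev y) → ∃ x ∈ g, src x = v := by
      have key : ∀ (u v : List α) (a b : V), IsWalk rev src a u b → IsWalk rev src b v a →
          u ++ v ≠ [] → ∃ x ∈ u ++ v, src x = a := by
        intro u v a b h1 h2 h3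
        rcases u with _ | ⟨x, u⟩
        · rcases v with _ | ⟨x, v⟩
          · exact absurd rfl h3
          · exact ⟨x, by simp, h2.1.trans (IsWalk.nil_iff.1 h1).symm⟩
        · exact ⟨x, by simp, h1.1⟩
      rintro v (rfl | rfl)
      · have hne' : (s ++ r) ++ (q ++ p) ≠ [] := by
          simp only [hgdef, ne_eq, List.append_eq_nil_iff] at hgne ⊢
          tauto
        obtain ⟨x, hx, hxv⟩ := key _ _ _ _ hwalk2 hwalk1 hne'
        refine ⟨x, ?_, hxv⟩
        simp only [hgdef, List.mem_append] at hx ⊢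
        tauto
      · exact key _ _ _ _ hwalk1 hwalk2 hgne
    have hV : innerVertices rev src A ⊆ innerVertices rev src {x | x ∈ (g :: N).flatten} := by
      intro v hv
      rw [hset]
      refine innerVertices_diff hrr hyA hyA' hv ?_
      rw [← hset]
      obtain ⟨⟨x, hx, rfl⟩, -⟩ := hv
      have hgf : ∀ x ∈ g, x ∈ (g :: N).flatten := fun x hx => by simp [hx]
      rcases (hmem x).1 hx with rfl | rfl | hx
      · obtain ⟨t, ht, h⟩ := ht1 _ (Or.inl rfl)
        exact ⟨t, hgf t ht, h⟩
      · obtain ⟨t, ht, h⟩ := ht1 _ (Or.inr rfl)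
        exact ⟨t, hgf t ht, h⟩
      · exact ⟨x, hx, rfl⟩
    have hV' := Set.ncard_le_ncard hV (finite_innerVertices _)
    refine ⟨by omega, fun heq => ?_⟩
    obtain ⟨b, w', h1, h2, h3⟩ := i2 (by omega)
    exact ⟨b, w', h1, h2, fun z => (h3 z).trans (hfd z)⟩

end Polygons

/-! ### The cell structure of a resolution -/

theorem sameCycle_three {α : Type*} {σ : Equiv.Perm α} {a b c : α} (h1 : σ a = b) (h2 : σ b = c)
    (h3 : σ c = a) (x : α) : σ.SameCycle a x ↔ x = a ∨ x = b ∨ x = c := by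
  constructor
  · rintro ⟨n, rfl⟩
    have h1' : σ.symm b = a := by rw [← h1, Equiv.symm_apply_apply]
    have h2' : σ.symm c = b := by rw [← h2, Equiv.symm_apply_apply]
    have h3' : σ.symm a = c := by rw [← h3, Equiv.symm_apply_apply]
    induction n with
    | zero => exact Or.inl rfl
    | succ n ih =>
      rw [add_comm, zpow_add, zpow_one, Equiv.Perm.mul_apply]
      rcases ih with ih | ih | ih <;> rw [ih] <;> tauto
    | pred n ih =>
      rw [sub_eq_add_neg, add_comm, zpow_add, zpow_neg_one, Equiv.Perm.mul_apply]
      rcases ih with ih | ih | ih <;> rw [ih]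
      exacts [Or.inr (Or.inr h3'), Or.inl h1', Or.inr (Or.inl h2')]
  · rintro (rfl | rfl | rfl)
    · exact Equiv.Perm.SameCycle.refl _ _
    · exact ⟨1, by simpa using h1⟩
    · exact ⟨2, by rw [zpow_ofNat, pow_two, Equiv.Perm.mul_apply, h1, h2]⟩

namespace CellSurface

variable {D : Type*} {M : CellSurface D}

theorem faceClosed_faceOf (d : D) : M.FaceClosed (M.faceOf d) := fun e =>
  (Equiv.Perm.sameCycle_apply_right : M.face.SameCycle d (M.face e) ↔ _)

/-- Every dart lies in a component. -/
theorem exists_isComponent (d : D) : ∃ Z, M.IsComponent Z ∧ d ∈ Z := by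
  let Z : Set D := {e | M.Linked Set.univ d e}
  have hstep : ∀ x y, (y = M.face x ∨ y = M.rev x) → (y ∈ Z ↔ x ∈ Z) := fun x y h =>
    have hxy : M.Linked Set.univ x y := Relation.EqvGen.rel _ _ ⟨trivial, trivial, h⟩
    ⟨fun hy => Relation.EqvGen.trans _ _ _ hy (hxy.symm _ _),
      fun hx => Relation.EqvGen.trans _ _ _ hx hxy⟩
  refine ⟨Z, ⟨fun x => hstep x _ (Or.inl rfl), fun x hx => (hstep x _ (Or.inr rfl)).2 hx, ?_⟩,
    Relation.EqvGen.refl _⟩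
  have key : ∀ x y, M.Linked Set.univ x y → (x ∈ Z ↔ y ∈ Z) ∧ (x ∈ Z → M.Linked Z x y) := by
    intro x y h
    induction h with
    | rel x y h =>
      have := hstep x y h.2.2
      exact ⟨this.symm, fun hx => Relation.EqvGen.rel _ _ ⟨hx, this.2 hx, h.2.2⟩⟩
    | refl x => exact ⟨Iff.rfl, fun _ => Relation.EqvGen.refl _⟩
    | symm x y _ ih => exact ⟨ih.1.symm, fun hy => (ih.2 (ih.1.2 hy)).symm _ _⟩
    | trans x y z _ _ ih1 ih2 =>
      exact ⟨ih1.1.trans ih2.1, fun hx => (ih1.2 hx).trans _ _ _ (ih2.2 (ih1.1.1 hx))⟩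
  exact fun x hx y hy => (key x y (Relation.EqvGen.trans _ _ _ (Relation.EqvGen.symm _ _ hx) hy)).2 hx

end CellSurface

namespace TangleDiagram

variable {D : Type*} {M : CellSurface D} (T : TangleDiagram M) (S : T.Resolution)

/-- The old dart at the vertex of which, before the resolution, a dart starts. -/
def site : D ⊕ T.OverDart → D := Sum.elim id (fun b => b.1)

open Classical in
/-- The old dart which has the 2-cell on the left of a dart in its own corner, next counterclockwise
to it. -/
def corner : D ⊕ T.OverDart → D :=
  Sum.elim id (fun b => if T.IsOne S b.1 then M.rot.symm b.1 else M.rot (M.rot b.1))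

open Classical in
/-- The new dart which starts at the same vertex of the resolution as the dart `d` and its successor,
when the resolution joins these two. -/
def bar (d : D) (h : T.IsCrossing d) : T.OverDart :=
  if ho : d ∈ T.upper then ⟨d, h, ho⟩
  else ⟨M.rot d, (T.isCrossing_rot d).2 h, (T.upper_rot d h).2 ho⟩

theorem turn_eq_rot_iff {d : D} (h : T.IsCrossing d) :
    T.turn S d = M.rot d ↔ (d ∈ T.upper ↔ T.IsOne S d) := by
  have hne : M.rot.symm d ≠ M.rot d := by
    rw [Ne, Equiv.symm_apply_eq]
    exact fun h' => h.2.2.2.2.2.1 h'.symm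
  unfold turn
  split_ifs with h1
  · simp [h1]
  · simp [hne, h1]

theorem isCrossing_opp {d : D} (h : T.IsCrossing d) : T.IsCrossing (M.rot (M.rot d)) :=
  (T.isCrossing_rot _).2 ((T.isCrossing_rot _).2 h)

theorem upper_opp {d : D} (h : T.IsCrossing d) : M.rot (M.rot d) ∈ T.upper ↔ d ∈ T.upper := by
  rw [T.upper_rot _ ((T.isCrossing_rot _).2 h), T.upper_rot d h, not_not]

theorem turn_opp {d : D} (h : T.IsCrossing d) (hd : T.turn S d = M.rot d) :
    T.turn S (M.rot (M.rot d)) = M.rot (M.rot (M.rot d)) := by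
  rw [turn_eq_rot_iff _ _ h] at hd
  rw [turn_eq_rot_iff _ _ (T.isCrossing_opp h), T.upper_opp h, T.isOne_rot, T.isOne_rot, hd]

theorem resolved_rot_of_not_crossing {d : D} (h : ¬ T.IsCrossing d) :
    (T.resolved S).rot (Sum.inl d) = Sum.inl (M.rot d) :=
  (dif_neg h : T.resolvedRotFun S (Sum.inl d) = _)

section First

variable {S} {d : D} (h : T.IsCrossing d) (hd : T.turn S d = M.rot d)

include h hd

theorem resolved_rot_first : (T.resolved S).rot (Sum.inl d) = Sum.inl (M.rot d) := by
  rw [turn_eq_rot_iff _ _ h] at hd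
  show T.resolvedRotFun S (Sum.inl d) = _
  by_cases h1 : T.IsOne S d
  · simp [resolvedRotFun, h, h1, hd.2 h1]
  · simp [resolvedRotFun, h, h1, hd.not.2 h1]

theorem resolved_rot_second :
    (T.resolved S).rot (Sum.inl (M.rot d)) = Sum.inr (T.bar d h) := by
  rw [turn_eq_rot_iff _ _ h] at hd
  show T.resolvedRotFun S (Sum.inl (M.rot d)) = _
  have hr := (T.isCrossing_rot d).2 h
  have hu := T.upper_rot d h
  by_cases h1 : T.IsOne S d
  · simp [resolvedRotFun, bar, hr, T.isOne_rot, h1, hd.2 h1, hu]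
  · simp [resolvedRotFun, bar, hr, T.isOne_rot, h1, hd.not.2 h1, hu]

theorem resolved_rot_bar : (T.resolved S).rot (Sum.inr (T.bar d h)) = Sum.inl d := by
  rw [turn_eq_rot_iff _ _ h] at hd
  show T.resolvedRotFun S (Sum.inr (T.bar d h)) = _
  by_cases h1 : T.IsOne S d
  · simp [resolvedRotFun, bar, h1, hd.2 h1]
  · simp [resolvedRotFun, bar, T.isOne_rot, h1, hd.not.2 h1]

theorem corner_bar : T.corner S (Sum.inr (T.bar d h)) = M.rot.symm d := by
  rw [turn_eq_rot_iff _ _ h] at hd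
  have hs := M.rot_symm_of_crossing h
  by_cases h1 : T.IsOne S d
  · simp [corner, bar, h1, hd.2 h1]
  · simp [corner, bar, T.isOne_rot, h1, hd.not.2 h1, hs]

omit hd in
theorem site_bar : M.SameVertex d (T.site (Sum.inr (T.bar d h))) := by
  unfold bar
  split_ifs
  · exact CellSurface.SameVertex.refl _ _
  · exact M.sameVertex_rot d

omit hd in
theorem resolved_rev_bar : (T.resolved S).rev (Sum.inr (T.bar d h))
    = Sum.inr (T.bar (M.rot (M.rot d)) (T.isCrossing_opp h)) := by
  show T.resolvedRev (Sum.inr (T.bar d h)) = _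
  by_cases h1 : d ∈ T.upper
  · have h2 := (T.upper_opp h).2 h1
    simp [resolvedRev, bar, h1, h2]
  · have h2 := (T.upper_opp h).not.2 h1
    simp [resolvedRev, bar, h1, h2]

theorem sameVertex_first (x : D ⊕ T.OverDart) : (T.resolved S).SameVertex (Sum.inl d) x ↔
    x = Sum.inl d ∨ x = Sum.inl (M.rot d) ∨ x = Sum.inr (T.bar d h) :=
  sameCycle_three (T.resolved_rot_first h hd) (T.resolved_rot_second h hd)
    (T.resolved_rot_bar h hd) x

end First

/-- A dart at a crossing starts at the vertex of a dart which is joined to its successor. -/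
theorem exists_first (x : D ⊕ T.OverDart) (hx : T.IsCrossing (T.site x)) :
    ∃ (d : D) (h : T.IsCrossing d), T.turn S d = M.rot d ∧ M.SameVertex (T.site x) d ∧
      (x = Sum.inl d ∨ x = Sum.inl (M.rot d) ∨ x = Sum.inr (T.bar d h)) := by
  rcases x with d | b
  · by_cases hd : T.turn S d = M.rot d
    · exact ⟨d, hx, hd, CellSurface.SameVertex.refl _ _, Or.inl rfl⟩
    · have hx' := (T.isCrossing_rot_symm d).2 hx
      refine ⟨M.rot.symm d, hx', ?_, M.sameVertex_rot_symm d,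
        Or.inr (Or.inl (by rw [Equiv.apply_symm_apply]))⟩
      have hx : T.IsCrossing d := hx
      rw [turn_eq_rot_iff _ _ hx']
      rw [turn_eq_rot_iff _ _ hx] at hd
      rw [T.upper_rot_symm d hx, T.isOne_rot_symm]
      tauto
  · have hb := b.2.1
    by_cases h1 : T.IsOne S b.1
    · refine ⟨b.1, hb, ?_, CellSurface.SameVertex.refl _ _, Or.inr (Or.inr ?_)⟩
      · rw [turn_eq_rot_iff _ _ hb]
        exact iff_of_true b.2.2 h1
      · simp [bar, b.2.2]
    · have hb' := (T.isCrossing_rot_symm b.1).2 hb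
      have hu := (T.upper_rot_symm b.1 hb).not.2 (not_not.2 b.2.2)
      refine ⟨M.rot.symm b.1, hb', ?_, M.sameVertex_rot_symm b.1, Or.inr (Or.inr ?_)⟩
      · rw [turn_eq_rot_iff _ _ hb', T.isOne_rot_symm]
        exact iff_of_false hu h1
      · simp [bar, hu]

theorem sameVertex_corner (x : D ⊕ T.OverDart) : M.SameVertex (T.site x) (T.corner S x) := by
  rcases x with d | b
  · exact CellSurface.SameVertex.refl _ _
  · show M.SameVertex b.1 (T.corner S (Sum.inr b))
    rw [corner, Sum.elim_inr]
    split_ifs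
    · exact M.sameVertex_rot_symm _
    · exact (M.sameVertex_rot _).trans (M.sameVertex_rot _)

theorem site_rot (x : D ⊕ T.OverDart) :
    M.SameVertex (T.site x) (T.site ((T.resolved S).rot x)) := by
  by_cases hx : T.IsCrossing (T.site x)
  · obtain ⟨d, h, hd, hxd, rfl | rfl | rfl⟩ := T.exists_first S x hx
    · rw [T.resolved_rot_first h hd]
      exact M.sameVertex_rot d
    · rw [T.resolved_rot_second h hd]
      exact (M.sameVertex_rot d).symm.trans (T.site_bar h)
    · rw [T.resolved_rot_bar h hd]
      exact (T.site_bar h).symm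
  · rcases x with d | b
    · rw [T.resolved_rot_of_not_crossing S (d := d) hx]
      exact M.sameVertex_rot d
    · exact absurd b.2.1 hx

variable {S}

theorem site_sameVertex {x y : D ⊕ T.OverDart} (h : (T.resolved S).SameVertex x y) :
    M.SameVertex (T.site x) (T.site y) := by
  obtain ⟨n, rfl⟩ := h
  induction n with
  | zero => exact CellSurface.SameVertex.refl _ _
  | succ n ih =>
    rw [add_comm, zpow_add, zpow_one, Equiv.Perm.mul_apply]
    exact ih.trans (T.site_rot S _)
  | pred n ih =>
    rw [sub_eq_add_neg, add_comm, zpow_add, zpow_neg_one, Equiv.Perm.mul_apply]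
    refine ih.trans (CellSurface.SameVertex.symm ?_)
    have := T.site_rot S ((T.resolved S).rot⁻¹ (((T.resolved S).rot ^ (-(n : ℤ))) x))
    rwa [show (T.resolved S).rot ((T.resolved S).rot⁻¹ _) = _ from
      (T.resolved S).rot.apply_symm_apply _] at this

theorem sameVertex_inl_mate (d : T.strand) :
    (T.resolved S).SameVertex (Sum.inl d.1) (Sum.inl (T.mate S d).1) := by
  by_cases h : T.IsCrossing d.1
  · rw [T.mate_crossing S h]
    obtain ⟨e, h', he, -, h1⟩ := T.exists_first S (Sum.inl d.1) h
    rcases h1 with h1 | h1 | h1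
    · rw [Sum.inl_injective h1, he, T.sameVertex_first h' he]
      exact Or.inr (Or.inl rfl)
    · have h2 := T.turn_turn S h'
      rw [he] at h2
      rw [Sum.inl_injective h1, h2]
      exact CellSurface.SameVertex.symm ((T.sameVertex_first h' he _).2 (Or.inr (Or.inl rfl)))
    · simp at h1
  · obtain ⟨n, hn⟩ := T.sameVertex_mate S d
    exact ⟨n, by rw [← hn]; exact T.resolvedRot_pow_inl S d.1 h n⟩

theorem sameVertex_inl_strand {d e : T.strand}
    (h : (T.resolved S).SameVertex (Sum.inl d.1) (Sum.inl e.1)) : e = d ∨ e = T.mate S d := by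
  by_cases hc : T.IsCrossing d.1
  · obtain ⟨f, h', hf, -, h1⟩ := T.exists_first S (Sum.inl d.1) hc
    have h2 := T.turn_turn S h'
    rw [hf] at h2
    have hfd : (T.resolved S).SameVertex (Sum.inl f) (Sum.inl d.1) :=
      (T.sameVertex_first h' hf _).2 h1
    have he := (T.sameVertex_first h' hf _).1 (hfd.trans h)
    simp only [Sum.inl.injEq, reduceCtorEq, or_false] at h1 he
    have hm := T.mate_crossing S hc
    rcases h1 with h1 | h1 <;> rcases he with he | he
    · exact Or.inl (Subtype.ext (he.trans h1.symm))
    · exact Or.inr (Subtype.ext (by rw [hm, he, h1, hf]))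
    · exact Or.inr (Subtype.ext (by rw [hm, he, h1, h2]))
    · exact Or.inl (Subtype.ext (he.trans h1.symm))
  · rw [or_iff_not_imp_left]
    intro hne
    exact (T.mate_eq_of_not_crossing S hc hne (T.site_sameVertex h)).symm

variable (S)

theorem face_inr (b : T.OverDart) :
    (T.resolved S).face (Sum.inr b) = Sum.inl (T.corner S (Sum.inr b)) := by
  show T.resolvedRotInv S (T.resolvedRev (Sum.inr b)) = _
  by_cases h1 : T.IsOne S b.1
  · have := M.rot_symm_of_crossing b.2.1
    simp [resolvedRotInv, resolvedRev, corner, T.isOne_rot, h1, this]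
  · simp [resolvedRotInv, resolvedRev, corner, T.isOne_rot, h1]

theorem corner_face_inl (d : D) :
    T.corner S ((T.resolved S).face (Sum.inl d)) = M.face d := by
  show T.corner S (T.resolvedRotInv S (Sum.inl (M.rev d))) = M.rot.symm (M.rev d)
  set e := M.rev d
  by_cases h : T.IsCrossing e
  · have hs := M.rot_symm_of_crossing h
    by_cases h1 : T.IsOne S e <;> by_cases h2 : e ∈ T.upper <;>
      simp [resolvedRotInv, corner, T.isOne_rot, h1, h2, h, hs]
  · simp [resolvedRotInv, corner, h]

/-- The region of the resolution which corresponds to a union of 2-cells. -/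
def lift (W : Set D) : Set (D ⊕ T.OverDart) := {x | T.corner S x ∈ W}

variable {S} {W W' Z : Set D}

theorem inl_mem_lift {d : D} : Sum.inl d ∈ T.lift S W ↔ d ∈ W := Iff.rfl

theorem faceClosed_lift (h : M.FaceClosed W) : (T.resolved S).FaceClosed (T.lift S W) := by
  rintro (d | b)
  · show T.corner S _ ∈ W ↔ d ∈ W
    rw [T.corner_face_inl, h]
  · rw [T.face_inr]
    rfl

theorem faceClosed_of_resolved {A : Set (D ⊕ T.OverDart)} (h : (T.resolved S).FaceClosed A) :
    M.FaceClosed {d | Sum.inl d ∈ A} ∧ A = T.lift S {d | Sum.inl d ∈ A} := by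
  have key : ∀ x, Sum.inl (T.corner S x) ∈ A ↔ x ∈ A := by
    rintro (d | b)
    · rfl
    · rw [← h (Sum.inr b), T.face_inr]
  refine ⟨fun d => ?_, Set.ext fun x => (key x).symm⟩
  show Sum.inl (M.face d) ∈ A ↔ Sum.inl d ∈ A
  rw [← T.corner_face_inl S, key, h]

theorem lift_injective : Function.Injective (T.lift S) := fun W W' h => by
  ext d
  rw [← T.inl_mem_lift (S := S), h, T.inl_mem_lift]

theorem lift_subset_iff : T.lift S W ⊆ T.lift S W' ↔ W ⊆ W' :=
  ⟨fun h d hd => h (a := Sum.inl d) hd, fun h _ hx => h hx⟩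

theorem disjoint_hole_lift : Disjoint (T.lift S W) (T.resolved S).hole ↔ Disjoint W M.hole := by
  rw [Set.disjoint_left, Set.disjoint_left]
  constructor
  · intro h d hd hd'
    exact h (a := Sum.inl d) hd ⟨d, hd', rfl⟩
  · rintro h _ hx ⟨d, hd, rfl⟩
    exact h hx hd

theorem faceOf_resolved (d : D) :
    (T.resolved S).faceOf (Sum.inl d) = T.lift S (M.faceOf d) := by
  apply Set.Subset.antisymm
  · exact (T.faceClosed_lift (CellSurface.faceClosed_faceOf d)).faceOf_subset
      (CellSurface.mem_faceOf_self d : d ∈ M.faceOf d)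
  · obtain ⟨h1, h2⟩ := T.faceClosed_of_resolved
      (CellSurface.faceClosed_faceOf (M := T.resolved S) (Sum.inl d))
    rw [h2, T.lift_subset_iff]
    exact h1.faceOf_subset (CellSurface.mem_faceOf_self (M := T.resolved S) (Sum.inl d))

theorem faceOf_corner (x : D ⊕ T.OverDart) :
    (T.resolved S).faceOf x = T.lift S (M.faceOf (T.corner S x)) := by
  rcases x with d | b
  · exact T.faceOf_resolved d
  · rw [← T.faceOf_resolved, ← T.face_inr]
    ext y
    exact (Equiv.Perm.sameCycle_apply_left : (T.resolved S).face.SameCycle _ _ ↔ _).symm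

theorem faces_lift : {f | (∃ x, f = (T.resolved S).faceOf x) ∧ f ⊆ T.lift S W}
    = T.lift S '' {f | (∃ d, f = M.faceOf d) ∧ f ⊆ W} := by
  ext f
  constructor
  · rintro ⟨⟨x, rfl⟩, h⟩
    rw [T.faceOf_corner, T.lift_subset_iff] at h
    exact ⟨_, ⟨⟨_, rfl⟩, h⟩, (T.faceOf_corner x).symm⟩
  · rintro ⟨_, ⟨⟨d, rfl⟩, h⟩, rfl⟩
    exact ⟨⟨Sum.inl d, (T.faceOf_resolved d).symm⟩, T.lift_subset_iff.2 h⟩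

theorem ncard_faces_lift : {f | (∃ x, f = (T.resolved S).faceOf x) ∧ f ⊆ T.lift S W}.ncard
    = {f | (∃ d, f = M.faceOf d) ∧ f ⊆ W}.ncard := by
  rw [T.faces_lift, Set.ncard_image_of_injective _ T.lift_injective]

theorem isComponent_lift (hZ : M.IsComponent Z) : (T.resolved S).IsComponent (T.lift S Z) := by
  have hsite : ∀ x, x ∈ T.lift S Z ↔ T.site x ∈ Z := fun x =>
    (hZ.sameVertex (T.sameVertex_corner S x)).symm
  have hlc : ∀ x ∈ T.lift S Z, (T.resolved S).Linked (T.lift S Z) x (Sum.inl (T.corner S x)) := by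
    rintro (d | b) hx
    · exact Relation.EqvGen.refl _
    · exact Relation.EqvGen.rel _ _ ⟨hx, hx, Or.inl (T.face_inr S b).symm⟩
  refine ⟨T.faceClosed_lift hZ.faceClosed, ?_, ?_⟩
  · rintro (d | b) hx
    · exact hZ.rev_mem d hx
    · rw [hsite] at hx ⊢
      exact (hZ.sameVertex ((M.sameVertex_rot _).trans (M.sameVertex_rot _))).1 hx
  · intro x hx y hy
    refine (hlc x hx).trans _ _ _ (Relation.EqvGen.trans _ _ _ ?_ ((hlc y hy).symm _ _))
    have h := hZ.linked _ hx _ hy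
    generalize T.corner S x = d at h
    generalize T.corner S y = e at h
    clear hx hy
    induction h with
    | rel d e hde =>
      obtain ⟨hd, he, rfl | rfl⟩ := hde
      · have h1 : (T.resolved S).face (Sum.inl d) ∈ T.lift S Z :=
          (T.faceClosed_lift hZ.faceClosed _).2 hd
        have h2 := hlc _ h1
        rw [T.corner_face_inl] at h2
        exact Relation.EqvGen.trans _ _ _ (Relation.EqvGen.rel _ _ ⟨hd, h1, Or.inl rfl⟩) h2
      · exact Relation.EqvGen.rel _ _ ⟨hd, he, Or.inr rfl⟩
    | refl d => exact Relation.EqvGen.refl _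
    | symm d e _ ih => exact ih.symm _ _
    | trans d e f _ _ ih1 ih2 => exact ih1.trans _ _ _ ih2

/-! ### Circles of a resolution and their sides -/

variable (S)

/-- The darts of a component, in the cell structure of the resolution. -/
def circleDarts (C : T.Component S) : Set (D ⊕ T.OverDart) :=
  {x | ∃ d : T.strand, T.comp S d = C ∧ x = Sum.inl d.1}

open Classical in
/-- The two darts of the diagram at a vertex of the resolution are exchanged. -/
def mateX : D ⊕ T.OverDart → D ⊕ T.OverDart :=
  Sum.elim (fun d => if h : d ∈ T.strand then Sum.inl (T.mate S ⟨d, h⟩).1 else Sum.inl d) Sum.inr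

variable {S}

theorem mateX_inl (d : T.strand) : T.mateX S (Sum.inl d.1) = Sum.inl (T.mate S d).1 :=
  dif_pos d.2

theorem inl_mem_circleDarts {C : T.Component S} {d : T.strand} :
    Sum.inl d.1 ∈ T.circleDarts S C ↔ T.comp S d = C := by
  constructor
  · rintro ⟨e, he, h⟩
    rwa [Subtype.ext (Sum.inl_injective h) (a1 := d)]
  · exact fun h => ⟨d, h, rfl⟩

theorem circuit {C : T.Component S} (hC : ¬ T.IsArc C) :
    (T.resolved S).Circuit (T.circleDarts S C) (T.mateX S) where
  rev_mem := by
    rintro _ ⟨d, hd, rfl⟩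
    exact ⟨T.sRev d, (T.comp_sRev S d).trans hd, rfl⟩
  m_mem := by
    rintro _ ⟨d, hd, rfl⟩
    exact ⟨T.mate S d, (T.comp_mate S d).trans hd, T.mateX_inl d⟩
  m_ne := by
    rintro _ ⟨d, hd, rfl⟩ h
    rw [T.mateX_inl] at h
    exact hC ⟨d, (T.mate_eq_self_iff S d).1 (Subtype.ext (Sum.inl_injective h)), hd⟩
  same := by
    rintro _ ⟨d, hd, rfl⟩
    rw [T.mateX_inl]
    exact T.sameVertex_inl_mate d
  only := by
    rintro _ ⟨d, hd, rfl⟩ _ ⟨e, he, rfl⟩ h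
    rw [T.mateX_inl]
    rcases T.sameVertex_inl_strand h with rfl | rfl
    exacts [Or.inl rfl, Or.inr rfl]
  conn := by
    rintro P h1 h2 _ ⟨d, rfl, rfl⟩ hP _ ⟨e, he, rfl⟩
    have key : ∀ x y : T.strand, Conn T.sRev (T.mate S) x y →
        T.comp S x = T.comp S d → (P (Sum.inl x.1) ↔ P (Sum.inl y.1)) := by
      intro x y hxy
      induction hxy with
      | rel x y h =>
        intro hx
        rcases h with rfl | rfl
        · refine ⟨h1 _ ⟨x, hx, rfl⟩, fun h => ?_⟩
          have := h1 _ ⟨T.sRev x, (T.comp_sRev S x).trans hx, rfl⟩ h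
          exact (congrArg P ((T.resolved S).rev_rev (Sum.inl x.1))).mp this
        · have e1 := T.mateX_inl (S := S) x
          have e2 := T.mateX_inl (S := S) (T.mate S x)
          rw [T.mate_involutive S x] at e2
          rw [← e1]
          refine ⟨h2 _ ⟨x, hx, rfl⟩, fun h => ?_⟩
          rw [e1] at h
          rw [← e2]
          exact h2 _ ⟨T.mate S x, (T.comp_mate S x).trans hx, rfl⟩ h
      | refl x => exact fun _ => Iff.rfl
      | symm x y hxy ih =>
        exact fun hy => (ih (((T.comp_eq_iff S).2 hxy).trans hy)).symm
      | trans x y z hxy _ ih1 ih2 =>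
        exact fun hx => (ih1 hx).trans (ih2 (((T.comp_eq_iff S).2 hxy).symm.trans hx))
    exact (key d e ((T.comp_eq_iff S).1 he.symm) rfl).1 hP

end TangleDiagram

/-! ### The Euler characteristic under a change of the resolution -/

theorem ncard_classes_split {α : Type*} [Finite α] {o : α → Set α} {P : α → Prop}
    (hP : ∀ x y, o x = o y → P x → P y) (Q : Set α → Prop) :
    {v | (∃ x, v = o x) ∧ Q v}.ncard
      = {v | (∃ x, v = o x ∧ ¬ P x) ∧ Q v}.ncard + {v | (∃ x, v = o x ∧ P x) ∧ Q v}.ncard := by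
  rw [← Set.ncard_union_eq ?_ (Set.toFinite _) (Set.toFinite _)]
  · congr 1
    ext v
    constructor
    · rintro ⟨⟨x, rfl⟩, h⟩
      by_cases hx : P x
      · exact Or.inr ⟨⟨x, rfl, hx⟩, h⟩
      · exact Or.inl ⟨⟨x, rfl, hx⟩, h⟩
    · rintro (⟨⟨x, rfl, -⟩, h⟩ | ⟨⟨x, rfl, -⟩, h⟩) <;> exact ⟨⟨x, rfl⟩, h⟩
  · rw [Set.disjoint_left]
    rintro _ ⟨⟨x, rfl, hx⟩, -⟩ ⟨⟨y, hy, hy'⟩, -⟩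
    exact hx (hP y x hy.symm hy')

namespace TangleDiagram

variable {D : Type*} {M : CellSurface D} {T : TangleDiagram M} {S S' : T.Resolution} {d : D}

section Away

theorem sameVertex_away
    (hS : ∀ x, ¬ M.SameVertex d (T.site x) → (T.resolved S').rot x = (T.resolved S).rot x)
    {x y : D ⊕ T.OverDart} (hx : ¬ M.SameVertex d (T.site x))
    (h : (T.resolved S).SameVertex x y) : (T.resolved S').SameVertex x y := by
  have hn : ∀ y, (T.resolved S).SameVertex x y → ¬ M.SameVertex d (T.site y) := fun y hy h' =>
    hx (h'.trans (T.site_sameVertex hy).symm)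
  have step : ∀ y, (T.resolved S).SameVertex x y →
      (T.resolved S').SameVertex y ((T.resolved S).rot y) := fun y hy => by
    rw [← hS y (hn y hy)]
    exact CellSurface.sameVertex_rot _ _
  obtain ⟨n, rfl⟩ := h
  induction n with
  | zero => exact CellSurface.SameVertex.refl _ _
  | succ n ih =>
    rw [add_comm, zpow_add, zpow_one, Equiv.Perm.mul_apply]
    exact ih.trans (step _ ⟨n, rfl⟩)
  | pred n ih =>
    refine ih.trans (CellSurface.SameVertex.symm ?_)
    have := step (((T.resolved S).rot ^ (-(n : ℤ) - 1)) x) ⟨_, rfl⟩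
    rwa [← Equiv.Perm.mul_apply, show (T.resolved S).rot * (T.resolved S).rot ^ (-(n : ℤ) - 1)
      = (T.resolved S).rot ^ (-(n : ℤ)) by rw [← zpow_one_add]; congr 1; ring] at this

theorem vertexOf_away
    (hS : ∀ x, ¬ M.SameVertex d (T.site x) → (T.resolved S').rot x = (T.resolved S).rot x)
    {x : D ⊕ T.OverDart} (hx : ¬ M.SameVertex d (T.site x)) :
    (T.resolved S').vertexOf x = (T.resolved S).vertexOf x :=
  Set.Subset.antisymm (fun _ hy => sameVertex_away (fun x hx => (hS x hx).symm) hx hy)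
    (fun _ hy => sameVertex_away hS hx hy)

end Away

section Flip

variable (h : T.IsCrossing d)

theorem rot_flip_away {x : D ⊕ T.OverDart} (hx : ¬ M.SameVertex d (T.site x)) :
    (T.resolved (T.flip S (T.crossingOf d h))).rot x = (T.resolved S).rot x := by
  have e := T.isOne_flip_of_ne S h hx
  rcases x with y | b
  · change T.IsOne _ y ↔ T.IsOne S y at e
    show T.resolvedRotFun _ (Sum.inl y) = T.resolvedRotFun _ (Sum.inl y)
    by_cases h1 : T.IsOne S y
    · simp [resolvedRotFun, h1, e.2 h1]
    · simp [resolvedRotFun, h1, e.not.2 h1]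
  · change T.IsOne _ b.1 ↔ T.IsOne S b.1 at e
    show T.resolvedRotFun _ (Sum.inr b) = T.resolvedRotFun _ (Sum.inr b)
    by_cases h1 : T.IsOne S b.1
    · simp [resolvedRotFun, h1, e.2 h1]
    · simp [resolvedRotFun, h1, e.not.2 h1]

theorem corner_flip_away {x : D ⊕ T.OverDart} (hx : ¬ M.SameVertex d (T.site x)) :
    T.corner (T.flip S (T.crossingOf d h)) x = T.corner S x := by
  have e := T.isOne_flip_of_ne S h hx
  rcases x with y | b
  · rfl
  · change T.IsOne _ b.1 ↔ T.IsOne S b.1 at e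
    by_cases h1 : T.IsOne S b.1
    · simp [corner, h1, e.2 h1]
    · simp [corner, h1, e.not.2 h1]

theorem vertexOf_flip_away {x : D ⊕ T.OverDart} (hx : ¬ M.SameVertex d (T.site x)) :
    (T.resolved (T.flip S (T.crossingOf d h))).vertexOf x = (T.resolved S).vertexOf x :=
  vertexOf_away (fun _ => rot_flip_away h) hx

theorem turn_flip_rot (hd : T.turn S d = M.rot d) :
    T.turn (T.flip S (T.crossingOf d h)) (M.rot d) = M.rot (M.rot d) := by
  rw [turn_rot _ _ h, T.turn_flip S h, if_pos hd, Equiv.symm_apply_eq]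
  exact fun h' => h.2.2.2.2.2.1 h'.symm

/-- The new darts at the crossing of `d` are those of `d` and of the opposite dart. -/
theorem bar_or (b : T.OverDart) (hb : M.SameVertex d b.1) :
    b = T.bar d h ∨ b = T.bar (M.rot (M.rot d)) (T.isCrossing_opp h) := by
  have hu := T.upper_rot d h
  have hu2 := T.upper_opp h
  have hu3 := T.upper_opp ((T.isCrossing_rot d).2 h)
  have hb2 := b.2.2
  rcases M.sameVertex_crossing h hb with e | e | e | e <;> rw [e] at hb2
  · left
    apply Subtype.ext
    simp [bar, hb2, e]
  · left
    apply Subtype.ext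
    simp [bar, hu.1 hb2, e]
  · right
    apply Subtype.ext
    simp [bar, hb2, e]
  · right
    apply Subtype.ext
    have : M.rot (M.rot d) ∉ T.upper := by tauto
    simp [bar, this, e]

section Count

variable [Finite D] {W : Set D} (hd : T.turn S d = M.rot d)

include h hd

omit [Finite D] in
theorem vertexOf_first : (T.resolved S).vertexOf (Sum.inl d)
    = {Sum.inl d, Sum.inl (M.rot d), Sum.inr (T.bar d h)} :=
  Set.ext fun x => T.sameVertex_first h hd x

omit [Finite D] in
theorem vertexOf_first_subset : (T.resolved S).vertexOf (Sum.inl d) ⊆ T.lift S W ↔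
    d ∈ W ∧ M.rot d ∈ W ∧ M.rot (M.rot (M.rot d)) ∈ W := by
  rw [vertexOf_first h hd, Set.insert_subset_iff, Set.insert_subset_iff, Set.singleton_subset_iff,
    T.inl_mem_lift, T.inl_mem_lift, lift, Set.mem_ofPred_eq, T.corner_bar h hd,
    M.rot_symm_of_crossing h]

omit [Finite D] in
theorem near_vertices : {v | (∃ x, v = (T.resolved S).vertexOf x ∧ M.SameVertex d (T.site x)) ∧
      v ⊆ T.lift S W}
    = {v | (v = (T.resolved S).vertexOf (Sum.inl d) ∨
        v = (T.resolved S).vertexOf (Sum.inl (M.rot (M.rot d)))) ∧ v ⊆ T.lift S W} := by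
  ext v
  refine and_congr_left fun _ => ⟨?_, ?_⟩
  · rintro ⟨x, rfl, hx⟩
    obtain ⟨e, he, hf, hxe, hx'⟩ := T.exists_first S x ((T.isCrossing_sameVertex hx).1 h)
    have h1 : (T.resolved S).vertexOf x = (T.resolved S).vertexOf (Sum.inl e) :=
      CellSurface.vertexOf_eq_iff.2 ((T.sameVertex_first he hf x).2 hx')
    rw [h1]
    have hne : ∀ y, T.turn S y = M.rot y → e ≠ M.rot y ∨ ¬ T.IsCrossing y := by
      intro y hy
      by_contra hcon
      push Not at hcon
      obtain ⟨rfl, hy'⟩ := hcon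
      exact (T.turn_rot S hy').1 hf hy
    rcases M.sameVertex_crossing h (hx.trans hxe) with rfl | rfl | rfl | rfl
    · exact Or.inl rfl
    · exact absurd rfl ((hne _ hd).resolve_right (not_not.2 h))
    · exact Or.inr rfl
    · exact absurd rfl ((hne _ (T.turn_opp S h hd)).resolve_right (not_not.2 (T.isCrossing_opp h)))
  · rintro (rfl | rfl)
    · exact ⟨_, rfl, CellSurface.SameVertex.refl _ _⟩
    · exact ⟨_, rfl, (M.sameVertex_rot _).trans (M.sameVertex_rot _)⟩

omit [Finite D] in
theorem near_vertices_empty (h1 : ¬ (d ∈ W ∧ M.rot d ∈ W ∧ M.rot (M.rot (M.rot d)) ∈ W))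
    (h2 : ¬ (M.rot (M.rot d) ∈ W ∧ M.rot (M.rot (M.rot d)) ∈ W ∧ M.rot d ∈ W)) :
    {v | (∃ x, v = (T.resolved S).vertexOf x ∧ M.SameVertex d (T.site x)) ∧
      v ⊆ T.lift S W} = ∅ := by
  rw [near_vertices h hd, Set.eq_empty_iff_forall_notMem]
  rintro _ ⟨rfl | rfl, hv⟩
  · exact h1 ((vertexOf_first_subset h hd).1 hv)
  · have := (vertexOf_first_subset (T.isCrossing_opp h) (T.turn_opp S h hd)).1 hv
    rw [show M.rot (M.rot (M.rot (M.rot d))) = d from h.2.2.2.2.2.2] at this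
    exact h2 this

omit [Finite D] in
theorem near_vertices_full (h0 : d ∈ W) (h1 : M.rot d ∈ W) (h2 : M.rot (M.rot d) ∈ W)
    (h3 : M.rot (M.rot (M.rot d)) ∈ W) :
    {v | (∃ x, v = (T.resolved S).vertexOf x ∧ M.SameVertex d (T.site x)) ∧
      v ⊆ T.lift S W}.ncard = 2 := by
  rw [near_vertices h hd, Set.ncard_eq_two]
  refine ⟨(T.resolved S).vertexOf (Sum.inl d),
    (T.resolved S).vertexOf (Sum.inl (M.rot (M.rot d))), fun he => ?_, ?_⟩
  · have := (T.sameVertex_first h hd _).1 (CellSurface.vertexOf_eq_iff.1 he.symm)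
    simp only [Sum.inl.injEq, reduceCtorEq, or_false] at this
    rcases this with h' | h'
    · exact h.2.2.2.2.2.1 h'
    · exact h.2.2.2.2.1 (M.rot.injective h')
  · ext v
    constructor
    · exact fun hv => hv.1
    · rintro (rfl | rfl)
      · exact ⟨Or.inl rfl, (vertexOf_first_subset h hd).2 ⟨h0, h1, h3⟩⟩
      · refine ⟨Or.inr rfl, (vertexOf_first_subset (T.isCrossing_opp h) (T.turn_opp S h hd)).2
          ⟨h2, h3, ?_⟩⟩
        rw [show M.rot (M.rot (M.rot (M.rot d))) = d from h.2.2.2.2.2.2]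
        exact h1

omit [Finite D] in
theorem near_edges : {v | (∃ x, v = (T.resolved S).edgeOf x ∧
      ∃ b : T.OverDart, x = Sum.inr b ∧ M.SameVertex d b.1) ∧ v ⊆ T.lift S W}.ncard
    = open Classical in if M.rot d ∈ W ∧ M.rot (M.rot (M.rot d)) ∈ W then 1 else 0 := by
  have hset : {v | (∃ x, v = (T.resolved S).edgeOf x ∧
      ∃ b : T.OverDart, x = Sum.inr b ∧ M.SameVertex d b.1) ∧ v ⊆ T.lift S W}
      = {v | v = (T.resolved S).edgeOf (Sum.inr (T.bar d h)) ∧ v ⊆ T.lift S W} := by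
    ext v
    refine and_congr_left fun _ => ⟨?_, ?_⟩
    · rintro ⟨_, rfl, b, rfl, hb⟩
      rw [CellSurface.edgeOf_eq_iff, T.resolved_rev_bar h]
      rcases bar_or h b hb with rfl | rfl
      exacts [Or.inl rfl, Or.inr rfl]
    · rintro rfl
      exact ⟨_, rfl, _, rfl, T.site_bar h⟩
  have hsub : (T.resolved S).edgeOf (Sum.inr (T.bar d h)) ⊆ T.lift S W ↔
      M.rot d ∈ W ∧ M.rot (M.rot (M.rot d)) ∈ W := by
    rw [CellSurface.edgeOf, Set.insert_subset_iff, Set.singleton_subset_iff, T.resolved_rev_bar h,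
      lift, Set.mem_ofPred_eq, Set.mem_ofPred_eq, T.corner_bar h hd,
      T.corner_bar (T.isCrossing_opp h) (T.turn_opp S h hd), M.rot_symm_of_crossing h,
      Equiv.symm_apply_apply, and_comm]
  rw [hset]
  split_ifs with hc
  · rw [Set.ncard_eq_one]
    exact ⟨_, Set.ext fun v => ⟨fun hv => hv.1, fun hv => ⟨hv, by
      rw [Set.mem_singleton_iff.1 hv]; exact hsub.2 hc⟩⟩⟩
  · rw [show {v | v = (T.resolved S).edgeOf (Sum.inr (T.bar d h)) ∧ v ⊆ T.lift S W} = ∅ from ?_,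
      Set.ncard_empty]
    rw [Set.eq_empty_iff_forall_notMem]
    rintro _ ⟨rfl, hv⟩
    exact hc (hsub.1 hv)

/-- The Euler characteristics of a region in two resolutions which differ at one crossing differ by
the contribution of this crossing. -/
theorem euler_flip : ∃ χ : ℤ,
    (T.resolved S).euler (T.lift S W) = χ
      + {v | (∃ x, v = (T.resolved S).vertexOf x ∧ M.SameVertex d (T.site x)) ∧
          v ⊆ T.lift S W}.ncard
      - (open Classical in if M.rot d ∈ W ∧ M.rot (M.rot (M.rot d)) ∈ W then 1 else 0) ∧
    (T.resolved (T.flip S (T.crossingOf d h))).euler (T.lift (T.flip S (T.crossingOf d h)) W) = χ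
      + {v | (∃ x, v = (T.resolved (T.flip S (T.crossingOf d h))).vertexOf x ∧
          M.SameVertex (M.rot d) (T.site x)) ∧ v ⊆ T.lift (T.flip S (T.crossingOf d h)) W}.ncard
      - (open Classical in if M.rot (M.rot d) ∈ W ∧ d ∈ W then 1 else 0) := by
  classical
  set S' := T.flip S (T.crossingOf d h) with hS'
  have hr := (T.isCrossing_rot d).2 h
  have hd' : T.turn S' (M.rot d) = M.rot (M.rot d) := turn_flip_rot h hd
  have hsr : ∀ y, M.SameVertex (M.rot d) y ↔ M.SameVertex d y := fun y =>
    ⟨(M.sameVertex_rot d).trans, (M.sameVertex_rot d).symm.trans⟩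
  have e1 := near_edges h hd (W := W)
  have e2 := near_edges hr hd' (W := W)
  rw [show M.rot (M.rot (M.rot (M.rot d))) = d from h.2.2.2.2.2.2] at e2
  simp only [hsr] at e2 ⊢
  have sv : ∀ S : T.Resolution, ∀ x y, (T.resolved S).vertexOf x = (T.resolved S).vertexOf y →
      M.SameVertex d (T.site x) → M.SameVertex d (T.site y) := fun S x y hxy hx =>
    hx.trans (T.site_sameVertex (CellSurface.vertexOf_eq_iff.1 hxy.symm))
  have se : ∀ S : T.Resolution, ∀ x y, (T.resolved S).edgeOf x = (T.resolved S).edgeOf y →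
      (∃ b : T.OverDart, x = Sum.inr b ∧ M.SameVertex d b.1) →
      ∃ b : T.OverDart, y = Sum.inr b ∧ M.SameVertex d b.1 := by
    rintro S _ y hxy ⟨b, rfl, hb⟩
    rcases CellSurface.edgeOf_eq_iff.1 hxy.symm with rfl | rfl
    · exact ⟨b, rfl, hb⟩
    · exact ⟨_, rfl, hb.trans ((M.sameVertex_rot _).trans (M.sameVertex_rot _))⟩
  -- the vertices and edges away from the crossing are the same in both resolutions
  have v1 : {v | (∃ x, v = (T.resolved S').vertexOf x ∧ ¬ M.SameVertex d (T.site x)) ∧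
      v ⊆ T.lift S' W} = {v | (∃ x, v = (T.resolved S).vertexOf x ∧ ¬ M.SameVertex d (T.site x)) ∧
      v ⊆ T.lift S W} := by
    have key : ∀ x, ¬ M.SameVertex d (T.site x) →
        ((T.resolved S).vertexOf x ⊆ T.lift S' W ↔ (T.resolved S).vertexOf x ⊆ T.lift S W) := by
      intro x hx
      have : ∀ y ∈ (T.resolved S).vertexOf x, (y ∈ T.lift S' W ↔ y ∈ T.lift S W) := by
        intro y hy
        have hy' : ¬ M.SameVertex d (T.site y) := fun h' => hx (h'.trans (T.site_sameVertex hy).symm)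
        rw [lift, lift, Set.mem_ofPred_eq, Set.mem_ofPred_eq, hS', corner_flip_away h hy']
      exact ⟨fun hs y hy => (this y hy).1 (hs hy), fun hs y hy => (this y hy).2 (hs hy)⟩
    ext v
    constructor
    · rintro ⟨⟨x, rfl, hx⟩, hv⟩
      rw [hS', vertexOf_flip_away h hx] at hv ⊢
      exact ⟨⟨x, rfl, hx⟩, (key x hx).1 hv⟩
    · rintro ⟨⟨x, rfl, hx⟩, hv⟩
      exact ⟨⟨x, by rw [hS', vertexOf_flip_away h hx], hx⟩, (key x hx).2 hv⟩
  have e3 : {v | (∃ x, v = (T.resolved S').edgeOf x ∧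
        ¬ ∃ b : T.OverDart, x = Sum.inr b ∧ M.SameVertex d b.1) ∧ v ⊆ T.lift S' W}
      = {v | (∃ x, v = (T.resolved S).edgeOf x ∧
        ¬ ∃ b : T.OverDart, x = Sum.inr b ∧ M.SameVertex d b.1) ∧ v ⊆ T.lift S W} := by
    ext v
    refine and_congr_right ?_
    rintro ⟨x, rfl, hx⟩
    have key : ∀ y : D ⊕ T.OverDart, (¬ ∃ b : T.OverDart, y = Sum.inr b ∧ M.SameVertex d b.1) →
        (y ∈ T.lift S' W ↔ y ∈ T.lift S W) := by
      rintro (y | b) hy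
      · rfl
      · have hb : ¬ M.SameVertex d (T.site (Sum.inr b)) := fun h' => hy ⟨b, rfl, h'⟩
        rw [lift, lift, Set.mem_ofPred_eq, Set.mem_ofPred_eq, hS', corner_flip_away h hb]
    have hx' : ¬ ∃ b : T.OverDart, (T.resolved S).rev x = Sum.inr b ∧ M.SameVertex d b.1 := by
      intro hx'
      exact hx (se S _ x (CellSurface.edgeOf_eq_iff.2 (Or.inr rfl)) hx')
    have heq : (T.resolved S').edgeOf x = (T.resolved S).edgeOf x := rfl
    rw [heq, CellSurface.edgeOf, Set.insert_subset_iff, Set.singleton_subset_iff,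
      Set.insert_subset_iff, Set.singleton_subset_iff, key x hx, key _ hx']
  refine ⟨{v | (∃ x, v = (T.resolved S).vertexOf x ∧ ¬ M.SameVertex d (T.site x)) ∧
      v ⊆ T.lift S W}.ncard - {v | (∃ x, v = (T.resolved S).edgeOf x ∧
        ¬ ∃ b : T.OverDart, x = Sum.inr b ∧ M.SameVertex d b.1) ∧ v ⊆ T.lift S W}.ncard
      + {f | (∃ d, f = M.faceOf d) ∧ f ⊆ W}.ncard, ?_, ?_⟩
  · rw [CellSurface.euler, T.ncard_faces_lift, ncard_classes_split (sv S),
      ncard_classes_split (se S), e1]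
    push_cast
    ring
  · rw [CellSurface.euler, T.ncard_faces_lift, ncard_classes_split (sv S'),
      ncard_classes_split (se S'), e2, v1, e3]
    push_cast
    ring

theorem euler_flip_of_iff (h1 : M.rot d ∈ W ↔ d ∈ W) (h2 : M.rot (M.rot d) ∈ W ↔ d ∈ W)
    (h3 : M.rot (M.rot (M.rot d)) ∈ W ↔ d ∈ W) :
    (T.resolved (T.flip S (T.crossingOf d h))).euler (T.lift (T.flip S (T.crossingOf d h)) W)
      = (T.resolved S).euler (T.lift S W) := by
  have hr := (T.isCrossing_rot d).2 h
  have hd' := turn_flip_rot h hd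
  have h4 : M.rot (M.rot (M.rot (M.rot d))) = d := h.2.2.2.2.2.2
  obtain ⟨χ, e1, e2⟩ := euler_flip h (W := W) hd
  rw [e1, e2]
  by_cases hW : d ∈ W
  · rw [near_vertices_full h hd hW (h1.2 hW) (h2.2 hW) (h3.2 hW),
      near_vertices_full hr hd' (h1.2 hW) (h2.2 hW) (h3.2 hW) (h4.symm ▸ hW)]
    simp [h1, h2, h3, hW]
  · rw [near_vertices_empty h hd (by tauto) (by tauto),
      near_vertices_empty hr hd' (by rw [h4]; tauto) (by rw [h4]; tauto)]
    simp [h1, h2, hW]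

theorem euler_flip_of_merge (h0 : d ∈ W) (h1 : M.rot d ∉ W) (h2 : M.rot (M.rot d) ∈ W)
    (h3 : M.rot (M.rot (M.rot d)) ∉ W) :
    (T.resolved (T.flip S (T.crossingOf d h))).euler (T.lift (T.flip S (T.crossingOf d h)) W)
      = (T.resolved S).euler (T.lift S W) - 1 := by
  have hr := (T.isCrossing_rot d).2 h
  have hd' := turn_flip_rot h hd
  have h4 : M.rot (M.rot (M.rot (M.rot d))) = d := h.2.2.2.2.2.2
  obtain ⟨χ, e1, e2⟩ := euler_flip h (W := W) hd
  rw [e1, e2]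
  rw [near_vertices_empty h hd (by tauto) (by tauto),
    near_vertices_empty hr hd' (by rw [h4]; tauto) (by rw [h4]; tauto)]
  simp [h0, h1, h2]

end Count

end Flip

end TangleDiagram

/-! ### Regions of Euler characteristic one are discs -/

section Orbits

variable {α : Type*} [Finite α] (σ : Equiv.Perm α) (x : α)

omit [Finite α] in
theorem nodup_iterate {n : ℕ} (h : n ≤ Function.minimalPeriod σ x) :
    (List.iterate σ x n).Nodup := by
  rw [← List.range_map_iterate]
  refine List.Nodup.map_on ?_ List.nodup_range
  intro i hi j hj hij
  exact Function.iterate_injOn_Iio_minimalPeriod (Set.mem_Iio.2 ((List.mem_range.1 hi).trans_le h))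
    (Set.mem_Iio.2 ((List.mem_range.1 hj).trans_le h)) hij

theorem minimalPeriod_pos : 0 < Function.minimalPeriod σ x := by
  obtain ⟨n, hn, hx⟩ := σ.injective.mem_periodicPts x
  exact Function.IsPeriodicPt.minimalPeriod_pos hn hx

theorem sameCycle_iff_mem_iterate (y : α) :
    σ.SameCycle x y ↔ y ∈ List.iterate σ x (Function.minimalPeriod σ x) := by
  rw [← List.range_map_iterate, List.mem_map]
  constructor
  · intro h
    obtain ⟨n, hn⟩ := h.exists_pow_eq''
    obtain ⟨-, -, hn⟩ := hn
    refine ⟨n % Function.minimalPeriod σ x,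
      List.mem_range.2 (Nat.mod_lt _ (minimalPeriod_pos σ x)), ?_⟩
    rw [Function.iterate_mod_minimalPeriod_eq, ← hn, Equiv.Perm.iterate_eq_pow]
  · rintro ⟨n, -, rfl⟩
    exact ⟨n, by rw [zpow_natCast, Equiv.Perm.iterate_eq_pow]⟩

theorem ncard_sameCycle : {y | σ.SameCycle x y}.ncard = Function.minimalPeriod σ x := by
  classical
  have h := nodup_iterate σ x le_rfl
  rw [show {y | σ.SameCycle x y} =
    ((List.iterate σ x (Function.minimalPeriod σ x)).toFinset : Set α) from ?_,
    Set.ncard_coe_finset, List.toFinset_card_of_nodup h, List.length_iterate]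
  ext y
  rw [List.coe_toFinset]
  exact sameCycle_iff_mem_iterate σ x y

end Orbits

namespace CellSurface

variable {D : Type*} [Finite D] {M : CellSurface D}

theorem faceWord_eq (d : D) :
    M.faceWord d = List.iterate M.face d (Function.minimalPeriod M.face d) := by
  rw [faceWord, faceOf, ncard_sameCycle, ← List.range_map_iterate]
  simp only [Equiv.Perm.iterate_eq_pow]

theorem mem_faceWord {d e : D} : e ∈ M.faceWord d ↔ e ∈ M.faceOf d := by
  rw [faceWord_eq]
  exact (sameCycle_iff_mem_iterate _ _ _).symm

theorem nodup_faceWord (d : D) : (M.faceWord d).Nodup := by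
  rw [faceWord_eq]
  exact nodup_iterate _ _ le_rfl

omit [Finite D] in
theorem isWalk_iterate (d : D) (n : ℕ) :
    IsWalk M.rev M.vertexOf (M.vertexOf d) (List.iterate M.face d n)
      (M.vertexOf (M.face^[n] d)) := by
  induction n generalizing d with
  | zero => rfl
  | succ n ih =>
    rw [List.iterate, Function.iterate_succ_apply]
    refine ⟨rfl, ?_⟩
    rw [show M.vertexOf (M.rev d) = M.vertexOf (M.face d) from
      (vertexOf_eq_iff.2 (M.sameVertex_rot_symm (M.rev d))).symm]
    exact ih _

theorem isWalk_faceWord (d : D) :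
    IsWalk M.rev M.vertexOf (M.vertexOf d) (M.faceWord d) (M.vertexOf d) := by
  have := isWalk_iterate (M := M) d (Function.minimalPeriod M.face d)
  rwa [Function.iterate_minimalPeriod, ← faceWord_eq] at this

variable {A : Set D} (hA : M.FaceClosed A)

include hA

omit [Finite D] in
theorem vertices_eq : {v | (∃ d, v = M.vertexOf d) ∧ v ⊆ A} = innerVertices M.rev M.vertexOf A := by
  ext v
  constructor
  · rintro ⟨⟨d, rfl⟩, h⟩
    refine ⟨⟨d, h (mem_vertexOf_self d), rfl⟩, fun x hx hx' => ⟨fun he => ?_, fun he => ?_⟩⟩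
    · refine hx' ((hA.rev_mem_iff x).2 (h ?_))
      rw [← he]
      exact M.sameVertex_rot_symm x
    · refine hx' (h ?_)
      rw [← he]
      exact mem_vertexOf_self _
  · rintro ⟨⟨d, hd, rfl⟩, h⟩
    refine ⟨⟨d, rfl⟩, fun e he => ?_⟩
    refine (vertex_iff hA (he : M.SameVertex d e) fun x hx hdx => ?_).1 hd
    by_cases hxA : x ∈ A
    · have hx' : M.rev x ∉ A := fun h' => hx ⟨fun _ => h', fun _ => hxA⟩
      exact (h x hxA hx').1 (vertexOf_eq_iff.2 hdx)
    · have hx' : M.rev x ∈ A := by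
        by_contra h'
        exact hx ⟨fun h => absurd h hxA, fun h => absurd h h'⟩
      refine (h _ hx' ?_).2 ?_
      · rwa [M.rev_rev]
      · rw [M.rev_rev]
        exact vertexOf_eq_iff.2 hdx

omit hA in
theorem two_mul_edges : 2 * {e | (∃ d, e = M.edgeOf d) ∧ e ⊆ A}.ncard
    = (innerDarts M.rev A).ncard := by
  rw [← ncard_image_pairs (f := M.edgeOf) (Γ := innerDarts M.rev A) (m := M.rev)
    (fun x hx => ⟨hx.2, by rw [M.rev_rev]; exact hx.1⟩) (fun x _ => M.rev_ne x)
    (fun x _ y _ => edgeOf_eq_iff)]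
  congr 2
  ext e
  constructor
  · rintro ⟨⟨d, rfl⟩, h⟩
    exact ⟨d, ⟨h (Or.inl rfl), h (Or.inr rfl)⟩, rfl⟩
  · rintro ⟨d, hd, rfl⟩
    refine ⟨⟨d, rfl⟩, ?_⟩
    rintro x (rfl | rfl)
    exacts [hd.1, hd.2]

/-- A connected region with nonempty frontier has Euler characteristic at most `1`; if it is `1`, then
each property of edge loops which holds for the boundaries of the 2-cells in the region and is
inherited under gluing holds for the boundary of the region. -/
theorem euler_le_one {R : Set D → List D → Prop}
    (hR : ∀ a w, R a w → IsWalk M.rev M.vertexOf a w a)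
    (hrot : ∀ a b u v, IsWalk M.rev M.vertexOf a u b → IsWalk M.rev M.vertexOf b v a →
      R a (u ++ v) → R b (v ++ u))
    (hleaf : ∀ a x w, R a (x :: M.rev x :: w) → R a w)
    (hglue : ∀ x u v, R (M.vertexOf x) (x :: u) → R (M.vertexOf (M.rev x)) (M.rev x :: v) →
      R (M.vertexOf (M.rev x)) (u ++ v))
    (hface : ∀ d ∈ A, R (M.vertexOf d) (M.faceWord d))
    (hc : ∀ d ∈ A, ∀ e ∈ A, M.Linked A d e) (hfr : (M.frontier A).Nonempty) :
    M.euler A ≤ 1 ∧ (M.euler A = 1 →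
      ∃ b w, R b w ∧ w.Nodup ∧ ∀ x, x ∈ w ↔ x ∈ A ∧ M.rev x ∉ A) := by
  classical
  set F : Set (Set D) := {f | (∃ d, f = M.faceOf d) ∧ f ⊆ A} with hF
  have hFfin : F.Finite := Set.toFinite _
  have hrep : ∀ f ∈ F, ∃ d, f = M.faceOf d := fun f hf => hf.1
  obtain ⟨x₀, hx₀, hx₀'⟩ : ∃ x ∈ A, M.rev x ∉ A := by
    obtain ⟨x, hx⟩ := hfr
    by_cases h : x ∈ A
    · exact ⟨x, h, fun h' => hx ⟨fun _ => h', fun _ => h⟩⟩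
    · refine ⟨M.rev x, ?_, by rwa [M.rev_rev]⟩
      by_contra h'
      exact hx ⟨fun h2 => absurd h2 h, fun h2 => absurd h2 h'⟩
  have : Nonempty D := ⟨x₀⟩
  choose! rep hrep using hrep
  -- the boundary words of the 2-cells in the region
  set L : List (List D) := hFfin.toFinset.toList.map (fun f => M.faceWord (rep f)) with hL
  have hLlen : L.length = F.ncard := by
    rw [hL, List.length_map, Finset.length_toList, Set.ncard_eq_toFinset_card F hFfin]
  have hmemL : ∀ w, w ∈ L ↔ ∃ f ∈ F, w = M.faceWord (rep f) := by
    intro w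
    rw [hL, List.mem_map]
    simp only [Finset.mem_toList, Set.Finite.mem_toFinset]
    exact ⟨fun ⟨f, h1, h2⟩ => ⟨f, h1, h2.symm⟩, fun ⟨f, h1, h2⟩ => ⟨f, h1, h2.symm⟩⟩
  have hwf : ∀ f ∈ F, ∀ x, x ∈ M.faceWord (rep f) ↔ x ∈ f := by
    intro f hf x
    rw [mem_faceWord, ← hrep f hf]
  have hflat : ∀ x, x ∈ L.flatten ↔ x ∈ A := by
    intro x
    rw [List.mem_flatten]
    constructor
    · rintro ⟨w, hw, hx⟩
      obtain ⟨f, hf, rfl⟩ := (hmemL w).1 hw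
      exact hf.2 ((hwf f hf x).1 hx)
    · intro hx
      have hf : M.faceOf x ∈ F := ⟨⟨x, rfl⟩, hA.faceOf_subset hx⟩
      exact ⟨_, (hmemL _).2 ⟨_, hf, rfl⟩, (hwf _ hf x).2 (mem_faceOf_self x)⟩
  have hset : {x | x ∈ L.flatten} = A := Set.ext hflat
  have hsame : ∀ f ∈ F, ∀ g ∈ F, ∀ x, x ∈ f → x ∈ g → f = g := by
    rintro _ ⟨⟨d, rfl⟩, -⟩ _ ⟨⟨e, rfl⟩, -⟩ x hx hx'
    ext y
    have hx : M.face.SameCycle d x := hx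
    have hx' : M.face.SameCycle e x := hx'
    exact ⟨fun hy => (hx'.trans hx.symm).trans hy, fun hy => (hx.trans hx'.symm).trans hy⟩
  have hnd : L.flatten.Nodup := by
    rw [List.nodup_flatten]
    constructor
    · intro w hw
      obtain ⟨f, -, rfl⟩ := (hmemL w).1 hw
      exact nodup_faceWord _
    · rw [hL, List.pairwise_map]
      refine List.Pairwise.imp_of_mem ?_ (Finset.nodup_toList _)
      intro f g hf hg hne x hx hx'
      rw [Finset.mem_toList, Set.Finite.mem_toFinset] at hf hg
      exact hne (hsame f hf g hg x ((hwf f hf x).1 hx) ((hwf g hg x).1 hx'))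
  have hw : ∀ w ∈ L, w ≠ [] ∧ ∃ a, R a w := by
    intro w hw
    obtain ⟨f, hf, rfl⟩ := (hmemL w).1 hw
    have h1 : rep f ∈ M.faceWord (rep f) := mem_faceWord.2 (mem_faceOf_self _)
    exact ⟨List.ne_nil_of_mem h1, _, hface _ (hf.2 ((hwf f hf _).1 h1))⟩
  obtain ⟨n, hn⟩ : ∃ n, F.ncard = n + 1 := by
    refine Nat.exists_eq_succ_of_ne_zero fun h0 => ?_
    rw [Set.ncard_eq_zero] at h0
    have : M.faceOf x₀ ∈ F := ⟨⟨x₀, rfl⟩, hA.faceOf_subset hx₀⟩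
    rw [h0] at this
    exact this
  obtain ⟨i1, i2⟩ := polygons (src := M.vertexOf) M.rev_rev M.rev_ne hR hrot hleaf hglue n L
    (hLlen.trans hn) hw hnd ⟨x₀, (hflat _).2 hx₀, fun h => hx₀' ((hflat _).1 h)⟩ (by
      intro Q h1 h2 x hx hQ y hy
      rw [hflat] at hx hy
      refine (Linked.mem_iff (P := {x | Q x}) (fun z hz => ?_) (hc x hx y hy)).1 hQ
      have hf : M.faceOf z ∈ F := ⟨⟨z, rfl⟩, hA.faceOf_subset hz⟩
      have m1 := (hwf _ hf z).2 (mem_faceOf_self z)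
      have m2 := (hwf _ hf (M.face z)).2
        (Equiv.Perm.sameCycle_apply_right.2 (Equiv.Perm.SameCycle.refl _ _))
      have hwL := (hmemL _).2 ⟨_, hf, rfl⟩
      refine ⟨⟨h1 _ hwL _ m2 _ m1, h1 _ hwL _ m1 _ m2⟩, fun hz' => ⟨fun h => ?_, ?_⟩⟩
      · have := h2 _ ((hflat _).2 hz') (by rw [M.rev_rev]; exact (hflat _).2 hz) h
        rwa [M.rev_rev] at this
      · exact h2 _ ((hflat _).2 hz) ((hflat _).2 hz'))
  rw [hset] at i1 i2
  have hV := vertices_eq hA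
  have hE := two_mul_edges (M := M) (A := A)
  simp only [hflat] at i2
  -- the count of darts and vertices in terms of the Euler characteristic
  have hχ : M.euler A = ((innerVertices M.rev M.vertexOf A).ncard : ℤ)
      - ({e | (∃ d, e = M.edgeOf d) ∧ e ⊆ A}.ncard : ℤ) + (n + 1) := by
    rw [euler, hV, ← hF, hn]
    push_cast
    ring
  refine ⟨by omega, fun h1 => i2 (by omega)⟩

end CellSurface

/-! ### Contractible circles at a saddle -/

theorem CellSurface.IsComponent.mem_iff_mem {D : Type*} {M : CellSurface D} {Z : Set D}
    (hZ : M.IsComponent Z) {P : Set D}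
    (hP : ∀ x ∈ Z, (M.face x ∈ P ↔ x ∈ P) ∧ (M.rev x ∈ P ↔ x ∈ P)) {x y : D} (hx : x ∈ Z)
    (hy : y ∈ Z) : x ∈ P ↔ y ∈ P :=
  Linked.mem_iff (fun z hz => ⟨(hP z hz).1, fun _ => (hP z hz).2⟩) (hZ.linked x hx y hy)

theorem union_sdiff_union {α : Type*} {U V Z : Set α} (hV : V ⊆ Z) (h : Disjoint U V) :
    V ∪ Z \ (U ∪ V) = Z \ U := by
  ext x
  have h1 := @hV x
  have h2 : x ∈ U → x ∉ V := fun hx => Set.disjoint_left.1 h hx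
  simp only [Set.mem_union, Set.mem_sdiff]
  tauto

theorem not_iff_or {a b a' b' : Prop} (h1 : a → ¬ b) (h2 : a' → ¬ b')
    (h3 : ¬ (¬ (a ↔ a') ∧ ¬ (b ↔ b'))) :
    ¬ (a ∨ b ↔ a' ∨ b') ↔ ¬ (a ↔ a') ∨ ¬ (b ↔ b') := by
  by_cases a <;> by_cases b <;> by_cases a' <;> by_cases b' <;> simp_all

namespace TangleDiagram

variable {D : Type*} {M : CellSurface D} {T : TangleDiagram M} {S S' : T.Resolution}

/-- The region `W` of the component `Z` of the surface is one side of the circle `C`. -/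
structure Side (S : T.Resolution) (Z W : Set D) (C : T.Component S) : Prop where
  closed : M.FaceClosed W
  sub : W ⊆ Z
  front : (T.resolved S).frontier (T.lift S W) = T.circleDarts S C

/-- A region without holes and of Euler characteristic `1`. -/
def IsDisc (S : T.Resolution) (W : Set D) : Prop :=
  (T.resolved S).euler (T.lift S W) = 1 ∧ Disjoint W M.hole

variable {Z W W' : Set D} {C : T.Component S}

theorem circleDarts_nonempty (C : T.Component S) : (T.circleDarts S C).Nonempty := by
  obtain ⟨d, rfl⟩ := Quot.exists_rep C
  exact ⟨_, d, rfl, rfl⟩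

namespace Side

theorem front_inl (h : Side S Z W C) (d : T.strand) :
    ¬ (d.1 ∈ W ↔ M.rev d.1 ∈ W) ↔ T.comp S d = C := by
  rw [← T.inl_mem_circleDarts, ← h.front]
  rfl

theorem front_off (h : Side S Z W C) {d : D} (hd : d ∉ T.strand) : d ∈ W ↔ M.rev d ∈ W := by
  by_contra h'
  have : Sum.inl d ∈ (T.resolved S).frontier (T.lift S W) := h'
  rw [h.front] at this
  obtain ⟨e, -, he⟩ := this
  exact hd (by rw [Sum.inl_injective he]; exact e.2)

theorem front_inr (h : Side S Z W C) (b : T.OverDart) :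
    T.corner S (Sum.inr b) ∈ W ↔ T.corner S ((T.resolved S).rev (Sum.inr b)) ∈ W := by
  by_contra h'
  have : Sum.inr b ∈ (T.resolved S).frontier (T.lift S W) := h'
  rw [h.front] at this
  obtain ⟨e, -, he⟩ := this
  simp at he

theorem mk' (h1 : M.FaceClosed W) (h2 : W ⊆ Z)
    (h3 : ∀ d : T.strand, ¬ (d.1 ∈ W ↔ M.rev d.1 ∈ W) ↔ T.comp S d = C)
    (h4 : ∀ d ∉ T.strand, (d ∈ W ↔ M.rev d ∈ W))
    (h5 : ∀ b : T.OverDart, T.corner S (Sum.inr b) ∈ W ↔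
      T.corner S ((T.resolved S).rev (Sum.inr b)) ∈ W) : Side S Z W C := by
  refine ⟨h1, h2, Set.ext ?_⟩
  rintro (d | b)
  · by_cases hd : d ∈ T.strand
    · exact (h3 ⟨d, hd⟩).trans (T.inl_mem_circleDarts (d := ⟨d, hd⟩)).symm
    · refine iff_of_false (fun h => h (h4 d hd)) ?_
      rintro ⟨e, -, he⟩
      exact hd (by rw [Sum.inl_injective he]; exact e.2)
  · refine iff_of_false (fun h => h (h5 b)) ?_
    rintro ⟨e, -, he⟩
    simp at he

theorem diff (hZ : M.IsComponent Z) (h : Side S Z W C) : Side S Z (Z \ W) C :=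
  ⟨hZ.faceClosed.diff h.closed, Set.sdiff_subset, by
    rw [← h.front]
    exact (T.isComponent_lift hZ).frontier_diff (T.lift_subset_iff.2 h.sub)⟩

theorem unique (hZ : M.IsComponent Z) (h : Side S Z W C) (h' : Side S Z W' C) :
    W' = W ∨ W' = Z \ W := by
  have hP : ∀ x ∈ T.lift S Z, ((T.resolved S).face x ∈ {x | x ∈ T.lift S W ↔ x ∈ T.lift S W'} ↔
        x ∈ {x | x ∈ T.lift S W ↔ x ∈ T.lift S W'}) ∧
      ((T.resolved S).rev x ∈ {x | x ∈ T.lift S W ↔ x ∈ T.lift S W'} ↔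
        x ∈ {x | x ∈ T.lift S W ↔ x ∈ T.lift S W'}) := by
    intro x _
    refine ⟨iff_congr (T.faceClosed_lift h.closed x) (T.faceClosed_lift h'.closed x), ?_⟩
    have e : x ∈ (T.resolved S).frontier (T.lift S W) ↔
      x ∈ (T.resolved S).frontier (T.lift S W') := by rw [h.front, h'.front]
    simp only [CellSurface.frontier, Set.mem_ofPred_eq] at e ⊢
    tauto
  by_cases hex : ∃ x ∈ Z, (x ∈ W ↔ x ∈ W')
  · left
    obtain ⟨x, hx, hxW⟩ := hex
    ext y
    by_cases hy : y ∈ Z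
    · exact (((T.isComponent_lift hZ).mem_iff_mem hP (x := Sum.inl x) (y := Sum.inl y) hx hy).1
        hxW).symm
    · exact iff_of_false (fun h1 => hy (h'.sub h1)) (fun h1 => hy (h.sub h1))
  · right
    push Not at hex
    ext y
    have h1 := hex y
    have h2 := @Side.sub _ _ _ _ _ _ _ h' y
    rw [Set.mem_sdiff]
    tauto

variable [Finite D]

theorem linked (hZ : M.IsComponent Z) (hC : ¬ T.IsArc C) (h : Side S Z W C) :
    ∀ x ∈ T.lift S W, ∀ y ∈ T.lift S W, (T.resolved S).Linked (T.lift S W) x y :=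
  CellSurface.linked_of_circuit (T.isComponent_lift hZ) (T.circuit hC)
    (T.faceClosed_lift h.closed) (T.lift_subset_iff.2 h.sub) h.front (circleDarts_nonempty C)

theorem euler_add (hZ : M.IsComponent Z) (hC : ¬ T.IsArc C) (h : Side S Z W C) :
    (T.resolved S).euler (T.lift S W) + (T.resolved S).euler (T.lift S (Z \ W))
      = (T.resolved S).euler (T.lift S Z) :=
  CellSurface.euler_add_diff (T.isComponent_lift hZ) (T.circuit hC)
    (T.faceClosed_lift h.closed) (T.lift_subset_iff.2 h.sub) h.front

theorem euler_le (hZ : M.IsComponent Z) (hC : ¬ T.IsArc C) (h : Side S Z W C) :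
    (T.resolved S).euler (T.lift S W) ≤ 1 := by
  refine (CellSurface.euler_le_one (T.faceClosed_lift h.closed)
    (R := fun a w => IsWalk (T.resolved S).rev (T.resolved S).vertexOf a w a)
    (fun _ _ h => h) (fun a b u v h1 h2 _ => h2.append h1) ?_ ?_
    (fun d _ => CellSurface.isWalk_faceWord d) (h.linked hZ hC)
    (h.front ▸ circleDarts_nonempty C)).1
  · rintro a x w ⟨rfl, -, h⟩
    rwa [(T.resolved S).rev_rev] at h
  · rintro x u v ⟨-, h1⟩ ⟨-, h2⟩
    rw [(T.resolved S).rev_rev] at h2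
    exact h1.append h2

omit [Finite D] in
theorem nonempty (h : Side S Z W C) : (T.lift S W).Nonempty := by
  obtain ⟨x, hx⟩ := circleDarts_nonempty C
  rw [← h.front] at hx
  by_contra h0
  rw [Set.not_nonempty_iff_eq_empty] at h0
  refine hx ?_
  rw [h0]
  exact Iff.rfl

theorem bounds (hZ : M.IsComponent Z) (hC : ¬ T.IsArc C) (h : Side S Z W C) (hd : T.IsDisc S W) :
    T.Contractible C :=
  ⟨T.lift S W, T.faceClosed_lift h.closed, T.disjoint_hole_lift.2 hd.2, h.nonempty,
    h.linked hZ hC, fun x => by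
      rw [show (¬ (x ∈ T.lift S W ↔ (T.resolved S).rev x ∈ T.lift S W)) ↔ x ∈ T.circleDarts S C from
        by rw [← h.front]; rfl]
      rfl, hd.1⟩

end Side

theorem Contractible.exists_side (hZ : M.IsComponent Z) {d : T.strand} (hd : d.1 ∈ Z)
    (hC : T.comp S d = C) (h : T.Contractible C) : ∃ W, Side S Z W C ∧ T.IsDisc S W := by
  obtain ⟨A, h1, h2, h3, h4, h5, h6⟩ := h
  obtain ⟨hW, hA⟩ := T.faceClosed_of_resolved h1
  set W := {d | Sum.inl d ∈ A}
  have hfr : (T.resolved S).frontier A = T.circleDarts S C :=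
    Set.ext fun x => (h5 x).symm
  have hsub : A ⊆ T.lift S Z := by
    have hdA : Sum.inl d.1 ∈ (T.resolved S).frontier A := by
      rw [hfr, T.inl_mem_circleDarts, hC]
    by_cases hd' : Sum.inl d.1 ∈ A
    · exact (T.isComponent_lift hZ).subset_of_linked h4 hd' hd
    · have : Sum.inl (M.rev d.1) ∈ A := by
        by_contra h'
        exact hdA ⟨fun h => absurd h hd', fun h => absurd h h'⟩
      exact (T.isComponent_lift hZ).subset_of_linked h4 this (hZ.rev_mem _ hd)
  rw [hA] at h2 h6 hfr hsub
  exact ⟨W, ⟨hW, T.lift_subset_iff.1 hsub, hfr⟩, h6, T.disjoint_hole_lift.1 h2⟩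

variable [Finite D]

/-- A circle is contractible if and only if one of its two sides is a disc. -/
theorem Side.contractible_iff (hZ : M.IsComponent Z) (hC : ¬ T.IsArc C) (h : Side S Z W C)
    {d : T.strand} (hd : d.1 ∈ Z) (hdC : T.comp S d = C) :
    T.Contractible C ↔ T.IsDisc S W ∨ T.IsDisc S (Z \ W) := by
  constructor
  · intro hc
    obtain ⟨W', h1, h2⟩ := hc.exists_side hZ hd hdC
    rcases h.unique hZ h1 with rfl | rfl
    exacts [Or.inl h2, Or.inr h2]
  · rintro (h1 | h1)
    · exact h.bounds hZ hC h1
    · exact (h.diff hZ).bounds hZ hC h1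

section Saddle

variable {p : D} (h : T.IsCrossing p) (hp : T.turn S p = M.rot p)
  (hS' : S' = T.flip S (T.crossingOf p h))

omit [Finite D] in
/-- A dart of a crossing belongs to the circle if and only if the corners before and after it are on
different sides. -/
theorem Side.corner_iff (hW : Side S Z W C) {e : D} (he : T.IsCrossing e) :
    T.comp S ⟨e, he.1⟩ = C ↔ ¬ (e ∈ W ↔ M.rot.symm e ∈ W) := by
  rw [← hW.front_inl ⟨e, he.1⟩, hW.closed.rev_mem_iff]

omit [Finite D] in
include hp hS' in
theorem corner_saddle (b : T.OverDart) (hb : M.SameVertex p b.1) :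
    (T.corner S' (Sum.inr b) = p ∧
      T.corner S' ((T.resolved S').rev (Sum.inr b)) = M.rot (M.rot p)) ∨
    (T.corner S' (Sum.inr b) = M.rot (M.rot p) ∧
      T.corner S' ((T.resolved S').rev (Sum.inr b)) = p) := by
  subst hS'
  have hr := (T.isCrossing_rot p).2 h
  have hp' := turn_flip_rot h hp
  have c1 := T.corner_bar hr hp'
  have c2 := T.corner_bar (T.isCrossing_opp hr) (T.turn_opp _ hr hp')
  have c3 := T.resolved_rev_bar (S := T.flip S (T.crossingOf p h)) hr
  have c4 := T.resolved_rev_bar (S := T.flip S (T.crossingOf p h)) (T.isCrossing_opp hr)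
  have h4 : M.rot (M.rot (M.rot (M.rot p))) = p := h.2.2.2.2.2.2
  simp only [h4] at c4
  rw [Equiv.symm_apply_apply] at c1 c2
  rcases bar_or hr b ((M.sameVertex_rot p).symm.trans hb) with rfl | rfl
  · exact Or.inl ⟨c1, by rw [c3, c2]⟩
  · exact Or.inr ⟨c2, by rw [c4, c1]⟩

omit [Finite D] in
include h hp in
theorem corner_saddle' (b : T.OverDart) (hb : M.SameVertex p b.1) :
    (T.corner S (Sum.inr b) = M.rot p ∧
      T.corner S ((T.resolved S).rev (Sum.inr b)) = M.rot (M.rot (M.rot p))) ∨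
    (T.corner S (Sum.inr b) = M.rot (M.rot (M.rot p)) ∧
      T.corner S ((T.resolved S).rev (Sum.inr b)) = M.rot p) := by
  have c1 := T.corner_bar h hp
  have c2 := T.corner_bar (T.isCrossing_opp h) (T.turn_opp _ h hp)
  have c3 := T.resolved_rev_bar (S := S) h
  have c4 := T.resolved_rev_bar (S := S) (T.isCrossing_opp h)
  have h4 : M.rot (M.rot (M.rot (M.rot p))) = p := h.2.2.2.2.2.2
  simp only [h4] at c4
  rw [M.rot_symm_of_crossing h] at c1
  rw [Equiv.symm_apply_apply] at c2
  rcases bar_or h b hb with rfl | rfl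
  · exact Or.inr ⟨c1, by rw [c3, c2]⟩
  · exact Or.inl ⟨c2, by rw [c4, c1]⟩

omit [Finite D] in
include hS' in
theorem corner_off (b : T.OverDart) (hb : ¬ M.SameVertex p b.1) :
    T.corner S' (Sum.inr b) = T.corner S (Sum.inr b) ∧
      T.corner S' ((T.resolved S').rev (Sum.inr b))
        = T.corner S ((T.resolved S).rev (Sum.inr b)) := by
  subst hS'
  exact ⟨corner_flip_away h hb, corner_flip_away h fun h' => hb
    (h'.trans ((M.sameVertex_rot _).trans (M.sameVertex_rot _)).symm)⟩

include hp hS'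

/-- A circle which does not abut the crossing remains contractible when the resolution is changed
there. -/
theorem contractible_of_untouched {d : T.strand} (ha : ¬ T.IsArc (T.comp S d))
    (hne : ∀ e : T.strand, M.SameVertex p e.1 → T.comp S e ≠ T.comp S d)
    (hcomp : ∀ e, T.comp S' e = T.comp S' d ↔ T.comp S e = T.comp S d)
    (hc : T.Contractible (T.comp S d)) : T.Contractible (T.comp S' d) := by
  obtain ⟨Z, hZ, hdZ⟩ := CellSurface.exists_isComponent (M := M) d.1
  obtain ⟨W, hW, hD⟩ := hc.exists_side hZ hdZ rfl
  have hr := (T.isCrossing_rot p).2 h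
  have hrr := T.isCrossing_opp h
  have hrrr := T.isCrossing_opp hr
  have s1 := M.sameVertex_rot p
  have s2 := s1.trans (M.sameVertex_rot _)
  have s3 := s2.trans (M.sameVertex_rot _)
  have n0 := (hW.corner_iff h).not.1 (hne ⟨p, h.1⟩ (CellSurface.SameVertex.refl _ _))
  have n1 := (hW.corner_iff hr).not.1 (hne ⟨_, hr.1⟩ s1)
  have n2 := (hW.corner_iff hrr).not.1 (hne ⟨_, hrr.1⟩ s2)
  have n3 := (hW.corner_iff hrrr).not.1 (hne ⟨_, hrrr.1⟩ s3)
  rw [M.rot_symm_of_crossing h] at n0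
  rw [Equiv.symm_apply_apply] at n1 n2 n3
  rw [not_not] at n0 n1 n2 n3
  have ha' : ¬ T.IsArc (T.comp S' d) := by
    rintro ⟨e, he, hed⟩
    exact ha ⟨e, he, (hcomp e).1 hed⟩
  have hW' : Side S' Z W (T.comp S' d) := by
    refine Side.mk' hW.closed hW.sub (fun e => (hW.front_inl e).trans (hcomp e).symm)
      (fun e he => hW.front_off he) fun b => ?_
    by_cases hb : M.SameVertex p b.1
    · rcases corner_saddle h hp hS' b hb with ⟨e1, e2⟩ | ⟨e1, e2⟩ <;> rw [e1, e2] <;> tauto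
    · obtain ⟨e1, e2⟩ := corner_off h hS' b hb
      rw [e1, e2]
      exact hW.front_inr b
  refine hW'.bounds hZ ha' ⟨?_, hD.2⟩
  subst hS'
  rw [euler_flip_of_iff h hp (by tauto) (by tauto) (by tauto)]
  exact hD.1

variable {A B : T.Component S} {C : T.Component S'} {U V Y : Set D}
  (hA : T.comp S ⟨p, h.1⟩ = A) (hB : T.comp S ⟨M.rot (M.rot p), (T.isCrossing_opp h).1⟩ = B)
  (hAB : A ≠ B) (hC : ∀ e, T.comp S' e = C ↔ T.comp S e = A ∨ T.comp S e = B)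

omit [Finite D] hS' in
theorem comp_rot : T.comp S ⟨M.rot p, h.2.1⟩ = T.comp S ⟨p, h.1⟩ := by
  rw [← T.comp_mate S ⟨p, h.1⟩]
  exact congrArg _ (Subtype.ext (by rw [T.mate_crossing S h, hp]))

omit hS' [Finite D] in
include hA hB hAB in
/-- The corners on the side `U` of the circle through the dart `p`. -/
theorem Side.corners (hU : Side S Z U A) (hpU : p ∈ U) :
    M.rot p ∉ U ∧ M.rot (M.rot p) ∉ U ∧ M.rot (M.rot (M.rot p)) ∉ U := by
  have hr := (T.isCrossing_rot p).2 h
  have hrr := T.isCrossing_opp h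
  have hrrr := T.isCrossing_opp hr
  have e1 := comp_rot h hp
  have e3 := comp_rot hrr (T.turn_opp S h hp)
  have n0 := hU.corner_iff h
  have n1 := hU.corner_iff hr
  have n2 := hU.corner_iff hrr
  have n3 := hU.corner_iff hrrr
  rw [M.rot_symm_of_crossing h] at n0
  rw [Equiv.symm_apply_apply] at n1 n2 n3
  rw [hA] at n0
  rw [e1, hA] at n1
  rw [hB] at n2
  rw [e3, hB] at n3
  have := hAB.symm
  tauto

omit hS' [Finite D] in
include hA hB hAB in
/-- The sides, at opposite darts of the crossing, of the two circles there are disjoint. -/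
theorem Side.disjoint (hZ : M.IsComponent Z) (hpZ : p ∈ Z) (haA : ¬ T.IsArc A)
    (haB : ¬ T.IsArc B) (hU : Side S Z U A) (hpU : p ∈ U) (hV : Side S Z V B)
    (hpV : M.rot (M.rot p) ∈ V) : Disjoint U V := by
  have hrr := T.isCrossing_opp h
  have h4 : M.rot (M.rot (M.rot (M.rot p))) = p := h.2.2.2.2.2.2
  -- each circle lies off the chosen side of the other one
  have key : ∀ {A B : T.Component S} {U V : Set D} {q : T.strand}, A ≠ B → ¬ T.IsArc B →
      Side S Z U A → T.comp S q = B → q.1 ∉ U → ∀ x ∈ T.circleDarts S B, x ∉ T.lift S U := by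
    intro A B U V q hAB haB hU hq hqU
    have hcirc := T.circuit haB
    have hoff : ∀ x ∈ T.circleDarts S B, x ∉ T.circleDarts S A := by
      rintro _ ⟨e, he, rfl⟩ hx
      rw [T.inl_mem_circleDarts] at hx
      exact hAB (hx.symm.trans he)
    refine fun x hx => hcirc.conn (fun x => x ∉ T.lift S U) ?_ ?_ (Sum.inl q.1) ⟨q, hq, rfl⟩ hqU x hx
    · intro x hx hxU hxU'
      have := hoff x hx
      rw [← hU.front] at this
      exact this fun h' => hxU (h'.2 hxU')
    · rintro x hx hxU hxU'
      refine hxU ((CellSurface.vertex_iff (T.faceClosed_lift hU.closed) (hcirc.same x hx) ?_).2 hxU')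
      intro y hy hxy
      rw [hU.front] at hy
      obtain ⟨e, he, rfl⟩ := hy
      obtain ⟨f, hf, rfl⟩ := hx
      rcases T.sameVertex_inl_strand hxy with rfl | rfl
      · exact hAB (he.symm.trans hf)
      · rw [T.comp_mate] at he
        exact hAB (he.symm.trans hf)
  obtain ⟨-, hU2, -⟩ := hU.corners h hp hA hB hAB hpU
  obtain ⟨-, hV2, -⟩ := hV.corners hrr (T.turn_opp S h hp) hB (B := A)
    (by rw [← hA]; exact congrArg _ (Subtype.ext h4)) hAB.symm hpV
  rw [h4] at hV2
  have k1 := key (V := V) hAB haB hU hB hU2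
  have k2 := key (V := U) hAB.symm haA hV hA hV2
  have hP : ∀ x ∈ T.lift S Z, ((T.resolved S).face x ∈ T.lift S U ∩ T.lift S V ↔
      x ∈ T.lift S U ∩ T.lift S V) ∧ ((T.resolved S).rev x ∈ T.lift S U ∩ T.lift S V ↔
      x ∈ T.lift S U ∩ T.lift S V) := by
    intro x _
    refine ⟨and_congr (T.faceClosed_lift hU.closed x) (T.faceClosed_lift hV.closed x), ?_⟩
    have r1 := k1 x
    have r2 := k2 x
    have r3 := k1 ((T.resolved S).rev x)
    have r4 := k2 ((T.resolved S).rev x)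
    rw [← hV.front] at r1 r3
    rw [← hU.front] at r2 r4
    simp only [CellSurface.frontier, Set.mem_ofPred_eq, (T.resolved S).rev_rev, Set.mem_inter_iff]
      at r1 r2 r3 r4 ⊢
    tauto
  rw [Set.disjoint_left]
  intro y hy hy'
  exact hV2 (((T.isComponent_lift hZ).mem_iff_mem hP (x := Sum.inl y) (y := Sum.inl p)
    (hU.sub hy) hpZ).1 ⟨hy, hy'⟩).2

include hA hB hAB hC in
/-- The band sum of two discs, or more generally of two disjoint regions. -/
theorem Side.union (hZ : M.IsComponent Z) (hpZ : p ∈ Z) (haA : ¬ T.IsArc A)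
    (haB : ¬ T.IsArc B) (hU : Side S Z U A) (hpU : p ∈ U) (hV : Side S Z V B)
    (hpV : M.rot (M.rot p) ∈ V) : Side S' Z (U ∪ V) C ∧
      (T.resolved S').euler (T.lift S' (U ∪ V)) = (T.resolved S).euler (T.lift S U)
        + (T.resolved S).euler (T.lift S V) - 1 := by
  have h4 : M.rot (M.rot (M.rot (M.rot p))) = p := h.2.2.2.2.2.2
  have hdis := hU.disjoint h hp hA hB hAB hZ hpZ haA haB hpU hV hpV
  have hdis' := Set.disjoint_left.1 hdis
  obtain ⟨hU1, hU2, hU3⟩ := hU.corners h hp hA hB hAB hpU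
  obtain ⟨hV3, hV0, hV1⟩ := hV.corners (T.isCrossing_opp h) (T.turn_opp S h hp) hB (B := A)
    (by rw [← hA]; exact congrArg _ (Subtype.ext h4)) hAB.symm hpV
  rw [h4] at hV0 hV1
  constructor
  · refine Side.mk' (hU.closed.union hV.closed) (Set.union_subset hU.sub hV.sub) ?_ ?_ ?_
    · intro e
      rw [hC, ← hU.front_inl e, ← hV.front_inl e, Set.mem_union, Set.mem_union]
      have r1 := @hdis' e.1
      have r2 := @hdis' (M.rev e.1)
      have r3 : ¬ (T.comp S e = A ∧ T.comp S e = B) := fun h' => hAB (h'.1.symm.trans h'.2)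
      rw [← hU.front_inl e, ← hV.front_inl e] at r3
      exact not_iff_or r1 r2 r3
    · intro e he
      rw [Set.mem_union, Set.mem_union, hU.front_off he, hV.front_off he]
    · intro b
      by_cases hb : M.SameVertex p b.1
      · rcases corner_saddle h hp hS' b hb with ⟨e1, e2⟩ | ⟨e1, e2⟩ <;> rw [e1, e2]
        · exact iff_of_true (Or.inl hpU) (Or.inr hpV)
        · exact iff_of_true (Or.inr hpV) (Or.inl hpU)
      · obtain ⟨e1, e2⟩ := corner_off h hS' b hb
        rw [e1, e2, Set.mem_union, Set.mem_union, hU.front_inr b, hV.front_inr b]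
  · subst hS'
    rw [euler_flip_of_merge h hp (Or.inl hpU) (by simp [hU1, hV1]) (Or.inr hpV)
      (by simp [hU3, hV3])]
    rw [← CellSurface.euler_disjoint_union (M := T.resolved S) (T.faceClosed_lift hU.closed)
      (T.faceClosed_lift hV.closed) ?_ ?_]
    · rfl
    · exact Set.disjoint_left.2 fun x hx hx' => hdis' hx hx'
    · rw [hU.front, hV.front, Set.disjoint_left]
      rintro _ ⟨e, he, rfl⟩ hx
      rw [T.inl_mem_circleDarts] at hx
      exact hAB (he.symm.trans hx)

omit [Finite D] hS' in
include hA hC in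
theorem Side.corners_merged (hY : Side S' Z Y C) (hpY : p ∈ Y) (hB : T.comp S
    ⟨M.rot (M.rot p), (T.isCrossing_opp h).1⟩ = B) :
    M.rot p ∉ Y ∧ M.rot (M.rot p) ∈ Y ∧ M.rot (M.rot (M.rot p)) ∉ Y := by
  have hr := (T.isCrossing_rot p).2 h
  have hrr := T.isCrossing_opp h
  have e1 := comp_rot h hp
  have n0 := (hY.corner_iff h).1 ((hC _).2 (Or.inl hA))
  have n1 := (hY.corner_iff hr).1 ((hC _).2 (Or.inl (e1.trans hA)))
  have n2 := (hY.corner_iff hrr).1 ((hC _).2 (Or.inr hB))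
  rw [M.rot_symm_of_crossing h] at n0
  rw [Equiv.symm_apply_apply] at n1 n2
  clear hC hA hB e1
  tauto

omit [Finite D] in
include hA hB hAB hC in
theorem Side.symmDiff (hU : Side S Z U A) (hpU : p ∈ U) (hY : Side S' Z Y C)
    (hpY : p ∈ Y) : Side S Z {x | ¬ (x ∈ U ↔ x ∈ Y)} B ∧
      M.rot (M.rot p) ∈ {x | ¬ (x ∈ U ↔ x ∈ Y)} := by
  obtain ⟨hU1, hU2, hU3⟩ := hU.corners h hp hA hB hAB hpU
  obtain ⟨hY1, hY2, hY3⟩ := hY.corners_merged h hp hA hC hpY hB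
  refine ⟨Side.mk' ?_ ?_ ?_ ?_ ?_, fun h' => hU2 (h'.2 hY2)⟩
  · intro x
    exact not_congr (iff_congr (hU.closed x) (hY.closed x))
  · intro x hx
    by_contra hxZ
    exact hx (iff_of_false (fun h' => hxZ (hU.sub h')) (fun h' => hxZ (hY.sub h')))
  · intro e
    have r1 := hU.front_inl e
    have r2 := (hY.front_inl e).trans (hC e)
    have r3 : ¬ (T.comp S e = A ∧ T.comp S e = B) := fun h' => hAB (h'.1.symm.trans h'.2)
    simp only [Set.mem_ofPred_eq]
    tauto
  · intro e he
    have r1 := hU.front_off he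
    have r2 := hY.front_off he
    simp only [Set.mem_ofPred_eq]
    tauto
  · intro b
    by_cases hb : M.SameVertex p b.1
    · rcases corner_saddle' h hp b hb with ⟨e1, e2⟩ | ⟨e1, e2⟩ <;> rw [e1, e2] <;>
        simp [hU1, hU3, hY1, hY3]
    · obtain ⟨e1, e2⟩ := corner_off h hS' b hb
      have r1 := hU.front_inr b
      have r2 := hY.front_inr b
      rw [e1, e2] at r2
      simp only [Set.mem_ofPred_eq]
      tauto

include hA hB hAB hC in
/-- Of three circles which cobound a pair of pants, the third one is contractible if two are. -/
theorem contractible_pants (haA : ¬ T.IsArc A) (haB : ¬ T.IsArc B) (haC : ¬ T.IsArc C) :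
    (T.Contractible A → T.Contractible B → T.Contractible C) ∧
    (T.Contractible A → T.Contractible C → T.Contractible B) := by
  obtain ⟨Z, hZ, hpZ⟩ := CellSurface.exists_isComponent (M := M) p
  have hppZ : M.rot (M.rot p) ∈ Z :=
    (hZ.sameVertex ((M.sameVertex_rot _).trans (M.sameVertex_rot _))).1 hpZ
  have hpC : T.comp S' ⟨p, h.1⟩ = C := (hC _).2 (Or.inl hA)
  have norm : ∀ {S : T.Resolution} {C : T.Component S} {q : T.strand}, q.1 ∈ Z → T.comp S q = C →
      T.Contractible C → ∃ W, Side S Z W C ∧ q.1 ∈ W := by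
    intro S C q hq hqC hc
    obtain ⟨W, hW, -⟩ := hc.exists_side hZ hq hqC
    by_cases hqW : q.1 ∈ W
    · exact ⟨W, hW, hqW⟩
    · exact ⟨Z \ W, hW.diff hZ, hq, hqW⟩
  -- the Euler characteristics of the sides decide
  have main : ∀ U V, Side S Z U A → p ∈ U → Side S Z V B → M.rot (M.rot p) ∈ V →
      (T.Contractible A → T.Contractible B → T.Contractible C) ∧
      (T.Contractible A → T.Contractible C → T.Contractible B) := by
    intro U V hU hpU hV hpV
    have hdis := hU.disjoint h hp hA hB hAB hZ hpZ haA haB hpU hV hpV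
    obtain ⟨hY, hχ⟩ := hU.union h hp hS' hA hB hAB hC hZ hpZ haA haB hpU hV hpV
    rw [hU.contractible_iff hZ haA hpZ hA, hV.contractible_iff hZ haB hppZ hB,
      hY.contractible_iff hZ haC hpZ hpC]
    have a1 := hU.euler_add hZ haA
    have a2 := hV.euler_add hZ haB
    have a3 := hY.euler_add hZ haC
    have l1 := hU.euler_le hZ haA
    have l2 := hV.euler_le hZ haB
    have l4 := (hU.diff hZ).euler_le hZ haA
    have l5 := (hV.diff hZ).euler_le hZ haB
    have l6 := (hY.diff hZ).euler_le hZ haC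
    have hz : (T.resolved S').euler (T.lift S' Z) = (T.resolved S).euler (T.lift S Z) := by
      subst hS'
      have s1 := M.sameVertex_rot p
      have s2 := s1.trans (M.sameVertex_rot _)
      have s3 := s2.trans (M.sameVertex_rot _)
      exact euler_flip_of_iff h hp (hZ.sameVertex s1).symm (hZ.sameVertex s2).symm
        (hZ.sameVertex s3).symm
    have d3 : Disjoint (U ∪ V) M.hole ↔ Disjoint U M.hole ∧ Disjoint V M.hole :=
      Set.disjoint_union_left
    have d1 : Disjoint (Z \ U) M.hole ↔
        Disjoint V M.hole ∧ Disjoint (Z \ (U ∪ V)) M.hole := by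
      rw [← Set.disjoint_union_left]
      rw [union_sdiff_union hV.sub hdis]
    have d2 : Disjoint (Z \ V) M.hole ↔
        Disjoint U M.hole ∧ Disjoint (Z \ (U ∪ V)) M.hole := by
      rw [← Set.disjoint_union_left]
      rw [Set.union_comm U V, union_sdiff_union hU.sub hdis.symm]
    unfold IsDisc
    rw [d1, d2, d3]
    constructor
    · rintro (⟨e1, e2⟩ | ⟨e1, e2, e3⟩) (⟨f1, f2⟩ | ⟨f1, f2, f3⟩)
      · exact Or.inl ⟨by omega, e2, f2⟩
      · exact Or.inr ⟨by omega, f3⟩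
      · exact Or.inr ⟨by omega, e3⟩
      · exact Or.inl ⟨by omega, f2, e2⟩
    · rintro (⟨e1, e2⟩ | ⟨e1, e2, e3⟩) (⟨f1, f2, f3⟩ | ⟨f1, f2⟩)
      · exact Or.inl ⟨by omega, f3⟩
      · exact Or.inr ⟨by omega, e2, f2⟩
      · exact Or.inl ⟨by omega, f3⟩
      · exact Or.inl ⟨by omega, e2⟩
  constructor
  · intro cA cB
    obtain ⟨U, hU, hpU⟩ := norm (q := ⟨p, h.1⟩) hpZ hA cA
    obtain ⟨V, hV, hpV⟩ := norm (q := ⟨M.rot (M.rot p), (T.isCrossing_opp h).1⟩) hppZ hB cB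
    exact (main U V hU hpU hV hpV).1 cA cB
  · intro cA cC
    obtain ⟨U, hU, hpU⟩ := norm (q := ⟨p, h.1⟩) hpZ hA cA
    obtain ⟨Y, hY, hpY⟩ := norm (q := ⟨p, h.1⟩) hpZ hpC cC
    obtain ⟨hV, hpV⟩ := hU.symmDiff h hp hS' hA hB hAB hC hpU hY hpY
    exact (main U _ hU hpU hV hpV).2 cA cC

end Saddle

end TangleDiagram

/-! ### Contractible circles before and after a merging -/

namespace TangleDiagram

variable {D : Type*} {M : CellSurface D} {T : TangleDiagram M} {S : T.Resolution} {c : T.Crossing}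

theorem exists_first_at (S : T.Resolution) (c : T.Crossing) :
    ∃ (p : D) (h : T.IsCrossing p), T.turn S p = M.rot p ∧ T.crossingOf p h = c ∧
      T.comp S ⟨p, h.1⟩ = T.comp S (T.dartAt c) ∧
      T.comp S ⟨M.rot (M.rot p), (T.isCrossing_opp h).1⟩ = T.comp S (T.oppAt c) := by
  obtain ⟨p, h, hp, hs, hx⟩ := T.exists_first S (Sum.inl (T.dartAt c).1) (T.isCrossing_dartAt c)
  have hc : T.crossingOf p h = c := by
    rw [← T.crossingOf_dartAt c, T.crossingOf_eq_iff]
    exact hs.symm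
  refine ⟨p, h, hp, hc, ?_⟩
  rcases hx with hx | hx | hx
  · have hx : (T.dartAt c).1 = p := Sum.inl_injective hx
    exact ⟨congrArg _ (Subtype.ext hx.symm), congrArg _ (Subtype.ext (by
      show _ = M.rot (M.rot (T.dartAt c).1)
      rw [hx]))⟩
  · have hx : (T.dartAt c).1 = M.rot p := Sum.inl_injective hx
    constructor
    · rw [← comp_rot h hp]
      exact congrArg _ (Subtype.ext hx.symm)
    · rw [← comp_rot (T.isCrossing_opp h) (T.turn_opp S h hp)]
      exact congrArg _ (Subtype.ext (by
        show _ = M.rot (M.rot (T.dartAt c).1)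
        rw [hx]))
  · simp at hx

theorem not_touches_of_mem {d : T.strand} (hd : ¬ T.Touches S c d) {p : D} (h : T.IsCrossing p)
    (hc : T.crossingOf p h = c) (e : T.strand) (he : M.SameVertex p e.1) :
    T.comp S e ≠ T.comp S d := by
  intro hed
  have hm : T.comp S e ∈ T.touching S c :=
    ⟨e, (T.isCrossing_sameVertex he).1 h, by
      rw [← hc, T.crossingOf_eq_iff]; exact he.symm, rfl⟩
  rw [T.touching_eq] at hm
  exact hd (hm.imp hed.symm.trans hed.symm.trans)

variable [Finite D]

/-- The change of the resolution does not affect the circles away from the crossing. -/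
theorem contractible_flip (hb : T.bridge c ∉ T.rels S) {d : T.strand} (hd : ¬ T.Touches S c d)
    (ha : ¬ T.IsArc (T.comp S d)) :
    T.Contractible (T.comp S d) ↔ T.Contractible (T.comp (T.flip S c) d) := by
  have hcomp : ∀ e, T.comp (T.flip S c) e = T.comp (T.flip S c) d ↔ T.comp S e = T.comp S d :=
    fun e => ⟨fun h => (merge_fine_off hd h.symm).symm, merge_coarse hb⟩
  constructor
  · obtain ⟨p, h, hp, hc, -⟩ := exists_first_at S c
    refine contractible_of_untouched h hp (by rw [hc]) ha (not_touches_of_mem hd h hc) hcomp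
  · obtain ⟨p, h, hp, hc, -⟩ := exists_first_at (T.flip S c) c
    refine contractible_of_untouched (S' := S) h hp (by rw [hc, T.flip_flip])
      (fun h' => ha ((merge_isArc_off hb hd).1 h')) (fun e he h' => ?_) (fun e => (hcomp e).symm)
    exact not_touches_of_mem hd h hc e he ((hcomp e).1 h')

/-- If two of the three circles at a merging are contractible, so is the third one. -/
theorem contractible_merge (hb : T.bridge c ∉ T.rels S)
    (hA : ¬ T.IsArc (T.comp S (T.dartAt c))) (hB : ¬ T.IsArc (T.comp S (T.oppAt c))) :
    (T.Contractible (T.comp S (T.dartAt c)) → T.Contractible (T.comp S (T.oppAt c)) →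
      T.Contractible (T.comp (T.flip S c) (T.dartAt c))) ∧
    (T.Contractible (T.comp S (T.dartAt c)) → T.Contractible (T.comp (T.flip S c) (T.dartAt c)) →
      T.Contractible (T.comp S (T.oppAt c))) ∧
    (T.Contractible (T.comp S (T.oppAt c)) → T.Contractible (T.comp (T.flip S c) (T.dartAt c)) →
      T.Contractible (T.comp S (T.dartAt c))) := by
  obtain ⟨p, h, hp, hc, e1, e2⟩ := exists_first_at S c
  have hC : ¬ T.IsArc (T.comp (T.flip S c) (T.dartAt c)) := fun h' =>
    ((merge_isArc hb).1 h').elim hA hB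
  have hcomp : ∀ e, T.comp (T.flip S c) e = T.comp (T.flip S c) (T.dartAt c) ↔
      T.comp S e = T.comp S (T.dartAt c) ∨ T.comp S e = T.comp S (T.oppAt c) :=
    fun e => merge_touches hb
  have hne := merge_ne hb
  obtain ⟨k1, k2⟩ := contractible_pants (S' := T.flip S c) h hp (by rw [hc]) e1 e2 hne hcomp hA hB hC
  have h4 : M.rot (M.rot (M.rot (M.rot p))) = p := h.2.2.2.2.2.2
  have e3 : T.comp S ⟨M.rot (M.rot (M.rot (M.rot p))),
      (T.isCrossing_opp (T.isCrossing_opp h)).1⟩ = T.comp S (T.dartAt c) := by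
    rw [← e1]
    exact congrArg _ (Subtype.ext h4)
  obtain ⟨-, k3⟩ := contractible_pants (S' := T.flip S c) (T.isCrossing_opp h) (T.turn_opp S h hp)
    (by
      rw [← hc, (T.crossingOf_eq_iff (T.isCrossing_opp h) h).2
        ((M.sameVertex_rot _).trans (M.sameVertex_rot _)).symm])
    e2 e3 hne.symm (fun e => (hcomp e).trans or_comm) hB hA hC
  exact ⟨k1, k2, k3⟩

end TangleDiagram

/-! ### Homotopy of edge paths -/

namespace IsWalk

variable {α V : Type*} {rev : α → α} {src : α → V} {a b c : V} {w : List α}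

theorem right_unique (h : IsWalk rev src a w b) (h' : IsWalk rev src a w c) : b = c := by
  induction w generalizing a with
  | nil => exact h.symm.trans h'
  | cons x w ih => exact ih h.2 h'.2

end IsWalk

namespace CellSurface

variable {D : Type*} {M : CellSurface D} {a b c : Set D} {u v w w' : List D} {d : D}

variable (M) in
/-- An elementary homotopy between edge paths which start at `a` and have the same end. -/
def Step (a : Set D) (w w' : List D) : Prop :=
  (∃ b, IsWalk M.rev M.vertexOf a w b ∧ IsWalk M.rev M.vertexOf a w' b) ∧
  ∃ u v d, w = u ++ v ∧
    (w' = u ++ [d, M.rev d] ++ v ∨ (d ∉ M.hole ∧ w' = u ++ M.faceWord d ++ v))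

variable (M) in
/-- Homotopy with fixed ends between edge paths which start at `a`. -/
def Homotopic (a : Set D) : List D → List D → Prop := Relation.EqvGen (M.Step a)

theorem isEdgePath_of_isWalk (h : IsWalk M.rev M.vertexOf a w b) : M.IsEdgePath w := by
  induction w generalizing a with
  | nil => exact List.isChain_nil
  | cons x w ih =>
    rcases w with _ | ⟨y, w⟩
    · exact List.isChain_singleton x
    · exact List.isChain_cons_cons.2 ⟨vertexOf_eq_iff.1 h.2.1, ih h.2⟩

theorem isLoop_of_isWalk (h : IsWalk M.rev M.vertexOf a w a) : M.IsLoop w := by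
  refine ⟨isEdgePath_of_isWalk h, fun d hd e he => ?_⟩
  obtain ⟨u, rfl⟩ := List.getLast?_eq_some_iff.1 he
  obtain ⟨c, -, -, h2⟩ := IsWalk.append_iff.1 h
  have h2 : M.vertexOf (M.rev e) = a := h2
  have h1 : M.vertexOf d = a := by
    rcases u with _ | ⟨x, u⟩
    · obtain rfl : e = d := by simpa using hd
      exact h.1
    · obtain rfl : x = d := by simpa using hd
      exact h.1
  exact vertexOf_eq_iff.1 (h1.trans h2.symm)

namespace Homotopic

@[refl] theorem refl (w : List D) : M.Homotopic a w w := Relation.EqvGen.refl _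

theorem symm (h : M.Homotopic a w w') : M.Homotopic a w' w := Relation.EqvGen.symm _ _ h

theorem trans (h : M.Homotopic a u v) (h' : M.Homotopic a v w) : M.Homotopic a u w :=
  Relation.EqvGen.trans _ _ _ h h'

theorem isWalk_iff (h : M.Homotopic a w w') :
    IsWalk M.rev M.vertexOf a w b ↔ IsWalk M.rev M.vertexOf a w' b := by
  induction h with
  | rel w w' h =>
    obtain ⟨⟨c, h1, h2⟩, -⟩ := h
    exact ⟨fun h => (h1.right_unique h) ▸ h2, fun h => (h2.right_unique h) ▸ h1⟩
  | refl => rfl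
  | symm _ _ _ ih => exact ih.symm
  | trans _ _ _ _ _ ih1 ih2 => exact ih1.trans ih2

theorem append_left (hu : IsWalk M.rev M.vertexOf a u b) (h : M.Homotopic b w w') :
    M.Homotopic a (u ++ w) (u ++ w') := by
  induction h with
  | rel w w' h =>
    obtain ⟨⟨c, h1, h2⟩, s, t, d, rfl, h3⟩ := h
    refine Relation.EqvGen.rel _ _ ⟨⟨c, hu.append h1, hu.append h2⟩, u ++ s, t, d,
      (List.append_assoc _ _ _).symm, ?_⟩
    rcases h3 with rfl | ⟨h3, rfl⟩
    · exact Or.inl (by simp)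
    · exact Or.inr ⟨h3, by simp⟩
  | refl => exact refl _
  | symm _ _ _ ih => exact ih.symm
  | trans _ _ _ _ _ ih1 ih2 => exact ih1.trans ih2

theorem append_right (hw : IsWalk M.rev M.vertexOf a w b) (hv : IsWalk M.rev M.vertexOf b v c)
    (h : M.Homotopic a w w') : M.Homotopic a (w ++ v) (w' ++ v) := by
  induction h with
  | rel w w' h =>
    obtain ⟨⟨e, h1, h2⟩, s, t, d, rfl, h3⟩ := h
    obtain rfl := h1.right_unique hw
    refine Relation.EqvGen.rel _ _ ⟨⟨c, h1.append hv, h2.append hv⟩, s, t ++ v, d,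
      List.append_assoc _ _ _, ?_⟩
    rcases h3 with rfl | ⟨h3, rfl⟩
    · exact Or.inl (by simp)
    · exact Or.inr ⟨h3, by simp⟩
  | refl => exact refl _
  | symm _ _ h ih => exact (ih ((isWalk_iff h).2 hw)).symm
  | trans _ _ _ h _ ih1 ih2 => exact (ih1 hw).trans (ih2 ((isWalk_iff h).1 hw))

/-- A closed path which is homotopic to the constant path may be inserted. -/
theorem insert (hu : IsWalk M.rev M.vertexOf a u b) (hv : IsWalk M.rev M.vertexOf b v c)
    (h : M.Homotopic b w []) : M.Homotopic a (u ++ v) (u ++ w ++ v) := by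
  have hw := (isWalk_iff (b := b) h).2 rfl
  rw [List.append_assoc]
  have h1 : M.Homotopic b ([] ++ v) (w ++ v) :=
    append_right (b := b) (IsWalk.nil_iff.2 rfl) hv h.symm
  exact append_left hu h1

theorem backtrack (hv : IsWalk M.rev M.vertexOf (M.vertexOf d) v c) :
    M.Homotopic (M.vertexOf d) v ([d, M.rev d] ++ v) :=
  Relation.EqvGen.rel _ _ ⟨⟨c, hv, rfl, rfl, by rwa [M.rev_rev]⟩, [], v, d, rfl, Or.inl rfl⟩

theorem pathClass_eq (h : M.Homotopic a w w') :
    (Quot.mk _ w : M.PathClass) = Quot.mk _ w' := by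
  induction h with
  | rel w w' h =>
    obtain ⟨⟨c, h1, h2⟩, h3⟩ := h
    exact Quot.sound (Or.inl ⟨isEdgePath_of_isWalk h1, isEdgePath_of_isWalk h2, h3⟩)
  | refl => rfl
  | symm _ _ _ ih => exact ih.symm
  | trans _ _ _ _ _ ih1 ih2 => exact ih1.trans ih2

theorem loopClass_eq (h : M.Homotopic a w w') :
    (Quot.mk _ w : M.LoopClass) = Quot.mk _ w' := by
  induction h with
  | rel w w' h =>
    obtain ⟨⟨c, h1, h2⟩, h3⟩ := h
    exact Quot.sound (Or.inl ⟨isEdgePath_of_isWalk h1, isEdgePath_of_isWalk h2, h3⟩)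
  | refl => rfl
  | symm _ _ _ ih => exact ih.symm
  | trans _ _ _ _ _ ih1 ih2 => exact ih1.trans ih2

end Homotopic

theorem reversePath_cons (d : D) (w : List D) :
    M.reversePath (d :: w) = M.reversePath w ++ [M.rev d] := by simp [reversePath]

theorem isWalk_reversePath (h : IsWalk M.rev M.vertexOf a w b) :
    IsWalk M.rev M.vertexOf b (M.reversePath w) a := by
  induction w generalizing a with
  | nil => exact h.symm
  | cons x w ih =>
    rw [reversePath_cons]
    refine (ih h.2).append ⟨rfl, ?_⟩
    rw [M.rev_rev]
    exact h.1

theorem homotopic_reversePath_append (h : IsWalk M.rev M.vertexOf a w b) :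
    M.Homotopic b (M.reversePath w ++ w) [] := by
  induction w generalizing a with
  | nil => rfl
  | cons x w ih =>
    rw [reversePath_cons]
    have h2 := (Homotopic.backtrack (d := M.rev x) h.2).append_left (isWalk_reversePath h.2)
    rw [M.rev_rev] at h2
    refine Homotopic.trans ?_ (ih h.2)
    simpa using h2.symm

section Null

/-- A rotation of a contractible edge loop is contractible. -/
theorem null_rotate (hu : IsWalk M.rev M.vertexOf a u b) (hv : IsWalk M.rev M.vertexOf b v a)
    (h : M.Homotopic a (u ++ v) []) : M.Homotopic b (v ++ u) [] := by
  have h1 := homotopic_reversePath_append hu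
  have h2 := Homotopic.insert (a := b) (u := []) rfl (hv.append hu) h1
  have h3 := Homotopic.insert (isWalk_reversePath hu) hu h
  refine h2.trans (Homotopic.trans ?_ (h3.symm.trans h1))
  simp only [List.nil_append, List.append_assoc]
  rfl

theorem null_leaf (h : M.Homotopic (M.vertexOf d) (d :: M.rev d :: w) []) :
    M.Homotopic (M.vertexOf d) w [] := by
  have hw := (Homotopic.isWalk_iff (b := M.vertexOf d) h).2 rfl
  obtain ⟨-, -, hw⟩ := hw
  rw [M.rev_rev] at hw
  exact (Homotopic.backtrack hw).trans h

/-- The product of two contractible loops along a common dart is contractible, with the dart removed. -/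
theorem null_glue (h : M.Homotopic (M.vertexOf d) (d :: u) [])
    (h' : M.Homotopic (M.vertexOf (M.rev d)) (M.rev d :: v) []) :
    M.Homotopic (M.vertexOf (M.rev d)) (u ++ v) [] := by
  have hu := ((Homotopic.isWalk_iff (b := M.vertexOf d) h).2 rfl).2
  have hv := ((Homotopic.isWalk_iff (b := M.vertexOf (M.rev d)) h').2 rfl).2
  rw [M.rev_rev] at hv
  have h1 := Homotopic.backtrack hu
  rw [M.rev_rev] at h1
  have hd : IsWalk M.rev M.vertexOf (M.vertexOf (M.rev d)) [M.rev d] (M.vertexOf d) :=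
    ⟨rfl, by rw [M.rev_rev]; rfl⟩
  have h2 : M.Homotopic (M.vertexOf (M.rev d)) u [M.rev d] := h1.trans (h.append_left hd)
  exact (h2.append_right hu hv).trans h'

theorem null_reverse (hw : IsWalk M.rev M.vertexOf a w a) (h : M.Homotopic a w []) :
    M.Homotopic a (M.reversePath w) [] := by
  have h1 := h.append_left (isWalk_reversePath hw)
  rw [List.append_nil] at h1
  exact h1.symm.trans (homotopic_reversePath_append hw)

theorem null_faceWord [Finite D] (hd : d ∉ M.hole) :
    M.Homotopic (M.vertexOf d) (M.faceWord d) [] :=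
  Homotopic.symm (Relation.EqvGen.rel _ _ ⟨⟨_, rfl, isWalk_faceWord d⟩, [], [], d, rfl,
    Or.inr ⟨hd, by simp⟩⟩)

/-- If the product of two loops is contractible, then they are inverse to each other. -/
theorem loopClass_eq_of_null (hu : IsWalk M.rev M.vertexOf a u a)
    (hv : IsWalk M.rev M.vertexOf a v a) (h : M.Homotopic a (u ++ v) []) :
    (Quot.mk _ u : M.LoopClass) = Quot.mk _ v := by
  have h1 := (homotopic_reversePath_append (isWalk_reversePath hv)).append_left hu
  have h2 := h.append_right (hu.append hv) (isWalk_reversePath hv)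
  have hvv : M.reversePath (M.reversePath v) = v := by
    simp [reversePath, List.map_reverse, Function.comp_def, M.rev_rev]
  rw [hvv, List.append_nil, ← List.append_assoc] at h1
  refine (h1.symm.trans h2).loopClass_eq.trans ?_
  symm
  exact Quot.sound (Or.inr (Or.inl rfl))

end Null

end CellSurface

section Iterate

variable {α : Type*} {σ : Equiv.Perm α} {x : α} {n : ℕ}

/-- A closed and simple run of a permutation goes once around the cycle. -/
theorem eq_minimalPeriod_of_nodup (h : (List.iterate σ x n).Nodup) (hx : σ^[n] x = x)
    (hn : 0 < n) : n = Function.minimalPeriod σ x := by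
  refine le_antisymm ?_ (Function.IsPeriodicPt.minimalPeriod_le hn hx)
  by_contra hlt
  rw [not_le] at hlt
  have hpos := Function.IsPeriodicPt.minimalPeriod_pos hn hx
  have h1 : (List.iterate σ x n)[0]'(by simpa using hn)
      = (List.iterate σ x n)[Function.minimalPeriod σ x]'(by simpa using hlt) := by
    rw [List.getElem_iterate, List.getElem_iterate, Function.iterate_minimalPeriod]
    rfl
  have := (h.getElem_inj_iff).1 h1
  omega

theorem iterate_add {f : α → α} (m n : ℕ) :
    List.iterate f x (m + n) = List.iterate f x m ++ List.iterate f (f^[m] x) n := by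
  induction m generalizing x with
  | zero => simp
  | succ m ih =>
    rw [Nat.succ_add, List.iterate, ih]
    rfl

end Iterate

namespace TangleDiagram

variable {D : Type*} {M : CellSurface D} {T : TangleDiagram M} {S : T.Resolution}

/-- The edges of the surface in an edge path of the resolution: its new edges are contracted. -/
def erase (w : List (D ⊕ T.OverDart)) : List D := w.filterMap Sum.getLeft?

/-- The vertex of the surface to which a vertex of the resolution is contracted. -/
def base (v : Set (D ⊕ T.OverDart)) : Set D := {d | ∃ x ∈ v, M.SameVertex (T.site x) d}

theorem base_vertexOf (x : D ⊕ T.OverDart) :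
    base ((T.resolved S).vertexOf x) = M.vertexOf (T.site x) := by
  ext d
  constructor
  · rintro ⟨y, hy, hd⟩
    exact (T.site_sameVertex hy).trans hd
  · intro h
    exact ⟨x, CellSurface.mem_vertexOf_self x, h⟩

theorem site_rev (x : D ⊕ T.OverDart) (hx : ∀ d, x ≠ Sum.inl d) :
    M.vertexOf (T.site ((T.resolved S).rev x)) = M.vertexOf (T.site x) := by
  rcases x with d | b
  · exact absurd rfl (hx d)
  · exact CellSurface.vertexOf_eq_iff.2 ((M.sameVertex_rot _).trans (M.sameVertex_rot _))

theorem erase_append (u v : List (D ⊕ T.OverDart)) : erase (u ++ v) = erase u ++ erase v :=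
  List.filterMap_append

theorem erase_inl (d : D) (w : List (D ⊕ T.OverDart)) : erase (Sum.inl d :: w) = d :: erase w :=
  rfl

theorem erase_inr (e : T.OverDart) (w : List (D ⊕ T.OverDart)) : erase (Sum.inr e :: w) = erase w :=
  rfl

variable {a b : Set (D ⊕ T.OverDart)} {w : List (D ⊕ T.OverDart)}

theorem isWalk_erase
    (h : IsWalk (T.resolved S).rev (T.resolved S).vertexOf a w b) :
    IsWalk M.rev M.vertexOf (base a) (erase w) (base b) := by
  induction w generalizing a with
  | nil => exact congrArg base h
  | cons x w ih =>
    obtain ⟨rfl, h⟩ := h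
    have h := ih h
    rw [base_vertexOf] at h ⊢
    rcases x with d | e
    · exact ⟨rfl, h⟩
    · rwa [site_rev _ (by simp)] at h

theorem erase_iterate (x : D ⊕ T.OverDart) (n : ℕ) :
    ∃ k, erase (List.iterate (T.resolved S).face x n) = List.iterate M.face (T.corner S x) k ∧
      M.face^[k] (T.corner S x) = T.corner S ((T.resolved S).face^[n] x) := by
  induction n generalizing x with
  | zero => exact ⟨0, rfl, rfl⟩
  | succ n ih =>
    obtain ⟨k, h1, h2⟩ := ih ((T.resolved S).face x)
    rw [Function.iterate_succ_apply, List.iterate]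
    rcases x with d | e
    · refine ⟨k + 1, ?_, ?_⟩
      · rw [erase_inl, h1, T.corner_face_inl]
        rfl
      · rw [← h2, T.corner_face_inl]
        rfl
    · refine ⟨k, ?_, ?_⟩
      · rw [erase_inr, h1, T.face_inr]
        rfl
      · rw [← h2, T.face_inr]
        rfl

variable [Finite D]

theorem null_erase_faceWord (x : D ⊕ T.OverDart) (hx : T.corner S x ∉ M.hole) :
    M.Homotopic (base ((T.resolved S).vertexOf x)) (erase ((T.resolved S).faceWord x)) [] := by
  rw [base_vertexOf, ← CellSurface.vertexOf_eq_iff.2 (T.sameVertex_corner S x)]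
  have hnd := CellSurface.nodup_faceWord (M := T.resolved S) x
  rw [CellSurface.faceWord_eq] at hnd ⊢
  obtain ⟨k, h1, h2⟩ := erase_iterate (S := S) x (Function.minimalPeriod (T.resolved S).face x)
  rw [Function.iterate_minimalPeriod] at h2
  rw [h1]
  rcases Nat.eq_zero_or_pos k with rfl | hk
  · rfl
  · have h3 : (erase (List.iterate (T.resolved S).face x
        (Function.minimalPeriod (T.resolved S).face x))).Nodup := by
      refine List.Nodup.filterMap ?_ hnd
      rintro (d | e) (d' | e') y <;> simp
      rintro rfl rfl
      rfl
    rw [h1] at h3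
    rw [eq_minimalPeriod_of_nodup h3 h2 hk, ← CellSurface.faceWord_eq]
    exact CellSurface.null_faceWord hx

variable {Z W : Set D} {C : T.Component S}

/-- The boundary of a disc in the resolution is a contractible loop in the surface. -/
theorem Side.exists_null (hZ : M.IsComponent Z) (hC : ¬ T.IsArc C) (h : Side S Z W C)
    (hd : T.IsDisc S W) : ∃ b w, IsWalk (T.resolved S).rev (T.resolved S).vertexOf b w b ∧
      M.Homotopic (base b) (erase w) [] ∧ w.Nodup ∧
      ∀ x, x ∈ w ↔ x ∈ T.lift S W ∧ (T.resolved S).rev x ∉ T.lift S W := by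
  have key := CellSurface.euler_le_one (T.faceClosed_lift h.closed)
    (R := fun a w => IsWalk (T.resolved S).rev (T.resolved S).vertexOf a w a ∧
      M.Homotopic (base a) (erase w) []) (fun _ _ h => h.1)
  refine have ⟨b, w, h1, h2⟩ := (key ?_ ?_ ?_ ?_ (h.linked hZ hC)
    (h.front ▸ circleDarts_nonempty C)).2 hd.1
    ⟨b, w, h1.1, h1.2, h2⟩
  · rintro a b u v h1 h2 ⟨-, h⟩
    rw [erase_append] at h
    refine ⟨h2.append h1, ?_⟩
    rw [erase_append]
    exact CellSurface.null_rotate (isWalk_erase h1) (isWalk_erase h2) h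
  · rintro a x w ⟨⟨rfl, -, h⟩, h'⟩
    rw [(T.resolved S).rev_rev] at h
    refine ⟨h, ?_⟩
    rw [base_vertexOf] at h' ⊢
    rcases x with d | e
    · exact CellSurface.null_leaf h'
    · exact h'
  · rintro x u v ⟨⟨-, h1⟩, h1'⟩ ⟨⟨-, h2⟩, h2'⟩
    have h3 := isWalk_erase h1
    rw [(T.resolved S).rev_rev] at h2
    have h4 := isWalk_erase h2
    refine ⟨h1.append h2, ?_⟩
    rw [erase_append]
    rw [base_vertexOf] at h1' h2' h3 h4 ⊢
    rw [base_vertexOf] at h3 h4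
    rcases x with d | e
    · exact CellSurface.null_glue h1' h2'
    · rw [site_rev _ (by simp)] at h2' h3 h4 ⊢
      exact (CellSurface.Homotopic.append_right h3 h4 h1').trans h2'
  · intro x hx
    exact ⟨CellSurface.isWalk_faceWord x,
      null_erase_faceWord x fun h' => Set.disjoint_left.1 hd.2 hx h'⟩

end TangleDiagram

/-! ### The loops of the circles of a resolution -/

section Iterate

variable {α : Type*} {σ : Equiv.Perm α} {x : α}

theorem minimalPeriod_congr [Finite α] {τ : Equiv.Perm α} (h : ∀ n, τ^[n] x = σ^[n] x) :
    Function.minimalPeriod τ x = Function.minimalPeriod σ x := by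
  have h2 : List.iterate τ x (Function.minimalPeriod σ x)
      = List.iterate σ x (Function.minimalPeriod σ x) := by
    rw [← List.range_map_iterate, ← List.range_map_iterate]
    exact List.map_congr_left fun n _ => h n
  refine (eq_minimalPeriod_of_nodup ?_ ?_ (minimalPeriod_pos σ x)).symm
  · rw [h2]
    exact nodup_iterate σ x le_rfl
  · rw [h, Function.iterate_minimalPeriod]

end Iterate

namespace TangleDiagram

variable {D : Type*} {M : CellSurface D} (T : TangleDiagram M) (S : T.Resolution)

/-- The next dart along the component of a dart; at an end of an arc the component is run back. -/
def next : Equiv.Perm T.strand := walk T.sRev_involutive (T.mate_involutive S)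

theorem next_apply (x : T.strand) : T.next S x = T.mate S (T.sRev x) := rfl

theorem comp_next (x : T.strand) : T.comp S (T.next S x) = T.comp S x := by
  rw [next_apply, comp_mate, comp_sRev]

theorem comp_iterate_next (x : T.strand) (n : ℕ) :
    T.comp S ((T.next S)^[n] x) = T.comp S x := by
  induction n generalizing x with
  | zero => rfl
  | succ n ih => rw [Function.iterate_succ_apply, ih, comp_next]

/-- The closed path which runs from the dart `x` on along its component until it returns to `x`: once
around a circle, or back and forth along an arc. -/
def lap (x : T.strand) : List D :=
  (List.iterate (T.next S) x (Function.minimalPeriod (T.next S) x)).map Subtype.val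

theorem isWalk_run (x : T.strand) (n : ℕ) :
    IsWalk M.rev M.vertexOf (M.vertexOf x.1) ((List.iterate (T.next S) x n).map Subtype.val)
      (M.vertexOf ((T.next S)^[n] x).1) := by
  induction n generalizing x with
  | zero => rfl
  | succ n ih =>
    rw [Function.iterate_succ_apply, List.iterate, List.map_cons]
    refine ⟨rfl, ?_⟩
    rw [show M.vertexOf (M.rev x.1) = M.vertexOf (T.next S x).1 from
      (CellSurface.vertexOf_eq_iff.2 (T.sameVertex_mate S (T.sRev x))).symm]
    exact ih _

theorem isWalk_lap (x : T.strand) :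
    IsWalk M.rev M.vertexOf (M.vertexOf x.1) (T.lap S x) (M.vertexOf x.1) := by
  have := T.isWalk_run S x (Function.minimalPeriod (T.next S) x)
  rwa [Function.iterate_minimalPeriod] at this

theorem iterate_next_mate (x : T.strand) (n : ℕ) :
    (T.next S)^[n] (T.mate S ((T.next S)^[n] x)) = T.mate S x := by
  induction n with
  | zero => rfl
  | succ n ih =>
    rw [Function.iterate_succ_apply, Function.iterate_succ_apply']
    have : T.next S (T.mate S (T.next S ((T.next S)^[n] x))) = T.mate S ((T.next S)^[n] x) := by
      rw [next_apply, next_apply, T.mate_involutive, T.sRev_involutive]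
    rw [this, ih]

theorem reverse_run (x : T.strand) (n : ℕ) :
    M.reversePath ((List.iterate (T.next S) x n).map Subtype.val)
      = (List.iterate (T.next S) (T.mate S ((T.next S)^[n] x)) n).map Subtype.val := by
  induction n with
  | zero => rfl
  | succ n ih =>
    have e1 : T.mate S ((T.next S)^[n + 1] x) = T.sRev ((T.next S)^[n] x) := by
      rw [Function.iterate_succ_apply', next_apply, T.mate_involutive]
    have e2 : T.next S (T.sRev ((T.next S)^[n] x)) = T.mate S ((T.next S)^[n] x) := by
      rw [next_apply, T.sRev_involutive]
    rw [e1, iterate_add, show List.iterate (T.next S) (T.sRev ((T.next S)^[n] x)) (n + 1)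
      = _ :: List.iterate (T.next S) (T.next S _) n from rfl, e2, List.map_cons, ← ih]
    simp [CellSurface.reversePath, sRev]

variable [Finite D]

theorem lap_cons (x : T.strand) :
    ∃ v, T.lap S x = x.1 :: v ∧ T.lap S (T.next S x) = v ++ [x.1] := by
  have hp := Function.minimalPeriod_apply ((T.next S).injective.mem_periodicPts x)
  obtain ⟨n, hn⟩ := Nat.exists_eq_succ_of_ne_zero (minimalPeriod_pos (T.next S) x).ne'
  refine ⟨(List.iterate (T.next S) (T.next S x) n).map Subtype.val, ?_, ?_⟩
  · rw [lap, hn]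
    rfl
  · have h1 := Function.iterate_minimalPeriod (f := T.next S) (x := x)
    rw [hn] at h1
    rw [lap, hp, hn, Nat.succ_eq_add_one, iterate_add, List.map_append]
    congr 1
    show [((T.next S)^[n] (T.next S x)).1] = _
    rw [← Function.iterate_succ_apply, h1]

theorem lap_mate (x : T.strand) : T.lap S (T.mate S x) = M.reversePath (T.lap S x) := by
  have h1 := T.reverse_run S x (Function.minimalPeriod (T.next S) x)
  have h2 := T.iterate_next_mate S x (Function.minimalPeriod (T.next S) x)
  rw [Function.iterate_minimalPeriod] at h1 h2
  rw [lap, lap, h1, ← eq_minimalPeriod_of_nodup _ h2 (minimalPeriod_pos _ x)]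
  have h3 : (M.reversePath (T.lap S x)).Nodup := by
    rw [CellSurface.reversePath, List.nodup_reverse]
    refine List.Nodup.map (fun d e h => ?_)
      ((nodup_iterate _ x le_rfl).map Subtype.val_injective)
    rw [← M.rev_rev d, h, M.rev_rev]
  rw [lap, h1] at h3
  exact h3.of_map _

theorem loop_next (x : T.strand) :
    (Quot.mk _ (T.lap S (T.next S x)) : M.LoopClass) = Quot.mk _ (T.lap S x) := by
  obtain ⟨v, h1, h2⟩ := T.lap_cons S x
  symm
  exact Quot.sound (Or.inr (Or.inr
    ⟨CellSurface.isLoop_of_isWalk (T.isWalk_lap S x), [x.1], v, h1, h2⟩))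

theorem loop_mate (x : T.strand) :
    (Quot.mk _ (T.lap S (T.mate S x)) : M.LoopClass) = Quot.mk _ (T.lap S x) := by
  rw [lap_mate]
  symm
  exact Quot.sound (Or.inr (Or.inl rfl))

theorem loop_congr {x y : T.strand} (h : T.comp S x = T.comp S y) :
    (Quot.mk _ (T.lap S x) : M.LoopClass) = Quot.mk _ (T.lap S y) := by
  refine Conn.lift (fun x => (Quot.mk _ (T.lap S x) : M.LoopClass)) (fun x => ?_)
    (T.loop_mate S) ((T.comp_eq_iff S).1 h)
  rw [← T.loop_mate S (T.sRev x)]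
  exact T.loop_next S x

/-- The free homotopy class of a component. -/
def loopClass (C : T.Component S) : M.LoopClass := Quot.mk _ (T.lap S (T.rep C))

theorem loopClass_comp (x : T.strand) : T.loopClass S (T.comp S x) = Quot.mk _ (T.lap S x) :=
  T.loop_congr S (T.comp_rep _)

/-- The component of `x` is contractible as a loop. -/
def NullAt (x : T.strand) : Prop := M.Homotopic (M.vertexOf x.1) (T.lap S x) []

variable {T S}

theorem NullAt.next {x : T.strand} (h : T.NullAt S x) : T.NullAt S (T.next S x) := by
  obtain ⟨v, h1, h2⟩ := T.lap_cons S x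
  have hw := T.isWalk_lap S x
  have hw' := T.isWalk_lap S (T.next S x)
  unfold NullAt at h ⊢
  rw [h1] at h hw
  rw [h2] at hw' ⊢
  obtain ⟨b, h3, h4⟩ := IsWalk.append_iff.1 (show IsWalk _ _ _ ([x.1] ++ v) _ from hw)
  have hb : M.vertexOf (T.next S x).1 = b := (CellSurface.vertexOf_eq_iff.2
    (T.sameVertex_mate S (T.sRev x))).trans h3.2
  rw [hb]
  exact CellSurface.null_rotate h3 h4 h

theorem NullAt.mate {x : T.strand} (h : T.NullAt S x) : T.NullAt S (T.mate S x) := by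
  have h1 := CellSurface.null_reverse (T.isWalk_lap S x) h
  rwa [← lap_mate, ← CellSurface.vertexOf_eq_iff.2 (T.sameVertex_mate S x)] at h1

theorem NullAt.congr {x y : T.strand} (h : T.comp S x = T.comp S y) :
    T.NullAt S x ↔ T.NullAt S y := by
  have hm : ∀ x, T.NullAt S (T.mate S x) ↔ T.NullAt S x := fun x =>
    ⟨fun h => by
      have := h.mate
      rwa [T.mate_involutive] at this, NullAt.mate⟩
  have hr : ∀ x, T.NullAt S x → T.NullAt S (T.sRev x) := fun x h => (hm _).1 h.next
  refine iff_of_eq (Conn.lift (T.NullAt S) (fun x => propext ⟨fun h => ?_, hr x⟩)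
    (fun x => propext (hm x)) ((T.comp_eq_iff S).1 h))
  have := hr _ h
  rwa [T.sRev_involutive] at this

/-! ### Contractible circles are contractible as loops -/

omit [Finite D] in
theorem exists_iterate {P : Set T.strand} (hP : ∀ x ∈ P, T.sRev x ∉ P)
    {w : List (D ⊕ T.OverDart)} (hw : ∀ x ∈ w, ∃ d ∈ P, x = Sum.inl d.1) {a : Set (D ⊕ T.OverDart)}
    {d e : T.strand} (hd : d ∈ P) (he : e ∈ P)
    (h : IsWalk (T.resolved S).rev (T.resolved S).vertexOf a (Sum.inl d.1 :: w)
      ((T.resolved S).vertexOf (Sum.inl e.1))) :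
    ∃ n, erase (Sum.inl d.1 :: w) = (List.iterate (T.next S) d (n + 1)).map Subtype.val ∧
      (T.next S)^[n + 1] d = e := by
  have step : ∀ {d e : T.strand}, d ∈ P → e ∈ P →
      (T.resolved S).vertexOf (Sum.inl e.1) = (T.resolved S).vertexOf (Sum.inl (M.rev d.1)) →
      T.next S d = e := by
    intro d e hd he h
    rcases T.sameVertex_inl_strand (d := T.sRev d) (CellSurface.vertexOf_eq_iff.1 h) with rfl | rfl
    · exact absurd he (hP d hd)
    · rfl
  induction w generalizing a d with
  | nil =>
    exact ⟨0, rfl, step hd he h.2.symm⟩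
  | cons x w ih =>
    obtain ⟨f, hf, rfl⟩ := hw x List.mem_cons_self
    obtain ⟨n, h1, h2⟩ := ih (fun y hy => hw y (List.mem_cons_of_mem _ hy)) hf h.2
    have hs := step hd hf h.2.1
    refine ⟨n + 1, ?_, ?_⟩
    · rw [erase_inl, h1, show List.iterate (T.next S) d (n + 1 + 1)
        = d :: List.iterate (T.next S) (T.next S d) (n + 1) from rfl, hs]
      rfl
    · rw [Function.iterate_succ_apply, hs, h2]

/-- The boundary word of the disc runs once along the circle. -/
theorem nullAt_of_contractible {x : T.strand} (ha : ¬ T.IsArc (T.comp S x))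
    (h : T.Contractible (T.comp S x)) : T.NullAt S x := by
  obtain ⟨Z, hZ, hxZ⟩ := CellSurface.exists_isComponent (M := M) x.1
  obtain ⟨W, hW, hd⟩ := h.exists_side hZ hxZ rfl
  obtain ⟨b, w, h1, h2, h3, h4⟩ := hW.exists_null hZ ha hd
  set P : Set T.strand := {d | Sum.inl d.1 ∈ w} with hPdef
  have hP : ∀ d ∈ P, T.sRev d ∉ P := fun d hd hd' => by
    have e1 := (h4 _).1 hd
    have e2 := (h4 _).1 hd'
    exact e1.2 e2.1
  have hfr : ∀ y ∈ w, ∃ d ∈ P, T.comp S d = T.comp S x ∧ y = Sum.inl d.1 := by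
    intro y hy
    have : y ∈ (T.resolved S).frontier (T.lift S W) := fun h' =>
      ((h4 y).1 hy).2 (h'.1 ((h4 y).1 hy).1)
    rw [hW.front] at this
    obtain ⟨d, hd, rfl⟩ := this
    exact ⟨d, hy, hd, rfl⟩
  have hne : w ≠ [] := by
    rintro rfl
    have hx := (hW.front_inl x).2 rfl
    have e1 := h4 (Sum.inl x.1)
    have e2 := h4 ((T.resolved S).rev (Sum.inl x.1))
    rw [(T.resolved S).rev_rev] at e2
    simp only [List.not_mem_nil, false_iff, not_and, not_not] at e1 e2
    exact hx ⟨e1, e2⟩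
  rcases w with _ | ⟨y, w⟩
  · exact absurd rfl hne
  obtain ⟨d, hd, hdx, rfl⟩ := hfr y List.mem_cons_self
  have hb : (T.resolved S).vertexOf (Sum.inl d.1) = b := h1.1
  rw [← hb] at h1
  obtain ⟨n, h5, h6⟩ := exists_iterate hP (fun y hy => by
    obtain ⟨e, he, -, rfl⟩ := hfr y (List.mem_cons_of_mem _ hy)
    exact ⟨e, he, rfl⟩) hd hd h1
  have hnd : (erase (Sum.inl d.1 :: w)).Nodup := by
    refine List.Nodup.filterMap ?_ h3
    rintro (d | e) (d' | e') y <;> simp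
    rintro rfl rfl
    rfl
  rw [h5] at hnd
  have hn := eq_minimalPeriod_of_nodup (hnd.of_map _) h6 n.succ_pos
  rw [← NullAt.congr hdx, NullAt, lap, ← hn, ← h5]
  rw [← hb, base_vertexOf] at h2
  exact h2

end TangleDiagram

/-! ### Traces of circles and arcs -/

namespace TangleDiagram

variable {D : Type*} {M : CellSurface D} {T : TangleDiagram M} {S S' : T.Resolution}

theorem next_eq_sRev_iff {x : T.strand} : T.next S x = T.sRev x ↔ T.IsEnd (M.rev x.1) :=
  T.mate_eq_self_iff S (T.sRev x)

theorem follows_iff {d : T.strand} {e : D} :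
    T.Follows S d.1 e ↔ e = (T.next S d).1 ∧ ¬ T.IsEnd (M.rev d.1) := by
  rw [← next_eq_sRev_iff (S := S)]
  constructor
  · rintro ⟨he, ⟨h1, h2, h3⟩ | ⟨h1, h2⟩⟩
    · have h4 : T.mate S (T.sRev d) = ⟨e, he⟩ :=
        T.mate_eq_of_not_crossing S (d := T.sRev d) (e := ⟨e, he⟩) h1
          (fun h => h3 (congrArg Subtype.val h)) h2
      refine ⟨by rw [next_apply, h4], fun h => h3 ?_⟩
      rw [next_apply, h4] at h
      exact congrArg Subtype.val h
    · refine ⟨h2.trans (T.mate_crossing S (d := T.sRev d) h1).symm, ?_⟩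
      exact T.mate_ne_of_crossing S (d := T.sRev d) h1
  · rintro ⟨rfl, h⟩
    refine ⟨(T.next S d).2, ?_⟩
    by_cases h1 : T.IsCrossing (M.rev d.1)
    · exact Or.inr ⟨h1, T.mate_crossing S (d := T.sRev d) h1⟩
    · exact Or.inl ⟨h1, T.sameVertex_mate S (T.sRev d), fun h' => h (Subtype.ext h')⟩

theorem eq_iterate_of_isChain {d : T.strand} {t : List D}
    (h : (d.1 :: t).IsChain (T.Follows S)) :
    d.1 :: t = (List.iterate (T.next S) d (t.length + 1)).map Subtype.val := by
  induction t generalizing d with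
  | nil => rfl
  | cons y t ih =>
    rw [List.isChain_cons_cons] at h
    obtain ⟨rfl, -⟩ := follows_iff.1 h.1
    exact congrArg (d.1 :: ·) (ih h.2)

theorem isChain_iterate {d : T.strand} (h : ¬ T.IsArc (T.comp S d)) (n : ℕ) :
    ((List.iterate (T.next S) d n).map Subtype.val).IsChain (T.Follows S) := by
  induction n generalizing d with
  | zero => exact List.isChain_nil
  | succ n ih =>
    rcases n with _ | n
    · exact List.isChain_singleton _
    · refine List.isChain_cons_cons.2 ⟨follows_iff.2 ⟨rfl, fun he => h ?_⟩, ih ?_⟩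
      · exact ⟨T.sRev d, he, T.comp_sRev S d⟩
      · rwa [T.comp_next]

section Circles

variable [Finite D]

theorem tracesCircle_lap {d : T.strand} (h : ¬ T.IsArc (T.comp S d)) :
    T.TracesCircle (T.comp S d) (T.lap S d) := by
  refine ⟨isChain_iterate h _, (nodup_iterate _ d le_rfl).map Subtype.val_injective, ?_, ?_⟩
  · obtain ⟨n, hn⟩ := Nat.exists_eq_succ_of_ne_zero (minimalPeriod_pos (T.next S) d).ne'
    have h1 := Function.iterate_minimalPeriod (f := T.next S) (x := d)
    rw [hn, Function.iterate_succ_apply'] at h1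
    refine ⟨d.1, ?_, ((T.next S)^[n] d).1, ?_, follows_iff.2 ⟨congrArg _ h1.symm, fun he => h ?_⟩⟩
    · rw [lap, hn]
      rfl
    · rw [lap, hn, Nat.succ_eq_add_one, iterate_add, List.map_append]
      simp
    · exact ⟨T.sRev _, he, by rw [T.comp_sRev, T.comp_iterate_next]⟩
  · intro e he
    obtain ⟨x, hx, rfl⟩ := List.mem_map.1 he
    refine ⟨x.2, ?_⟩
    rw [← List.range_map_iterate] at hx
    obtain ⟨n, -, rfl⟩ := List.mem_map.1 hx
    exact T.comp_iterate_next S d n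

theorem exists_tracesCircle_iff {C : T.Component S} (hC : ¬ T.IsArc C) (γ : M.LoopClass) :
    (∃ p, T.TracesCircle C p ∧ Quot.mk _ p = γ) ↔ T.loopClass S C = γ := by
  constructor
  · rintro ⟨p, ⟨h1, h2, ⟨d, hd, e, he, hed⟩, h4⟩, rfl⟩
    rcases p with _ | ⟨x, t⟩
    · simp at hd
    obtain rfl : x = d := by simpa using hd
    obtain ⟨hx, rfl⟩ := h4 x List.mem_cons_self
    have h5 := eq_iterate_of_isChain (d := ⟨x, hx⟩) h1
    have he' : e = ((T.next S)^[t.length] ⟨x, hx⟩).1 := by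
      rw [h5, iterate_add, List.map_append] at he
      simpa using he.symm
    subst he'
    have h6 := (follows_iff.1 hed).1
    have hx' : (T.next S)^[t.length + 1] ⟨x, hx⟩ = ⟨x, hx⟩ := by
      rw [Function.iterate_succ_apply']
      exact Subtype.ext h6.symm
    rw [h5] at h2
    rw [T.loopClass_comp, lap, ← eq_minimalPeriod_of_nodup (h2.of_map _) hx' (Nat.succ_pos _), ← h5]
  · rintro rfl
    obtain ⟨d, rfl⟩ := Quot.exists_rep C
    exact ⟨_, tracesCircle_lap hC, (T.loopClass_comp S d).symm⟩

end Circles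

/-- The list of the darts from `x` to the end of its arc. -/
inductive Run (S : T.Resolution) : T.strand → List T.strand → Prop
  | last {x : T.strand} : T.IsEnd (M.rev x.1) → Run S x [x]
  | step {x : T.strand} {w : List T.strand} : ¬ T.IsEnd (M.rev x.1) → Run S (T.next S x) w →
      Run S x (x :: w)

theorem Run.unique {x : T.strand} {w w' : List T.strand} (h : Run S x w) (h' : Run S x w') :
    w = w' := by
  induction h generalizing w' with
  | last h =>
    cases h' with
    | last => rfl
    | step h1 => exact absurd h h1
  | step h _ ih =>
    cases h' with
    | last h1 => exact absurd h1 h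
    | step _ h1 => rw [ih h1]

theorem vertexOf_next (x : T.strand) : M.vertexOf (T.next S x).1 = M.vertexOf (M.rev x.1) :=
  CellSurface.vertexOf_eq_iff.2 (T.sameVertex_mate S (T.sRev x))

theorem Run.isWalk {x : T.strand} {w : List T.strand} (h : Run S x w) :
    ∃ b, IsWalk M.rev M.vertexOf (M.vertexOf x.1) (w.map Subtype.val) b := by
  induction h with
  | last => exact ⟨_, rfl, rfl⟩
  | @step x w _ _ ih =>
    obtain ⟨b, h⟩ := ih
    rw [vertexOf_next] at h
    exact ⟨b, rfl, h⟩

theorem Run.of_iterate {x : T.strand} {n : ℕ} {w : List T.strand}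
    (hx : ∀ k < n, ¬ T.IsEnd (M.rev ((T.next S)^[k] x).1)) (h : Run S ((T.next S)^[n] x) w) :
    Run S x (List.iterate (T.next S) x n ++ w) := by
  induction n generalizing x with
  | zero => exact h
  | succ n ih => exact .step (hx 0 n.succ_pos) (ih (fun k hk => hx (k + 1) (by omega)) h)

theorem Run.exists [Finite D] {x : T.strand} (hx : T.IsEnd x.1) : ∃ w, Run S x w := by
  have key : ∀ n (x : T.strand), T.IsEnd (M.rev ((T.next S)^[n] x).1) → ∃ w, Run S x w := by
    intro n
    induction n with
    | zero => exact fun x h => ⟨_, .last h⟩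
    | succ n ih =>
      intro x h
      by_cases h1 : T.IsEnd (M.rev x.1)
      · exact ⟨_, .last h1⟩
      · obtain ⟨w, hw⟩ := ih _ h
        exact ⟨_, .step h1 hw⟩
  obtain ⟨n, hn⟩ := Nat.exists_eq_succ_of_ne_zero (minimalPeriod_pos (T.next S) x).ne'
  have h1 := Function.iterate_minimalPeriod (f := T.next S) (x := x)
  rw [hn, Function.iterate_succ_apply', next_apply] at h1
  refine key n x ?_
  have h2 : T.sRev ((T.next S)^[n] x) = x := by
    rw [← T.mate_involutive S (T.sRev _), h1]
    exact (T.mate_eq_self_iff S x).2 hx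
  show T.IsEnd (T.sRev ((T.next S)^[n] x)).1
  rwa [h2]

theorem tracesArc_iff {p : List D} : T.TracesArc S p ↔
    ∃ (x : T.strand) (w : List T.strand), T.IsEnd x.1 ∧ Run S x w ∧ p = w.map Subtype.val := by
  constructor
  · rintro ⟨h1, ⟨d, hd, hde⟩, e, he, hee⟩
    rcases p with _ | ⟨x, t⟩
    · simp at hd
    obtain rfl : x = d := by simpa using hd
    have key : ∀ (t : List D) (x : T.strand), (x.1 :: t).IsChain (T.Follows S) →
        e ∈ (x.1 :: t).getLast? → ∃ w, Run S x w ∧ x.1 :: t = w.map Subtype.val := by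
      intro t
      induction t with
      | nil =>
        intro x _ hx
        obtain rfl : x.1 = e := by simpa using hx
        exact ⟨_, .last hee, rfl⟩
      | cons y t ih =>
        intro x h hx
        rw [List.isChain_cons_cons] at h
        obtain ⟨rfl, h2⟩ := follows_iff.1 h.1
        obtain ⟨w, h3, h4⟩ := ih (T.next S x) h.2 (by rwa [List.getLast?_cons_cons] at hx)
        exact ⟨_, .step h2 h3, by rw [h4]; rfl⟩
    obtain ⟨w, h2, h3⟩ := key t ⟨x, hde.1⟩ h1 he
    exact ⟨_, w, hde, h2, h3⟩
  · rintro ⟨x, w, hx, hw, rfl⟩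
    have key : ∀ {x w}, Run S x w → (w.map Subtype.val).IsChain (T.Follows S) ∧
        (w.map Subtype.val).head? = some x.1 ∧
        ∃ e ∈ (w.map Subtype.val).getLast?, T.IsEnd (M.rev e) := by
      intro x w hw
      induction hw with
      | last h => exact ⟨List.isChain_singleton _, rfl, _, rfl, h⟩
      | @step x w h1 hw ih =>
        obtain ⟨h2, h3, e, h4, h5⟩ := ih
        rcases w with _ | ⟨y, w⟩
        · simp at h3
        obtain hy : y.1 = (T.next S x).1 := by simpa using h3
        refine ⟨List.isChain_cons_cons.2 ⟨follows_iff.2 ⟨hy, h1⟩, h2⟩, rfl, e, ?_, h5⟩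
        rwa [List.map_cons, List.map_cons, List.getLast?_cons_cons]
    obtain ⟨h1, h2, h3⟩ := key hw
    exact ⟨h1, ⟨x.1, h2, hx⟩, h3⟩

/-! ### Traces at a saddle -/

section Smoothing

variable {p a q b : T.strand} (hs : Smoothing (T.mate S) (T.mate S') p a q b)

include hs

theorem next_off {y : T.strand} (hp : T.comp S y ≠ T.comp S p) (hq : T.comp S y ≠ T.comp S q) :
    T.next S' y = T.next S y := by
  rw [← T.comp_sRev S y] at hp hq
  refine hs.off_not (x := T.sRev y) ?_
  rintro (h | h | h | h)
  · exact hp (congrArg _ h)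
  · exact hp (by rw [h, ← hs.m_p, T.comp_mate])
  · exact hq (congrArg _ h)
  · exact hq (by rw [h, ← hs.m_q, T.comp_mate])

theorem iterate_off {x : T.strand} (hp : T.comp S x ≠ T.comp S p)
    (hq : T.comp S x ≠ T.comp S q) (n : ℕ) : (T.next S')^[n] x = (T.next S)^[n] x := by
  induction n with
  | zero => rfl
  | succ n ih =>
    rw [Function.iterate_succ_apply', ih, Function.iterate_succ_apply', next_off hs]
    · rwa [T.comp_iterate_next]
    · rwa [T.comp_iterate_next]

omit hs in
/-- A circle is run in one direction only. -/
theorem iterate_ne_sRev {x : T.strand} (ha : ¬ T.IsArc (T.comp S x)) (n : ℕ) :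
    (T.next S)^[n] x ≠ T.sRev x := by
  induction n using Nat.strong_induction_on generalizing x with
  | _ n ih =>
    intro h
    match n with
    | 0 => exact T.sRev_ne x h.symm
    | 1 => exact ha ⟨_, next_eq_sRev_iff.1 h, T.comp_sRev S x⟩
    | n + 2 =>
      rw [Function.iterate_succ_apply', Function.iterate_succ_apply] at h
      refine ih n (by omega) (x := T.next S x) (by rwa [T.comp_next]) ?_
      have h1 : T.sRev ((T.next S)^[n] (T.next S x)) = T.next S x := by
        rw [← T.mate_involutive S (T.sRev _)]
        exact congrArg (T.mate S) h
      exact (T.sRev_involutive _).symm.trans (congrArg T.sRev h1)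

variable [Finite D]

theorem lap_off {x : T.strand} (hp : T.comp S x ≠ T.comp S p) (hq : T.comp S x ≠ T.comp S q) :
    T.lap S' x = T.lap S x := by
  rw [lap, lap, minimalPeriod_congr (iterate_off hs hp hq), ← List.range_map_iterate,
    ← List.range_map_iterate]
  exact congrArg _ (List.map_congr_left fun n _ => iterate_off hs hp hq n)

/-- After the change of the resolution, the walk along a circle through `q` goes once around this circle
and ends in the dart `p`. -/
theorem iterate_circle (hne : T.comp S p ≠ T.comp S q) (hq : ¬ T.IsArc (T.comp S q)) :
    List.iterate (T.next S') q (Function.minimalPeriod (T.next S) q)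
      = List.iterate (T.next S) q (Function.minimalPeriod (T.next S) q) ∧
    (T.next S')^[Function.minimalPeriod (T.next S) q] q = p := by
  obtain ⟨m, hm⟩ := Nat.exists_eq_succ_of_ne_zero (minimalPeriod_pos (T.next S) q).ne'
  have h1 := Function.iterate_minimalPeriod (f := T.next S) (x := q)
  rw [hm, Function.iterate_succ_apply'] at h1
  have h2 : T.sRev ((T.next S)^[m] q) = b :=
    (T.mate_involutive S _).symm.trans ((congrArg (T.mate S) h1).trans hs.m_q)
  have hb : T.mate S b = q := by rw [← hs.m_q, T.mate_involutive]
  have hb' : T.mate S' b = p := by rw [← hs.m'_p, T.mate_involutive]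
  have hcomp : ∀ k, T.comp S (T.sRev ((T.next S)^[k] q)) = T.comp S q := fun k => by
    rw [T.comp_sRev, T.comp_iterate_next]
  have hstep : ∀ k < m, T.next S' ((T.next S)^[k] q) = T.next S ((T.next S)^[k] q) := by
    intro k hk
    refine hs.off_not (x := T.sRev _) ?_
    rintro (h | h | h | h)
    · exact hne (by rw [← h, hcomp])
    · refine hne ?_
      rw [← T.comp_mate S p, hs.m_p, ← h, hcomp]
    · refine iterate_ne_sRev hq k ?_
      rw [← h, T.sRev_involutive, h]
    · have : (T.next S)^[k + 1] q = q := by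
        rw [Function.iterate_succ_apply', next_apply, h, hb]
      have := Function.IsPeriodicPt.minimalPeriod_le k.succ_pos this
      omega
  have hit : ∀ k ≤ m, (T.next S')^[k] q = (T.next S)^[k] q := by
    intro k hk
    induction k with
    | zero => rfl
    | succ k ih =>
      rw [Function.iterate_succ_apply', ih (by omega), Function.iterate_succ_apply',
        hstep k (by omega)]
  refine ⟨?_, ?_⟩
  · rw [hm, ← List.range_map_iterate, ← List.range_map_iterate]
    refine List.map_congr_left fun k hk => hit k ?_
    have := List.mem_range.1 hk
    omega
  · rw [hm, Function.iterate_succ_apply', hit m le_rfl, next_apply, h2, hb']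

/-- Two circles are joined to one. -/
theorem lap_merge (hne : T.comp S p ≠ T.comp S q) (hp : ¬ T.IsArc (T.comp S p))
    (hq : ¬ T.IsArc (T.comp S q)) : T.lap S' p = T.lap S p ++ T.lap S q := by
  obtain ⟨h1, h2⟩ := iterate_circle hs hne hq
  obtain ⟨h3, h4⟩ := iterate_circle hs.turn hne.symm hp
  set m := Function.minimalPeriod (T.next S) p with hm
  set n := Function.minimalPeriod (T.next S) q with hn
  have h5 : List.iterate (T.next S') p (m + n)
      = List.iterate (T.next S) p m ++ List.iterate (T.next S) q n := by
    rw [iterate_add, h4, h1, h3]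
  have h6 : (T.next S')^[m + n] p = p := by
    rw [add_comm, Function.iterate_add_apply, h4, h2]
  have h7 : (List.iterate (T.next S') p (m + n)).Nodup := by
    rw [h5, List.nodup_append']
    refine ⟨nodup_iterate _ p le_rfl, nodup_iterate _ q le_rfl, fun x hx hx' => hne ?_⟩
    rw [← List.range_map_iterate] at hx hx'
    obtain ⟨i, -, rfl⟩ := List.mem_map.1 hx
    obtain ⟨j, -, hj⟩ := List.mem_map.1 hx'
    rw [← T.comp_iterate_next S p i, ← hj, T.comp_iterate_next]
  rw [lap, ← eq_minimalPeriod_of_nodup h7 h6 (Nat.add_pos_left (minimalPeriod_pos _ _) _), h5,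
    List.map_append]
  rfl

/-- If an arc passes the smoothing and a contractible circle is joined to it there, then the run along
the arc is changed by the insertion of this circle. -/
theorem Run.insert (hne : T.comp S p ≠ T.comp S q) (hq : ¬ T.IsArc (T.comp S q))
    (hc : T.Contractible (T.comp S q)) {x : T.strand} (hx : T.sRev x = a)
    {w w' : List T.strand} (h' : Run S' (T.next S x) w')
    (hw : M.Homotopic (M.vertexOf (T.next S x).1) (w.map Subtype.val) (w'.map Subtype.val)) :
    ∃ w'', Run S' x w'' ∧ M.Homotopic (M.vertexOf x.1) ((x :: w).map Subtype.val)
      (w''.map Subtype.val) := by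
  have hp : T.next S x = p := by rw [next_apply, hx, ← hs.m_p, T.mate_involutive]
  have hp' : T.next S' x = q := by rw [next_apply, hx, ← hs.m'_q, T.mate_involutive]
  have hv := vertexOf_next (S := S) x
  have hv' : M.vertexOf q.1 = M.vertexOf (M.rev x.1) := by
    rw [← hp']
    exact vertexOf_next x
  have hx' : ¬ T.IsEnd (M.rev x.1) := by
    rw [← next_eq_sRev_iff (S := S), hp, hx]
    exact hs.ne.1
  obtain ⟨h1, h2⟩ := iterate_circle hs hne hq
  have hnull := nullAt_of_contractible hq hc
  obtain ⟨c, hwalk⟩ := h'.isWalk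
  have hxw : IsWalk M.rev M.vertexOf (M.vertexOf x.1) [x.1] (M.vertexOf (M.rev x.1)) := ⟨rfl, rfl⟩
  rw [hp, ← h2] at h'
  have h3 := Run.of_iterate (fun k hk he => hq ?_) h'
  · rw [h1] at h3
    refine ⟨x :: (List.iterate (T.next S) q (Function.minimalPeriod (T.next S) q) ++ w'),
      .step hx' (by rwa [hp']), ?_⟩
    rw [hv] at hw hwalk
    rw [NullAt, hv'] at hnull
    refine (hw.append_left hxw).trans ?_
    have := CellSurface.Homotopic.insert hxw hwalk hnull
    rw [List.map_cons, List.map_append]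
    exact this
  · have h4 : (T.next S')^[k] q = (T.next S)^[k] q := by
      have h5 := congrArg (fun l => l[k]?) h1
      simpa [List.getElem?_iterate, hk] using h5
    rw [h4] at he
    exact ⟨T.sRev _, he, by rw [T.comp_sRev, T.comp_iterate_next]⟩

/-- The arcs keep their homotopy classes if at most a contractible circle is joined to them. -/
theorem Run.detour (hne : T.comp S p ≠ T.comp S q) (hq : ¬ T.IsArc (T.comp S q))
    {x : T.strand} {w : List T.strand} (h : Run S x w) (hxq : T.comp S x ≠ T.comp S q)
    (hc : T.comp S x = T.comp S p → T.Contractible (T.comp S q)) :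
    ∃ w', Run S' x w' ∧ M.Homotopic (M.vertexOf x.1) (w.map Subtype.val)
      (w'.map Subtype.val) := by
  induction h with
  | last h => exact ⟨_, .last h, .refl _⟩
  | @step x w h1 h ih =>
    rw [T.comp_next] at ih
    obtain ⟨w', h2, h3⟩ := ih hxq hc
    have hpa : T.comp S a = T.comp S p := by rw [← hs.m_p, T.comp_mate]
    have hqb : T.comp S b = T.comp S q := by rw [← hs.m_q, T.comp_mate]
    rw [← T.comp_sRev S x] at hc hxq
    by_cases hxa : T.sRev x = a
    · exact Run.insert hs hne hq (hc (by rw [hxa, hpa])) hxa h2 h3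
    by_cases hxp : T.sRev x = p
    · have hs' := hs.flip (T.mate_involutive S) (T.mate_involutive S')
      refine Run.insert hs' (by rwa [hpa, hqb]) (by rwa [hqb]) ?_ hxp h2 h3
      rw [hqb]
      exact hc (by rw [hxp])
    have hn : T.next S' x = T.next S x := by
      refine hs.off_not (x := T.sRev x) ?_
      rintro (h | h | h | h)
      · exact hxp h
      · exact hxa h
      · exact hxq (by rw [h])
      · exact hxq (by rw [h, hqb])
    refine ⟨_, .step h1 (hn.symm ▸ h2), ?_⟩
    rw [vertexOf_next] at h3
    exact h3.append_left (u := [x.1]) ⟨rfl, rfl⟩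

omit hs in
theorem arcs_eq (h : ∀ x : T.strand, T.IsEnd x.1 → ∀ w, Run S x w →
      ∃ w', Run S' x w' ∧ M.Homotopic (M.vertexOf x.1) (w.map Subtype.val) (w'.map Subtype.val)) :
    {κ : M.PathClass | ∃ p, T.TracesArc S' p ∧ κ = Quot.mk _ p}
      = {κ | ∃ p, T.TracesArc S p ∧ κ = Quot.mk _ p} := by
  ext κ
  constructor
  · rintro ⟨p, hp, rfl⟩
    obtain ⟨x, w', hx, hw', rfl⟩ := tracesArc_iff.1 hp
    obtain ⟨w, hw⟩ := Run.exists (S := S) hx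
    obtain ⟨w'', h1, h2⟩ := h x hx w hw
    obtain rfl := hw'.unique h1
    exact ⟨_, tracesArc_iff.2 ⟨x, w, hx, hw, rfl⟩, h2.pathClass_eq.symm⟩
  · rintro ⟨p, hp, rfl⟩
    obtain ⟨x, w, hx, hw, rfl⟩ := tracesArc_iff.1 hp
    obtain ⟨w', h1, h2⟩ := h x hx w hw
    exact ⟨_, tracesArc_iff.2 ⟨x, w', hx, h1, rfl⟩, h2.pathClass_eq⟩

end Smoothing

end TangleDiagram

/-! ### The glyph is preserved by the horizontal differential -/

/-- The decorations of two components and of the component which arises from their merging, or is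
divided into them, if the labels of the noncontractible circles add up and arcs are joined to
contractible circles only. -/
def Balanced (A B C : Decor) : Prop :=
  (A.IsTriv ∧ B.IsTriv ∧ C.IsTriv) ∨ (A.IsTriv ∧ ∃ ε, B = .ess ε ∧ C = .ess ε) ∨
  (∃ ε, A = .ess ε ∧ B.IsTriv ∧ C = .ess ε) ∨ (∃ ε, A = .ess ε ∧ B = .ess (!ε) ∧ C.IsTriv) ∨
  (A.IsTriv ∧ B = .arc ∧ C = .arc) ∨ (A = .arc ∧ B.IsTriv ∧ C = .arc)

theorem Merge.balanced {A B C : Decor} (h : Merge A B C) : Balanced A B C := by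
  cases h <;> simp [Balanced, Decor.IsTriv]

theorem Divide.balanced {A B C : Decor} (h : Divide A B C) : Balanced B C A := by
  cases h <;> simp [Balanced, Decor.IsTriv]

theorem Decor.weight_of_isTriv {A : Decor} (h : A.IsTriv) : A.weight = 0 := by
  cases A <;> simp_all [Decor.IsTriv, Decor.weight]

theorem Decor.weight_not (ε : Bool) : (Decor.ess (!ε)).weight = -(Decor.ess ε).weight := by
  cases ε <;> rfl

namespace TangleDiagram

variable {D : Type*} {M : CellSurface D} [Finite D] {T : TangleDiagram M} {S : T.Resolution}
  {c : T.Crossing}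

theorem touches_flip (hb : T.bridge c ∉ T.rels S) (d : T.strand) :
    T.Touches (T.flip S c) c d ↔ T.Touches S c d := by
  rw [← merge_touches hb, Touches, ← merge_comp hb, or_self]

open Classical in
variable (T) in
/-- The contribution of a component to the label of the class `γ`. -/
def labelAt (s : T.State) (γ : M.LoopClass) (C : T.Component s.1) : ℤ :=
  if T.loopClass s.1 C = γ then (T.decor s C).weight else 0

theorem isLabelled_iff {s : T.State} {γ : M.LoopClass} {ε : Bool} {C : T.Circle s.1} :
    T.IsLabelled s γ ε C ↔ T.loopClass s.1 C.1 = γ ∧ T.decor s C.1 = .ess ε := by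
  rw [IsLabelled, exists_tracesCircle_iff C.2, decor, dif_neg C.2]
  split_ifs with h
  · simp [h]
  · simp only [h, not_false_eq_true, true_and, Decor.ess.injEq]
    rfl

theorem label_eq (s : T.State) (γ : M.LoopClass) [Fintype (T.Component s.1)] :
    (T.glyph s).label γ = ∑ C, T.labelAt s γ C := by
  classical
  have h1 : ∑ C, T.labelAt s γ C = ∑ C : T.Circle s.1, T.labelAt s γ C.1 := by
    refine (Finset.sum_of_injOn (fun C : T.Circle s.1 => C.1) Subtype.val_injective.injOn
      (by simp) (fun C _ hC => ?_) (fun _ _ => rfl)).symm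
    have hC : T.IsArc C := by
      by_contra h
      exact hC ⟨⟨C, h⟩, Finset.mem_coe.2 (Finset.mem_univ _), rfl⟩
    rw [labelAt, decor, dif_pos hC]
    simp [Decor.weight]
  have h2 : ∀ C : T.Circle s.1, T.labelAt s γ C.1
      = (if T.IsLabelled s γ true C then 1 else 0)
        - (if T.IsLabelled s γ false C then 1 else 0) := by
    intro C
    simp only [isLabelled_iff, labelAt]
    by_cases h : T.loopClass s.1 C.1 = γ
    · rcases T.decor s C.1 with _ | _ | (_ | _) <;> simp [h, Decor.weight]
    · simp [h]
  rw [h1, Finset.sum_congr rfl fun C _ => h2 C, Finset.sum_sub_distrib]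
  simp only [glyph, Nat.card_eq_fintype_card, Fintype.card_subtype, Finset.sum_boole]

open Classical in
theorem labelAt_dec (s : T.State) (γ : M.LoopClass) (d : T.strand) :
    T.labelAt s γ (T.comp s.1 d)
      = if (Quot.mk _ (T.lap s.1 d) : M.LoopClass) = γ then (T.dec s d).weight else 0 := by
  rw [labelAt, loopClass_comp, dec]
  congr

omit [Finite D] in
theorem not_isArc_of_dec {s : T.State} {d : T.strand} (h : T.dec s d ≠ .arc) :
    ¬ T.IsArc (T.comp s.1 d) := fun h' => h (T.dec_eq_arc_iff.2 h')

omit [Finite D] in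
theorem circle_of_isTriv {s : T.State} {d : T.strand} (h : (T.dec s d).IsTriv) :
    ¬ T.IsArc (T.comp s.1 d) ∧ T.Contractible (T.comp s.1 d) := by
  have h1 : ¬ T.IsArc (T.comp s.1 d) := not_isArc_of_dec fun h' => by
    rw [h'] at h
    exact h
  exact ⟨h1, (T.isTriv_dec_iff h1).1 h⟩

theorem nullAt_of_isTriv {s : T.State} {d : T.strand} (h : (T.dec s d).IsTriv) :
    T.NullAt s.1 d :=
  nullAt_of_contractible (circle_of_isTriv h).1 (circle_of_isTriv h).2

omit [Finite D] in
theorem not_isArc_of_ess {s : T.State} {d : T.strand} {ε : Bool} (h : T.dec s d = .ess ε) :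
    ¬ T.IsArc (T.comp s.1 d) := not_isArc_of_dec (by simp [h])

/-- The labels of the circles at a saddle add up. -/
theorem labelAt_add (hb : T.bridge c ∉ T.rels S) {σ : T.Circle S → Bool}
    {τ : T.Circle (T.flip S c) → Bool}
    (h : Balanced (T.dec ⟨S, σ⟩ (T.dartAt c)) (T.dec ⟨S, σ⟩ (T.oppAt c))
      (T.dec ⟨T.flip S c, τ⟩ (T.dartAt c))) (γ : M.LoopClass) :
    T.labelAt ⟨S, σ⟩ γ (T.comp S (T.dartAt c)) + T.labelAt ⟨S, σ⟩ γ (T.comp S (T.oppAt c))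
      = T.labelAt ⟨T.flip S c, τ⟩ γ (T.comp (T.flip S c) (T.dartAt c)) := by
  classical
  have hs := T.smoothing_at S c
  have hne := merge_ne hb
  rw [T.labelAt_dec ⟨S, σ⟩, T.labelAt_dec ⟨S, σ⟩, T.labelAt_dec ⟨T.flip S c, τ⟩]
  have hv : M.vertexOf (T.oppAt c).1 = M.vertexOf (T.dartAt c).1 :=
    CellSurface.vertexOf_eq_iff.2 ((M.sameVertex_rot _).trans (M.sameVertex_rot _))
  have hp := T.isWalk_lap S (T.dartAt c)
  have hq := T.isWalk_lap S (T.oppAt c)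
  rw [hv] at hq
  rcases h with ⟨h1, h2, h3⟩ | ⟨h1, ε, h2, h3⟩ | ⟨ε, h1, h2, h3⟩ | ⟨ε, h1, h2, h3⟩ |
    ⟨h1, h2, h3⟩ | ⟨h1, h2, h3⟩
  · rw [Decor.weight_of_isTriv h1, Decor.weight_of_isTriv h2, Decor.weight_of_isTriv h3]
    simp
  · have hl := lap_merge hs hne (circle_of_isTriv h1).1 (not_isArc_of_ess h2)
    have := ((nullAt_of_isTriv h1).append_right hp hq).loopClass_eq
    rw [Decor.weight_of_isTriv h1, h2, h3, hl, this]
    simp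
  · have hl := lap_merge hs hne (not_isArc_of_ess h1) (circle_of_isTriv h2).1
    have hn := nullAt_of_isTriv h2
    rw [NullAt, hv] at hn
    have := (hn.append_left hp).loopClass_eq
    rw [Decor.weight_of_isTriv h2, h1, h3, hl, this]
    simp
  · have hl := lap_merge hs hne (not_isArc_of_ess h1) (not_isArc_of_ess h2)
    have hn := nullAt_of_isTriv h3
    rw [NullAt, hl] at hn
    have := CellSurface.loopClass_eq_of_null hp hq hn
    rw [Decor.weight_of_isTriv h3, h1, h2, this, Decor.weight_not]
    split_ifs <;> simp
  · rw [Decor.weight_of_isTriv h1, h2, h3]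
    simp [Decor.weight]
  · rw [Decor.weight_of_isTriv h2, h1, h3]
    simp [Decor.weight]

theorem glyph_merge (hb : T.bridge c ∉ T.rels S) {σ : T.Circle S → Bool}
    {τ : T.Circle (T.flip S c) → Bool}
    (hoff : ∀ d, ¬ T.Touches S c d → T.dec ⟨S, σ⟩ d = T.dec ⟨T.flip S c, τ⟩ d)
    (h : Balanced (T.dec ⟨S, σ⟩ (T.dartAt c)) (T.dec ⟨S, σ⟩ (T.oppAt c))
      (T.dec ⟨T.flip S c, τ⟩ (T.dartAt c))) :
    T.glyph ⟨T.flip S c, τ⟩ = T.glyph ⟨S, σ⟩ := by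
  classical
  have hs := T.smoothing_at S c
  have hne := merge_ne hb
  have harcs : (T.glyph ⟨T.flip S c, τ⟩).arcs = (T.glyph ⟨S, σ⟩).arcs := by
    refine arcs_eq (S := S) fun x hx w hw => ?_
    have hxa : T.IsArc (T.comp S x) := ⟨x, hx, rfl⟩
    -- at most one of the two components is an arc, and then the other one is contractible
    have key : (¬ T.IsArc (T.comp S (T.oppAt c)) ∧
          (T.comp S x = T.comp S (T.dartAt c) → T.Contractible (T.comp S (T.oppAt c)))) ∨
        (¬ T.IsArc (T.comp S (T.dartAt c)) ∧
          (T.comp S x = T.comp S (T.oppAt c) → T.Contractible (T.comp S (T.dartAt c)))) := by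
      have both : ¬ T.IsArc (T.comp S (T.dartAt c)) → ¬ T.IsArc (T.comp S (T.oppAt c)) →
          ¬ T.IsArc (T.comp S (T.oppAt c)) ∧
          (T.comp S x = T.comp S (T.dartAt c) → T.Contractible (T.comp S (T.oppAt c))) :=
        fun h1 h2 => ⟨h2, fun h' => absurd (h' ▸ hxa) h1⟩
      rcases h with ⟨h1, h2, -⟩ | ⟨h1, ε, h2, -⟩ | ⟨ε, h1, h2, -⟩ | ⟨ε, h1, h2, -⟩ |
        ⟨h1, -, -⟩ | ⟨-, h2, -⟩
      · exact Or.inl (both (circle_of_isTriv h1).1 (circle_of_isTriv h2).1)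
      · exact Or.inl (both (circle_of_isTriv h1).1 (not_isArc_of_ess h2))
      · exact Or.inl (both (not_isArc_of_ess h1) (circle_of_isTriv h2).1)
      · exact Or.inl (both (not_isArc_of_ess h1) (not_isArc_of_ess h2))
      · exact Or.inr ⟨(circle_of_isTriv h1).1, fun _ => (circle_of_isTriv h1).2⟩
      · exact Or.inl ⟨(circle_of_isTriv h2).1, fun _ => (circle_of_isTriv h2).2⟩
    rcases key with ⟨h1, h2⟩ | ⟨h1, h2⟩
    · exact Run.detour hs hne h1 hw (fun h' => h1 (h' ▸ hxa)) h2
    · exact Run.detour hs.turn hne.symm h1 hw (fun h' => h1 (h' ▸ hxa)) h2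
  have hlabel : (T.glyph ⟨T.flip S c, τ⟩).label = (T.glyph ⟨S, σ⟩).label := by
    funext γ
    have := Fintype.ofFinite (T.Component S)
    have := Fintype.ofFinite (T.Component (T.flip S c))
    rw [label_eq ⟨T.flip S c, τ⟩, label_eq ⟨S, σ⟩]
    have h1 := merge_sum hb (f := T.labelAt ⟨S, σ⟩ γ) (g := T.labelAt ⟨T.flip S c, τ⟩ γ) ?_
    · have h2 := labelAt_add hb h γ
      linarith
    · intro d hd
      rw [T.labelAt_dec ⟨S, σ⟩, T.labelAt_dec ⟨T.flip S c, τ⟩, hoff d hd,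
        lap_off hs (fun h => hd (Or.inl h)) (fun h => hd (Or.inr h))]
  exact congrArg₂ Glyph.mk harcs hlabel

/-- The entries of the horizontal differential preserve the glyph. -/
theorem glyph_local {s s' : T.State} (h : T.Local T.dec Merge Divide c s s') :
    T.glyph s' = T.glyph s := by
  obtain ⟨S, σ⟩ := s
  obtain ⟨S', τ⟩ := s'
  have h1 : S' = T.flip S c := h.1
  obtain ⟨-, h2, ⟨h3, h4, h5⟩ | ⟨h3, h4, h5⟩⟩ := h
  · subst h1
    refine glyph_merge ?_ h2 h5.balanced
    rw [bridge_mem_iff]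
    rintro (h | ⟨h, h'⟩)
    · exact h3 h
    · rw [T.dec_eq_arc_iff.2 h, T.dec_eq_arc_iff.2 h'] at h5
      cases h5
  · have h1' : S = T.flip S' c := by rw [h1, T.flip_flip]
    subst h1'
    have hb : T.bridge c ∉ T.rels S' := by
      rw [bridge_mem_iff]
      rintro (h | ⟨h, h'⟩)
      · exact h4 h
      · rw [T.dec_eq_arc_iff (s := ⟨S', τ⟩) |>.2 h, T.dec_eq_arc_iff (s := ⟨S', τ⟩) |>.2 h'] at h5
        generalize T.dec ⟨T.flip S' c, σ⟩ (T.dartAt c) = A at h5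
        cases h5
    exact (glyph_merge hb (fun d hd => (h2 d fun h => hd ((touches_flip hb d).1 h)).symm)
      h5.balanced).symm

end TangleDiagram

/-! ### The degrees of the pure states -/

namespace TangleDiagram

variable {D : Type*} {M : CellSurface D} (T : TangleDiagram M)

section Degrees

variable [Finite D]

instance (S : T.Resolution) : Fintype (T.Component S) := Fintype.ofFinite _

/-- The number of `+` minus the number of `-` on the noncontractible circles. -/
def essDegree (s : T.State) : ℤ := ∑ C : T.Component s.1, (T.decor s C).weight

/-- The number of `+` minus the number of `-` on all circles. -/
def signDegree (s : T.State) : ℤ := ∑ C : T.Component s.1, (T.decor s C).charge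

variable {T} {S : T.Resolution} {c : T.Crossing} (hb : T.bridge c ∉ T.rels S)
  (σ : T.Circle S → Bool) (τ : T.Circle (T.flip S c) → Bool)

include hb

theorem dec_off (h : ∀ d, ¬ T.Touches S c d → T.sign ⟨S, σ⟩ d = T.sign ⟨T.flip S c, τ⟩ d)
    (d : T.strand) (hd : ¬ T.Touches S c d) :
    T.dec ⟨S, σ⟩ d = T.dec ⟨T.flip S c, τ⟩ d := by
  refine Decor.ext_sign (by rw [T.toSign_dec, T.toSign_dec, h d hd]) ?_
  by_cases ha : T.IsArc (T.comp S d)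
  · have ha' := (merge_isArc_off hb hd).2 ha
    rw [T.dec_eq_arc_iff (s := ⟨S, σ⟩).2 ha, T.dec_eq_arc_iff (s := ⟨T.flip S c, τ⟩).2 ha']
  · have ha' : ¬ T.IsArc (T.comp (T.flip S c) d) := fun h => ha ((merge_isArc_off hb hd).1 h)
    rw [T.isTriv_dec_iff (s := ⟨S, σ⟩) ha, T.isTriv_dec_iff (s := ⟨T.flip S c, τ⟩) ha']
    exact contractible_flip hb hd ha

theorem pants_dec : Pants (T.dec ⟨S, σ⟩ (T.dartAt c)) (T.dec ⟨S, σ⟩ (T.oppAt c))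
    (T.dec ⟨T.flip S c, τ⟩ (T.dartAt c)) := by
  intro hA hB
  rw [Ne, T.dec_eq_arc_iff] at hA hB
  have hC : ¬ T.IsArc (T.comp (T.flip S c) (T.dartAt c)) := fun h =>
    ((merge_isArc hb).1 h).elim hA hB
  rw [T.isTriv_dec_iff hA, T.isTriv_dec_iff hB, T.isTriv_dec_iff (s := ⟨T.flip S c, τ⟩) hC]
  exact contractible_merge hb hA hB

theorem degree_sum (φ : Decor → ℤ)
    (h : ∀ d, ¬ T.Touches S c d → T.sign ⟨S, σ⟩ d = T.sign ⟨T.flip S c, τ⟩ d) :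
    ∑ C, φ (T.decor ⟨S, σ⟩ C) - φ (T.dec ⟨S, σ⟩ (T.dartAt c)) - φ (T.dec ⟨S, σ⟩ (T.oppAt c))
      = ∑ C, φ (T.decor ⟨T.flip S c, τ⟩ C) - φ (T.dec ⟨T.flip S c, τ⟩ (T.dartAt c)) :=
  merge_sum hb (f := fun C => φ (T.decor ⟨S, σ⟩ C))
    (g := fun C => φ (T.decor ⟨T.flip S c, τ⟩ C))
    (fun d hd => congrArg φ (dec_off hb σ τ h d hd))

omit hb

/-- A surgery does not increase `T.essDegree`, and the entries which preserve it are those of the skein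
algebra. -/
theorem local_sign {s s' : T.State} (h : T.Local T.sign SignMerge SignDivide c s s') :
    T.essDegree s' ≤ T.essDegree s ∧ T.signDegree s' = T.signDegree s - 1 ∧
      (T.essDegree s' = T.essDegree s ↔ T.Local T.dec Merge Divide c s s') := by
  obtain ⟨S, σ⟩ := s
  obtain ⟨S', τ⟩ := s'
  have h1 : S' = T.flip S c := h.1
  obtain ⟨-, h2, ⟨h3, h4, h5⟩ | ⟨h3, h4, h5⟩⟩ := h
  · subst h1
    have hb : T.bridge c ∉ T.rels S := by
      rw [bridge_mem_iff]
      rintro (h | ⟨h, h'⟩)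
      · exact h3 h
      · rw [T.sign_arc (s := ⟨S, σ⟩) h, T.sign_arc (s := ⟨S, σ⟩) h'] at h5
        exact SignMerge.not_arcs h5
    simp only [← toSign_dec] at h5
    obtain ⟨a1, a2, a3⟩ := h5.weight (pants_dec hb σ τ)
    have e1 := degree_sum hb σ τ Decor.weight h2
    have e2 := degree_sum hb σ τ Decor.charge h2
    refine ⟨?_, ?_, ?_⟩
    · unfold essDegree; linarith
    · unfold signDegree; linarith
    · have : T.Local T.dec Merge Divide c ⟨S, σ⟩ ⟨T.flip S c, τ⟩ ↔
          Merge (T.dec ⟨S, σ⟩ (T.dartAt c)) (T.dec ⟨S, σ⟩ (T.oppAt c))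
            (T.dec ⟨T.flip S c, τ⟩ (T.dartAt c)) := by
        constructor
        · rintro ⟨-, -, ⟨-, -, h⟩ | ⟨h, -⟩⟩
          · exact h
          · exact absurd h h3
        · exact fun h => ⟨rfl, fun d hd => dec_off hb σ τ h2 d hd, Or.inl ⟨h3, h4, h⟩⟩
      rw [this, ← a3]
      unfold essDegree
      constructor <;> intro h <;> linarith
  -- a division is a merging backwards
  · have h1' : S = T.flip S' c := by rw [h1, T.flip_flip]
    subst h1'
    have hb : T.bridge c ∉ T.rels S' := by
      rw [bridge_mem_iff]
      rintro (h | ⟨h, h'⟩)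
      · exact h4 h
      · rw [T.sign_arc (s := ⟨S', τ⟩) h, T.sign_arc (s := ⟨S', τ⟩) h'] at h5
        exact SignDivide.not_arcs h5
    have h2' : ∀ d, ¬ T.Touches S' c d → T.sign ⟨S', τ⟩ d = T.sign ⟨T.flip S' c, σ⟩ d :=
      fun d hd => (h2 d (fun h => hd ((touches_flip hb d).1 h))).symm
    simp only [← toSign_dec] at h5
    obtain ⟨a1, a2, a3⟩ := h5.weight (pants_dec hb τ σ)
    have e1 := degree_sum hb τ σ Decor.weight h2'
    have e2 := degree_sum hb τ σ Decor.charge h2'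
    refine ⟨?_, ?_, ?_⟩
    · unfold essDegree; linarith
    · unfold signDegree; linarith
    · have : T.Local T.dec Merge Divide c ⟨T.flip S' c, σ⟩ ⟨S', τ⟩ ↔
          Divide (T.dec ⟨T.flip S' c, σ⟩ (T.dartAt c)) (T.dec ⟨S', τ⟩ (T.dartAt c))
            (T.dec ⟨S', τ⟩ (T.oppAt c)) := by
        constructor
        · rintro ⟨-, -, ⟨h, -⟩ | ⟨-, -, h⟩⟩
          · exact absurd h3 h
          · exact h
        · exact fun h => ⟨h1, fun d hd => (dec_off hb τ σ h2' d
            (fun h => hd ((touches_flip hb d).2 h))).symm, Or.inr ⟨h3, h4, h⟩⟩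
      rw [this, ← a3]
      unfold essDegree
      constructor <;> intro h <;> linarith

omit [Finite D] in
theorem Local.toSign {s s' : T.State} (h : T.Local T.dec Merge Divide c s s') :
    T.Local T.sign SignMerge SignDivide c s s' := by
  obtain ⟨h1, h2, h3⟩ := h
  refine ⟨h1, fun d hd => by rw [← toSign_dec, ← toSign_dec, h2 d hd], h3.imp ?_ ?_⟩
  · rintro ⟨a, b, h⟩
    exact ⟨a, b, by simpa only [toSign_dec] using h.toSign⟩
  · rintro ⟨a, b, h⟩
    exact ⟨a, b, by simpa only [toSign_dec] using h.toSign⟩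

end Degrees

/-- The nonzero entries of the horizontal differential. -/
theorem saddle_iff {c : T.Crossing} {s s' : T.State} :
    T.Saddle c s s' ↔ s.1 c = false ∧ T.Local T.dec Merge Divide c s s' := by
  have hone : ∀ (S : T.Resolution) (C : T.Component S), T.touching S c = {C} ↔
      T.comp S (T.dartAt c) = C ∧ T.comp S (T.oppAt c) = C := by
    intro S C
    rw [touching_eq, show ({C} : Set (T.Component S)) = {C, C} from (Set.pair_eq_singleton C).symm,
      Set.pair_eq_pair_iff, or_self]
  classical
  unfold Saddle Local
  constructor
  · rintro ⟨h1, h2, h3, h4⟩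
    have hf : Function.update s.1 c true = T.flip s.1 c := by
      rw [flip, h1]
      rfl
    refine ⟨h1, h2.trans hf, fun d hd => h3 d ?_, ?_⟩
    · rw [touching_eq]
      exact hd
    rcases h4 with ⟨A, B, C, hAB, h5, h6, h7⟩ | ⟨A, B, C, hBC, h5, h6, h7⟩
    · rw [hone] at h6
      rw [touching_eq, Set.pair_eq_pair_iff] at h5
      refine Or.inl ⟨?_, h6.1.trans h6.2.symm, ?_⟩
      · rcases h5 with ⟨rfl, rfl⟩ | ⟨rfl, rfl⟩
        · exact hAB
        · exact hAB.symm
      · unfold dec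
        rw [h6.1]
        rcases h5 with ⟨rfl, rfl⟩ | ⟨rfl, rfl⟩
        · exact h7
        · exact h7.symm
    · rw [hone] at h5
      rw [touching_eq, Set.pair_eq_pair_iff] at h6
      refine Or.inr ⟨h5.1.trans h5.2.symm, ?_, ?_⟩
      · rcases h6 with ⟨rfl, rfl⟩ | ⟨rfl, rfl⟩
        · exact hBC
        · exact hBC.symm
      · unfold dec
        rw [h5.1]
        rcases h6 with ⟨rfl, rfl⟩ | ⟨rfl, rfl⟩
        · exact h7
        · exact h7.symm
  · rintro ⟨h1, h2, h3, h4⟩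
    have hf : Function.update s.1 c true = T.flip s.1 c := by
      rw [flip, h1]
      rfl
    refine ⟨h1, h2.trans hf.symm, fun d hd => h3 d ?_, ?_⟩
    · rw [touching_eq] at hd
      exact hd
    rcases h4 with ⟨h5, h6, h7⟩ | ⟨h5, h6, h7⟩
    · exact Or.inl ⟨_, _, _, h5, T.touching_eq _ c, (hone _ _).2 ⟨rfl, h6.symm⟩, h7⟩
    · exact Or.inr ⟨_, _, _, h6, (hone _ _).2 ⟨rfl, h5.symm⟩, T.touching_eq _ c, h7⟩

end TangleDiagram

/-! ### The skein algebra operators -/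

section Graded

variable {ι R : Type*} [CommRing R] (k : ι → ℤ)

/-- The operator does not increase the degree `k` of the basis vectors. -/
def Filtered (F : Module.End R (ι →₀ R)) : Prop :=
  ∀ i j, F (Finsupp.single i 1) j ≠ 0 → k j ≤ k i

/-- The part of an operator which preserves the degree `k` of the basis vectors. -/
def gr : Module.End R (ι →₀ R) →ₗ[R] Module.End R (ι →₀ R) where
  toFun F := Finsupp.linearCombination R
    (fun i => Finsupp.filter (fun j => k j = k i) (F (Finsupp.single i 1)))
  map_add' F G := by
    refine Finsupp.lhom_ext' fun i => LinearMap.ext_ring ?_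
    simp [Finsupp.filter_add]
  map_smul' a F := by
    refine Finsupp.lhom_ext' fun i => LinearMap.ext_ring ?_
    simp [Finsupp.filter_smul]

theorem gr_entry (F : Module.End R (ι →₀ R)) (i j : ι) :
    gr k F (Finsupp.single i 1) j = if k j = k i then F (Finsupp.single i 1) j else 0 := by
  simp [gr, Finsupp.filter_apply]

theorem apply_eq_sum [Fintype ι] (F : Module.End R (ι →₀ R)) (v : ι →₀ R) (j : ι) :
    F v j = ∑ l, v l * F (Finsupp.single l 1) j := by
  conv_lhs => rw [← Finsupp.univ_sum_single v, map_sum, Finsupp.finsetSum_apply]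
  refine Finset.sum_congr rfl fun l _ => ?_
  rw [show Finsupp.single l (v l) = v l • Finsupp.single l (1 : R) by simp, map_smul,
    Finsupp.smul_apply, smul_eq_mul]

/-- Passage to the associated graded operators is multiplicative. -/
theorem gr_mul [Finite ι] {F G : Module.End R (ι →₀ R)} (hF : Filtered k F) (hG : Filtered k G) :
    gr k (F * G) = gr k F * gr k G := by
  have := Fintype.ofFinite ι
  refine Finsupp.lhom_ext' fun i => LinearMap.ext_ring (Finsupp.ext fun j => ?_)
  show gr k (F * G) (Finsupp.single i 1) j = gr k F (gr k G (Finsupp.single i 1)) j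
  rw [gr_entry, apply_eq_sum (gr k F)]
  simp only [gr_entry]
  rw [Module.End.mul_apply, apply_eq_sum F]
  split_ifs with h
  · refine Finset.sum_congr rfl fun l _ => ?_
    rw [h]
    split_ifs with h1 h2
    · rfl
    · exact absurd h1.symm h2
    · exact absurd (by assumption : k i = k l).symm h1
    · by_cases h3 : G (Finsupp.single i 1) l = 0
      · rw [h3, zero_mul, zero_mul]
      · by_cases h4 : F (Finsupp.single l 1) j = 0
        · rw [h4, mul_zero, mul_zero]
        · exact absurd (le_antisymm (hG i l h3) (h ▸ hF l j h4)) h1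
  · refine (Finset.sum_eq_zero fun l _ => ?_).symm
    split_ifs with h1 h2
    · exact absurd (h2.trans h1) h
    · rw [mul_zero]
    · rw [zero_mul]
    · rw [zero_mul]

end Graded

namespace TangleDiagram

variable {D : Type*} {M : CellSurface D} [Finite D] (T : TangleDiagram M)
variable (R : Type*) [CommRing R] [Algebra (ZMod 2) R]

/-- The change of the resolution of the crossing `c`, in either direction, by the entries of the skein
algebra. -/
def saddle (c : T.Crossing) : Module.End R (T.State →₀ R) := gr T.essDegree (T.surgery R c)

/-- The change of the sign of the component of `d` from `+` to `-`, if this is a contractible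
circle. -/
def dot (d : T.strand) : Module.End R (T.State →₀ R) := gr T.essDegree (T.lower R d)

variable {R}

theorem filtered_surgery (c : T.Crossing) : Filtered T.essDegree (T.surgery R c) := by
  classical
  intro s s' h
  rw [surgery_entry] at h
  split_ifs at h with h2
  · exact (local_sign h2).1
  · exact absurd rfl h

open Classical in
theorem saddle_entry (c : T.Crossing) (s s' : T.State) :
    T.saddle R c (Finsupp.single s 1) s'
      = if T.Local T.dec Merge Divide c s s' then 1 else 0 := by
  rw [saddle, gr_entry, surgery_entry]
  by_cases h : T.Local T.sign SignMerge SignDivide c s s'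
  · rw [if_pos h, if_congr (local_sign h).2.2 rfl rfl]
  · rw [if_neg h, ite_self, if_neg (fun h' => h h'.toSign)]

omit [Finite D] in
open Classical in
theorem decor_update {S : T.Resolution} (σ : T.Circle S → Bool) (C : T.Circle S) (b : Bool)
    (C' : T.Component S) (h : C' ≠ C.1) :
    T.decor ⟨S, Function.update σ C b⟩ C' = T.decor ⟨S, σ⟩ C' := by
  unfold decor
  split_ifs with h1 h2
  · rfl
  · exact congrArg Decor.triv (Function.update_of_ne (fun h' : circ C' h1 = C =>
      h (congrArg Subtype.val h')) _ _)
  · exact congrArg Decor.ess (Function.update_of_ne (fun h' : circ C' h1 = C =>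
      h (congrArg Subtype.val h')) _ _)

open Classical in
theorem sum_update {S : T.Resolution} (σ : T.Circle S → Bool) (C : T.Circle S) (b : Bool)
    (φ : Decor → ℤ) :
    ∑ C', φ (T.decor ⟨S, Function.update σ C b⟩ C')
      = ∑ C', φ (T.decor ⟨S, σ⟩ C') - φ (T.decor ⟨S, σ⟩ C.1)
        + φ (T.decor ⟨S, Function.update σ C b⟩ C.1) := by
  have h1 := Finset.add_sum_erase Finset.univ
    (fun C' : T.Component S => φ (T.decor ⟨S, Function.update σ C b⟩ C')) (Finset.mem_univ C.1)
  have h2 := Finset.add_sum_erase Finset.univ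
    (fun C' : T.Component S => φ (T.decor ⟨S, σ⟩ C')) (Finset.mem_univ C.1)
  have h3 : ∑ C' ∈ Finset.univ.erase C.1, φ (T.decor ⟨S, Function.update σ C b⟩ C')
      = ∑ C' ∈ Finset.univ.erase C.1, φ (T.decor ⟨S, σ⟩ C') :=
    Finset.sum_congr rfl fun C' hC => by
      rw [T.decor_update σ C b C' (Finset.ne_of_mem_erase hC)]
  show ∑ C' : T.Component S, φ (T.decor ⟨S, Function.update σ C b⟩ C')
      = ∑ C' : T.Component S, φ (T.decor ⟨S, σ⟩ C') - _ + _
  rw [← h1, ← h2, h3]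
  ring

omit [Finite D] in
open Classical in
theorem decor_circle {S : T.Resolution} (σ : T.Circle S → Bool) (C : T.Circle S) :
    T.decor ⟨S, σ⟩ C.1 = if T.Contractible C.1 then .triv (σ C) else .ess (σ C) := by
  unfold decor
  rw [dif_neg C.2]
  rfl

open Classical in
theorem degrees_update {S : T.Resolution} {σ : T.Circle S → Bool} {C : T.Circle S}
    (h : σ C = true) :
    T.essDegree ⟨S, Function.update σ C false⟩
        = T.essDegree ⟨S, σ⟩ - (if T.Contractible C.1 then 0 else 2) ∧
      T.signDegree ⟨S, Function.update σ C false⟩ = T.signDegree ⟨S, σ⟩ - 2 := by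
  have h1 := T.sum_update σ C false Decor.weight
  have h2 := T.sum_update σ C false Decor.charge
  rw [T.decor_circle, T.decor_circle, Function.update_self, h] at h1 h2
  constructor
  · unfold essDegree
    rw [h1]
    split_ifs <;> simp only [Decor.weight] <;> ring
  · unfold signDegree
    rw [h2]
    split_ifs <;> simp only [Decor.charge] <;> simp <;> ring

omit [Algebra (ZMod 2) R] in
open Classical in
theorem dot_single (d : T.strand) (s : T.State) :
    T.dot R d (Finsupp.single s 1)
      = if T.Contractible (T.comp s.1 d) then T.lower R d (Finsupp.single s 1) else 0 := by
  obtain ⟨S, σ⟩ := s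
  refine Finsupp.ext fun s' => ?_
  rw [dot, gr_entry, lower_single]
  show (if _ then T.hit R (T.comp S d) σ s' else 0)
    = (if T.Contractible (T.comp S d) then T.hit R (T.comp S d) σ else 0) s'
  by_cases ha : T.IsArc (T.comp S d)
  · rw [T.hit_arc ha, ite_self, Finsupp.zero_apply, ite_self]
  cases hσ : σ (circ _ ha)
  · rw [T.hit_neg ha hσ, ite_self, Finsupp.zero_apply, ite_self]
  · rw [T.hit_pos ha hσ]
    have hd := (T.degrees_update hσ).1
    by_cases hs : (⟨S, Function.update σ (circ _ ha) false⟩ : T.State) = s'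
    · subst hs
      rw [hd]
      by_cases hc : T.Contractible (T.comp S d)
      · rw [if_pos hc, if_pos]
        rw [if_pos (show T.Contractible (circ _ ha).1 from hc), sub_zero]
      · rw [if_neg hc, if_neg, Finsupp.zero_apply]
        rw [if_neg (show ¬ T.Contractible (circ _ ha).1 from hc)]
        omega
    · rw [Finsupp.single_eq_of_ne (Ne.symm hs), ite_self]
      split_ifs
      · rw [Finsupp.single_eq_of_ne (Ne.symm hs)]
      · rfl

omit [Algebra (ZMod 2) R] in
theorem filtered_lower (d : T.strand) : Filtered T.essDegree (T.lower R d) := by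
  classical
  rintro ⟨S, σ⟩ s' h
  rw [lower_single] at h
  change T.hit R (T.comp S d) σ s' ≠ 0 at h
  by_cases ha : T.IsArc (T.comp S d)
  · rw [T.hit_arc ha] at h
    exact absurd rfl h
  cases hσ : σ (circ _ ha)
  · rw [T.hit_neg ha hσ] at h
    exact absurd rfl h
  · rw [T.hit_pos ha hσ] at h
    have hs : (⟨S, Function.update σ (circ _ ha) false⟩ : T.State) = s' := by
      by_contra hs
      rw [Finsupp.single_eq_of_ne (Ne.symm hs)] at h
      exact h rfl
    rw [← hs, (T.degrees_update hσ).1]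
    split_ifs <;> omega

/-- Two opposite darts lie on the same component before or after the surgery, up to arcs, so that their
operators cancel. -/
theorem surgery_bridge (c : T.Crossing) :
    T.surgery R c * (T.lower R (T.dartAt c) + T.lower R (T.oppAt c)) = 0 := by
  refine T.ext_of_lower (fun d v => ?_) (fun d v => ?_) (fun S => ?_)
  · simp only [Module.End.mul_apply, LinearMap.add_apply, map_add, surgery_lower_apply,
      T.lower_comm_apply _ d]
  · simp
  rw [← lowerSum_bridge, Module.End.mul_apply, surgery_lowerSum, surgery_top, LinearMap.zero_apply]
  have h : ∀ v, T.lowerSum R (T.bridge c) (T.factor R c S v)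
      = T.factor R c S (T.lowerSum R (T.bridge c) v) := by
    intro v
    unfold factor
    split_ifs <;> rfl
  rcases T.bridge_mem_or S c with h1 | h1
  · rw [factor, if_pos h1, lowerSum_bridge_sq]
  · rw [h, T.lowerSum_top h1, map_zero]

theorem saddle_comm (c c' : T.Crossing) :
    T.saddle R c * T.saddle R c' = T.saddle R c' * T.saddle R c := by
  unfold saddle
  rw [← gr_mul _ (T.filtered_surgery c) (T.filtered_surgery c'), surgery_comm,
    gr_mul _ (T.filtered_surgery c') (T.filtered_surgery c)]

theorem saddle_dot (c : T.Crossing) (d : T.strand) :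
    T.saddle R c * T.dot R d = T.dot R d * T.saddle R c := by
  unfold saddle dot
  rw [← gr_mul _ (T.filtered_surgery c) (T.filtered_lower d), surgery_lower,
    gr_mul _ (T.filtered_lower d) (T.filtered_surgery c)]

/-- The change of a crossing and back again is the sum of the dots on two opposite darts there. -/
theorem saddle_sq (c : T.Crossing) :
    T.saddle R c * T.saddle R c = T.dot R (T.dartAt c) + T.dot R (T.oppAt c) := by
  unfold saddle dot
  rw [← gr_mul _ (T.filtered_surgery c) (T.filtered_surgery c), surgery_sq, map_add]

theorem saddle_bridge (c : T.Crossing) :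
    T.saddle R c * (T.dot R (T.dartAt c) + T.dot R (T.oppAt c)) = 0 := by
  rw [mul_add]
  unfold saddle dot
  rw [← gr_mul _ (T.filtered_surgery c) (T.filtered_lower _),
    ← gr_mul _ (T.filtered_surgery c) (T.filtered_lower _), ← map_add, ← mul_add, surgery_bridge,
    map_zero]

variable (R) in
open Classical in
/-- The projection onto the span of the states in which the crossing `c` has the resolution `b`. -/
def proj (c : T.Crossing) (b : Bool) : Module.End R (T.State →₀ R) :=
  Finsupp.linearCombination R
    (fun s : T.State => if s.1 c = b then Finsupp.single s (1 : R) else 0)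

omit [Algebra (ZMod 2) R] [Finite D] in
open Classical in
theorem proj_single (c : T.Crossing) (b : Bool) (s : T.State) :
    T.proj R c b (Finsupp.single s 1) = if s.1 c = b then Finsupp.single s (1 : R) else 0 := by
  simp [proj]

omit [Algebra (ZMod 2) R] [Finite D] in
open Classical in
theorem proj_apply (c : T.Crossing) (b : Bool) (v : T.State →₀ R) (s : T.State) :
    T.proj R c b v s = if s.1 c = b then v s else 0 := by
  induction v using Finsupp.induction_linear with
  | zero => simp
  | add v w hv hw =>
    rw [map_add, Finsupp.add_apply, hv, hw, Finsupp.add_apply]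
    split_ifs <;> simp
  | single s' a =>
    rw [show Finsupp.single s' a = a • Finsupp.single s' (1 : R) by simp, map_smul, proj_single]
    by_cases h : s' = s
    · subst h
      split_ifs <;> simp
    · split_ifs <;> simp [Finsupp.single_eq_of_ne (Ne.symm h)]

omit [Algebra (ZMod 2) R] [Finite D] in
theorem proj_sq (c : T.Crossing) (b : Bool) : T.proj R c b * T.proj R c b = T.proj R c b := by
  classical
  refine LinearMap.ext fun v => Finsupp.ext fun s => ?_
  rw [Module.End.mul_apply, proj_apply, proj_apply]
  split_ifs <;> rfl

omit [Algebra (ZMod 2) R] [Finite D] in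
theorem proj_not (c : T.Crossing) (b : Bool) : T.proj R c b * T.proj R c (!b) = 0 := by
  classical
  refine LinearMap.ext fun v => Finsupp.ext fun s => ?_
  rw [Module.End.mul_apply, proj_apply, proj_apply]
  cases b <;> cases s.1 c <;> simp

omit [Algebra (ZMod 2) R] [Finite D] in
theorem proj_add (c : T.Crossing) : T.proj R c false + T.proj R c true = 1 := by
  classical
  refine LinearMap.ext fun v => Finsupp.ext fun s => ?_
  rw [LinearMap.add_apply, Finsupp.add_apply, proj_apply, proj_apply]
  cases s.1 c <;> simp

omit [Algebra (ZMod 2) R] [Finite D] in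
theorem proj_comm (c c' : T.Crossing) (b b' : Bool) :
    T.proj R c b * T.proj R c' b' = T.proj R c' b' * T.proj R c b := by
  classical
  refine LinearMap.ext fun v => Finsupp.ext fun s => ?_
  simp only [Module.End.mul_apply, proj_apply]
  split_ifs <;> rfl

omit [Algebra (ZMod 2) R] [Finite D] in
/-- An operator which moves the resolution of `c` in a uniform way is compatible with the
projections. -/
theorem mul_proj {F : Module.End R (T.State →₀ R)} {c : T.Crossing} {b b' : Bool}
    (h : ∀ s s', F (Finsupp.single s 1) s' ≠ 0 → (s.1 c = b ↔ s'.1 c = b')) :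
    F * T.proj R c b = T.proj R c b' * F := by
  classical
  refine T.linearMap_ext fun s => Finsupp.ext fun s' => ?_
  simp only [Module.End.mul_apply, proj_apply, proj_single]
  by_cases h0 : F (Finsupp.single s 1) s' = 0
  · rw [h0, ite_self]
    split_ifs
    · exact h0
    · simp
  · have := h s s' h0
    by_cases h1 : s.1 c = b
    · rw [if_pos h1, if_pos (this.1 h1)]
    · rw [if_neg h1, if_neg (fun h2 => h1 (this.2 h2)), map_zero, Finsupp.zero_apply]

theorem saddle_flip {c : T.Crossing} {s s' : T.State}
    (h : T.saddle R c (Finsupp.single s 1) s' ≠ 0) : T.Local T.dec Merge Divide c s s' := by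
  classical
  rw [saddle_entry] at h
  by_contra h2
  rw [if_neg h2] at h
  exact h rfl

theorem saddle_proj (c : T.Crossing) (b : Bool) :
    T.saddle R c * T.proj R c b = T.proj R c (!b) * T.saddle R c := by
  refine T.mul_proj fun s s' h => ?_
  rw [(T.saddle_flip h).1, flip_same]
  cases b <;> cases s.1 c <;> simp

theorem saddle_proj_of_ne {c c' : T.Crossing} (hc : c' ≠ c) (b : Bool) :
    T.saddle R c * T.proj R c' b = T.proj R c' b * T.saddle R c := by
  refine T.mul_proj fun s s' h => ?_
  rw [(T.saddle_flip h).1, flip_of_ne _ _ hc]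

omit [Algebra (ZMod 2) R] in
/-- The entries of the operators `T.dot R d`. -/
theorem dot_entry {d : T.strand} {s s' : T.State}
    (h : T.dot R d (Finsupp.single s 1) s' ≠ 0) :
    open Classical in ∃ C : T.Circle s.1, T.Contractible C.1 ∧ s.2 C = true ∧
      s' = ⟨s.1, Function.update s.2 C false⟩ := by
  classical
  obtain ⟨S, σ⟩ := s
  rw [dot_single] at h
  split_ifs at h with hc
  · rw [lower_single] at h
    change T.hit R (T.comp S d) σ s' ≠ 0 at h
    by_cases ha : T.IsArc (T.comp S d)
    · rw [T.hit_arc ha] at h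
      exact absurd rfl h
    cases hσ : σ (circ _ ha)
    · rw [T.hit_neg ha hσ] at h
      exact absurd rfl h
    · rw [T.hit_pos ha hσ] at h
      refine ⟨circ _ ha, hc, hσ, ?_⟩
      by_contra hs
      rw [Finsupp.single_eq_of_ne hs] at h
      exact h rfl
  · exact absurd rfl h

omit [Algebra (ZMod 2) R] in
theorem dot_proj (d : T.strand) (c : T.Crossing) (b : Bool) :
    T.dot R d * T.proj R c b = T.proj R c b * T.dot R d := by
  refine T.mul_proj fun s s' h => ?_
  obtain ⟨C, -, -, rfl⟩ := T.dot_entry h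
  rfl

end TangleDiagram

/-! ### Conjugation of the differentials -/

section CharTwoRing

variable {A : Type*} [Ring A] (h2 : ∀ x : A, x + x = 0)

include h2

/-- In characteristic two, a sum of commuting elements of square zero has square zero. -/
theorem sum_mul_sum_self {κ : Type*} (t : Finset κ) (δ : κ → A) (h : ∀ c ∈ t, δ c * δ c = 0)
    (hc : ∀ c c', δ c * δ c' = δ c' * δ c) : (∑ c ∈ t, δ c) * ∑ c ∈ t, δ c = 0 := by
  classical
  induction t using Finset.induction_on with
  | empty => simp
  | insert a t ha ih =>
    rw [Finset.sum_insert ha, add_mul, mul_add, mul_add, h a (Finset.mem_insert_self _ _),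
      ih fun c hc => h c (Finset.mem_insert_of_mem hc), Finset.mul_sum, Finset.sum_mul, zero_add,
      add_zero, Finset.sum_congr rfl fun c _ => hc a c]
    exact h2 _

end CharTwoRing

namespace TangleDiagram

variable {D : Type*} {M : CellSurface D} [Finite D] (T : TangleDiagram M)
variable (R : Type*) [CommRing R] [Algebra (ZMod 2) R]

instance : Fintype T.Crossing := Fintype.ofFinite _

omit [Finite D] in
theorem end_add_self (F : Module.End R (T.State →₀ R)) : F + F = 0 :=
  LinearMap.ext fun v => T.add_self_eq_zero' (F v)

theorem horizontal_eq : T.horizontal R = ∑ c, T.saddle R c * T.proj R c false := by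
  classical
  refine T.linearMap_ext fun s => Finsupp.ext fun s' => ?_
  rw [LinearMap.sum_apply, Finsupp.finsetSum_apply]
  have h1 : T.horizontal R (Finsupp.single s 1) s' = if ∃ c, T.Saddle c s s' then 1 else 0 := by
    simp only [horizontal, Finsupp.linearCombination_single, one_smul, Finsupp.finsetSum_apply]
    rw [Finset.sum_eq_single s']
    · split_ifs <;> simp
    · intro t _ ht
      split_ifs
      · exact Finsupp.single_eq_of_ne (Ne.symm ht)
      · rfl
    · exact fun h => absurd (Finset.mem_univ _) h
  have h3 : ∀ c, (T.saddle R c * T.proj R c false) (Finsupp.single s 1) s'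
      = if T.Saddle c s s' then 1 else 0 := by
    intro c
    rw [Module.End.mul_apply, proj_single, if_congr T.saddle_iff rfl rfl]
    by_cases h : s.1 c = false
    · rw [if_pos h, saddle_entry]
      exact if_congr (by simp [h]) rfl rfl
    · rw [if_neg h, if_neg (fun h' => h h'.1)]
      simp
  simp only [h1, h3]
  by_cases h : ∃ c, T.Saddle c s s'
  · obtain ⟨c, hc⟩ := h
    rw [if_pos ⟨c, hc⟩, Finset.sum_eq_single c, if_pos hc]
    · intro c' _ hne
      refine if_neg fun hc' => ?_
      rw [saddle_iff] at hc hc'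
      have e := congrFun (hc.2.1.symm.trans hc'.2.1) c
      rw [flip_same, flip_of_ne _ _ (Ne.symm hne)] at e
      cases h : s.1 c <;> rw [h] at e <;> cases e
    · exact fun h => absurd (Finset.mem_univ _) h
  · rw [if_neg h, Finset.sum_eq_zero]
    exact fun c _ => if_neg fun hc => h ⟨c, hc⟩

/-- The change of the crossing `c` from its 0-resolution to its 1-resolution. -/
def forward (c : T.Crossing) : Module.End R (T.State →₀ R) := T.saddle R c * T.proj R c false

/-- The change of the crossing `c` from its 1-resolution to its 0-resolution. -/
def backward (c : T.Crossing) : Module.End R (T.State →₀ R) := T.saddle R c * T.proj R c true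

/-- The sum of the operators of two opposite darts at the crossing `c`. This is the commutator of
`T.backward R c` and the horizontal differential. -/
def bridgeDot (c : T.Crossing) : Module.End R (T.State →₀ R) :=
  T.dot R (T.dartAt c) + T.dot R (T.oppAt c)

variable {R}

theorem saddle_proj_mul_comm {c c' : T.Crossing} (h : c ≠ c') (b b' : Bool) :
    (T.saddle R c * T.proj R c b) * (T.saddle R c' * T.proj R c' b')
      = (T.saddle R c' * T.proj R c' b') * (T.saddle R c * T.proj R c b) := by
  rw [mul_assoc, ← mul_assoc (T.proj R c b), ← T.saddle_proj_of_ne h, mul_assoc,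
    T.proj_comm c c', ← mul_assoc, T.saddle_comm, mul_assoc, mul_assoc, ← mul_assoc (T.proj R c' b'),
    ← T.saddle_proj_of_ne h.symm, mul_assoc]

theorem forward_comm (c c' : T.Crossing) :
    T.forward R c * T.forward R c' = T.forward R c' * T.forward R c := by
  by_cases h : c = c'
  · rw [h]
  · exact T.saddle_proj_mul_comm h _ _

theorem forward_sq (c : T.Crossing) : T.forward R c * T.forward R c = 0 := by
  unfold forward
  rw [mul_assoc, ← mul_assoc (T.proj R c false), show T.proj R c false * T.saddle R c
    = T.saddle R c * T.proj R c true from (T.saddle_proj c true).symm, mul_assoc (T.saddle R c),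
    show T.proj R c true * T.proj R c false = 0 from T.proj_not c true, mul_zero, mul_zero]

variable (R) in
theorem horizontal_sq : T.horizontal R * T.horizontal R = 0 := by
  rw [horizontal_eq]
  exact sum_mul_sum_self (T.end_add_self R) Finset.univ (T.forward R) (fun c _ => T.forward_sq c)
    T.forward_comm

theorem saddle_bridgeDot (c c' : T.Crossing) :
    T.saddle R c * T.bridgeDot R c' = T.bridgeDot R c' * T.saddle R c := by
  simp only [bridgeDot, mul_add, add_mul, saddle_dot]

omit [Algebra (ZMod 2) R] in
theorem bridgeDot_proj (c c' : T.Crossing) (b : Bool) :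
    T.bridgeDot R c' * T.proj R c b = T.proj R c b * T.bridgeDot R c' := by
  simp only [bridgeDot, mul_add, add_mul, dot_proj]

/-- Conjugation by `1 + a c • T.backward R c` adds `a c • T.bridgeDot R c` to the differential: the
homotopy `T.backward R c` commutes with the other summands and is annihilated by `T.bridgeDot R c`. -/
theorem backward_conj (a : T.Crossing → R) (c : T.Crossing) (t : Finset T.Crossing) :
    (1 + a c • T.backward R c) * (T.horizontal R + ∑ c' ∈ t, a c' • T.bridgeDot R c')
      = (T.horizontal R + ∑ c' ∈ t, a c' • T.bridgeDot R c' + a c • T.bridgeDot R c)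
        * (1 + a c • T.backward R c) := by
  classical
  have hH : T.backward R c * (T.saddle R c * T.proj R c false) +
      (T.saddle R c * T.proj R c false) * T.backward R c = T.bridgeDot R c := by
    unfold backward
    have e1 : T.proj R c true * T.saddle R c = T.saddle R c * T.proj R c false :=
      (T.saddle_proj c false).symm
    have e2 : T.proj R c false * T.saddle R c = T.saddle R c * T.proj R c true :=
      (T.saddle_proj c true).symm
    rw [mul_assoc, ← mul_assoc (T.proj R c true), e1, mul_assoc, mul_assoc (T.saddle R c) _
      (T.saddle R c * _), ← mul_assoc (T.proj R c false) (T.saddle R c), e2, mul_assoc, proj_sq,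
      proj_sq, ← mul_add, ← mul_add, proj_add, mul_one, saddle_sq]
    rfl
  have hY : T.bridgeDot R c * T.backward R c = 0 := by
    unfold backward
    rw [← mul_assoc, ← saddle_bridgeDot, bridgeDot, saddle_bridge, zero_mul]
  have hcomm : ∀ F, F * T.saddle R c = T.saddle R c * F → F * T.proj R c true = T.proj R c true * F →
      F * T.backward R c = T.backward R c * F := by
    intro F h1 h2
    unfold backward
    rw [← mul_assoc, h1, mul_assoc, h2, mul_assoc]
  have hYc : ∀ c', T.bridgeDot R c' * T.backward R c = T.backward R c * T.bridgeDot R c' :=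
    fun c' => hcomm _ (T.saddle_bridgeDot c c').symm (T.bridgeDot_proj c c' true)
  set E := ∑ c' ∈ t, a c' • T.bridgeDot R c' with hE
  have hEc : E * T.backward R c = T.backward R c * E := by
    rw [hE, Finset.sum_mul, Finset.mul_sum]
    refine Finset.sum_congr rfl fun c' _ => ?_
    rw [smul_mul_assoc, mul_smul_comm, hYc]
  have hhor : T.backward R c * T.horizontal R + T.horizontal R * T.backward R c
      = T.bridgeDot R c := by
    rw [horizontal_eq, Finset.mul_sum, Finset.sum_mul, ← Finset.sum_add_distrib,
      Finset.sum_eq_single c, hH]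
    · intro c' _ hne
      unfold backward
      rw [T.saddle_proj_mul_comm hne]
      exact T.end_add_self R _
    · exact fun h => absurd (Finset.mem_univ _) h
  have hhor' : T.backward R c * T.horizontal R = T.horizontal R * T.backward R c
      + T.bridgeDot R c := by
    rw [← hhor, add_left_comm, T.end_add_self, add_zero]
  have e3 : a c • T.bridgeDot R c * (a c • T.backward R c) = 0 := by
    rw [smul_mul_smul_comm, hY, smul_zero]
  rw [add_mul, one_mul, mul_add (_ + a c • T.bridgeDot R c), mul_one, add_mul (T.horizontal R + E),
    e3, add_zero, smul_mul_assoc, mul_smul_comm, mul_add, add_mul, hEc, hhor']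
  simp only [smul_add]
  abel

theorem backward_sq (c : T.Crossing) : T.backward R c * T.backward R c = 0 := by
  unfold backward
  rw [mul_assoc, ← mul_assoc (T.proj R c true), show T.proj R c true * T.saddle R c
    = T.saddle R c * T.proj R c false from (T.saddle_proj c false).symm, mul_assoc (T.saddle R c),
    show T.proj R c false * T.proj R c true = 0 from T.proj_not c false, mul_zero, mul_zero]

theorem one_add_backward_sq (a : R) (c : T.Crossing) :
    (1 + a • T.backward R c) * (1 + a • T.backward R c) = 1 := by
  rw [add_mul, one_mul, mul_add, mul_one, smul_mul_smul_comm, backward_sq, smul_zero, add_zero,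
    add_assoc, T.end_add_self, add_zero]

/-! ### Gradings -/

theorem signDegree_eq (s : T.State) :
    T.signDegree s = (Nat.card {C // s.2 C = true} : ℤ) - (Nat.card {C // s.2 C = false} : ℤ) := by
  classical
  have e1 : ∀ C : T.Circle s.1, (T.decor s C.1).charge
      = (if s.2 C = true then (1 : ℤ) else 0) - (if s.2 C = false then 1 else 0) := by
    intro C
    rw [T.decor_circle s.2 C]
    split_ifs <;> simp_all [Decor.charge]
  have e2 := Fintype.sum_subtype_add_sum_subtype (fun C : T.Component s.1 => T.IsArc C)
    (fun C => (T.decor s C).charge)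
  have e3 : ∑ C : {C : T.Component s.1 // T.IsArc C}, (T.decor s C.1).charge = 0 := by
    refine Finset.sum_eq_zero fun C _ => ?_
    rw [decor, dif_pos C.2]
    rfl
  have e5 : ∑ C : {C : T.Component s.1 // ¬ T.IsArc C}, (T.decor s C.1).charge
      = ∑ C : T.Circle s.1, (T.decor s C.1).charge :=
    Fintype.sum_equiv (⟨fun C => C, fun C => C, fun _ => rfl, fun _ => rfl⟩ :
      {C : T.Component s.1 // ¬ T.IsArc C} ≃ T.Circle s.1) _ _ fun _ => rfl
  rw [e3, zero_add, e5, Finset.sum_congr rfl fun C _ => e1 C, Finset.sum_sub_distrib,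
    Finset.sum_boole, Finset.sum_boole] at e2
  rw [signDegree, ← e2, Nat.card_eq_fintype_card, Nat.card_eq_fintype_card, Fintype.card_subtype,
    Fintype.card_subtype]

theorem delta_eq (s : T.State) : T.delta s = T.hGrading s - T.signDegree s - T.nPos := by
  rw [delta, qGrading, signDegree_eq]
  ring

theorem hGrading_flip {s s' : T.State} {c : T.Crossing} (h : s'.1 = T.flip s.1 c) :
    T.hGrading s' = T.hGrading s + (if s.1 c = false then 1 else -1) := by
  classical
  have key : ∀ S : T.Resolution, (Nat.card {c // S c = true} : ℤ)
      = (if S c = true then 1 else 0)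
        + ∑ c' ∈ Finset.univ.erase c, if S c' = true then (1 : ℤ) else 0 := by
    intro S
    rw [Finset.add_sum_erase _ (fun c' => if S c' = true then (1 : ℤ) else 0) (Finset.mem_univ c),
      Finset.sum_boole, Nat.card_eq_fintype_card, Fintype.card_subtype]
  unfold hGrading
  rw [key, key, h, flip_same, Finset.sum_congr rfl fun c' hc' => by
    rw [flip_of_ne _ _ (Finset.ne_of_mem_erase hc')]]
  cases s.1 c
  · simp
    ring
  · simp

theorem saddle_degrees {c : T.Crossing} {s s' : T.State}
    (h : T.saddle R c (Finsupp.single s 1) s' ≠ 0) :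
    T.delta s' = T.delta s + (if s.1 c = false then 2 else 0) ∧ T.glyph s' = T.glyph s := by
  have hl := T.saddle_flip h
  refine ⟨?_, glyph_local hl⟩
  rw [delta_eq, delta_eq, T.hGrading_flip hl.1, (local_sign hl.toSign).2.1]
  split_ifs <;> ring

omit [Finite D] in
open Classical in
theorem glyph_update {S : T.Resolution} (σ : T.Circle S → Bool) {C : T.Circle S} (b : Bool)
    (hC : T.Contractible C.1) : T.glyph ⟨S, Function.update σ C b⟩ = T.glyph ⟨S, σ⟩ := by
  have key : ∀ γ ε C', T.IsLabelled ⟨S, Function.update σ C b⟩ γ ε C' ↔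
      T.IsLabelled ⟨S, σ⟩ γ ε C' := by
    intro γ ε C'
    refine and_congr_right fun h => and_congr_right fun _ => ?_
    have hne : C' ≠ C := fun h' => h (h' ▸ hC)
    show Function.update σ C b C' = ε ↔ σ C' = ε
    rw [Function.update_of_ne hne]
  unfold glyph
  congr 1
  funext γ
  congr 3
  · exact congrArg Subtype (funext fun C' => propext (key γ true C'))
  · exact congrArg Subtype (funext fun C' => propext (key γ false C'))

omit [Algebra (ZMod 2) R] in
theorem dot_degrees {d : T.strand} {s s' : T.State}
    (h : T.dot R d (Finsupp.single s 1) s' ≠ 0) :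
    T.delta s' = T.delta s + 2 ∧ T.glyph s' = T.glyph s := by
  obtain ⟨C, h1, h2, rfl⟩ := T.dot_entry h
  obtain ⟨S, σ⟩ := s
  refine ⟨?_, T.glyph_update σ false h1⟩
  rw [delta_eq, delta_eq, (T.degrees_update h2).2]
  show T.hGrading ⟨S, σ⟩ - _ - _ = _
  ring

/-- The operator maps the part `(i, b)` into the part `(i + n, b)`. -/
def Shifts (F : Module.End R (T.State →₀ R)) (n : ℤ) : Prop :=
  ∀ i b, (T.piece R i b).map F ≤ T.piece R (i + n) b

omit [Algebra (ZMod 2) R] in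
theorem shifts_of_entries {F : Module.End R (T.State →₀ R)} {n : ℤ}
    (h : ∀ s s', F (Finsupp.single s 1) s' ≠ 0 → T.delta s' = T.delta s + n ∧
      T.glyph s' = T.glyph s) : T.Shifts F n := by
  rintro i b _ ⟨v, hv, rfl⟩
  have hv' : ↑v.support ⊆ {s | T.delta s = i ∧ T.glyph s = b} := hv
  show ↑(F v).support ⊆ {s | T.delta s = i + n ∧ T.glyph s = b}
  intro s' hs'
  rw [Finset.mem_coe, Finsupp.mem_support_iff, apply_eq_sum] at hs'
  obtain ⟨s, -, hs⟩ := Finset.exists_ne_zero_of_sum_ne_zero hs'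
  obtain ⟨h1, h2⟩ := hv' (Finsupp.mem_support_iff.2 (left_ne_zero_of_mul hs))
  obtain ⟨h3, h5⟩ := h s s' (right_ne_zero_of_mul hs)
  exact ⟨by rw [h3, h1], by rw [h5, h2]⟩

omit [Finite D] [Algebra (ZMod 2) R] in
theorem Shifts.add {F G : Module.End R (T.State →₀ R)} {n : ℤ} (hF : T.Shifts F n)
    (hG : T.Shifts G n) : T.Shifts (F + G) n := by
  rintro i b _ ⟨v, hv, rfl⟩
  exact Submodule.add_mem _ (hF i b ⟨v, hv, rfl⟩) (hG i b ⟨v, hv, rfl⟩)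

omit [Finite D] [Algebra (ZMod 2) R] in
theorem Shifts.smul {F : Module.End R (T.State →₀ R)} {n : ℤ} (a : R) (hF : T.Shifts F n) :
    T.Shifts (a • F) n := by
  rintro i b _ ⟨v, hv, rfl⟩
  exact Submodule.smul_mem _ _ (hF i b ⟨v, hv, rfl⟩)

omit [Finite D] [Algebra (ZMod 2) R] in
theorem Shifts.sum {κ : Type*} {t : Finset κ} {F : κ → Module.End R (T.State →₀ R)} {n : ℤ}
    (hF : ∀ c ∈ t, T.Shifts (F c) n) : T.Shifts (∑ c ∈ t, F c) n := by
  rintro i b _ ⟨v, hv, rfl⟩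
  rw [LinearMap.sum_apply]
  exact Submodule.sum_mem _ fun c hc => hF c hc i b ⟨v, hv, rfl⟩

omit [Finite D] [Algebra (ZMod 2) R] in
theorem Shifts.mul {F G : Module.End R (T.State →₀ R)} {n m : ℤ} (hF : T.Shifts F n)
    (hG : T.Shifts G m) : T.Shifts (F * G) (m + n) := by
  rintro i b _ ⟨v, hv, rfl⟩
  rw [← add_assoc]
  exact hF _ b ⟨_, hG i b ⟨v, hv, rfl⟩, rfl⟩

omit [Algebra (ZMod 2) R] in
theorem shifts_one : T.Shifts (1 : Module.End R (T.State →₀ R)) 0 :=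
  T.shifts_of_entries fun s s' h => by
    have : s = s' := by
      by_contra hs
      exact h (Finsupp.single_eq_of_ne (Ne.symm hs))
    rw [this, add_zero]
    exact ⟨rfl, rfl⟩

theorem saddle_proj_entry {c : T.Crossing} {b : Bool} {s s' : T.State}
    (h : (T.saddle R c * T.proj R c b) (Finsupp.single s 1) s' ≠ 0) :
    s.1 c = b ∧ T.saddle R c (Finsupp.single s 1) s' ≠ 0 := by
  classical
  rw [Module.End.mul_apply, proj_single] at h
  split_ifs at h with h1
  · exact ⟨h1, h⟩
  · rw [map_zero] at h
    exact absurd rfl h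

theorem shifts_forward (c : T.Crossing) : T.Shifts (T.forward R c) 2 :=
  T.shifts_of_entries fun s s' h => by
    obtain ⟨h1, h2⟩ := T.saddle_proj_entry h
    have := T.saddle_degrees h2
    rwa [if_pos h1] at this

theorem shifts_backward (c : T.Crossing) : T.Shifts (T.backward R c) 0 :=
  T.shifts_of_entries fun s s' h => by
    obtain ⟨h1, h2⟩ := T.saddle_proj_entry h
    have := T.saddle_degrees h2
    rwa [h1, if_neg (by simp)] at this

omit [Algebra (ZMod 2) R] in
theorem shifts_dot (d : T.strand) : T.Shifts (T.dot R d) 2 :=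
  T.shifts_of_entries fun _ _ h => T.dot_degrees h

variable (R) in
theorem shifts_horizontal : T.Shifts (T.horizontal R) 2 := by
  rw [horizontal_eq]
  exact Shifts.sum T fun c _ => T.shifts_forward c

/-- Any combination of the operators `T.bridgeDot R c`, added to the horizontal differential, is removed by
the conjugation with an automorphism which preserves the gradings. -/
theorem exists_conj (a : T.Crossing → R) (t : Finset T.Crossing) :
    ∃ Φ Ψ : Module.End R (T.State →₀ R), Φ * Ψ = 1 ∧ Ψ * Φ = 1 ∧ T.Shifts Φ 0 ∧ T.Shifts Ψ 0 ∧
      Φ * (T.horizontal R + ∑ c ∈ t, a c • T.bridgeDot R c) = T.horizontal R * Φ := by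
  classical
  induction t using Finset.induction_on with
  | empty => exact ⟨1, 1, one_mul _, one_mul _, T.shifts_one, T.shifts_one, by simp⟩
  | insert c t hc ih =>
    obtain ⟨Φ, Ψ, h1, h2, h3, h5, h6⟩ := ih
    have hs := T.one_add_backward_sq (a c) c
    have hsh : T.Shifts (1 + a c • T.backward R c) 0 :=
      Shifts.add T T.shifts_one (Shifts.smul T (a c) (T.shifts_backward c))
    have hb := T.backward_conj a c t
    set J := 1 + a c • T.backward R c with hJ
    set E := T.horizontal R + ∑ c' ∈ t, a c' • T.bridgeDot R c' with hE
    refine ⟨Φ * J, J * Ψ, ?_, ?_, Shifts.mul T h3 hsh, Shifts.mul T hsh h5, ?_⟩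
    · rw [mul_assoc, ← mul_assoc J, hs, one_mul, h1]
    · rw [mul_assoc, ← mul_assoc Ψ, h2, one_mul, hs]
    · have e : T.horizontal R + ∑ c' ∈ insert c t, a c' • T.bridgeDot R c'
          = E + a c • T.bridgeDot R c := by
        rw [Finset.sum_insert hc, hE, add_assoc, add_comm (a c • _)]
      rw [e, ← mul_assoc, ← h6, mul_assoc, mul_assoc]
      congr 1
      -- `J` is an involution, so `J E = (E + Y) J` gives `J (E + Y) = E J`
      have e2 : J * (J * E) * J = J * ((E + a c • T.bridgeDot R c) * J) * J := by rw [hb]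
      rw [← mul_assoc, hs, one_mul, mul_assoc J, mul_assoc _ J J, hs, mul_one] at e2
      exact e2.symm

end TangleDiagram

/-! ### The vertical differential of a tangle of arcs -/

namespace TangleDiagram

variable {D : Type*} {M : CellSurface D} [Finite D] (T : TangleDiagram M)

omit [Finite D] in
theorem comp_eq_of_edge_eq (S : T.Resolution) {d e : T.strand} (h : T.edge d = T.edge e) :
    T.comp S d = T.comp S e := by
  have h2 := Quot.eqvGen_exact h
  clear h
  induction h2 with
  | rel x y h =>
    refine (T.comp_sound S ?_).symm
    rcases h with h | ⟨h, h'⟩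
    · exact Or.inl h
    · exact Or.inr (Or.inl ⟨h, h'⟩)
  | refl x => rfl
  | symm x y _ ih => exact ih.symm
  | trans x y z _ _ ih1 ih2 => exact ih1.trans ih2

/-- A dart on an edge of the diagram. -/
def edgeRep (f : T.Edge) : T.strand := Quot.out f

omit [Finite D] in
theorem edge_edgeRep (f : T.Edge) : T.edge (T.edgeRep f) = f := Quot.out_eq f

omit [Finite D] in
theorem exists_edge_iff {S : T.Resolution} (f : T.Edge) (C : T.Component S) :
    (∃ d : T.strand, T.edge d = f ∧ T.comp S d = C) ↔ T.comp S (T.edgeRep f) = C := by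
  constructor
  · rintro ⟨d, rfl, rfl⟩
    exact T.comp_eq_of_edge_eq S (T.edge_edgeRep _)
  · exact fun h => ⟨_, T.edge_edgeRep f, h⟩

/-- The vertical differential, sorted by the edges of the diagram instead of the circles. -/
theorem vertical_eq : T.vertical = ∑ f, T.var f • T.dot T.Coeff (T.edgeRep f) := by
  classical
  refine T.linearMap_ext fun s => ?_
  obtain ⟨S, σ⟩ := s
  rw [vertical, Finsupp.linearCombination_single, one_smul, LinearMap.sum_apply]
  have h1 : ∀ f, (T.var f • T.dot T.Coeff (T.edgeRep f)) (Finsupp.single ⟨S, σ⟩ 1)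
      = ∑ C : T.Circle S, if σ C = true ∧ T.comp S (T.edgeRep f) = C.1 ∧ T.Contractible C.1 then
        Finsupp.single (⟨S, Function.update σ C false⟩ : T.State) (T.var f) else 0 := by
    intro f
    rw [LinearMap.smul_apply, dot_single, lower_single]
    show T.var f • (if T.Contractible (T.comp S (T.edgeRep f)) then
      T.hit T.Coeff (T.comp S (T.edgeRep f)) σ else 0) = _
    by_cases ha : T.IsArc (T.comp S (T.edgeRep f))
    · rw [T.hit_arc ha, ite_self, smul_zero, Finset.sum_eq_zero]
      exact fun C _ => if_neg fun h => C.2 (by rw [← h.2.1]; exact ha)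
    rw [Finset.sum_eq_single (circ _ ha)]
    · cases hσ : σ (circ _ ha)
      · rw [T.hit_neg ha hσ, ite_self, smul_zero, if_neg (by simp)]
      · rw [T.hit_pos ha hσ]
        by_cases hc : T.Contractible (T.comp S (T.edgeRep f))
        · rw [if_pos hc, if_pos ⟨rfl, rfl, hc⟩, Finsupp.smul_single, smul_eq_mul, mul_one]
        · rw [if_neg hc, if_neg (fun h => hc h.2.2), smul_zero]
    · exact fun C _ hC => if_neg fun h => hC (Subtype.ext h.2.1.symm)
    · exact fun h => absurd (Finset.mem_univ _) h
  rw [Finset.sum_congr rfl fun f _ => h1 f, Finset.sum_comm]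
  refine Finset.sum_congr rfl fun C _ => ?_
  show (if σ C = true then Finsupp.single (⟨S, Function.update σ C false⟩ : T.State)
    (T.weight C.1) else 0) = _
  by_cases hσ : σ C = true
  · rw [if_pos hσ]
    unfold weight
    by_cases hc : T.Contractible C.1
    · rw [if_pos hc, ← Finsupp.singleAddHom_apply, map_sum]
      refine Finset.sum_congr rfl fun f _ => ?_
      rw [if_congr (T.exists_edge_iff f C.1) rfl rfl]
      by_cases hf : T.comp S (T.edgeRep f) = C.1
      · rw [if_pos hf, if_pos ⟨hσ, hf, hc⟩]
        rfl
      · rw [if_neg hf, if_neg (fun h => hf h.2.1), map_zero]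
    · rw [if_neg hc, Finsupp.single_zero, Finset.sum_eq_zero]
      exact fun f _ => if_neg fun h => hc h.2.2
  · rw [if_neg hσ, Finset.sum_eq_zero]
    exact fun f _ => if_neg fun h => hσ h.1

variable (R : Type*) [CommRing R] [Algebra (ZMod 2) R]

omit [Algebra (ZMod 2) R] in
theorem dot_congr {S : T.Resolution} {d e : T.strand} (h : T.comp S d = T.comp S e)
    (σ : T.Circle S → Bool) :
    T.dot R d (Finsupp.single ⟨S, σ⟩ 1) = T.dot R e (Finsupp.single ⟨S, σ⟩ 1) := by
  classical
  rw [dot_single, dot_single, lower_single, lower_single]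
  show (if T.Contractible (T.comp S d) then T.hit R (T.comp S d) σ else 0)
    = (if T.Contractible (T.comp S e) then T.hit R (T.comp S e) σ else 0)
  rw [h]

omit [Algebra (ZMod 2) R] in
theorem dot_eq {d e : T.strand} (h : ∀ S, T.comp S d = T.comp S e) : T.dot R d = T.dot R e :=
  T.linearMap_ext fun ⟨S, σ⟩ => T.dot_congr R (h S) σ

omit [Algebra (ZMod 2) R] in
theorem dot_isEnd {d : T.strand} (h : T.IsEnd d.1) : T.dot R d = 0 := by
  classical
  refine T.linearMap_ext fun s => ?_
  rw [dot_single, lower_single, T.hit_arc ⟨d, h, rfl⟩, ite_self, LinearMap.zero_apply]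

omit [Algebra (ZMod 2) R] in
/-- At a crossing, the sum of the operators of two opposite darts does not depend on the choice. -/
theorem dot_add_opp {d : T.strand} (h : T.IsCrossing d.1) :
    T.dot R d + T.dot R (T.opp d h) = T.bridgeDot R (T.crossingOf d.1 h) := by
  set c := T.crossingOf d.1 h with hc
  have h1 : ∀ S, T.touching S c = {T.comp S d, T.comp S (T.opp d h)} := by
    intro S
    ext C
    constructor
    · rintro ⟨e, he, hec, rfl⟩
      have hs := M.sameVertex_crossing h ((T.crossingOf_eq_iff he h).1 hec).symm
      have hsm := T.smoothing S d h
      have hm : (T.mate S d).1 = M.rot d.1 ∨ (T.mate S d).1 = M.rot.symm d.1 := by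
        rw [T.mate_crossing S h]
        exact T.turn_eq_or S d.1
      have hm2 : (T.mate S (T.opp d h)).1 = T.turn S (M.rot (M.rot d.1)) :=
        T.mate_crossing S ((T.isCrossing_rot _).2 ((T.isCrossing_rot _).2 h))
      have hr := M.rot_symm_of_crossing h
      have hturn := T.turn_rot S ((T.isCrossing_rot d.1).2 h)
      have hturn1 := T.turn_rot S h
      have hor := T.turn_eq_or S (M.rot (M.rot d.1))
      rw [Equiv.symm_apply_apply] at hor
      rw [T.mate_crossing S h] at hm
      have e0 : ∀ x : T.strand, e = x ∨ e = T.mate S x → T.comp S e = T.comp S x := by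
        rintro x (rfl | rfl)
        · rfl
        · exact T.comp_mate S x
      have e1 : (e = d ∨ e = T.mate S d) ∨ (e = T.opp d h ∨ e = T.mate S (T.opp d h)) := by
        simp only [Subtype.ext_iff, T.mate_crossing S h, hm2]
        show (e.1 = d.1 ∨ _) ∨ (e.1 = M.rot (M.rot d.1) ∨ _)
        rw [hr] at hm
        have hne : M.rot d.1 ≠ M.rot (M.rot (M.rot d.1)) := fun h' =>
          h.2.2.2.2.2.1 (M.rot.injective h').symm
        rcases hm with hm | hm
        · have hx : T.turn S (M.rot (M.rot d.1)) = M.rot (M.rot (M.rot d.1)) := by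
            rw [hturn, hturn1]
            simp [hm]
          rw [hx, hm]
          tauto
        · have hx : T.turn S (M.rot (M.rot d.1)) = M.rot d.1 := by
            refine hor.resolve_left fun h' => ?_
            rw [hturn, hturn1, hm] at h'
            exact h' hne.symm
          rw [hx, hm]
          tauto
      rcases e1 with e1 | e1
      · exact Or.inl (e0 _ e1)
      · exact Or.inr (e0 _ e1)
    · rintro (rfl | rfl)
      · exact ⟨d, h, rfl, rfl⟩
      · refine ⟨T.opp d h, (T.isCrossing_rot _).2 ((T.isCrossing_rot _).2 h), ?_, rfl⟩
        refine (T.crossingOf_eq_iff _ h).2 ?_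
        exact ((M.sameVertex_rot _).trans (M.sameVertex_rot _)).symm
  refine T.linearMap_ext fun ⟨S, σ⟩ => ?_
  have h2 := h1 S
  rw [touching_eq, Set.pair_eq_pair_iff] at h2
  rw [bridgeDot, LinearMap.add_apply, LinearMap.add_apply]
  rcases h2 with ⟨h2, h3⟩ | ⟨h2, h3⟩
  · rw [T.dot_congr R h2 σ, T.dot_congr R h3 σ]
  · rw [T.dot_congr R h2 σ, T.dot_congr R h3 σ, add_comm]

/-- If the tangle consists of arcs, all the operators `T.dot R d` are combinations of the sums at the
crossings: moving along a strand through a crossing adds such a sum, and the operator of an end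
point is zero. -/
theorem dot_mem_span (h : T.OnlyArcs) (d : T.strand) :
    T.dot R d ∈ Submodule.span R (Set.range (T.bridgeDot R)) := by
  set N := Submodule.span R (Set.range (T.bridgeDot R)) with hN
  have key : ∀ x y, T.linkComponent x = T.linkComponent y → (T.dot R x ∈ N ↔ T.dot R y ∈ N) := by
    intro x y hxy
    have h2 := Quot.eqvGen_exact hxy
    clear hxy
    induction h2 with
    | rel x y hxy =>
      by_cases hc : T.IsCrossing x.1 ∧ y.1 = M.rot (M.rot x.1)
      · have hy : y = T.opp x hc.1 := Subtype.ext hc.2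
        have h3 := T.dot_add_opp R hc.1
        rw [← hy] at h3
        have h5 : T.dot R x + T.dot R y ∈ N := by
          rw [h3]
          exact Submodule.subset_span ⟨_, rfl⟩
        constructor
        · intro hx
          have := N.add_mem h5 hx
          rwa [add_right_comm, T.end_add_self, zero_add] at this
        · intro hy
          have := N.add_mem h5 hy
          rwa [add_assoc, T.end_add_self, add_zero] at this
      · rw [T.dot_eq R fun S => (T.comp_sound S ?_).symm]
        rcases hxy with h3 | ⟨h3, h5⟩ | h3
        · exact Or.inl h3
        · exact Or.inr (Or.inl ⟨h3, h5⟩)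
        · exact absurd h3 hc
    | refl x => exact Iff.rfl
    | symm x y _ ih => exact ih.symm
    | trans x y z _ _ ih1 ih2 => exact ih1.trans ih2
  obtain ⟨e, he, hed⟩ := h (T.linkComponent d)
  rw [key d e hed.symm, T.dot_isEnd R he]
  exact N.zero_mem

/-- The vertical differential of a tangle of arcs is a combination of the operators at the crossings,
which are null-homotopic. -/
theorem exists_vertical_eq (h : T.OnlyArcs) :
    ∃ a : T.Crossing → T.Coeff, T.vertical = ∑ c, a c • T.bridgeDot T.Coeff c := by
  have h1 : T.vertical ∈ Submodule.span T.Coeff (Set.range (T.bridgeDot T.Coeff)) := by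
    rw [vertical_eq]
    exact Submodule.sum_mem _ fun f _ => Submodule.smul_mem _ _ (T.dot_mem_span _ h _)
  obtain ⟨a, ha⟩ := (Submodule.mem_span_range_iff_exists_fun _).1 h1
  exact ⟨a, ha.symm⟩

theorem shifts_vertical : T.Shifts T.vertical 2 := by
  rw [vertical_eq]
  exact Shifts.sum T fun f _ => Shifts.smul T _ (T.shifts_dot _)

end TangleDiagram

/-! ### Extension of scalars -/

section Homology

open Module

variable {K V : Type*} [Field K] [AddCommGroup V] [Module K V] [FiniteDimensional K V]

/-- The dimension of the homology is determined by the ranks of the differential; hence it is preserved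
by an extension of scalars. -/
theorem finrank_homologyAt (d : V →ₗ[K] V) (hd : d ∘ₗ d = 0) {B Z : Submodule K V}
    (hB : B.map d ≤ Z) :
    finrank K (homologyAt d B Z) + finrank K (B.map d) + finrank K (Z.map d) = finrank K Z := by
  have h1 := Submodule.finrank_quotient_add_finrank
    ((B.map d).comap (Z ⊓ LinearMap.ker d).subtype)
  have hle : B.map d ≤ Z ⊓ LinearMap.ker d := by
    refine le_inf hB ?_
    rintro _ ⟨v, -, rfl⟩
    exact LinearMap.congr_fun hd v
  have h2 : finrank K ((B.map d).comap (Z ⊓ LinearMap.ker d).subtype) = finrank K (B.map d) :=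
    (Submodule.comapSubtypeEquivOfLe hle).finrank_eq
  have h3 := LinearMap.finrank_range_add_finrank_ker (d.domRestrict Z)
  have h4 : finrank K (LinearMap.range (d.domRestrict Z)) = finrank K (Z.map d) := by
    rw [LinearMap.range_domRestrict]
  have h5 : finrank K (LinearMap.ker (d.domRestrict Z)) = finrank K (Z ⊓ LinearMap.ker d : Submodule K V) := by
    rw [LinearMap.ker_domRestrict]
    have := (Submodule.comapSubtypeEquivOfLe (p := Z ⊓ LinearMap.ker d) (q := Z)
      inf_le_left).finrank_eq
    rw [Submodule.comap_inf, Submodule.comap_subtype_self, top_inf_eq] at this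
    exact this
  rw [h2] at h1
  change finrank K (homologyAt d B Z) + _ = _ at h1
  omega

theorem finrank_baseChange_submodule {k : Type*} [Field k] {W : Type*} [AddCommGroup W]
    [Module k W] [Algebra k K] (p : Submodule k W) : finrank K (p.baseChange K) = finrank k p := by
  rw [← (Submodule.toBaseChange.toLinearEquiv K p).finrank_eq, Module.finrank_baseChange]

theorem map_baseChange_submodule {k : Type*} [Field k] {W : Type*} [AddCommGroup W]
    [Module k W] [Algebra k K] (d : W →ₗ[k] W) (p : Submodule k W) :
    (p.baseChange K).map (d.baseChange K) = (p.map d).baseChange K := by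
  have e : p = Submodule.span k (p : Set W) := (Submodule.span_eq p).symm
  rw [e, Submodule.map_span, Submodule.baseChange_span, Submodule.baseChange_span,
    Submodule.map_span]
  congr 1
  ext x
  simp only [Set.mem_image, exists_exists_and_eq_and]
  simp

end Homology

namespace TangleDiagram

variable {D : Type*} {M : CellSurface D} [Finite D] (T : TangleDiagram M)

/-- Extension of scalars in the free module over the pure states. -/
def extend : (T.State →₀ T.Coeff) ≃ₗ[T.Coeff] T.Coeff ⊗[ZMod 2] (T.State →₀ ZMod 2) :=
  (TensorProduct.finsuppScalarRight (ZMod 2) T.Coeff T.Coeff T.State).symm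

theorem extend_single (s : T.State) :
    T.extend (Finsupp.single s 1) = 1 ⊗ₜ Finsupp.single s 1 :=
  TensorProduct.finsuppScalarRight_symm_apply_single s 1

theorem extend_horizontal :
    T.extend.toLinearMap ∘ₗ T.horizontal T.Coeff
      = (T.horizontal (ZMod 2)).baseChange T.Coeff ∘ₗ T.extend.toLinearMap := by
  classical
  refine T.linearMap_ext fun s => ?_
  show T.extend (T.horizontal T.Coeff (Finsupp.single s 1))
    = (T.horizontal (ZMod 2)).baseChange T.Coeff (T.extend (Finsupp.single s 1))
  rw [extend_single, LinearMap.baseChange_tmul]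
  simp only [horizontal, Finsupp.linearCombination_single, one_smul, map_sum,
    TensorProduct.tmul_sum]
  refine Finset.sum_congr rfl fun s' _ => ?_
  split_ifs
  · exact T.extend_single s'
  · rw [map_zero, TensorProduct.tmul_zero]

theorem extend_piece (i : ℤ) (b : Glyph M) :
    (T.piece T.Coeff i b).map T.extend.toLinearMap = (T.piece (ZMod 2) i b).baseChange T.Coeff := by
  unfold piece
  rw [Finsupp.supported_eq_span_single, Finsupp.supported_eq_span_single,
    Submodule.baseChange_span, Submodule.map_span, Set.image_image, Set.image_image]
  congr 1
  exact Set.image_congr fun s _ => T.extend_single s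

omit [Finite D] in
theorem Shifts.map_eq {R : Type*} [CommRing R] {Φ Ψ : Module.End R (T.State →₀ R)}
    (h : Φ * Ψ = 1) (hΦ : T.Shifts Φ 0) (hΨ : T.Shifts Ψ 0) (i : ℤ) (b : Glyph M) :
    (T.piece R i b).map Φ = T.piece R i b := by
  refine le_antisymm ?_ fun v hv => ?_
  · have := hΦ i b
    rwa [add_zero] at this
  · have := hΨ i b
    rw [add_zero] at this
    exact ⟨Ψ v, this ⟨v, hv, rfl⟩, LinearMap.congr_fun h v⟩

/-- For a tangle of arcs the vertical differential is removed by the conjugation with the homotopies at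
the crossings. -/
theorem twistedIsoSkein (h : T.OnlyArcs) : T.TwistedIsoSkein := by
  obtain ⟨a, ha⟩ := T.exists_vertical_eq h
  obtain ⟨Φ, Ψ, h1, h2, h3, h5, h6⟩ := T.exists_conj a Finset.univ
  rw [← ha, add_comm] at h6
  change Φ * T.twisted = _ at h6
  have htw : T.twisted * T.twisted = 0 := by
    have e : Φ * (T.twisted * T.twisted) = 0 := by
      rw [← mul_assoc, h6, mul_assoc, h6, ← mul_assoc, horizontal_sq, zero_mul]
    rw [← one_mul (T.twisted * T.twisted), ← h2, mul_assoc, e, mul_zero]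
  have hsh : T.Shifts T.twisted 2 :=
    Shifts.add T T.shifts_vertical (T.shifts_horizontal T.Coeff)
  have hsh2 := T.shifts_horizontal (ZMod 2)
  let e1 : (T.State →₀ T.Coeff) ≃ₗ[T.Coeff] (T.State →₀ T.Coeff) :=
    LinearEquiv.ofLinearMap Φ Ψ h1 h2
  let e2 := e1.trans T.extend
  have hconj : e2.toLinearMap ∘ₗ T.twisted
      = (T.horizontal (ZMod 2)).baseChange T.Coeff ∘ₗ e2.toLinearMap := by
    have e3 : e2.toLinearMap = T.extend.toLinearMap ∘ₗ Φ := rfl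
    rw [e3, LinearMap.comp_assoc, show Φ ∘ₗ T.twisted = T.horizontal T.Coeff ∘ₗ Φ from h6,
      ← LinearMap.comp_assoc, extend_horizontal, LinearMap.comp_assoc]
  have hpiece : ∀ i b, (T.piece T.Coeff i b).map e2.toLinearMap
      = (T.piece (ZMod 2) i b).baseChange T.Coeff := by
    intro i b
    have e3 : e2.toLinearMap = T.extend.toLinearMap ∘ₗ Φ := rfl
    rw [e3, Submodule.map_comp, Shifts.map_eq T h1 h3 h5, extend_piece]
  refine ⟨htw, T.horizontal_sq (ZMod 2), hsh, hsh2, ⟨e2, hconj, hpiece⟩, fun i b => ?_⟩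
  have hfin : ∀ p : Submodule T.Coeff (T.State →₀ T.Coeff), ∀ q : Submodule (ZMod 2) _,
      p.map e2.toLinearMap = q.baseChange T.Coeff →
      Module.finrank T.Coeff p = Module.finrank (ZMod 2) q := by
    intro p q hpq
    rw [← finrank_baseChange_submodule (K := T.Coeff) q, ← hpq]
    exact (LinearEquiv.finrank_map_eq e2 p).symm
  have hmap : ∀ i, ((T.piece T.Coeff i b).map T.twisted).map e2.toLinearMap
      = ((T.piece (ZMod 2) i b).map (T.horizontal (ZMod 2))).baseChange T.Coeff := by
    intro i
    rw [← Submodule.map_comp, hconj, Submodule.map_comp, hpiece, map_baseChange_submodule]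
  have hB : (T.piece T.Coeff (i - 2) b).map T.twisted ≤ T.piece T.Coeff i b := by
    have := hsh (i - 2) b
    rwa [sub_add_cancel] at this
  have hB2 : (T.piece (ZMod 2) (i - 2) b).map (T.horizontal (ZMod 2)) ≤ T.piece (ZMod 2) i b := by
    have := hsh2 (i - 2) b
    rwa [sub_add_cancel] at this
  have f1 := finrank_homologyAt T.twisted htw hB
  have f2 := finrank_homologyAt (T.horizontal (ZMod 2)) (T.horizontal_sq (ZMod 2)) hB2
  rw [hfin _ _ (hmap _), hfin _ _ (hmap _), hfin _ _ (hpiece i b)] at f1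
  refine ⟨LinearEquiv.ofFinrankEq _ _ ?_⟩
  rw [Module.finrank_baseChange]
  exact Nat.add_right_cancel (Nat.add_right_cancel (f1.trans f2.symm))

end TangleDiagram

/-! ### Marked points -/

namespace TangleDiagram.Marking

variable {D : Type*} {M : CellSurface D} {T : TangleDiagram M} (P : T.Marking)

theorem isEnd_inl {d : D} (hd : d ∈ T.strand) (h : T.IsEnd d ∨ d ∈ P.darts) :
    P.punctured.IsEnd (Sum.inl d) := by
  by_cases hm : d ∈ P.darts
  · refine ⟨⟨d, hd, rfl⟩, ?_⟩
    rintro _ ⟨e, -, rfl⟩ hde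
    rw [P.sameVertex_marked d hm e hde]
  · refine ⟨⟨d, hd, rfl⟩, ?_⟩
    rintro _ ⟨e, he, rfl⟩ hde
    obtain ⟨f, hf, hdf⟩ := (P.sameVertex_inl d hm _).1 hde
    rw [(h.resolve_right hm).2 e he (by rw [Sum.inl_injective hf]; exact hdf)]

/-- Cutting the diagram open at the marked points leaves arcs only. -/
theorem onlyArcs_punctured (h : P.MeetsClosed) : P.punctured.OnlyArcs := by
  let lift : T.strand → P.punctured.strand := fun d => ⟨Sum.inl d.1, d.1, d.2, rfl⟩
  let good : T.strand → Prop := fun d =>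
    ∃ e : P.punctured.strand, P.punctured.IsEnd e.1 ∧
      P.punctured.linkComponent e = P.punctured.linkComponent (lift d)
  have hend : ∀ d : T.strand, T.IsEnd d.1 ∨ d.1 ∈ P.darts → good d := fun d hd =>
    ⟨lift d, P.isEnd_inl d.2 hd, rfl⟩
  have hstep : ∀ x y : T.strand, (y.1 = M.rev x.1 ∨
      (¬ T.IsCrossing x.1 ∧ M.SameVertex x.1 y.1) ∨
      (T.IsCrossing x.1 ∧ y.1 = M.rot (M.rot x.1))) → (good x ↔ good y) := by
    intro x y hxy
    have hlink : P.punctured.linkComponent (lift x) = P.punctured.linkComponent (lift y) →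
        (good x ↔ good y) := by
      intro h
      show (∃ e, _ ∧ _ = _) ↔ (∃ e, _ ∧ _ = _)
      rw [h]
    have hmk : ((lift y).1 = P.surface.rev (lift x).1 ∨
        (¬ P.punctured.IsCrossing (lift x).1 ∧ P.surface.SameVertex (lift x).1 (lift y).1) ∨
        (P.punctured.IsCrossing (lift x).1 ∧
          (lift y).1 = P.surface.rot (P.surface.rot (lift x).1))) → (good x ↔ good y) :=
      fun h => hlink (Quot.sound h)
    have hc : ∀ d, P.punctured.IsCrossing (Sum.inl d) ↔ T.IsCrossing d := by
      intro d
      refine (P.isCrossing_inl (Sum.inl d)).trans ?_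
      constructor
      · rintro ⟨e, he, h⟩
        rwa [Sum.inl_injective he]
      · exact fun h => ⟨d, rfl, h⟩
    have hrot : ∀ d, d ∉ P.darts → P.surface.rot (Sum.inl d) = Sum.inl (M.rot d) := fun d h =>
      (dif_neg h : P.rotFun (Sum.inl d) = _)
    rcases hxy with hxy | ⟨hx, hxy⟩ | ⟨hx, hxy⟩
    · exact hmk (Or.inl (by show Sum.inl y.1 = Sum.inl (M.rev x.1); rw [hxy]))
    · by_cases hm : x.1 ∈ P.darts
      · have hm' : y.1 ∈ P.darts := by
          obtain ⟨n, hn⟩ := hxy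
          rw [← hn, P.zpow_mem]
          exact hm
        exact iff_of_true (hend x (Or.inr hm)) (hend y (Or.inr hm'))
      · exact hmk (Or.inr (Or.inl ⟨fun h => hx ((hc _).1 h),
          (P.sameVertex_inl _ hm _).2 ⟨_, rfl, hxy⟩⟩))
    · have hm : x.1 ∉ P.darts := fun h => P.not_crossing _ h hx
      have hm2 : M.rot x.1 ∉ P.darts := fun h => hm ((P.rot_mem _).1 h)
      refine hmk (Or.inr (Or.inr ⟨(hc _).2 hx, ?_⟩))
      show Sum.inl y.1 = P.surface.rot (P.surface.rot (Sum.inl x.1))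
      rw [hrot _ hm, hrot _ hm2, hxy]
  intro K
  obtain ⟨⟨_, d, hd, rfl⟩, rfl⟩ := Quot.exists_rep K
  obtain ⟨e, he, he2⟩ := h (T.linkComponent ⟨d, hd⟩)
  have hgood : good e ↔ good ⟨d, hd⟩ := by
    have h2 := Quot.eqvGen_exact he
    clear he he2
    generalize (⟨d, hd⟩ : T.strand) = d' at h2
    induction h2 with
    | rel x y hxy => exact hstep x y hxy
    | refl x => exact Iff.rfl
    | symm x y _ ih => exact ih.symm
    | trans x y z _ _ ih1 ih2 => exact ih1.trans ih2
  exact hgood.1 (hend e he2)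

end TangleDiagram.Marking

end

end Skein

theorem mainTheorem6 {D : Type*} [Finite D] (M : Skein.CellSurface D)
    (T : Skein.TangleDiagram M) :
    (T.OnlyArcs → T.TwistedIsoSkein) ∧
    (∀ P : T.Marking, P.MeetsClosed → P.punctured.OnlyArcs ∧ P.punctured.TwistedIsoSkein) :=
  ⟨T.twistedIsoSkein, fun P hP => ⟨P.onlyArcs_punctured hP,
    P.punctured.twistedIsoSkein (P.onlyArcs_punctured hP)⟩⟩
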